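/- **Setting.** Let $K$ be a field, $n\ge 2$, and let $P^*$ be a regular $n$-gon with vertices $P_1,\dots,P_n$ (counterclockwise, indices modulo $n$), inscribed in the unit circle, with one puncture at its centre. For $r\ne s$ let $(P_r,P_s)$ be the curve from $P_r$ to $P_s$ turning counterclockwise around the puncture; $(P_r,P_{r+1})$ is a side, and $(P_r,P_s)$ with $s\neq r,r+1$ is a tagged arc. The other tagged arcs are $(P_r,*)$ (plain) and $(P_r,\bowtie)$ (notched), joining $P_r$ to the puncture. All are considered up to isotopy. Two tagged arcs are compatible if they have representatives with disjoint relative interiors and if, in case both end at the puncture and are not isotopic, they have the same tag. A tagged triangulation $\sigma$ is the set of all sides together with a maximal set of pairwise compatible tagged arcs; its elements are called edges. For an edge $a=(P_{a_1},P_{a_2})$ the indices are $a_1,a_2$; if $a$ ends at the puncture, $a=(P_{a_1},*)$ or $(P_{a_1},\bowtie)$, put $a_2=a_1$. **Quivers.** The vertices of the quiver $Q'_\sigma$ are the edges of $\sigma$. In each triangle of $\sigma$ whose interior does not contain the puncture, there is an internal arrow $a\to b$ at each corner, where $b$ follows $a$ in the anticlockwise order centred at the corner. If $\sigma$ contains $i=(P_k,*)$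 and $j=(P_k,\bowtie)$, these lie in a once-punctured digon with sides $a=(P_m,P_k)$ and $b=(P_k,P_m)$; then there are also internal arrows $\eta:a\to b$, $\alpha:b\to j$, $\beta:j\to a$, $\gamma:b\to i$, $\delta:i\to a$. For each $k$ there is an external arrow from $(P_{k-1},P_k)$ to $(P_k,P_{k+1})$. The quiver $Q_\sigma$ is obtained from $Q'_\sigma$ by removing the external arrows at the vertices $P_k$ with no incident tagged arc in $\sigma$. Paths are composed from left to right, and $e_a$ is the trivial path at $a$. The planar cycles are the following: the clockwise triangles (the 3-cycles of internal arrows of the triangles above; in the digon these are $\eta\alpha\beta$ and $\eta\gamma\delta$); for each $k$ (whose external arrow is in the quiver) the anticlockwise external cycle, formed by the external arrow at $P_k$ and the internal arrows at $P_k$, going through $\gamma\delta$ and not through $\alpha\beta$ in the digon; and, if there is no such digon, the anticlockwise punctured cycle of the arrows between arcs at the puncture. The potentials $W_\sigma$ on $Q_\sigma$ and $W'_\sigma$ on $Q'_\sigma$ are the sum of the clockwise triangles minus the sum of the anticlockwise external cycles minus the anticlockwise punctured cycle. With $F$ the set of sides, put $$\Gamma_\sigma=KQ_\sigma/\langle \partial_\alpha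 W_\sigma \mid s(\alpha)\notin F\text{ or }t(\alpha)\notin F\rangle ,$$ where $s(\alpha)$ and $t(\alpha)$ are the source and the target of $\alpha$ and $\partial_\alpha$ is the cyclic derivative. The inclusion $Q_\sigma\subset Q'_\sigma$ induces an isomorphism $\Gamma_\sigma\cong KQ'_\sigma/\langle\partial_\alpha W'_\sigma\mid\alpha\text{ internal}\rangle$, through which paths of $Q'_\sigma$ are regarded as elements of $\Gamma_\sigma$. **Grading.** Let $\vec a$ be the vector $\overrightarrow{P_{a_1}P_{a_2}}$ if $a_1\ne a_2$, and the clockwise unit tangent vector of the unit circle at $P_{a_1}$ if $a_1=a_2$. The $\theta$-length of an arrow $a\to b$ is $\frac n\pi\theta$, where $\theta\in[0,2\pi)$ is the oriented angle from $\vec a$ to $\vec b$; it is extended additively to paths. It induces a $\mathbb Z$-grading of $\Gamma_\sigma$ and of its centre $Z(\Gamma_\sigma)$. **The algebra $A$.** For $r,s\in\mathbb Z/n$ let $d(r,s)\in\{0,\dots,n-1\}$ be the residue of $s-r$, let $[r,s]=\{t: d(r,t)\le d(r,s)\}$ and let $]r,s[$ be the complement of $[s,r]$. With $\delta_{C}=1$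 if $C$ holds and $0$ otherwise, put $$\ell_{a,b}=d(a_1,b_1)+d(a_2,b_2)+n\,\bigl|\delta_{a_1\in ]b_1,a_2[}-\delta_{b_2\in ]b_1,a_2[}\bigr| ,$$ and for edges $a,b$ not incident to the puncture write $a\vdash b$ if $a_2\in{]b_2,a_1[}$ or $b_1\in{]b_2,a_1[}$. Let $R'=K[X,Y]/(YX-Y^2)$ be embedded in $\mathcal R'=K[u^{\pm1},v]/(vu-v^2)$ by $X\mapsto u^{2n}$, $Y\mapsto v^{2n}$; both are graded with $u,v$ of degree $1$ and $X,Y$ of degree $2n$. For edges $a,b$ of $\sigma$ define an $R'$-submodule $A_{a,b}$ of $\mathcal R'$: it is $0$ if $a,b$ are incident to the puncture with different tags; otherwise it is $u^{\ell_{a,b}-1}vR'$ if $a$ or $b$ is incident to the puncture and plain, $u^{\ell_{a,b}-1}(u-v)R'$ if $a$ or $b$ is incident to the puncture and notched, and, if neither is incident to the puncture, $u^{\ell_{a,b}}R'+v^{\ell_{a,b}}R'$ if $a\vdash b$ and $u^{\ell_{a,b}}R'$ if not. Let $A$ be the set of matrices over $\mathcal R'$ indexed by the edges of $\sigma$ whose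 $(a,b)$ entry lies in $A_{a,b}$ for all $a,b$. For a side $a$ let $E_a$ be the cycle at $a$ going once through each external arrow. For an edge $a$, put $C_a=0$ if $a$ is notched and $\sigma$ contains the plain arc with the same end on the polygon; otherwise let $C_a$ be the common class in $\Gamma_\sigma$ of all planar cycles of $Q'_\sigma$ based at $a$ that do not go through such a notched arc. **Proposition.** The set $A$ is closed under addition, matrix multiplication and the action of $R'$. There is an isomorphism of graded $K$-algebras $\phi: R'\to Z(\Gamma_\sigma)$ and, for the $R'$-algebra structure of $\Gamma_\sigma$ induced by $\phi$, an isomorphism of graded $R'$-algebras $\psi:A\to\Gamma_\sigma$ induced by isomorphisms of graded $R'$-modules $\psi^{a,b}:A_{a,b}\to e_a\Gamma_\sigma e_b$, such that: 1. (i) for each side $a$, $e_a\phi(X)=\phi(X)e_a=E_a$; 2. (ii) for each edge $a$, the element $C_a$ is well defined, and $e_a\phi(Y)=\phi(Y)e_a$ is equal to $C_a$ if $\sigma$ has a plain arc incident to the puncture, and to $e_a\phi(X)-C_a$ otherwise; 3. (iii) for all sides $a,b$, $\psi^{a,b}(u^{\ell_{a,b}})$ is the class of the shortest path from $a$ to $b$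 among the paths consisting of external arrows; 4. (iv) for all sides $a,b$ with $b_2=a_1$, let $s_{a,b}$ be the path from $a$ to $b$ whose composition with the external arrow $b\to a$ at $P_{a_1}$ is the anticlockwise external cycle at $P_{a_1}$; then $\psi^{a,b}(v^{\ell_{a,b}})$ is equal to $s_{a,b}$ if $\sigma$ has a plain arc incident to the puncture, and to $\psi^{a,b}(u^{\ell_{a,b}})-s_{a,b}$ otherwise; 5. (v) for every external arrow $\alpha$ of $Q'_\sigma$ and every $w\in\Gamma_\sigma$, $\alpha w=0$ implies $e_{t(\alpha)}w=0$, and $w\alpha=0$ implies $we_{s(\alpha)}=0$. -/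

import Mathlib

noncomputable section

universe u v w

/-- The path algebra `K V` of a quiver: the vector space with basis the paths. -/
def PathAlgebra (K : Type w) (V : Type u) [Field K] [Quiver.{v} V] : Type (max u v w) :=
  (Σ a b : V, Quiver.Path a b) →₀ K

namespace PathAlgebra

variable {K : Type w} {V : Type u} [Field K] [Quiver.{v} V]

instance : AddCommGroup (PathAlgebra K V) := inferInstanceAs (AddCommGroup (_ →₀ K))
instance : Module K (PathAlgebra K V) := inferInstanceAs (Module K (_ →₀ K))

/-- The basis consisting of the paths. -/
def basis : Module.Basis (Σ a b : V, Quiver.Path a b) K (PathAlgebra K V) :=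
  ⟨(LinearEquiv.refl K (_ →₀ K) : PathAlgebra K V ≃ₗ[K] _)⟩

variable (K) in
/-- The basis element given by a path. -/
def ofPath {a b : V} (p : Quiver.Path a b) : PathAlgebra K V :=
  basis ⟨a, b, p⟩

open Classical in
/-- Product of basis elements: the concatenation (first `x`, then `y`) if it exists, else `0`. -/
def mulBasis (x y : Σ a b : V, Quiver.Path a b) : PathAlgebra K V :=
  if h : x.2.1 = y.1 then ofPath K (x.2.2.comp (y.2.2.cast h.symm rfl)) else 0

/-- The multiplication as a bilinear map. -/
def mulLin : PathAlgebra K V →ₗ[K] PathAlgebra K V →ₗ[K] PathAlgebra K V :=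
  basis.constr K fun x => basis.constr K fun y => mulBasis x y

instance : Mul (PathAlgebra K V) := ⟨fun f g => mulLin f g⟩

theorem mul_def (f g : PathAlgebra K V) : f * g = mulLin f g := rfl

theorem hom_ext {M : Type*} [AddCommGroup M] [Module K M] {f g : PathAlgebra K V →ₗ[K] M}
    (h : ∀ (a b : V) (p : Quiver.Path a b), f (ofPath K p) = g (ofPath K p)) : f = g :=
  basis.ext fun x => h x.1 x.2.1 x.2.2

theorem ofPath_mul_ofPath {a b c : V} (p : Quiver.Path a b) (q : Quiver.Path b c) :
    ofPath K p * ofPath K q = ofPath K (p.comp q) := by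
  rw [mul_def]
  simp only [mulLin, ofPath, Module.Basis.constr_basis]
  simp [mulBasis, ofPath]

theorem ofPath_mul_ofPath_of_ne {a b c d : V} (p : Quiver.Path a b) (q : Quiver.Path c d)
    (h : b ≠ c) : ofPath K p * ofPath K q = 0 := by
  rw [mul_def]
  simp only [mulLin, ofPath, Module.Basis.constr_basis]
  simp [mulBasis, h]

theorem mul_assoc_aux (f g h : PathAlgebra K V) : f * g * h = f * (g * h) := by
  have key : (mulLin (K := K) (V := V)).compr₂ mulLin
      = ((LinearMap.llcomp K _ _ _ ∘ₗ mulLin).flip.comp mulLin).flip := by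
    refine hom_ext fun a b p => hom_ext fun c d q => hom_ext fun e f r => ?_
    change ofPath K p * ofPath K q * ofPath K r = ofPath K p * (ofPath K q * ofPath K r)
    by_cases h1 : b = c
    · subst h1
      rw [ofPath_mul_ofPath]
      by_cases h2 : d = e
      · subst h2
        rw [ofPath_mul_ofPath, ofPath_mul_ofPath, ofPath_mul_ofPath, Quiver.Path.comp_assoc]
      · rw [ofPath_mul_ofPath_of_ne _ _ h2, ofPath_mul_ofPath_of_ne _ _ h2]
        simp [mul_def]
    · rw [ofPath_mul_ofPath_of_ne _ _ h1]
      by_cases h2 : d = e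
      · subst h2
        rw [ofPath_mul_ofPath, ofPath_mul_ofPath_of_ne _ _ h1]
        simp [mul_def]
      · rw [ofPath_mul_ofPath_of_ne _ _ h2]
        simp [mul_def]
  exact DFunLike.congr_fun (DFunLike.congr_fun (DFunLike.congr_fun key f) g) h

instance : NonUnitalRing (PathAlgebra K V) where
  left_distrib f g h := by simp [mul_def]
  right_distrib f g h := by simp [mul_def]
  zero_mul f := by simp [mul_def]
  mul_zero f := by simp [mul_def]
  mul_assoc := mul_assoc_aux

instance [Fintype V] : One (PathAlgebra K V) :=
  ⟨∑ a : V, ofPath K (Quiver.Path.nil : Quiver.Path a a)⟩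

theorem one_def [Fintype V] :
    (1 : PathAlgebra K V) = ∑ a : V, ofPath K (Quiver.Path.nil : Quiver.Path a a) := rfl

theorem one_mul_aux [Fintype V] (f : PathAlgebra K V) : 1 * f = f := by
  have key : mulLin (1 : PathAlgebra K V) = LinearMap.id := by
    refine hom_ext fun a b p => ?_
    change 1 * ofPath K p = ofPath K p
    rw [one_def, Finset.sum_mul, Finset.sum_eq_single a]
    · rw [ofPath_mul_ofPath, Quiver.Path.nil_comp]
    · intro c _ hc
      exact ofPath_mul_ofPath_of_ne _ _ hc
    · simp
  exact DFunLike.congr_fun key f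

theorem mul_one_aux [Fintype V] (f : PathAlgebra K V) : f * 1 = f := by
  have key : mulLin.flip (1 : PathAlgebra K V) = LinearMap.id := by
    refine hom_ext fun a b p => ?_
    change ofPath K p * 1 = ofPath K p
    rw [one_def, Finset.mul_sum, Finset.sum_eq_single b]
    · rw [ofPath_mul_ofPath, Quiver.Path.comp_nil]
    · intro c _ hc
      exact ofPath_mul_ofPath_of_ne _ _ (Ne.symm hc)
    · simp
  exact DFunLike.congr_fun key f

instance [Fintype V] : Ring (PathAlgebra K V) :=
  { (inferInstance : NonUnitalRing (PathAlgebra K V)) with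
    one_mul := one_mul_aux
    mul_one := mul_one_aux }

instance [Fintype V] : Algebra K (PathAlgebra K V) :=
  Algebra.ofModule (fun r f g => by simp [mul_def]) (fun r f g => by simp [mul_def])

end PathAlgebra

/-! ### Potentials and frozen Jacobian algebras -/

namespace IceQuiver

open Quiver (Path Total)

variable {V : Type u} [Quiver.{v} V]

/-- The list of the arrows of a path, in the order in which they are followed. -/
def arrowList {a : V} : {b : V} → Path a b → List (Total V)
  | _, .nil => []
  | _, .cons p e => arrowList p ++ [⟨_, _, e⟩]

variable (V) in
/-- Cycles, with their base point. -/
abbrev BasedCycle : Type (max u v) := Σ a : V, Path a a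

/-- The cycle `c'` is obtained from `c` by moving the base point along `c`. -/
def IsRotation (c c' : BasedCycle V) : Prop :=
  ∃ (p : Path c.1 c'.1) (q : Path c'.1 c.1), c.2 = p.comp q ∧ c'.2 = q.comp p

variable (K : Type w) [Field K]

/-- Potentials: linear combinations of cycles. -/
abbrev Potential (V : Type u) [Quiver.{v} V] : Type (max u v w) := BasedCycle V →₀ K

open Classical in
/-- For a path `p : a → b` and a path `q : b → a`, the sum of `p₂ q p₁` over all the factorisations
`p = p₁ α p₂`. -/
def derivAux (α : Total V) {a : V} : {b : V} → Path a b → Path b a → PathAlgebra K V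
  | _, .nil, _ => 0
  | _, .cons p e, q => derivAux α p (e.toPath.comp q) +
      if (⟨_, _, e⟩ : Total V) = α then PathAlgebra.ofPath K (q.comp p) else 0

/-- The cyclic derivative `∂_α`: a cycle `α₁ ⋯ α_d` is sent to the sum of
`α_{i+1} ⋯ α_d α₁ ⋯ α_{i-1}` over all `i` such that `α_i = α`. -/
def cyclicDeriv (α : Total V) : Potential K V →ₗ[K] PathAlgebra K V :=
  Finsupp.linearCombination K fun c : BasedCycle V => derivAux K α c.2 Path.nil

variable {K}

/-- The relations `∂_α W = 0` for `α` in a set `S` of arrows. -/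
inductive JacobianRel (W : Potential K V) (S : Set (Total V)) :
    PathAlgebra K V → PathAlgebra K V → Prop
  | mk (α : Total V) (hα : α ∈ S) : JacobianRel W S (cyclicDeriv K α W) 0

/-- The quotient of the path algebra by the two-sided ideal generated by all `∂_α W`, `α ∈ S`. -/
abbrev JacobianAlgebra [Fintype V] (W : Potential K V) (S : Set (Total V)) :
    Type (max u v w) :=
  RingQuot (JacobianRel W S)

/-- The class of a path in a Jacobian algebra. -/
def pathClass [Fintype V] (W : Potential K V) (S : Set (Total V)) {a b : V} (p : Path a b) :
    JacobianAlgebra W S :=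
  RingQuot.mkAlgHom K (JacobianRel W S) (PathAlgebra.ofPath K p)

/-- The arrows with respect to which one differentiates when the vertices in `F` are frozen. -/
def unfrozenArrows (F : Set V) : Set (Total V) :=
  {α | α.left ∉ F ∨ α.right ∉ F}

/-- The frozen Jacobian algebra `P(Q, W, F)`. -/
abbrev FrozenJacobianAlgebra [Fintype V] (W : Potential K V) (F : Set V) : Type (max u v w) :=
  JacobianAlgebra W (unfrozenArrows F)

end IceQuiver

/-! ### Tagged triangulations of a once-punctured polygon

The vertices `P_1, …, P_n` of the polygon, in counterclockwise order, are indexed by `ZMod n`. -/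

namespace PuncturedPolygon

open Quiver (Path Total)
open IceQuiver

/-- `d(r, s)`: the number of sides followed when going counterclockwise from `P_r` to `P_s`. -/
def ccwDist {n : ℕ} (r s : ZMod n) : ℕ := (s - r).val

/-- `⟦r, s⟧ = {r, r + 1, …, s}`. -/
def closedInterval {n : ℕ} (r s : ZMod n) : Set (ZMod n) := {t | ccwDist r t ≤ ccwDist r s}

/-- `⟧r, s⟦`, the complement of `⟦s, r⟧`. -/
def openInterval {n : ℕ} (r s : ZMod n) : Set (ZMod n) := (closedInterval s r)ᶜ

/-- The tags of the arcs incident to the puncture. -/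
inductive Tag
  | plain
  | notched

/-- Isotopy classes of sides and tagged arcs. `chord r s` is `(P_r, P_s)`, the curve from `P_r` to
`P_s` turning counterclockwise around the puncture (meaningful for `r ≠ s`);
`spoke r plain` is `(P_r, *)` and `spoke r notched` is `(P_r, ⋈)`. -/
inductive Edge (n : ℕ)
  | chord (r s : ZMod n)
  | spoke (r : ZMod n) (t : Tag)

namespace Edge

variable {n : ℕ}

/-- The index `a₁`. -/
def fst : Edge n → ZMod n
  | chord r _ => r
  | spoke r _ => r

/-- The index `a₂`; by convention `a₂ = a₁` if `a` is incident to the puncture. -/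
def snd : Edge n → ZMod n
  | chord _ s => s
  | spoke r _ => r

/-- The side `(P_k, P_{k+1})`. -/
def side (k : ZMod n) : Edge n := chord k (k + 1)

/-- The sides of the polygon. -/
def IsSide (a : Edge n) : Prop := ∃ k, a = side k

/-- The tagged arcs: `(P_r, P_s)` with `s ≠ r, r + 1`, and all the arcs to the puncture. -/
def IsArc : Edge n → Prop
  | chord r s => s ≠ r ∧ s ≠ r + 1
  | spoke _ _ => True

/-- In the universal cover of the punctured disc, `(P_r, P_s)` lifts to curves joining the boundary
points `x` and `x + d(r, s)`, for the lifts `x ∈ ℤ` of `r`. This says that some lifts of `(P_r, P_s)`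
and `(P_t, P_u)` have interleaving endpoints `x < y < x + d(r, s) < y + d(t, u)`. -/
def Interleave (r s t u : ZMod n) : Prop :=
  0 < ccwDist r t ∧ ccwDist r t < ccwDist r s ∧ ccwDist r s < ccwDist r t + ccwDist t u

/-- The underlying arcs have to intersect in their relative interiors. -/
def Cross : Edge n → Edge n → Prop
  | chord r s, chord t u => Interleave r s t u ∨ Interleave t u r s
  | chord r s, spoke t _ => 0 < ccwDist r t ∧ ccwDist r t < ccwDist r s
  | spoke t _, chord r s => 0 < ccwDist r t ∧ ccwDist r t < ccwDist r s
  | spoke _ _, spoke _ _ => False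

/-- Two non-isotopic arcs to the puncture carry different tags. -/
def TagConflict : Edge n → Edge n → Prop
  | spoke r t, spoke s t' => r ≠ s ∧ t ≠ t'
  | _, _ => False

/-- Compatibility of tagged arcs. -/
def Compatible (a b : Edge n) : Prop := ¬ Cross a b ∧ ¬ TagConflict a b

/-- `ℓ^θ_{a,b} = d(a₁,b₁) + d(a₂,b₂) + n |δ(a₁ ∈ ⟧b₁,a₂⟦) - δ(b₂ ∈ ⟧b₁,a₂⟦)|`. -/
def ell (a b : Edge n) : ℕ :=
  open Classical in
  ccwDist a.fst b.fst + ccwDist a.snd b.snd +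
    n * Int.natAbs ((if a.fst ∈ openInterval b.fst a.snd then 1 else 0) -
      (if b.snd ∈ openInterval b.fst a.snd then 1 else 0))

/-- The relation `a ⊢ b` (used for `a` and `b` not incident to the puncture). -/
def Turn (a b : Edge n) : Prop :=
  a.snd ∈ openInterval b.snd a.fst ∨ b.fst ∈ openInterval b.snd a.fst

/-- The vertex `P_k` of the regular polygon inscribed in the unit circle. -/
def point (k : ZMod n) : ℂ :=
  Complex.exp (2 * Real.pi * Complex.I * (k.val : ℂ) / (n : ℂ))

/-- The vector from `P_{a₁}` to `P_{a₂}` or, if `a` is incident to the puncture, the clockwise unit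
tangent vector of the unit circle at `P_{a₁}`. -/
def vec : Edge n → ℂ
  | chord r s => point s - point r
  | spoke r _ => -Complex.I * point r

/-- The oriented angle from `vec a` to `vec b`, in `[0, 2π)`. -/
def angle (a b : Edge n) : ℝ :=
  toIcoMod Real.two_pi_pos 0 (Complex.arg (vec b / vec a))

end Edge

open Edge

/-- Tagged triangulations: the set of edges consists of all the sides and of a maximal collection of
pairwise compatible tagged arcs. -/
structure TaggedTriangulation (n : ℕ) where
  edges : Finset (Edge n)
  side_or_arc : ∀ a ∈ edges, IsSide a ∨ IsArc a
  side_mem : ∀ k, side k ∈ edges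
  compatible : ∀ a ∈ edges, ∀ b ∈ edges, IsArc a → IsArc b → Compatible a b
  maximal : ∀ a, IsArc a → (∀ b ∈ edges, IsArc b → Compatible a b) → a ∈ edges

variable {n : ℕ}

/-- Clockwise triangles `a → b → c → a` of edges of `σ`, where `p`, `q`, `r` are the joint vertices
of `a, b`, of `b, c` and of `c, a` (`none` is the puncture, `some k` is `P_k`); each edge is followed
by its successor in the anticlockwise order centred at the joint vertex.
* `polygon`: the true triangles with three vertices on the polygon;
* `puncture`: the true triangles with a vertex at the puncture;
* `digon`: a plain and a notched arc joining `P_k` to the puncture, inside the once-punctured digon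
  with vertices `P_k`, `P_m`; each of these two arcs gives a triangle, and the two triangles share
  the arrow at `P_m`. -/
inductive ClockwiseTriangle (σ : TaggedTriangulation n) :
    Edge n → Edge n → Edge n →
      Option (ZMod n) → Option (ZMod n) → Option (ZMod n) → Prop
  | polygon (x y z : ZMod n) (hd : ccwDist x y + ccwDist y z = ccwDist x z)
      (hxy : chord x y ∈ σ.edges) (hyz : chord y z ∈ σ.edges) (hxz : chord x z ∈ σ.edges) :
      ClockwiseTriangle σ (chord x y) (chord x z) (chord y z) (some x) (some z) (some y)
  | puncture (x y : ZMod n) (t : Tag) (hxy : chord x y ∈ σ.edges)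
      (hx : spoke x t ∈ σ.edges) (hy : spoke y t ∈ σ.edges) :
      ClockwiseTriangle σ (chord x y) (spoke x t) (spoke y t) (some x) none (some y)
  | digon (k m : ZMod n) (t : Tag) (hmk : chord m k ∈ σ.edges) (hkm : chord k m ∈ σ.edges)
      (hp : spoke k Tag.plain ∈ σ.edges) (hn : spoke k Tag.notched ∈ σ.edges) :
      ClockwiseTriangle σ (chord m k) (chord k m) (spoke k t) (some m) (some k) (some k)

/-- `a` precedes `b` in a triangle of `σ`, at their joint vertex `J`. -/
def Corner (σ : TaggedTriangulation n) (J : Option (ZMod n)) (a b : Edge n) : Prop :=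
  ∃ c p q, ClockwiseTriangle σ a b c J p q ∨ ClockwiseTriangle σ c a b p J q ∨
    ClockwiseTriangle σ b c a p q J

/-- The vertices of the quiver of `σ` whose external arrows are those winding around the `P_k`,
`k ∈ E`. -/
def QVert (σ : TaggedTriangulation n) (_E : Set (ZMod n)) : Type := {a : Edge n // a ∈ σ.edges}

instance (σ : TaggedTriangulation n) (E : Set (ZMod n)) : Fintype (QVert σ E) :=
  inferInstanceAs (Fintype {a : Edge n // a ∈ σ.edges})

/-- The arrows: internal arrows (in the triangles of `σ`), and external arrows. -/
inductive Arrow (σ : TaggedTriangulation n) (E : Set (ZMod n)) (a b : QVert σ E) : Type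
  | internal (J : Option (ZMod n)) (h : Corner σ J a.1 b.1)
  | external (k : ZMod n) (hk : k ∈ E) (ha : a.1 = side (k - 1)) (hb : b.1 = side k)

instance (σ : TaggedTriangulation n) (E : Set (ZMod n)) : Quiver (QVert σ E) := ⟨Arrow σ E⟩

/-- The vertices of the polygon with at least one incident tagged arc in `σ`. -/
def arcVertices (σ : TaggedTriangulation n) : Set (ZMod n) :=
  {k | ∃ a ∈ σ.edges, IsArc a ∧ (a.fst = k ∨ a.snd = k)}

/-- The quiver `Q'_σ`, with all the external arrows. -/
abbrev Q' (σ : TaggedTriangulation n) : Type := QVert σ Set.univ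

/-- The quiver `Q_σ`, without the external arrows winding around vertices with no incident tagged
arc. -/
abbrev Q (σ : TaggedTriangulation n) : Type := QVert σ (arcVertices σ)

section Planar

variable {σ : TaggedTriangulation n} {E : Set (ZMod n)}

/-- The same vertex, seen in `Q'_σ`. -/
def full (a : QVert σ E) : Q' σ := ⟨a.1, a.2⟩

/-- The same arrow, seen in `Q'_σ`. -/
def fullArrow {a b : QVert σ E} : (a ⟶ b) → (full a ⟶ full b)
  | .internal J h => Arrow.internal J h
  | .external k _ ha hb => Arrow.external k (Set.mem_univ k) ha hb

/-- The arrow `α` is internal, with joint vertex `J`. -/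
def IsInternalAt (J : Option (ZMod n)) (α : Total (QVert σ E)) : Prop :=
  ∃ h, α.hom = Arrow.internal J h

/-- The arrow `α` is the external arrow winding around `P_k`. -/
def IsExternalAt (k : ZMod n) (α : Total (QVert σ E)) : Prop :=
  ∃ hk ha hb, α.hom = Arrow.external k hk ha hb

/-- `a` is the notched arc, inside a once-punctured digon containing a plain and a notched arc. -/
def IsDigonNotched (a : QVert σ E) : Prop :=
  ∃ k, a.1 = spoke k Tag.notched ∧ spoke k Tag.plain ∈ σ.edges

/-- The path does not go through the notched arc of a once-punctured digon. -/
def AvoidsNotched {a b : QVert σ E} (p : Path a b) : Prop :=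
  ∀ α ∈ arrowList p, ¬ IsDigonNotched α.left ∧ ¬ IsDigonNotched α.right

/-- The path of the internal arrows around `P_k`, from the side `(P_k, P_{k+1})` to the side
`(P_{k-1}, P_k)`; in a once-punctured digon, it goes through the plain arc. -/
def IsFan (k : ZMod n) {a b : QVert σ E} (p : Path a b) : Prop :=
  a.1 = side k ∧ b.1 = side (k - 1) ∧
    (∀ α ∈ arrowList p, IsInternalAt (some k) α) ∧ AvoidsNotched p

variable (σ E)

/-- The clockwise triangles; the base point is determined by the triangle. -/
def clockwiseTriangles : Set (BasedCycle (QVert σ E)) :=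
  {c | ∃ (b d : QVert σ E) (α : c.1 ⟶ b) (β : b ⟶ d) (γ : d ⟶ c.1) (p q r : Option (ZMod n)),
    ClockwiseTriangle σ c.1.1 b.1 d.1 p q r ∧
    IsInternalAt p ⟨_, _, α⟩ ∧ IsInternalAt q ⟨_, _, β⟩ ∧ IsInternalAt r ⟨_, _, γ⟩ ∧
    c.2 = ((Path.nil.cons α).cons β).cons γ}

/-- The anticlockwise external cycles, starting with their external arrow. -/
def externalCycles : Set (BasedCycle (QVert σ E)) :=
  {c | ∃ (k : ZMod n) (b : QVert σ E) (α : c.1 ⟶ b) (s : Path b c.1),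
    IsExternalAt k ⟨_, _, α⟩ ∧ IsFan k s ∧ c.2 = α.toPath.comp s}

/-- The anticlockwise punctured cycle, consisting of the arrows at the puncture, with as base point
the arc to the puncture with smallest index. -/
def puncturedCycles : Set (BasedCycle (QVert σ E)) :=
  {c | arrowList c.2 ≠ [] ∧ (arrowList c.2).Nodup ∧
    (∀ α ∈ arrowList c.2, IsInternalAt none α) ∧
    ∀ k t, spoke k t ∈ σ.edges → c.1.1.fst.val ≤ k.val}

/-- The planar cycles used for the potential, up to the choice of the base point, that do not go
through the notched arc of a once-punctured digon. -/
def centralCycles : Set (BasedCycle (QVert σ E)) :=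
  {c | AvoidsNotched c.2 ∧
    ∃ c₀ ∈ clockwiseTriangles σ E ∪ externalCycles σ E ∪ puncturedCycles σ E, IsRotation c₀ c}

/-- The potential: clockwise triangles minus anticlockwise external cycles minus the anticlockwise
punctured cycle (these sets of cycles are finite). -/
def potential (K : Type*) [Field K] : Potential K (QVert σ E) :=
  (∑ᶠ c ∈ clockwiseTriangles σ E, Finsupp.single c 1) -
    (∑ᶠ c ∈ externalCycles σ E, Finsupp.single c 1) -
    ∑ᶠ c ∈ puncturedCycles σ E, Finsupp.single c 1

/-- The frozen vertices: the sides of the polygon. -/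
def frozen : Set (QVert σ E) := {a | IsSide a.1}

/-- The internal arrows. -/
def internalArrows : Set (Total (QVert σ E)) := {α | ∃ J, IsInternalAt J α}

variable {σ E}

/-- The `θ`-length of a path, `(n / π) θ` for an arrow with angle `θ`. -/
def thetaLength {a : QVert σ E} : {b : QVert σ E} → Path a b → ℝ
  | _, .nil => 0
  | _, .cons (b := b) (c := c) p _ => thetaLength p + n / Real.pi * Edge.angle b.1 c.1

/-- All the arrows of the path are external. -/
def AllExternal {a b : QVert σ E} (p : Path a b) : Prop :=
  ∀ α ∈ arrowList p, ∃ k, IsExternalAt k α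

/-- The cycle consists of external arrows, and goes once through each of them. -/
def IsBigCycle {a : Q' σ} (c : Path a a) : Prop :=
  AllExternal c ∧ (arrowList c).Nodup ∧ ∀ k : ZMod n, ∃ α ∈ arrowList c, IsExternalAt k α

/-- `p` is a shortest path among the paths consisting of external arrows. -/
def IsShortestExternal {a b : Q' σ} (p : Path a b) : Prop :=
  AllExternal p ∧ ∀ q : Path a b, AllExternal q → p.length ≤ q.length

end Planar

/-- `σ` has a plain arc incident to the puncture. -/
def HasPlain (σ : TaggedTriangulation n) : Prop := ∃ k, spoke k Tag.plain ∈ σ.edges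

section Algebras

variable (K : Type*) [Field K]

/-- The frozen Jacobian algebra `Γ_σ = P(Q_σ, W_σ, F)`. -/
abbrev Gamma (σ : TaggedTriangulation n) : Type _ :=
  FrozenJacobianAlgebra (potential σ (arcVertices σ) K) (frozen σ (arcVertices σ))

/-- The realisation `K Q'_σ / ⟨∂_α W'_σ | α internal⟩` of `Γ_σ`. -/
abbrev Gamma' (σ : TaggedTriangulation n) : Type _ :=
  JacobianAlgebra (potential σ Set.univ K) (internalArrows σ Set.univ)

/-- The class in `Γ_σ` of a path of `Q_σ`. -/
def cls {σ : TaggedTriangulation n} {a b : Q σ} (p : Path a b) : Gamma K σ :=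
  pathClass (potential σ (arcVertices σ) K) (unfrozenArrows (frozen σ (arcVertices σ))) p

/-- The class in `K Q'_σ / ⟨∂_α W'_σ | α internal⟩` of a path of `Q'_σ`. -/
def cls' {σ : TaggedTriangulation n} {a b : Q' σ} (p : Path a b) : Gamma' K σ :=
  pathClass (potential σ Set.univ K) (internalArrows σ Set.univ) p

/-- The idempotent `e_a` of `Γ_σ`. -/
def idem {σ : TaggedTriangulation n} (a : Q σ) : Gamma K σ := cls K (Path.nil : Path a a)

/-- `e_a Γ_σ e_b`. -/
def peirce {σ : TaggedTriangulation n} (a b : Q σ) : Submodule K (Gamma K σ) :=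
  LinearMap.range (LinearMap.mulLeftRight K (idem K a, idem K b))

/-- The part of `Γ_σ` of `θ`-length `m`. -/
def thetaPiece (σ : TaggedTriangulation n) (m : ℤ) : Submodule K (Gamma K σ) :=
  Submodule.span K {x | ∃ (a b : Q σ) (p : Path a b), thetaLength p = m ∧ x = cls K p}

/-- The part of the centre `Z(Γ_σ)` of `θ`-length `m`. -/
def centerPiece (σ : TaggedTriangulation n) (m : ℤ) :
    Submodule K (Subalgebra.center K (Gamma K σ)) :=
  (thetaPiece K σ m).comap (Subalgebra.center K (Gamma K σ)).val.toLinearMap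

open MvPolynomial in
/-- `R' = K[X, Y] / (Y X - Y ^ 2)`, where `X 0` is `X` and `X 1` is `Y`. (The parameter `n` is only
used for the degree `2 n` of `X` and `Y` and for the embedding in `K[u^{±1}, v] / (v u - v ^ 2)`.) -/
def RPrime (_n : ℕ) : Type _ :=
  MvPolynomial (Fin 2) K ⧸ Ideal.span {(X 1 * X 0 - X 1 ^ 2 : MvPolynomial (Fin 2) K)}

instance (n : ℕ) : CommRing (RPrime K n) :=
  inferInstanceAs (CommRing (MvPolynomial (Fin 2) K ⧸ Ideal.span _))

instance (n : ℕ) : Algebra K (RPrime K n) :=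
  inferInstanceAs (Algebra K (MvPolynomial (Fin 2) K ⧸ Ideal.span _))

/-- The element `X` of `R'`. -/
def RPrime.X (n : ℕ) : RPrime K n :=
  Ideal.Quotient.mk (Ideal.span {_}) (MvPolynomial.X 0 : MvPolynomial (Fin 2) K)

/-- The element `Y` of `R'`. -/
def RPrime.Y (n : ℕ) : RPrime K n :=
  Ideal.Quotient.mk (Ideal.span {_}) (MvPolynomial.X 1 : MvPolynomial (Fin 2) K)

open LaurentPolynomial in
/-- The algebra `K[u^{±1}, v] / (v u - v ^ 2)`. -/
def ScriptR : Type _ :=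
  Polynomial K[T;T⁻¹] ⧸ Ideal.span
    {(Polynomial.X * Polynomial.C (T 1) - Polynomial.X ^ 2 : Polynomial K[T;T⁻¹])}

open LaurentPolynomial in
instance : CommRing (ScriptR K) :=
  inferInstanceAs (CommRing (Polynomial K[T;T⁻¹] ⧸ Ideal.span _))

open LaurentPolynomial in
instance : Algebra K (ScriptR K) :=
  inferInstanceAs (Algebra K (Polynomial K[T;T⁻¹] ⧸ Ideal.span _))

open LaurentPolynomial in
/-- The class of a polynomial in `v` with coefficients in `K[u^{±1}]`. -/
def ScriptR.mk : Polynomial K[T;T⁻¹] →ₐ[K] ScriptR K :=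
  Ideal.Quotient.mkₐ K (Ideal.span
    {(Polynomial.X * Polynomial.C (T 1) - Polynomial.X ^ 2 : Polynomial K[T;T⁻¹])})

/-- The element `u ^ m`, for `m ∈ ℤ`. -/
def uPow (m : ℤ) : ScriptR K := ScriptR.mk K (Polynomial.C (LaurentPolynomial.T m))

/-- The element `v`. -/
def vElt : ScriptR K := ScriptR.mk K Polynomial.X

theorem vElt_mul_uPow_one : vElt K * uPow K 1 = vElt K ^ 2 := by
  rw [vElt, uPow, ← map_mul, ← map_pow]
  exact Ideal.Quotient.eq.2 (Ideal.subset_span rfl)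

theorem uPow_one_pow (m : ℕ) : uPow K 1 ^ m = uPow K m := by
  rw [uPow, uPow, ← map_pow, ← map_pow, LaurentPolynomial.T_pow, mul_one]

/-- The embedding of `R'`, sending `X` to `u ^ (2 n)` and `Y` to `v ^ (2 n)`. -/
def embed (n : ℕ) : RPrime K n →ₐ[K] ScriptR K :=
  Ideal.Quotient.liftₐ (Ideal.span {_})
    (MvPolynomial.aeval ![uPow K (2 * n), vElt K ^ (2 * n)]) (by
    suffices h : Ideal.span _ ≤ RingHom.ker
        (MvPolynomial.aeval ![uPow K (2 * n), vElt K ^ (2 * n)] :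
          MvPolynomial (Fin 2) K →ₐ[K] ScriptR K) from fun a ha => h ha
    rw [Ideal.span_singleton_le_iff_mem, RingHom.mem_ker]
    have h := uPow_one_pow K (2 * n)
    push_cast at h
    have h2 : vElt K ^ (2 * n) * uPow K 1 ^ (2 * n) = (vElt K ^ (2 * n)) ^ 2 := by
      rw [← mul_pow, vElt_mul_uPow_one, ← pow_mul, ← pow_mul, mul_comm]
    simp only [map_sub, map_mul, map_pow, MvPolynomial.aeval_X, Matrix.cons_val_one,
      Matrix.cons_val_zero, ← h, h2, sub_self])

/-- `K[u^{±1}, v] / (v u - v ^ 2)` as an algebra over `R'`. -/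
instance (n : ℕ) : Algebra (RPrime K n) (ScriptR K) := (embed K n : RPrime K n →+* ScriptR K).toAlgebra

/-- The part of degree `m` of `K[u^{±1}, v] / (v u - v ^ 2)`, where `u` and `v` have degree `1`. -/
def scriptPiece (m : ℤ) : Submodule K (ScriptR K) :=
  Submodule.span K {x | ∃ (i : ℤ) (j : ℕ), i + j = m ∧ x = uPow K i * vElt K ^ j}

/-- The part of degree `m` of `R'`. -/
def rPiece (n : ℕ) (m : ℤ) : Submodule K (RPrime K n) :=
  (scriptPiece K m).comap (embed K n).toLinearMap

open Classical in
/-- The `R'`-submodule `A_{a,b}`. -/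
def entry : Edge n → Edge n → Submodule (RPrime K n) (ScriptR K)
  | spoke _ .plain, spoke _ .notched => ⊥
  | spoke _ .notched, spoke _ .plain => ⊥
  | chord r s, chord r' s' =>
      if Turn (chord r s) (chord r' s') then
        Submodule.span _ {uPow K (ell (chord r s) (chord r' s')),
          vElt K ^ ell (chord r s) (chord r' s')}
      else Submodule.span _ {uPow K (ell (chord r s) (chord r' s'))}
  | spoke r .plain, b => Submodule.span _ {uPow K (ell (spoke r .plain) b - 1) * vElt K}
  | a, spoke s .plain => Submodule.span _ {uPow K (ell a (spoke s .plain) - 1) * vElt K}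
  | spoke r .notched, b =>
      Submodule.span _ {uPow K (ell (spoke r .notched) b - 1) * (uPow K 1 - vElt K)}
  | a, spoke s .notched =>
      Submodule.span _ {uPow K (ell a (spoke s .notched) - 1) * (uPow K 1 - vElt K)}

end Algebras

end PuncturedPolygon

end

open PuncturedPolygon

/-!
The proof replaces `Γ_σ` by its realisation with all the external arrows (`iota`: the clockwise
triangles with a corner at `P_k` express a missing external arrow at `P_k`), compares a spanning set
of it with monomials of `𝓡'`, and reads off all the assertions from matrices over `𝓡'`.

*Paths.* On the universal cover of the punctured polygon an edge becomes a pair of integers `(x, y)`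
with `x < y ≤ x + n`, where `y = x + n` for the arcs to the puncture; the lifts of an edge differ by
multiples of `(n, n)`. An edge is *visible* unless it is the notched arc of a once-punctured digon.
An arrow between visible edges adds nonnegative integers to `x` and `y`, whose sum is its
`θ`-length; it is *marked* if it passes in front of the puncture, or starts or ends at an arc to the
puncture. A path of such arrows (`Run`) is marked if one of its arrows is. The relations of the
Jacobian algebra close squares of arrows (`Lam.square`, `Tri.square`), so that, by induction on the
length, two paths with the same lifted ends and the same mark are equal (`Run.unique`); all the ends
allowed by the numerical conditions are reached (`Run.exists_false`, `Run.exists_true`). The notched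
arc of a digon is only used at the ends of paths, which gives the standard elements `Std`. They span
the algebra (`pathClass_mem_stdSpan`) and are determined by the lifted ends and the mark
(`Std.unique`).

*Matrices.* The ring `𝓡'` is spanned by the monomials `u ^ m` and `u ^ m ε`, where `ε` is one of the
complementary idempotents `u⁻¹ v` and `1 - u⁻¹ v`, the first one for plain and the second one for
notched arcs. Sending an arrow of `θ`-length `m` to the matrix with entry `u ^ m`, or `u ^ m ε` if
it is marked, satisfies the relations (`matData_relations`). Multiplying by the diagonal matrix of
the idempotents of the edges yields `psi`. A standard element from `(x, y)` to `(X, Y)` becomes a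
monomial of degree `X + Y - x - y`, with factor `ε` if it is marked; distinct nonzero ones become
distinct monomials, hence `psi_injective`. As `ℓ_{a,b}` is the smallest possible degree, and `a ⊢ b`
tells whether the path of this degree can be marked (`Lift.exists_ell`), the image is the set of
matrices with entries in the `A_{a,b}` (`psi_entry_mem`, `psi_surjective`).

*Consequences.* A matrix commuting with all the others is a scalar from `R'` (`central_matrix`). The
grading is the one by degree, since an oriented angle is computed by lifts (`Lift.angle_eq`). All
the planar cycles have degree `2 n` and are marked (`central_value`): their class is `v ^ (2 n)` if
there is a plain arc and `u ^ (2 n) - v ^ (2 n)` otherwise. An external arrow has the unit `u ^ 2`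
as its entry, so it can be cancelled.
-/

noncomputable section
universe u v w

/-! ### Morphisms from path algebras and Jacobian algebras -/

namespace PathAlgebra
open Quiver (Path)
variable {K : Type w} {V : Type u} [Field K] [Quiver.{v} V]

/-- The value of a path, given the values of the vertices and of the arrows. -/
def evalPath {B : Type*} [Mul B] (ε : V → B) (f : ∀ {a b : V}, (a ⟶ b) → B) {a : V} :
    {b : V} → Path a b → B
  | _, .nil => ε a
  | _, .cons p α => evalPath ε f p * f α

section Lift
variable {B : Type*} [Ring B] [Algebra K B] {ε : V → B} {f : ∀ {a b : V}, (a ⟶ b) → B}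

lemma evalPath_mul_idem (hε : ∀ a, ε a * ε a = ε a) (hr : ∀ {a b} (α : a ⟶ b), f α * ε b = f α)
    {a b : V} (p : Path a b) : evalPath ε f p * ε b = evalPath ε f p := by
  cases p with
  | nil => exact hε a
  | cons p α => simp only [evalPath, mul_assoc, hr]

lemma idem_mul_evalPath (hε : ∀ a, ε a * ε a = ε a) {a b : V} (p : Path a b) :
    ε a * evalPath ε f p = evalPath ε f p := by
  induction p with
  | nil => exact hε a
  | cons p α ih => simp only [evalPath, ← mul_assoc, ih]

lemma evalPath_comp (hε : ∀ a, ε a * ε a = ε a) (hr : ∀ {a b} (α : a ⟶ b), f α * ε b = f α)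
    {a b c : V} (p : Path a b) (q : Path b c) :
    evalPath ε f (p.comp q) = evalPath ε f p * evalPath ε f q := by
  induction q with
  | nil => exact (evalPath_mul_idem hε hr p).symm
  | cons q α ih => simp only [Quiver.Path.comp_cons, evalPath, ih, mul_assoc]

lemma evalPath_mul_eq_zero (ho : ∀ a b, a ≠ b → ε a * ε b = 0) (hε : ∀ a, ε a * ε a = ε a)
    (hr : ∀ {a b} (α : a ⟶ b), f α * ε b = f α) {a b c d : V} (p : Path a b) (q : Path c d)
    (h : b ≠ c) : evalPath ε f p * evalPath ε f q = 0 := by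
  rw [← evalPath_mul_idem hε hr p, ← idem_mul_evalPath hε q, mul_assoc, ← mul_assoc (ε b),
    ho b c h, zero_mul, mul_zero]

variable (K) in
/-- The algebra homomorphism from a path algebra given by the images of the vertices and of the
arrows. -/
def lift [Fintype V] (ε : V → B) (f : ∀ {a b : V}, (a ⟶ b) → B)
    (ho : ∀ a b, a ≠ b → ε a * ε b = 0) (hε : ∀ a, ε a * ε a = ε a) (h1 : ∑ a, ε a = 1)
    (hr : ∀ {a b} (α : a ⟶ b), f α * ε b = f α) : PathAlgebra K V →ₐ[K] B :=
  AlgHom.ofLinearMap (basis.constr K fun x => evalPath ε f x.2.2)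
    (by
      rw [one_def, map_sum, ← h1]
      exact Finset.sum_congr rfl fun a _ => by rw [ofPath, Module.Basis.constr_basis]; rfl)
    (by
      set L : PathAlgebra K V →ₗ[K] B := basis.constr K fun x => evalPath ε f x.2.2
      have hL : ∀ {a b : V} (p : Path a b), L (ofPath K p) = evalPath ε f p := fun p => by
        simp only [L, ofPath, Module.Basis.constr_basis]
      have key : (mulLin (K := K) (V := V)).compr₂ L = (LinearMap.mul K B).compl₁₂ L L := by
        refine hom_ext fun a b p => hom_ext fun c d q => ?_
        change L (ofPath K p * ofPath K q) = L (ofPath K p) * L (ofPath K q)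
        by_cases h : b = c
        · subst h
          rw [ofPath_mul_ofPath, hL, hL, hL, evalPath_comp hε hr]
        · rw [ofPath_mul_ofPath_of_ne _ _ h, hL, hL, evalPath_mul_eq_zero ho hε hr _ _ h, map_zero]
      exact fun x y => DFunLike.congr_fun (DFunLike.congr_fun key x) y)

lemma lift_ofPath [Fintype V] (ho : ∀ a b, a ≠ b → ε a * ε b = 0) (hε : ∀ a, ε a * ε a = ε a) (h1
    : ∑ a, ε a = 1) (hr : ∀ {a b} (α : a ⟶ b), f α * ε b = f α) {a b : V} (p : Path a b) : lift K ε
    f ho hε h1 hr (ofPath K p) = evalPath ε f p := by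
  change basis.constr K _ (basis _) = _
  rw [Module.Basis.constr_basis]

end Lift

lemma span_ofPath : Submodule.span K {x : PathAlgebra K V | ∃ (a b : V) (p : Path a b),
    x = ofPath K p} = ⊤ := by
  rw [eq_top_iff, ← basis.span_eq]
  exact Submodule.span_mono (by rintro _ ⟨⟨a, b, p⟩, rfl⟩; exact ⟨a, b, p, rfl⟩)

end PathAlgebra

namespace IceQuiver
open Quiver (Path Total)
open PathAlgebra

section Jac
variable {K : Type w} {V : Type u} [Field K] [Quiver.{v} V] [Fintype V]
  {W : Potential K V} {S : Set (Total V)}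

lemma pathClass_comp {a b c : V} (p : Path a b) (q : Path b c) :
    pathClass W S (p.comp q) = pathClass W S p * pathClass W S q := by
  rw [pathClass, pathClass, pathClass, ← map_mul, ofPath_mul_ofPath]

lemma pathClass_cons {a b c : V} (p : Path a b) (α : b ⟶ c) :
    pathClass W S (p.cons α) = pathClass W S p * pathClass W S α.toPath :=
  pathClass_comp p α.toPath

lemma pathClass_mul_of_ne {a b c d : V} (p : Path a b) (q : Path c d) (h : b ≠ c) :
    pathClass W S p * pathClass W S q = 0 := by
  rw [pathClass, pathClass, ← map_mul, ofPath_mul_ofPath_of_ne _ _ h, map_zero]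

lemma sum_pathClass_nil : ∑ a : V, pathClass W S (Quiver.Path.nil : Quiver.Path a a) = 1 := by
  simp only [pathClass]
  rw [← map_sum, ← one_def, map_one]

lemma nil_mul_pathClass {a b : V} (p : Path a b) :
    pathClass W S (Quiver.Path.nil : Quiver.Path a a) * pathClass W S p = pathClass W S p := by
  rw [← pathClass_comp, Quiver.Path.nil_comp]

lemma pathClass_mul_nil {a b : V} (p : Path a b) :
    pathClass W S p * pathClass W S (Path.nil : Path b b) = pathClass W S p := by
  rw [← pathClass_comp, Quiver.Path.comp_nil]

lemma span_pathClass : Submodule.span K {x : JacobianAlgebra W S | ∃ (a b : V) (p : Path a b),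
    x = pathClass W S p} = ⊤ := by
  have h := congrArg (Submodule.map (RingQuot.mkAlgHom K (JacobianRel W S)).toLinearMap)
    (span_ofPath (K := K) (V := V))
  rw [Submodule.map_span, Submodule.map_top, LinearMap.range_eq_top.2
    (RingQuot.mkAlgHom_surjective K (JacobianRel W S))] at h
  rw [← h]
  congr 1
  ext x
  constructor
  · rintro ⟨a, b, p, rfl⟩
    exact ⟨_, ⟨a, b, p, rfl⟩, rfl⟩
  · rintro ⟨_, ⟨a, b, p, rfl⟩, rfl⟩
    exact ⟨a, b, p, rfl⟩

lemma mk_cyclicDeriv {α : Total V} (hα : α ∈ S) :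
    RingQuot.mkAlgHom K (JacobianRel W S) (cyclicDeriv K α W) = 0 := by
  rw [RingQuot.mkAlgHom_rel K (JacobianRel.mk α hα), map_zero]

/-- The algebra homomorphism from a Jacobian algebra given by the images of the vertices and of the
arrows. -/
def jacLift {B : Type*} [Ring B] [Algebra K B] (g : PathAlgebra K V →ₐ[K] B)
    (hg : ∀ α ∈ S, g (cyclicDeriv K α W) = 0) : JacobianAlgebra W S →ₐ[K] B :=
  RingQuot.liftAlgHom K ⟨g, by rintro _ _ ⟨α, hα⟩; rw [hg α hα, map_zero]⟩

end Jac

section Deriv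
variable {K : Type w} {V : Type u} [Field K] [Quiver.{v} V]

lemma arrowList_comp {a b c : V} (p : Path a b) (q : Path b c) :
    arrowList (p.comp q) = arrowList p ++ arrowList q := by
  induction q with
  | nil => simp [arrowList]
  | cons q α ih => simp [arrowList, ih]

lemma derivAux_comp (α : Total V) {a b c : V} (p : Path a b) (q : Path b c) (r : Path c a) :
    derivAux K α (p.comp q) r = derivAux K α p (q.comp r) + derivAux K α q (r.comp p) := by
  induction q with
  | nil => simp [derivAux]
  | cons q e ih =>
    simp only [Quiver.Path.comp_cons, derivAux, ih, add_assoc, ← Quiver.Path.comp_assoc]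
    congr 2

lemma derivAux_eq_zero {α : Total V} {a b : V} {p : Path a b} (h : α ∉ arrowList p)
    (q : Path b a) : derivAux K α p q = 0 := by
  induction p with
  | nil => rfl
  | cons p e ih =>
    simp only [arrowList, List.mem_append, List.mem_singleton, not_or] at h
    simp [derivAux, ih h.1, Ne.symm h.2]

lemma derivAux_split {s t a : V} (α : s ⟶ t) {p₁ : Path a s} {p₂ : Path t a}
    (h₁ : (⟨s, t, α⟩ : Total V) ∉ arrowList p₁) (h₂ : (⟨s, t, α⟩ : Total V) ∉ arrowList p₂) :
    derivAux K ⟨s, t, α⟩ ((p₁.cons α).comp p₂) Path.nil = ofPath K (p₂.comp p₁) := by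
  rw [derivAux_comp, derivAux_eq_zero h₂]
  simp [derivAux, derivAux_eq_zero h₁]

lemma cyclicDeriv_finsum {S : Set (BasedCycle V)} (hS : S.Finite) (α : Total V) :
    cyclicDeriv K α (∑ᶠ c ∈ S, Finsupp.single c 1) = ∑ᶠ c ∈ S, derivAux K α c.2 Path.nil := by
  rw [finsum_mem_eq_finite_toFinset_sum _ hS, finsum_mem_eq_finite_toFinset_sum _ hS, map_sum]
  exact Finset.sum_congr rfl fun c _ => by simp [cyclicDeriv]

lemma cyclicDeriv_finsum_zero {S : Set (BasedCycle V)} (hS : S.Finite) (α : Total V) (h : ∀ c ∈ S,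
    α ∉ arrowList c.2) : cyclicDeriv K α (∑ᶠ c ∈ S, Finsupp.single c 1) = 0 := by
  rw [cyclicDeriv_finsum hS]
  exact finsum_mem_eq_zero_of_forall_eq_zero fun c hc => derivAux_eq_zero (h c hc) _

lemma cyclicDeriv_finsum_unique {S : Set (BasedCycle V)} (hS : S.Finite) (α : Total V)
    (c₀ : BasedCycle V) (h₀ : c₀ ∈ S) (h : ∀ c ∈ S, α ∈ arrowList c.2 → c = c₀) :
    cyclicDeriv K α (∑ᶠ c ∈ S, Finsupp.single c 1) = derivAux K α c₀.2 Path.nil := by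
  rw [cyclicDeriv_finsum hS, finsum_mem_eq_finite_toFinset_sum _ hS,
    Finset.sum_eq_single c₀]
  · intro c hc hne
    refine derivAux_eq_zero (fun hm => hne (h c ?_ hm)) _
    simpa using hc
  · simp [h₀]

lemma cyclicDeriv_finsum_pair {S : Set (BasedCycle V)} (hS : S.Finite) (α : Total V) (c₀ c₁ :
    BasedCycle V) (h₀ : c₀ ∈ S) (h₁ : c₁ ∈ S) (hne : c₀ ≠ c₁) (h : ∀ c ∈ S, α ∈ arrowList c.2 → c =
    c₀ ∨ c = c₁) : cyclicDeriv K α (∑ᶠ c ∈ S, Finsupp.single c 1) = derivAux K α c₀.2 Path.nil +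
    derivAux K α c₁.2 Path.nil := by
  classical
  rw [cyclicDeriv_finsum hS, finsum_mem_eq_finite_toFinset_sum _ hS, ← Finset.sum_pair (f := fun c : BasedCycle V => derivAux K α c.2 Path.nil) hne]
  refine (Finset.sum_subset ?_ ?_).symm
  · intro c hc
    rcases Finset.mem_insert.1 hc with rfl | hc
    · simpa using h₀
    · rw [Finset.mem_singleton.1 hc]; simpa using h₁
  · intro c hc hc'
    refine derivAux_eq_zero (fun hm => hc' ?_) _
    rcases h c (by simpa using hc) hm with rfl | rfl <;> simp

end Deriv
end IceQuiver

namespace PuncturedPolygon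
open Edge IceQuiver PathAlgebra
open Quiver (Total Path)

set_option linter.unusedSectionVars false
set_option linter.unusedSimpArgs false

section
variable {n : ℕ} [hn : Fact (2 ≤ n)]

variable {k p q s x y : ℤ} {t : Tag}

/-! ### Edges and triangles on the universal cover -/

instance neZero_of_two_le : NeZero n := ⟨by have := hn.out; omega⟩

lemma two_le_int : (2 : ℤ) ≤ n := by exact_mod_cast hn.out

lemma ccwDist_int (x y : ℤ) : (ccwDist (x : ZMod n) (y : ZMod n) : ℤ) = (y - x) % n := by
  rw [ccwDist, ← Int.cast_sub, ZMod.val_intCast]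

lemma ccwDist_of_le (h0 : x ≤ y := by omega) (h1 : y < x + n := by omega) :
    (ccwDist (x : ZMod n) (y : ZMod n) : ℤ) = y - x := by
  rw [ccwDist_int, Int.emod_eq_of_lt (by omega) (by omega)]

lemma ccwDist_lt (r s : ZMod n) : ccwDist r s < n := ZMod.val_lt _

lemma exists_lift (r : ZMod n) (x : ℤ) : ∃ y : ℤ, x ≤ y ∧ y < x + n ∧ (y : ZMod n) = r := by
  refine ⟨x + ccwDist x r, by omega, ?_, ?_⟩
  · have := ccwDist_lt (x : ZMod n) r
    omega
  · rw [ccwDist]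
    push_cast
    simp

lemma eq_of_cast_eq (h : (x : ZMod n) = y) (h0 : x < y + n := by omega)
    (h1 : y < x + n := by omega) : x = y := by
  rw [ZMod.intCast_eq_intCast_iff_dvd_sub] at h
  obtain ⟨i, hi⟩ := h
  have hn := two_le_int (n := n)
  have : i = 0 := by
    by_contra hne
    rcases lt_or_gt_of_ne hne with h | h <;> nlinarith
  subst this
  omega

lemma exists_shift (h : (x : ZMod n) = y) : ∃ i : ℤ, y = x + n * i := by
  rw [ZMod.intCast_eq_intCast_iff_dvd_sub] at h
  obtain ⟨i, hi⟩ := h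
  exact ⟨i, by omega⟩

@[simp] lemma cast_shift (x i : ℤ) : ((x + n * i : ℤ) : ZMod n) = x := by
  push_cast
  simp

@[simp] lemma cast_add_n (x : ℤ) : ((x + n : ℤ) : ZMod n) = x := by
  push_cast
  simp

@[simp] lemma cast_sub_n (x : ℤ) : ((x - n : ℤ) : ZMod n) = x := by
  push_cast
  simp

variable (σ : TaggedTriangulation n)

/-- The integers `x < y < x + n` are the endpoints of a lift to the universal cover of a side or
of an arc `(P_x, P_y)` of `σ`. -/
def IsChord (x y : ℤ) : Prop :=
  x < y ∧ y < x + n ∧ chord x y ∈ σ.edges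

/-- The arc joining `P_x` to the puncture with tag `t` belongs to `σ`. -/
def IsSpoke (t : Tag) (x : ℤ) : Prop := spoke x t ∈ σ.edges

/-- Both arcs joining `P_x` to the puncture belong to `σ`. -/
def IsDigon (x : ℤ) : Prop := IsSpoke σ .plain x ∧ IsSpoke σ .notched x

variable {σ}

lemma isChord_shift (i : ℤ) : IsChord σ (x + n * i) (y + n * i) ↔ IsChord σ x y := by
  simp only [IsChord, cast_shift]
  constructor <;> rintro ⟨h1, h2, h3⟩ <;> exact ⟨by omega, by omega, h3⟩

lemma isChord_add : IsChord σ (x + n) (y + n) ↔ IsChord σ x y := by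
  simpa using isChord_shift (σ := σ) (x := x) (y := y) 1

lemma isChord_sub : IsChord σ (x - n) (y - n) ↔ IsChord σ x y := by
  rw [← isChord_add, sub_add_cancel, sub_add_cancel]

lemma isSpoke_shift (i : ℤ) : IsSpoke σ t (x + n * i) ↔ IsSpoke σ t x := by
  simp only [IsSpoke, cast_shift]

lemma isSpoke_add : IsSpoke σ t (x + n) ↔ IsSpoke σ t x := by
  simp only [IsSpoke, cast_add_n]

lemma isSpoke_sub : IsSpoke σ t (x - n) ↔ IsSpoke σ t x := by
  simp only [IsSpoke, cast_sub_n]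

lemma isChord_side (x : ℤ) : IsChord σ x (x + 1) := by
  have := two_le_int (n := n)
  refine ⟨by omega, by omega, ?_⟩
  have := σ.side_mem x
  rw [side] at this
  push_cast
  exact this

lemma isArc_chord (h0 : x + 1 < y) (h1 : y < x + n) :
    IsArc (chord (x : ZMod n) (y : ZMod n)) := by
  refine ⟨fun h => ?_, fun h => ?_⟩
  · have := eq_of_cast_eq h
    omega
  · have h : ((y : ℤ) : ZMod n) = ((x + 1 : ℤ) : ZMod n) := by rw [h]; push_cast; rfl
    have := eq_of_cast_eq h
    omega

lemma IsChord.ne_cast (h : IsChord σ x y) : (x : ZMod n) ≠ y := fun he => by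
  have := eq_of_cast_eq he (by linarith [h.1, h.2.1]) (by linarith [h.1, h.2.1])
  linarith [h.1]

lemma chord_cases {r s : ZMod n} (h : chord r s ∈ σ.edges) (x : ℤ) (hx : (x : ZMod n) = r) :
    ∃ y : ℤ, (y : ZMod n) = s ∧ IsChord σ x y := by
  obtain ⟨y, h0, h1, rfl⟩ := exists_lift s x
  subst hx
  refine ⟨y, rfl, lt_of_le_of_ne h0 ?_, h1, h⟩
  rintro rfl
  rcases σ.side_or_arc _ h with ⟨k, hk⟩ | h
  · injection hk with h1 h2
    have hh := isChord_side (σ := σ) x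
    apply hh.ne_cast
    push_cast
    rw [h1] at h2 ⊢
    exact h2
  · exact h.1 rfl

/-- Edges of `σ` do not cross. -/
lemma IsChord.not_cross (h : IsChord σ x y) (h' : IsChord σ p q) : ¬ (x < p ∧ p < y ∧ y < q) := by
  rintro ⟨h1, h2, h3⟩
  obtain ⟨h4, h5, h6⟩ := h
  obtain ⟨h7, h8, h9⟩ := h'
  refine (σ.compatible _ h6 _ h9 (isArc_chord (by omega) h5) (isArc_chord (by omega) h8)).1
    (.inl ⟨?_, ?_, ?_⟩)
  all_goals
    have e1 := ccwDist_of_le (n := n) (x := x) (y := p)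
    have e2 := ccwDist_of_le (n := n) (x := x) (y := y)
    have e3 := ccwDist_of_le (n := n) (x := p) (y := q)
    omega

lemma IsSpoke.not_cross (h' : IsSpoke σ t s) (h : IsChord σ x y) : ¬ (x < s ∧ s < y) := by
  rintro ⟨h1, h2⟩
  obtain ⟨h4, h5, h6⟩ := h
  refine (σ.compatible _ h6 _ h' (isArc_chord (by omega) h5) trivial).1 ⟨?_, ?_⟩
  all_goals
    have e1 := ccwDist_of_le (n := n) (x := x) (y := s)
    have e2 := ccwDist_of_le (n := n) (x := x) (y := y)
    omega

lemma IsSpoke.cast_eq {t' : Tag} (h : IsSpoke σ t x) (h' : IsSpoke σ t' y)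
    (ht : t ≠ t') : (x : ZMod n) = y := by
  by_contra hne
  exact (σ.compatible _ h _ h' trivial trivial).2 ⟨hne, ht⟩

lemma IsSpoke.isDigon {t' : Tag} (h : IsSpoke σ t x) (h' : IsSpoke σ t' y) (ht : t ≠ t') :
    IsDigon σ x := by
  have he := h.cast_eq h' ht
  rw [IsSpoke, ← he] at h'
  cases t <;> cases t'
  exacts [absurd rfl ht, ⟨h, h'⟩, ⟨h', h⟩, absurd rfl ht]

lemma isChord_of_maximal (h0 : x < y) (h1 : y < x + n)
    (hC : ∀ p q, IsChord σ p q → ¬ (x < p ∧ p < y ∧ y < q) ∧ ¬ (p < x ∧ x < q ∧ q < y))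
    (hS : ∀ t s, IsSpoke σ t s → ¬ (x < s ∧ s < y)) : IsChord σ x y := by
  rcases eq_or_lt_of_le (Int.add_one_le_iff.2 h0) with rfl | h0'
  · exact isChord_side x
  refine ⟨h0, h1, σ.maximal _ (isArc_chord h0' h1) fun b hb hb' => ⟨?_, ?_⟩⟩
  · have e2 := ccwDist_of_le (n := n) (x := x) (y := y)
    rcases b with ⟨r, s⟩ | ⟨r, t⟩
    · rintro (⟨h2, h3, h4⟩ | ⟨h2, h3, h4⟩)
      · obtain ⟨p, hp0, hp1, rfl⟩ := exists_lift r x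
        obtain ⟨q, rfl, hq⟩ := chord_cases hb p rfl
        have e1 := ccwDist_of_le (n := n) (x := x) (y := p)
        have e3 := ccwDist_of_le (n := n) (x := p) (y := q) (by linarith [hq.1]) hq.2.1
        exact (hC p q hq).1 ⟨by omega, by omega, by omega⟩
      · obtain ⟨p, hp0, hp1, rfl⟩ := exists_lift r (x + 1 - n)
        obtain ⟨q, rfl, hq⟩ := chord_cases hb p rfl
        have e1 := ccwDist_of_le (n := n) (x := p) (y := x)
        have e3 := ccwDist_of_le (n := n) (x := p) (y := q) (by linarith [hq.1]) hq.2.1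
        exact (hC p q hq).2 ⟨by omega, by omega, by omega⟩
    · rintro ⟨h2, h3⟩
      obtain ⟨p, hp0, hp1, rfl⟩ := exists_lift r x
      have e1 := ccwDist_of_le (n := n) (x := x) (y := p)
      exact hS t p hb ⟨by omega, by omega⟩
  · rcases b with ⟨r, s⟩ | ⟨r, t⟩ <;> exact id

lemma isSpoke_of_maximal (hC : ∀ p q, IsChord σ p q → ¬ (p < x ∧ x < q))
    (hS : ∀ t' s, IsSpoke σ t' s → t ≠ t' → (x : ZMod n) = s) : IsSpoke σ t x := by
  refine σ.maximal _ trivial fun b hb hb' => ⟨?_, ?_⟩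
  · rcases b with ⟨r, s⟩ | ⟨r, t⟩
    · rintro ⟨h2, h3⟩
      obtain ⟨p, hp0, hp1, rfl⟩ := exists_lift r (x + 1 - n)
      obtain ⟨q, rfl, hq⟩ := chord_cases hb p rfl
      have e1 := ccwDist_of_le (n := n) (x := p) (y := x)
      have e3 := ccwDist_of_le (n := n) (x := p) (y := q) (by linarith [hq.1]) hq.2.1
      exact hC p q hq ⟨by omega, by omega⟩
    · exact id
  · rcases b with ⟨r, s⟩ | ⟨r, t'⟩
    · exact id
    · rintro ⟨h1, h2⟩
      obtain ⟨p, -, -, rfl⟩ := exists_lift r 0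
      exact h1 (hS t' p hb h2)

/-- The triangle on the side of `(P_x, P_z)` opposite to the puncture. -/
lemma IsChord.exists_right {z : ℤ} (h : IsChord σ x z) (hz : x + 1 < z) :
    ∃ y, x < y ∧ y < z ∧ IsChord σ x y ∧ IsChord σ y z := by
  obtain ⟨y, ⟨hy1, hy2⟩, hmax⟩ := Int.exists_greatest_of_bdd
    (P := fun y => IsChord σ x y ∧ y < z) ⟨z, fun y hy => hy.2.le⟩ ⟨x + 1, isChord_side x, hz⟩
  have h2 := h.2.1
  refine ⟨y, hy1.1, hy2, hy1, isChord_of_maximal hy2 (by linarith [hy1.1]) ?_ ?_⟩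
  · intro p q hpq
    have a1 := h.not_cross hpq
    have a2 := hpq.not_cross h
    have a3 := hy1.not_cross hpq
    have a4 := hpq.not_cross hy1
    have a5 := hy1.1
    refine ⟨by omega, ?_⟩
    rintro ⟨b1, b2, b3⟩
    have : p = x := by omega
    subst this
    have := hmax q ⟨hpq, by omega⟩
    omega
  · intro t s hs
    have := hs.not_cross h
    have := hy1.1
    omega

/-- Among the chords strictly containing a given one, some chord is minimal; the triangle below it
gives a triangle having the given chord as a side. -/
lemma IsChord.exists_parent (h : IsChord σ x y) (h' : IsChord σ p q) (h1 : p ≤ x) (h2 : y ≤ q)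
    (hne : y - x < q - p) : (∃ z, y < z ∧ IsChord σ x z ∧ IsChord σ y z) ∨ (∃ w, w < x ∧ IsChord σ w
    x ∧ IsChord σ w y) := by
  obtain ⟨L, ⟨p, q, h', h1, h2, hne, rfl⟩, hmin⟩ := Int.exists_least_of_bdd
    (P := fun L => ∃ p q, IsChord σ p q ∧ p ≤ x ∧ y ≤ q ∧ y - x < q - p ∧ L = q - p)
    ⟨0, by rintro _ ⟨p, q, h', h1, h2, hne, rfl⟩; have := h'.1; omega⟩
    ⟨q - p, p, q, h', h1, h2, hne, rfl⟩
  have h3 := h.1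
  obtain ⟨w, hw1, hw2, hw3, hw4⟩ := h'.exists_right (by omega)
  have a1 := h.not_cross hw3
  have a2 := hw3.not_cross h
  have a3 := h.not_cross hw4
  have a4 := hw4.not_cross h
  by_cases hyw : y ≤ w
  · by_cases he : y - x < w - p
    · have := hmin _ ⟨p, w, hw3, h1, hyw, he, rfl⟩
      omega
    · obtain rfl : p = x := by omega
      obtain rfl : w = y := by omega
      exact .inl ⟨q, hw2, h', hw4⟩
  · have : w ≤ x := by omega
    by_cases he : y - x < q - w
    · have := hmin _ ⟨w, q, hw4, this, h2, he, rfl⟩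
      omega
    · obtain rfl : w = x := by omega
      obtain rfl : q = y := by omega
      exact .inr ⟨p, hw1, hw3, h'⟩

lemma IsDigon.isSpoke_cast (h : IsDigon σ k) (hs : IsSpoke σ t s) : (k : ZMod n) = s := by
  cases t
  exacts [h.2.cast_eq hs (by simp), h.1.cast_eq hs (by simp)]

lemma IsDigon.shift (h : IsDigon σ k) (i : ℤ) : IsDigon σ (k + n * i) :=
  ⟨(isSpoke_shift i).2 h.1, (isSpoke_shift i).2 h.2⟩

lemma IsDigon.of_cast (h : IsDigon σ k) (hs : (k : ZMod n) = s) : IsDigon σ s := by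
  obtain ⟨i, rfl⟩ := exists_shift hs
  exact h.shift i

lemma IsDigon.add (h : IsDigon σ k) : IsDigon σ (k + n) := h.of_cast (by simp)
lemma IsDigon.sub (h : IsDigon σ k) : IsDigon σ (k - n) := h.of_cast (by simp)

/-- A vertex which is not below a chord is joined by chords to the vertex of the once-punctured
digon. -/
lemma IsDigon.isChord_of_exposed (h : IsDigon σ k)
    (hx : ∀ p q, IsChord σ p q → ¬ (p < x ∧ x < q)) (h0 : k < x := by omega)
    (h1 : x < k + n := by omega) : IsChord σ k x ∧ IsChord σ x (k + n) := by
  have hS : ∀ t s, IsSpoke σ t s → k ≤ s → s ≤ k + n → s = k ∨ s = k + n := by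
    intro t s hs h2 h3
    have := h.isSpoke_cast hs
    rcases eq_or_lt_of_le h3 with h3 | h3
    · exact .inr h3
    · exact .inl (eq_of_cast_eq this).symm
  constructor
  all_goals
    refine isChord_of_maximal (by omega) (by omega) (fun p q hpq => ?_) fun t s hs => ?_
    · have := hx p q hpq
      have := h.1.not_cross hpq
      have := h.add.1.not_cross hpq
      omega
    · have := hS t s hs
      omega

/-- The triangle on the side of `(P_x, P_y)` containing the puncture. -/
lemma IsChord.exists_left (h : IsChord σ x y) : (∃ z, y < z ∧ IsChord σ x z ∧ IsChord σ y z) ∨ (∃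
    w, w < x ∧ IsChord σ w x ∧ IsChord σ w y) ∨ (∃ t, IsSpoke σ t x ∧ IsSpoke σ t y) ∨ (IsDigon σ x
    ∧ IsChord σ y (x + n)) ∨ (IsDigon σ y ∧ IsChord σ (y - n) x) := by
  by_cases hp : ∃ p q, IsChord σ p q ∧ p ≤ x ∧ y ≤ q ∧ y - x < q - p
  · obtain ⟨p, q, h', h1, h2, hne⟩ := hp
    rcases h.exists_parent h' h1 h2 hne with h | h
    · exact .inl h
    · exact .inr (.inl h)
  right; right
  push Not at hp
  have hxy := h.1
  have hxn := h.2.1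
  have exy : ∀ p q, IsChord σ p q → ¬ (p < x ∧ x < q) ∧ ¬ (p < y ∧ y < q) := by
    intro p q hpq
    have := hp p q hpq
    have := hpq.not_cross h
    have := h.not_cross hpq
    omega
  have ex := fun p q hpq => (exy p q hpq).1
  have ey := fun p q hpq => (exy p q hpq).2
  by_cases hd : ∃ k, IsDigon σ k
  · right
    obtain ⟨k', hk'⟩ := hd
    obtain ⟨k, h0, h1, hk⟩ := exists_lift (k' : ZMod n) x
    have hk := hk'.of_cast hk.symm
    have c1 := hk.1.not_cross h
    rcases eq_or_lt_of_le h0 with rfl | h0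
    · exact .inl ⟨hk, (hk.isChord_of_exposed ey hxy hxn).2⟩
    by_cases hky : k = y
    · subst hky
      exact .inr ⟨hk, (hk.sub.isChord_of_exposed ex).1⟩
    · have c2 := (hk.sub.isChord_of_exposed ey).1
      have := hp _ _ c2
      omega
  · left
    by_cases hs : ∃ t s, IsSpoke σ t s
    · obtain ⟨t, s, hs⟩ := hs
      exact ⟨t, isSpoke_of_maximal ex fun _ _ h1 h2 => absurd ⟨_, hs.isDigon h1 h2⟩ hd,
        isSpoke_of_maximal ey fun _ _ h1 h2 => absurd ⟨_, hs.isDigon h1 h2⟩ hd⟩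
    · push Not at hs
      exact ⟨.plain, isSpoke_of_maximal ex fun t' s' h1 => (hs t' s' h1).elim,
        isSpoke_of_maximal ey fun t' s' h1 => (hs t' s' h1).elim⟩

/-- The sides of the once-punctured digon. -/
lemma IsDigon.exists_chord (h : IsDigon σ k) : ∃ m, IsChord σ k m ∧ IsChord σ m (k + n) := by
  obtain ⟨m, hm, hmax⟩ := Int.exists_greatest_of_bdd
    (P := fun m => IsChord σ k m) ⟨k + n, fun y hy => hy.2.1.le⟩ ⟨k + 1, isChord_side k⟩
  refine ⟨m, hm, (h.isChord_of_exposed ?_ hm.1 hm.2.1).2⟩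
  intro p q hpq
  have a1 := hm.not_cross hpq
  have a2 := h.1.not_cross hpq
  have a3 := hm.1
  rintro ⟨h1, h2⟩
  obtain rfl : p = k := by omega
  have := hmax q hpq
  omega

/-- The arcs to the puncture following and preceding a given one, if there is no once-punctured
digon. -/
lemma IsSpoke.exists_next (h : IsSpoke σ t x) (hd : ¬ IsDigon σ x) :
    (∃ y, IsChord σ x y ∧ IsSpoke σ t y) ∧ (∃ w, IsChord σ w x ∧ IsSpoke σ t w) := by
  have htag : ∀ t' s, IsSpoke σ t' s → t' = t := fun t' s hs =>
    by_contra fun hne => hd (h.isDigon hs (Ne.symm hne))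
  have hother : ∃ s, IsSpoke σ t s ∧ x < s ∧ s < x + n := by
    by_contra hno
    push Not at hno
    have hx : ∀ t' s, IsSpoke σ t' s → (x : ZMod n) = s := by
      intro t' s hs
      obtain ⟨s', h0, h1, h2⟩ := exists_lift (s : ZMod n) x
      rcases eq_or_lt_of_le h0 with rfl | h0
      · exact h2
      · obtain rfl := htag t' s hs
        rw [IsSpoke, ← h2] at hs
        have := hno s' hs h0
        omega
    have : ∀ t, IsSpoke σ t x := fun t => isSpoke_of_maximal (fun p q hpq => h.not_cross hpq)
      fun t' s h1 _ => hx t' s h1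
    exact hd ⟨this _, this _⟩
  obtain ⟨s, hs1, hs2, hs3⟩ := hother
  constructor
  · obtain ⟨y, ⟨hy1, hy2⟩, hmin⟩ := Int.exists_least_of_bdd
      (P := fun y => IsSpoke σ t y ∧ x < y) ⟨x, fun y hy => hy.2.le⟩ ⟨s, hs1, hs2⟩
    have := hmin s ⟨hs1, hs2⟩
    refine ⟨y, isChord_of_maximal hy2 (by omega) ?_ ?_, hy1⟩
    · intro p q hpq
      have := h.not_cross hpq
      have := hy1.not_cross hpq
      omega
    · intro t' s' hs'
      obtain rfl := htag t' s' hs'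
      have := hmin s'
      by_contra hc
      have := this ⟨hs', hc.1⟩
      omega
  · obtain ⟨w, ⟨hw1, hw2⟩, hmax⟩ := Int.exists_greatest_of_bdd
      (P := fun y => IsSpoke σ t y ∧ y < x) ⟨x, fun y hy => hy.2.le⟩
      ⟨s - n, isSpoke_sub.2 hs1, by omega⟩
    have := hmax (s - n) ⟨isSpoke_sub.2 hs1, by omega⟩
    refine ⟨w, isChord_of_maximal hw2 (by omega) ?_ ?_, hw1⟩
    · intro p q hpq
      have := h.not_cross hpq
      have := hw1.not_cross hpq
      omega
    · intro t' s' hs'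
      obtain rfl := htag t' s' hs'
      have := hmax s'
      by_contra hc
      have := this ⟨hs', hc.2⟩
      omega

end

section
variable {n : ℕ} [hn : Fact (2 ≤ n)]

variable {X Y x y y' : ℤ} {t t' : Tag}

/-! ### Clockwise triangles and internal arrows -/

/-- The vertex `P_x`, for an integer `x`, as a possible joint vertex of two edges. -/
notation "pt(" x ")" => some (Int.cast x : ZMod _)

/-- The edge `(P_x, P_y)`, for integers `x` and `y`. -/
abbrev ch (x y : ℤ) : Edge n := chord x y

/-- The arc joining `P_x` to the puncture, for an integer `x`. -/
abbrev sp (x : ℤ) (t : Tag) : Edge n := spoke x t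

variable {σ : TaggedTriangulation n}

lemma IsChord.mem (h : IsChord σ x y) : ch x y ∈ σ.edges := h.2.2

lemma IsDigon.mem (h : IsDigon σ x) : ∀ t, sp x t ∈ σ.edges
  | .plain => h.1
  | .notched => h.2

lemma edge_cases {a : Edge n} (ha : a ∈ σ.edges) :
    (∃ x y, IsChord σ x y ∧ a = ch x y) ∨ (∃ x t, IsSpoke σ t x ∧ a = sp x t) := by
  rcases a with ⟨r, s⟩ | ⟨r, t⟩
  · obtain ⟨x, -, -, rfl⟩ := exists_lift r 0
    obtain ⟨y, rfl, h⟩ := chord_cases ha x rfl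
    exact .inl ⟨x, y, h, rfl⟩
  · obtain ⟨x, -, -, rfl⟩ := exists_lift r 0
    exact .inr ⟨x, t, ha, rfl⟩

variable (σ) in
/-- Clockwise triangles, in terms of lifts of their vertices to the universal cover. -/
inductive LTri : Edge n → Edge n → Edge n →
    Option (ZMod n) → Option (ZMod n) → Option (ZMod n) → Prop
  | polygon (x y z : ℤ) (hxy : IsChord σ x y) (hyz : IsChord σ y z) (hxz : IsChord σ x z) :
      LTri (ch x y) (ch x z) (ch y z) (some x) (some z) (some y)
  | puncture (x y : ℤ) (t : Tag) (hxy : IsChord σ x y) (hx : IsSpoke σ t x) (hy : IsSpoke σ t y) :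
      LTri (ch x y) (sp x t) (sp y t) (some x) none (some y)
  | digon (k m : ℤ) (t : Tag) (hkm : IsChord σ k m) (hmk : IsChord σ m (k + n))
      (hk : IsDigon σ k) :
      LTri (ch m k) (ch k m) (sp k t) (some m) (some k) (some k)

lemma clockwiseTriangle_iff {a b c : Edge n} {p q r : Option (ZMod n)} :
    ClockwiseTriangle σ a b c p q r ↔ LTri σ a b c p q r := by
  constructor
  · rintro (⟨x, y, z, hd, hxy, hyz, hxz⟩ | ⟨x, y, t, hxy, hx, hy⟩ | ⟨k, m, t, hmk, hkm, hp, hn'⟩)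
    · obtain ⟨x, -, -, rfl⟩ := exists_lift x 0
      obtain ⟨y, rfl, hy⟩ := chord_cases hxy x rfl
      obtain ⟨z, rfl, hz⟩ := chord_cases hyz y rfl
      refine .polygon x y z hy hz ⟨hy.1.trans hz.1, ?_, hxz⟩
      have e1 := ccwDist_of_le (n := n) hy.1.le hy.2.1
      have e2 := ccwDist_of_le (n := n) hz.1.le hz.2.1
      have := ccwDist_lt (x : ZMod n) z
      omega
    · obtain ⟨x, -, -, rfl⟩ := exists_lift x 0
      obtain ⟨y, rfl, hy'⟩ := chord_cases hxy x rfl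
      exact .puncture x y t hy' hx hy
    · obtain ⟨k, -, -, rfl⟩ := exists_lift k 0
      obtain ⟨m, rfl, hm⟩ := chord_cases hkm k rfl
      refine .digon k m t hm ⟨by linarith [hm.2.1], by linarith [hm.1], ?_⟩ ⟨hp, hn'⟩
      rw [cast_add_n]
      exact hmk
  · rintro (⟨x, y, z, hxy, hyz, hxz⟩ | ⟨x, y, t, hxy, hx, hy⟩ | ⟨k, m, t, hkm, hmk, hk⟩)
    · refine .polygon _ _ _ ?_ hxy.2.2 hyz.2.2 hxz.2.2
      have e1 := ccwDist_of_le (n := n) hxy.1.le hxy.2.1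
      have e2 := ccwDist_of_le (n := n) hyz.1.le hyz.2.1
      have e3 := ccwDist_of_le (n := n) hxz.1.le hxz.2.1
      omega
    · exact .puncture _ _ _ hxy.2.2 hx hy
    · have := hmk.2.2
      rw [cast_add_n] at this
      exact .digon _ _ _ this hkm.2.2 hk.1 hk.2

variable (σ) in
/-- `LArr σ i J J₁ J₂ a b c`: there is a clockwise triangle `a → b → c → a` with joint vertices `J` of
`a, b`, `J₁` of `b, c` and `J₂` of `c, a`; its arrow `a → b` has position `i` in the chosen
cyclic presentation of the triangle. -/
inductive LArr : Fin 3 → Option (ZMod n) → Option (ZMod n) → Option (ZMod n) →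
    Edge n → Edge n → Edge n → Prop
  | A1 (x y z : ℤ) (hxy : IsChord σ x y) (hyz : IsChord σ y z) (hxz : IsChord σ x z) :
      LArr 0 (some x) (some z) (some y) (ch x y) (ch x z) (ch y z)
  | A2 (x y z : ℤ) (hxy : IsChord σ x y) (hyz : IsChord σ y z) (hxz : IsChord σ x z) :
      LArr 1 (some z) (some y) (some x) (ch x z) (ch y z) (ch x y)
  | A3 (x y z : ℤ) (hxy : IsChord σ x y) (hyz : IsChord σ y z) (hxz : IsChord σ x z) :
      LArr 2 (some y) (some x) (some z) (ch y z) (ch x y) (ch x z)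
  | B1 (x y : ℤ) (t : Tag) (hxy : IsChord σ x y) (hx : IsSpoke σ t x) (hy : IsSpoke σ t y) :
      LArr 0 (some x) none (some y) (ch x y) (sp x t) (sp y t)
  | B2 (x y : ℤ) (t : Tag) (hxy : IsChord σ x y) (hx : IsSpoke σ t x) (hy : IsSpoke σ t y) :
      LArr 1 none (some y) (some x) (sp x t) (sp y t) (ch x y)
  | B3 (x y : ℤ) (t : Tag) (hxy : IsChord σ x y) (hx : IsSpoke σ t x) (hy : IsSpoke σ t y) :
      LArr 2 (some y) (some x) none (sp y t) (ch x y) (sp x t)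
  | D1 (k m : ℤ) (t : Tag) (hkm : IsChord σ k m) (hmk : IsChord σ m (k + n)) (hk : IsDigon σ k) :
      LArr 0 (some m) (some k) (some k) (ch m k) (ch k m) (sp k t)
  | D2 (k m : ℤ) (t : Tag) (hkm : IsChord σ k m) (hmk : IsChord σ m (k + n)) (hk : IsDigon σ k) :
      LArr 1 (some k) (some k) (some m) (ch k m) (sp k t) (ch m k)
  | D3 (k m : ℤ) (t : Tag) (hkm : IsChord σ k m) (hmk : IsChord σ m (k + n)) (hk : IsDigon σ k) :
      LArr 2 (some k) (some m) (some k) (sp k t) (ch m k) (ch k m)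

variable {i : Fin 3} {J J₁ J₂ : Option (ZMod n)} {a b c : Edge n}

lemma LArr.rotate (h : LArr σ i J J₁ J₂ a b c) : LArr σ (i + 1) J₁ J₂ J b c a := by
  cases h
  · exact .A2 _ _ _ ‹_› ‹_› ‹_›
  · exact .A3 _ _ _ ‹_› ‹_› ‹_›
  · exact .A1 _ _ _ ‹_› ‹_› ‹_›
  · exact .B2 _ _ _ ‹_› ‹_› ‹_›
  · exact .B3 _ _ _ ‹_› ‹_› ‹_›
  · exact .B1 _ _ _ ‹_› ‹_› ‹_›
  · exact .D2 _ _ _ ‹_› ‹_› ‹_›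
  · exact .D3 _ _ _ ‹_› ‹_› ‹_›
  · exact .D1 _ _ _ ‹_› ‹_› ‹_›

lemma LArr.of_triangle (h : ClockwiseTriangle σ a b c J J₁ J₂) : LArr σ 0 J J₁ J₂ a b c := by
  cases clockwiseTriangle_iff.1 h
  · exact .A1 _ _ _ ‹_› ‹_› ‹_›
  · exact .B1 _ _ _ ‹_› ‹_› ‹_›
  · exact .D1 _ _ _ ‹_› ‹_› ‹_›

lemma LArr.triangle (h : LArr σ 0 J J₁ J₂ a b c) : ClockwiseTriangle σ a b c J J₁ J₂ := by
  rw [clockwiseTriangle_iff]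
  generalize h0 : (0 : Fin 3) = i at h
  cases h
  · exact .polygon _ _ _ ‹_› ‹_› ‹_›
  · simp at h0
  · simp at h0
  · exact .puncture _ _ _ ‹_› ‹_› ‹_›
  · simp at h0
  · simp at h0
  · exact .digon _ _ _ ‹_› ‹_› ‹_›
  · simp at h0
  · simp at h0

lemma corner_iff : Corner σ J a b ↔ ∃ i J₁ J₂ c, LArr σ i J J₁ J₂ a b c := by
  constructor
  · rintro ⟨c, p, q, h | h | h⟩
    · exact ⟨_, _, _, _, .of_triangle h⟩
    · exact ⟨_, _, _, _, (LArr.of_triangle h).rotate⟩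
    · exact ⟨_, _, _, _, (LArr.of_triangle h).rotate.rotate⟩
  · rintro ⟨i, J₁, J₂, c, h⟩
    fin_cases i
    · exact ⟨_, _, _, .inl h.triangle⟩
    · exact ⟨_, _, _, .inr (.inl h.rotate.rotate.triangle)⟩
    · exact ⟨_, _, _, .inr (.inr h.rotate.triangle)⟩

lemma LArr.corner (h : LArr σ i J J₁ J₂ a b c) : Corner σ J a b :=
  corner_iff.2 ⟨_, _, _, c, h⟩

lemma IsDigon.chord_mem {k m : ℤ} (h : IsChord σ m (k + n)) : ch m k ∈ σ.edges := by
  simpa using h.2.2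

lemma LArr.mem (h : LArr σ i J J₁ J₂ a b c) : a ∈ σ.edges ∧ b ∈ σ.edges ∧ c ∈ σ.edges := by
  cases h
  · exact ⟨IsChord.mem ‹_›, IsChord.mem ‹_›, IsChord.mem ‹_›⟩
  · exact ⟨IsChord.mem ‹_›, IsChord.mem ‹_›, IsChord.mem ‹_›⟩
  · exact ⟨IsChord.mem ‹_›, IsChord.mem ‹_›, IsChord.mem ‹_›⟩
  · exact ⟨IsChord.mem ‹_›, ‹_›, ‹_›⟩
  · exact ⟨‹_›, ‹_›, IsChord.mem ‹_›⟩
  · exact ⟨‹_›, IsChord.mem ‹_›, ‹_›⟩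
  · rename_i h1 h2 h3
    exact ⟨IsDigon.chord_mem h2, h1.mem, h3.mem _⟩
  · rename_i h1 h2 h3
    exact ⟨h1.mem, h3.mem _, IsDigon.chord_mem h2⟩
  · rename_i h1 h2 h3
    exact ⟨h3.mem _, IsDigon.chord_mem h2, h1.mem⟩

lemma Corner.mem (h : Corner σ J a b) : a ∈ σ.edges ∧ b ∈ σ.edges := by
  obtain ⟨_, _, _, _, h⟩ := corner_iff.1 h
  exact ⟨h.mem.1, h.mem.2.1⟩

/-- Two lifts of the same edge differ by a multiple of the period. -/
lemma IsChord.exists_shift (h : IsChord σ x y) (H : IsChord σ X Y)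
    (hx : (x : ZMod n) = X) (hy : (y : ZMod n) = Y) : ∃ i : ℤ, X = x + n * i ∧ Y = y + n * i := by
  obtain ⟨i, rfl⟩ := PuncturedPolygon.exists_shift hx
  refine ⟨i, rfl, ?_⟩
  refine (eq_of_cast_eq (n := n) ?_ ?_ ?_).symm
  · rw [cast_shift, hy]
  · linarith [h.1, h.2.1, H.1, H.2.1]
  · linarith [h.1, h.2.1, H.1, H.2.1]

lemma IsChord.sh (h : IsChord σ x y) (i : ℤ) : IsChord σ (x + n * i) (y + n * i) :=
  (isChord_shift i).2 h

lemma IsSpoke.sh (h : IsSpoke σ t x) (i : ℤ) : IsSpoke σ t (x + n * i) :=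
  (isSpoke_shift i).2 h

/-- The possible triangles on the side of a chord `(P_X, P_Y)` containing the puncture:
`right w` if the chord is the side `(P_X, P_Y)` of the triangle `w < X < Y`, `left z` for the
triangle `X < Y < z`, `spokes t` if the third vertex is the puncture, and `digon₁`, `digon₂` for a
once-punctured digon whose two arcs to the puncture end at `P_X` or at `P_Y`. -/
inductive LKind
  | right (w : ℤ)
  | left (z : ℤ)
  | spokes (t : Tag)
  | digon₁
  | digon₂

variable (σ) in
/-- The chord `(P_X, P_Y)` has a triangle of the given kind on the side of the puncture. -/
def LeftOpt (X Y : ℤ) : LKind → Prop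
  | .right w => IsChord σ w X ∧ IsChord σ w Y
  | .left z => IsChord σ Y z ∧ IsChord σ X z
  | .spokes t => IsSpoke σ t X ∧ IsSpoke σ t Y
  | .digon₁ => IsDigon σ X ∧ IsChord σ Y (X + n)
  | .digon₂ => IsDigon σ Y ∧ IsChord σ (Y - n) X

namespace LKind

/-- The edge following `(P_X, P_Y)` in its triangle on the side of the puncture. -/
def tgt (X Y : ℤ) (t : Tag) : LKind → Edge n
  | right w => ch w X
  | left z => ch X z
  | spokes t' => sp X t'
  | digon₁ => sp X t
  | digon₂ => ch Y X

/-- The edge preceding `(P_X, P_Y)` in its triangle on the side of the puncture. -/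
def src (X Y : ℤ) (t : Tag) : LKind → Edge n
  | right w => ch w Y
  | left z => ch Y z
  | spokes t' => sp Y t'
  | digon₁ => ch Y X
  | digon₂ => sp Y t

/-- The vertex opposite to `(P_X, P_Y)` in its triangle on the side of the puncture. -/
def apex (X Y : ℤ) : LKind → Option (ZMod n)
  | right w => some w
  | left z => some z
  | spokes _ => none
  | digon₁ => some X
  | digon₂ => some Y

/-- The position of the arrow leaving `(P_X, P_Y)`. -/
def pos : LKind → Fin 3
  | right _ => 2
  | left _ => 0
  | spokes _ => 0
  | digon₁ => 1
  | digon₂ => 0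

end LKind

lemma IsChord.exists_leftOpt (h : IsChord σ X Y) : ∃ κ, LeftOpt σ X Y κ := by
  rcases h.exists_left with ⟨z, h1, h2, h3⟩ | ⟨w, h1, h2, h3⟩ | ⟨t, h1, h2⟩ | ⟨h1, h2⟩ | ⟨h1, h2⟩
  · exact ⟨.left z, h3, h2⟩
  · exact ⟨.right w, h2, h3⟩
  · exact ⟨.spokes t, h1, h2⟩
  · exact ⟨.digon₁, h1, h2⟩
  · exact ⟨.digon₂, h1, h2⟩

lemma LeftOpt.larr {κ : LKind} (H : IsChord σ X Y) (h : LeftOpt σ X Y κ) (t : Tag) :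
    LArr σ κ.pos (some X) (κ.apex X Y) (some Y) (ch X Y) (κ.tgt X Y t) (κ.src X Y t) := by
  cases κ with
  | right w => exact .A3 w X Y h.1 H h.2
  | left z => exact .A1 X Y z H h.1 h.2
  | spokes t' => exact .B1 X Y t' H h.1 h.2
  | digon₁ => exact .D2 X Y t H h.2 h.1
  | digon₂ =>
    have := LArr.D1 (Y - n) X t h.2 (by rw [sub_add_cancel]; exact H) h.1.sub
    simpa [LKind.pos, LKind.apex, LKind.tgt, LKind.src, ch, sp] using this

/-- A chord lies in at most one triangle on the side of the puncture. -/
lemma LeftOpt.unique {κ κ' : LKind} (H : IsChord σ X Y) (h : LeftOpt σ X Y κ)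
    (h' : LeftOpt σ X Y κ') : κ = κ' := by
  have hXY := H.1
  have key : ∀ w z, IsChord σ w X → IsChord σ w Y → IsChord σ Y z → IsChord σ X z → False := by
    intro w z h1 h2 h3 h4
    have := h2.not_cross h4
    have := h1.1; have := h3.1
    omega
  have key2 : ∀ t w, IsSpoke σ t X → IsChord σ w X → IsChord σ w Y → False := by
    intro t w h1 h2 h3
    have := h1.not_cross h3
    have := h2.1
    omega
  have key3 : ∀ t z, IsSpoke σ t Y → IsChord σ Y z → IsChord σ X z → False := by
    intro t w h1 h2 h3
    have := h1.not_cross h3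
    have := h2.1
    omega
  have key4 : ∀ z, IsChord σ Y (X + n) → IsChord σ Y z → IsChord σ X z → False := by
    intro z h1 h2 h3
    have := h3.not_cross h1
    have := h3.2.1; have := h2.1
    omega
  have key5 : ∀ w, IsChord σ (Y - n) X → IsChord σ w X → IsChord σ w Y → False := by
    intro z h1 h2 h3
    have := h1.not_cross h3
    have := h3.2.1; have := h2.1
    omega
  cases κ <;> cases κ'
  · rename_i w w'
    have := h.1.not_cross h'.2
    have := h'.1.not_cross h.2
    have := h.1.1; have := h'.1.1
    obtain rfl : w = w' := by omega
    rfl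
  · exact (key _ _ h.1 h.2 h'.1 h'.2).elim
  · exact (key2 _ _ h'.1 h.1 h.2).elim
  · exact (key2 _ _ h'.1.1 h.1 h.2).elim
  · exact (key5 _ h'.2 h.1 h.2).elim
  · exact (key _ _ h'.1 h'.2 h.1 h.2).elim
  · rename_i w w'
    have := h.2.not_cross h'.1
    have := h'.2.not_cross h.1
    have := h.1.1; have := h'.1.1
    obtain rfl : w = w' := by omega
    rfl
  · exact (key3 _ _ h'.2 h.1 h.2).elim
  · exact (key4 _ h'.2 h.1 h.2).elim
  · exact (key3 _ _ h'.1.1 h.1 h.2).elim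
  · exact (key2 _ _ h.1 h'.1 h'.2).elim
  · exact (key3 _ _ h.2 h'.1 h'.2).elim
  · by_contra hne
    exact H.ne_cast (h.1.cast_eq h'.2 fun h => hne (by rw [h]))
  · exact (H.ne_cast (h'.1.isSpoke_cast h.2)).elim
  · exact (H.ne_cast (h'.1.isSpoke_cast h.1).symm).elim
  · exact (key2 _ _ h.1.1 h'.1 h'.2).elim
  · exact (key4 _ h.2 h'.1 h'.2).elim
  · exact (H.ne_cast (h.1.isSpoke_cast h'.2)).elim
  · rfl
  · exact (H.ne_cast (h.1.isSpoke_cast h'.1.1)).elim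
  · exact (key5 _ h.2 h'.1 h'.2).elim
  · exact (key3 _ _ h.1.1 h'.1 h'.2).elim
  · exact (H.ne_cast (h.1.isSpoke_cast h'.1).symm).elim
  · exact (H.ne_cast (h'.1.isSpoke_cast h.1.1)).elim
  · rfl

/-- A chord lies in at most one triangle on the side opposite to the puncture. -/
lemma IsChord.right_unique {w w' : ℤ} (h1 : IsChord σ X w) (h2 : IsChord σ w Y)
    (h1' : IsChord σ X w') (h2' : IsChord σ w' Y) : w = w' := by
  have := h1.not_cross h2'
  have := h1'.not_cross h2
  have := h1.1; have := h1'.1; have := h2.1; have := h2'.1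
  omega

/-- The arrows leaving a chord. -/
lemma LArr.out_chord (H : IsChord σ X Y) (h : LArr σ i J J₁ J₂ (ch X Y) b c) : (∃ κ t, LeftOpt σ X
    Y κ ∧ i = κ.pos ∧ J = pt(X) ∧ J₁ = κ.apex X Y ∧ J₂ = pt(Y) ∧ b = κ.tgt X
    Y t ∧ c = κ.src X Y t) ∨ (∃ w, IsChord σ X w ∧ IsChord σ w Y ∧ i = 1 ∧ J = pt(Y) ∧
    J₁ = pt(w) ∧ J₂ = pt(X) ∧ b = ch w Y ∧ c = ch X w) := by
  generalize ha : ch X Y = a at h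
  cases h with
  | A1 x y z h1 h2 h3 =>
    injection ha with e1 e2
    obtain ⟨i, rfl, rfl⟩ := h1.exists_shift H e1.symm e2.symm
    exact .inl ⟨.left (z + n * i), .plain, ⟨h2.sh i, h3.sh i⟩, by simp [LKind.pos, LKind.apex, LKind.tgt, LKind.src]⟩
  | A2 x y z h1 h2 h3 =>
    injection ha with e1 e2
    obtain ⟨i, rfl, rfl⟩ := h3.exists_shift H e1.symm e2.symm
    exact .inr ⟨y + n * i, h1.sh i, h2.sh i, by simp⟩
  | A3 x y z h1 h2 h3 =>
    injection ha with e1 e2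
    obtain ⟨i, rfl, rfl⟩ := h2.exists_shift H e1.symm e2.symm
    exact .inl ⟨.right (x + n * i), .plain, ⟨h1.sh i, h3.sh i⟩, by simp [LKind.pos, LKind.apex, LKind.tgt, LKind.src]⟩
  | B1 x y t h1 h2 h3 =>
    injection ha with e1 e2
    obtain ⟨i, rfl, rfl⟩ := h1.exists_shift H e1.symm e2.symm
    exact .inl ⟨.spokes t, .plain, ⟨h2.sh i, h3.sh i⟩, by simp [LKind.pos, LKind.apex, LKind.tgt, LKind.src]⟩
  | B2 => cases ha
  | B3 => cases ha
  | D1 k m t h1 h2 h3 =>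
    injection ha with e1 e2
    obtain ⟨i, rfl, rfl⟩ := h2.exists_shift H e1.symm (by rw [cast_add_n]; exact e2.symm)
    refine .inl ⟨.digon₂, t, ⟨(h3.shift i).of_cast (by simp), ?_⟩, by simp [LKind.pos, LKind.apex, LKind.tgt, LKind.src]⟩
    convert h1.sh i using 1
    ring
  | D2 k m t h1 h2 h3 =>
    injection ha with e1 e2
    obtain ⟨i, rfl, rfl⟩ := h1.exists_shift H e1.symm e2.symm
    refine .inl ⟨.digon₁, t, ⟨h3.shift i, ?_⟩, by simp [LKind.pos, LKind.apex, LKind.tgt, LKind.src]⟩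
    convert h2.sh i using 1
    ring
  | D3 => cases ha

/-- The arrows leaving an arc to the puncture. -/
lemma LArr.out_spoke (h : LArr σ i J J₁ J₂ (sp X t) b c) : (∃ y, IsChord σ X y ∧ IsSpoke σ t X ∧
    IsSpoke σ t y ∧ i = 1 ∧ J = none ∧ J₁ = pt(y) ∧ J₂ = pt(X) ∧ b = sp y t
    ∧ c = ch X y) ∨ (∃ w, IsChord σ w X ∧ IsSpoke σ t w ∧ IsSpoke σ t X ∧ i = 2 ∧ J = some (X : ZMod
    n) ∧ J₁ = pt(w) ∧ J₂ = none ∧ b = ch w X ∧ c = sp w t) ∨ (∃ m, IsDigon σ X ∧ IsChord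
    σ X m ∧ IsChord σ m (X + n) ∧ i = 2 ∧ J = pt(X) ∧ J₁ = pt(m) ∧ J₂ = some
    (X : ZMod n) ∧ b = ch m X ∧ c = ch X m) := by
  generalize ha : sp X t = a at h
  cases h with
  | A1 => cases ha
  | A2 => cases ha
  | A3 => cases ha
  | B1 => cases ha
  | B2 x y t h1 h2 h3 =>
    injection ha with e1 e2
    subst e2
    obtain ⟨i, rfl⟩ := PuncturedPolygon.exists_shift e1.symm
    exact .inl ⟨y + n * i, h1.sh i, h2.sh i, h3.sh i, by simp⟩
  | B3 x y t h1 h2 h3 =>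
    injection ha with e1 e2
    subst e2
    obtain ⟨i, rfl⟩ := PuncturedPolygon.exists_shift e1.symm
    exact .inr (.inl ⟨x + n * i, h1.sh i, h2.sh i, h3.sh i, by simp⟩)
  | D1 => cases ha
  | D2 => cases ha
  | D3 k m t h1 h2 h3 =>
    injection ha with e1 e2
    obtain ⟨i, rfl⟩ := PuncturedPolygon.exists_shift e1.symm
    refine .inr (.inr ⟨m + n * i, h3.shift i, h1.sh i, ?_, by simp⟩)
    convert h2.sh i using 1
    ring

lemma IsSpoke.next_unique (h1 : IsChord σ X y) (h2 : IsSpoke σ t y)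
    (h1' : IsChord σ X y') (h2' : IsSpoke σ t' y') : y = y' := by
  have := h2.not_cross h1'
  have := h2'.not_cross h1
  have := h1.1; have := h1'.1
  omega

lemma IsSpoke.prev_unique (h1 : IsChord σ y X) (h2 : IsSpoke σ t y)
    (h1' : IsChord σ y' X) (h2' : IsSpoke σ t' y') : y = y' := by
  have := h2.not_cross h1'
  have := h2'.not_cross h1
  have := h1.1; have := h1'.1
  omega

/-- The triangle containing a given arrow is unique, except for the arrow shared by the two triangles
of a once-punctured digon. -/
lemma LArr.third_unique {i' : Fin 3} {J₁' J₂' : Option (ZMod n)} {c' : Edge n}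
    (h : LArr σ i J J₁ J₂ a b c) (h' : LArr σ i' J J₁' J₂' a b c') :
    i' = i ∧ J₁' = J₁ ∧ J₂' = J₂ ∧ (c' = c ∨ ∃ k t t', IsDigon σ k ∧ c = sp k t ∧ c' = sp k t') := by
  obtain ⟨x, y, H, rfl⟩ | ⟨x, t, H, rfl⟩ := edge_cases h.mem.1
  · rcases h.out_chord H with ⟨κ, t, h1, rfl, rfl, rfl, rfl, rfl, rfl⟩ |
      ⟨w, h1, h2, rfl, rfl, rfl, rfl, rfl, rfl⟩
    · rcases h'.out_chord H with ⟨κ', t', h1', rfl, -, rfl, rfl, e, rfl⟩ |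
        ⟨w', h1', h2', -, e, -⟩
      · obtain rfl := h1.unique H h1'
        refine ⟨rfl, rfl, rfl, ?_⟩
        cases κ with
        | right w => exact .inl rfl
        | left w => exact .inl rfl
        | spokes w => exact .inl rfl
        | digon₁ => exact .inl rfl
        | digon₂ => exact .inr ⟨y, t, t', h1.1, rfl, rfl⟩
      · exact (H.ne_cast (Option.some.inj e)).elim
    · rcases h'.out_chord H with ⟨κ', t', h1', rfl, e, -⟩ |
        ⟨w', h1', h2', rfl, e, rfl, rfl, -, rfl⟩
      · exact (H.ne_cast (Option.some.inj e).symm).elim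
      · obtain rfl := h1.right_unique h2 h1' h2'
        exact ⟨rfl, rfl, rfl, .inl rfl⟩
  · rcases h.out_spoke with ⟨y, h1, h2, h3, rfl, rfl, rfl, rfl, rfl, rfl⟩ |
      ⟨y, h1, h2, h3, rfl, rfl, rfl, rfl, rfl, rfl⟩ | ⟨y, h1, h2, h3, rfl, rfl, rfl, rfl, rfl, rfl⟩
    · rcases h'.out_spoke with ⟨y', h1', h2', h3', rfl, -, rfl, rfl, -, rfl⟩ |
        ⟨y', h1', h2', h3', rfl, e, -⟩ | ⟨y', h1', h2', h3', rfl, e, -⟩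
      · obtain rfl := h3.next_unique h1 h1' h3'
        exact ⟨rfl, rfl, rfl, .inl rfl⟩
      · cases e
      · cases e
    · rcases h'.out_spoke with ⟨y', h1', h2', h3', rfl, e, -⟩ |
        ⟨y', h1', h2', h3', rfl, -, rfl, rfl, -, rfl⟩ | ⟨y', h1', h2', h3', rfl, -⟩
      · cases e
      · obtain rfl := h2.prev_unique h1 h1' h2'
        exact ⟨rfl, rfl, rfl, .inl rfl⟩
      · exact (h1.ne_cast (h1'.isSpoke_cast h2).symm).elim
    · rcases h'.out_spoke with ⟨y', h1', h2', h3', rfl, e, -⟩ |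
        ⟨y', h1', h2', h3', rfl, -⟩ | ⟨y', h1', h2', h3', rfl, -, rfl, rfl, -, rfl⟩
      · cases e
      · exact (h1'.ne_cast (h1.isSpoke_cast h2').symm).elim
      · obtain rfl := h2.right_unique h3 h2' h3'
        exact ⟨rfl, rfl, rfl, .inl rfl⟩

/-- The arrows ending at a chord. -/
lemma LArr.in_chord (H : IsChord σ X Y) (h : LArr σ i J J₁ J₂ a (ch X Y) c) :
    (J = pt(X) ∧ ∃ w, IsChord σ X w ∧ IsChord σ w Y ∧ a = ch X w) ∨
    (J = pt(Y) ∧ ∃ κ t, LeftOpt σ X Y κ ∧ a = κ.src X Y t) := by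
  rcases h.rotate.out_chord H with ⟨κ, t, h1, -, -, -, h2, -, h3⟩ | ⟨w, h1, h2, -, -, -, h3, -, h4⟩
  · exact .inr ⟨h2, κ, t, h1, h3⟩
  · exact .inl ⟨h3, w, h1, h2, h4⟩

/-- The arrows ending at an arc to the puncture. -/
lemma LArr.in_spoke (h : LArr σ i J J₁ J₂ a (sp X t) c) : (J = pt(X) ∧ ∃ y, IsChord σ
    X y ∧ IsSpoke σ t X ∧ IsSpoke σ t y ∧ a = ch X y) ∨ (J = none ∧ ∃ w, IsChord σ w X ∧ IsSpoke σ t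
    w ∧ IsSpoke σ t X ∧ a = sp w t) ∨ (J = pt(X) ∧ ∃ m, IsDigon σ X ∧ IsChord σ X m ∧
    IsChord σ m (X + n) ∧ a = ch X m) := by
  rcases h.rotate.out_spoke with ⟨y, h1, h2, h3, -, -, -, h4, -, h5⟩ |
    ⟨y, h1, h2, h3, -, -, -, h4, -, h5⟩ | ⟨y, h1, h2, h3, -, -, -, h4, -, h5⟩
  all_goals grind

end

section
variable {n : ℕ} [hn : Fact (2 ≤ n)] {σ : TaggedTriangulation n}
  {i : Fin 3} {J J₁ J₂ : Option (ZMod n)} {a b c : Edge n}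

variable {X Y x y : ℤ} {t : Tag} {k : ZMod n}

/-! ### Visible edges and the arrows at a vertex -/

variable (σ) in
/-- The edge is not the notched arc of a once-punctured digon. -/
def Visible (a : Edge n) : Prop := ¬ ∃ k, a = spoke k Tag.notched ∧ spoke k Tag.plain ∈ σ.edges

lemma visible_chord (r s : ZMod n) : Visible σ (chord r s) := by rintro ⟨k, h, -⟩; cases h

lemma visible_plain (r : ZMod n) : Visible σ (spoke r .plain) := by rintro ⟨k, h, -⟩; cases h

lemma IsDigon.visible_iff (h : IsDigon σ x) : Visible σ (sp x t) ↔ t = .plain := by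
  constructor
  · intro hv
    cases t
    · rfl
    · exact (hv ⟨_, rfl, h.1⟩).elim
  · rintro rfl
    exact visible_plain _

lemma visible_of_not_digon (ht : IsSpoke σ t x) (h : ¬ IsDigon σ x) : Visible σ (sp x t) := by
  rintro ⟨k, hk, hp⟩
  injection hk with h1 h2
  subst h1 h2
  exact h ⟨hp, ht⟩

lemma IsChord.not_digon {t' : Tag} (h : IsChord σ x y) (hx : IsSpoke σ t x)
    (hy : IsSpoke σ t' y) : ¬ IsDigon σ x ∧ ¬ IsDigon σ y :=
  ⟨fun hd => h.ne_cast (hd.isSpoke_cast hy), fun hd => h.ne_cast (hd.isSpoke_cast hx).symm⟩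

lemma LArr.out_digon (hX : IsDigon σ X) (h : LArr σ i J J₁ J₂ (sp X t) b c) :
    ∃ m, IsChord σ X m ∧ IsChord σ m (X + n) ∧ J = pt(X) ∧ b = ch m X ∧ c = ch X m := by
  rcases h.out_spoke with ⟨y, h1, h2, h3, -⟩ | ⟨w, h1, h2, h3, -⟩ |
    ⟨m, -, h1, h2, -, h3, -, -, h4, h5⟩
  exacts [absurd hX (h1.not_digon h2 h3).1, absurd hX (h1.not_digon h2 h3).2,
    ⟨m, h1, h2, h3, h4, h5⟩]

lemma LArr.in_digon (hX : IsDigon σ X) (h : LArr σ i J J₁ J₂ a (sp X t) c) :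
    ∃ m, IsChord σ X m ∧ IsChord σ m (X + n) ∧ J = pt(X) ∧ a = ch X m := by
  rcases h.in_spoke with ⟨_, y, h1, h2, h3, -⟩ | ⟨_, w, h1, h2, h3, -⟩ | ⟨h3, m, -, h1, h2, h4⟩
  exacts [absurd hX (h1.not_digon h2 h3).1, absurd hX (h1.not_digon h2 h3).2, ⟨m, h1, h2, h3, h4⟩]

/-- `P_k` is an endpoint of `a`. -/
def Incident (k : ZMod n) (a : Edge n) : Prop := a.fst = k ∨ a.snd = k

lemma LArr.incident (h : LArr σ i (some k) J₁ J₂ a b c) : Incident k a ∧ Incident k b := by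
  generalize hJ : some k = J at h
  cases h <;> first | (cases hJ; done) | (injection hJ with hJ; subst hJ; simp [Incident, fst, snd])

lemma side_int (X : ℤ) : side (X : ZMod n) = ch X (X + 1) := by simp [side, ch]

lemma side_int_pred (X : ℤ) : side ((X : ZMod n) - 1) = ch (X - 1) X := by simp [side, ch]

/-- `(n / π)` times the angle of an arrow `a → b`. -/
def theta (a b : Edge n) : ℕ := ccwDist a.fst b.fst + ccwDist a.snd b.snd

lemma theta_eq {x' y' : ℤ} (h1 : a.fst = x) (h2 : a.snd = y) (h3 : b.fst = x')
    (h4 : b.snd = y') (hx : x ≤ x') (hx' : x' < x + n) (hy : y ≤ y') (hy' : y' < y + n) :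
    (theta a b : ℤ) = x' - x + (y' - y) := by
  have e1 := ccwDist_of_le (n := n) hx hx'
  have e2 := ccwDist_of_le (n := n) hy hy'
  rw [theta, h1, h2, h3, h4]
  push_cast
  rw [e1, e2]

/-- The angle at `P_k`, in units of `π / n`, between the side `(P_k, P_{k+1})` and an edge ending at
`P_k`, up to an additive constant. -/
def meas (k : ZMod n) : Edge n → ℕ
  | chord r s => if r = k then ccwDist k s else n + ccwDist k r
  | spoke _ _ => n

lemma meas_fst (h : IsChord σ X Y) : (meas (X : ZMod n) (ch X Y) : ℤ) = Y - X := by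
  rw [meas, if_pos rfl, ccwDist_of_le h.1.le h.2.1]

lemma meas_snd (h : IsChord σ X Y) : (meas (Y : ZMod n) (ch X Y) : ℤ) = n + (X + n - Y) := by
  rw [meas, if_neg h.ne_cast, ← cast_add_n X]
  push_cast
  rw [← ccwDist_of_le (n := n) (x := Y) (y := X + n) (by linarith [h.2.1]) (by linarith [h.1])]
  push_cast
  rfl

/-- The internal arrows at `P_k` turn anticlockwise. -/
lemma LArr.meas_eq (h : LArr σ i (some k) J₁ J₂ a b c) :
    meas k b = meas k a + theta a b ∧ 0 < theta a b := by
  suffices H : (meas k b : ℤ) = meas k a + theta a b ∧ (0 : ℤ) < theta a b by omega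
  have hn2 := two_le_int (n := n)
  generalize hJ : some k = J at h
  cases h with
  | A1 x y z h1 h2 h3 =>
    injection hJ with hJ; subst hJ
    rw [meas_fst h1, meas_fst h3, theta_eq (x := x) (y := y) (x' := x) (y' := z) rfl rfl rfl rfl]
    all_goals have := h1.1; have := h2.1; have := h3.2.1; omega
  | A2 x y z h1 h2 h3 =>
    injection hJ with hJ; subst hJ
    rw [meas_snd h3, meas_snd h2, theta_eq (x := x) (y := z) (x' := y) (y' := z) rfl rfl rfl rfl]
    all_goals have := h1.1; have := h2.1; have := h3.2.1; omega
  | A3 x y z h1 h2 h3 =>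
    injection hJ with hJ; subst hJ
    rw [meas_fst h2, meas_snd h1, theta_eq (x := y) (y := z) (x' := x + n) (y' := y + n) rfl rfl
      (by simp [fst]) (by simp [snd])]
    all_goals have := h1.1; have := h2.1; have := h3.2.1; omega
  | B1 x y t h1 h2 h3 =>
    injection hJ with hJ; subst hJ
    rw [meas_fst h1, meas, theta_eq (x := x) (y := y) (x' := x) (y' := x + n) rfl rfl
      rfl (by simp [snd])]
    all_goals have := h1.1; have := h1.2.1; omega
  | B2 => cases hJ
  | B3 x y t h1 h2 h3 =>
    injection hJ with hJ; subst hJ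
    rw [meas_snd h1, meas, theta_eq (x := y) (y := y + n) (x' := x + n) (y' := y + n) rfl
      (by simp [snd]) (by simp [fst]) (by simp [snd])]
    all_goals have := h1.1; have := h1.2.1; omega
  | D1 k m t h1 h2 h3 =>
    injection hJ with hJ; subst hJ
    rw [meas_snd h1, theta_eq (x := m) (y := k + n) (x' := k + n) (y' := m + n) rfl
      (by simp [snd]) (by simp [fst]) (by simp [snd])]
    · have := meas_fst h2
      simp only [ch, cast_add_n] at this ⊢
      rw [this]
      have := h1.1; have := h1.2.1; omega
    all_goals have := h1.1; have := h1.2.1; omega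
  | D2 k m t h1 h2 h3 =>
    injection hJ with hJ; subst hJ
    rw [meas_fst h1, meas, theta_eq (x := k) (y := m) (x' := k) (y' := k + n) rfl
      rfl (by simp [fst]) (by simp [snd])]
    all_goals have := h1.1; have := h1.2.1; omega
  | D3 k m t h1 h2 h3 =>
    injection hJ with hJ; subst hJ
    have hs : meas (k : ZMod n) (sp k t) = n := rfl
    rw [hs, theta_eq (x := k) (y := k + n) (x' := m) (y' := k + n) rfl
      (by simp [snd]) (by simp [fst]) (by simp [snd])]
    · have := meas_snd h2
      simp only [ch, cast_add_n] at this ⊢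
      rw [this]
      have := h1.1; have := h1.2.1; omega
    all_goals have := h1.1; have := h1.2.1; omega

lemma LArr.ne (h : LArr σ i J J₁ J₂ a b c) : a ≠ b := by
  rintro rfl
  cases J with
  | some k => have := h.meas_eq; omega
  | none =>
    obtain ⟨x, y, H, rfl⟩ | ⟨x, t, H, rfl⟩ := edge_cases h.mem.1
    · rcases h.out_chord H with ⟨κ, t, -, -, e, -⟩ | ⟨w, -, -, -, e, -⟩ <;> cases e
    · rcases h.out_spoke with ⟨y, h1, -, -, -, -, -, -, e, -⟩ | ⟨y, -, -, -, -, e, -⟩ |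
        ⟨y, -, -, -, -, e, -⟩
      · injection e with e
        exact h1.ne_cast e
      · cases e
      · cases e

lemma in_unique {i' : Fin 3} {J₁' J₂' : Option (ZMod n)} {a' c' : Edge n}
    (h : LArr σ i (some k) J₁ J₂ a b c) (h' : LArr σ i' (some k) J₁' J₂' a' b c')
    (ha : Visible σ a) (ha' : Visible σ a') : a = a' := by
  obtain ⟨x, y, H, rfl⟩ | ⟨x, t, H, rfl⟩ := edge_cases h.mem.2.1
  · rcases h.in_chord H with ⟨e, w, h1, h2, rfl⟩ | ⟨e, κ, t, h1, rfl⟩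
    · rcases h'.in_chord H with ⟨e', w', h1', h2', rfl⟩ | ⟨e', κ', t', h1', rfl⟩
      · obtain rfl := h1.right_unique h2 h1' h2'
        rfl
      · exact (H.ne_cast (Option.some.inj (e.symm.trans e'))).elim
    · rcases h'.in_chord H with ⟨e', w', h1', h2', rfl⟩ | ⟨e', κ', t', h1', rfl⟩
      · exact (H.ne_cast (Option.some.inj (e.symm.trans e')).symm).elim
      · obtain rfl := h1.unique H h1'
        cases κ with
        | digon₂ =>
          have e1 := (h1.1.visible_iff).1 ha
          have e2 := (h1.1.visible_iff).1 ha'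
          rw [e1, e2]
        | _ => rfl
  · rcases h.in_spoke with ⟨e, y, h1, h2, h3, rfl⟩ | ⟨e, y, h1, h2, h3, rfl⟩ | ⟨e, m, h1, h2, h3, rfl⟩
    · rcases h'.in_spoke with ⟨e, y', h1', h2', h3', rfl⟩ | ⟨e, y', h1', h2', h3', rfl⟩ |
        ⟨e, m', h1', h2', h3', rfl⟩
      · obtain rfl := h3.next_unique h1 h1' h3'
        rfl
      · cases e
      · exact ((h1.not_digon h2 h3).1 h1').elim
    · cases e
    · rcases h'.in_spoke with ⟨e, y', h1', h2', h3', rfl⟩ | ⟨e, y', h1', h2', h3', rfl⟩ |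
        ⟨e, m', h1', h2', h3', rfl⟩
      · exact ((h1'.not_digon h2' h3').1 h1).elim
      · cases e
      · obtain rfl := h2.right_unique h3 h2' h3'
        rfl

lemma Corner.meas_lt (h : Corner σ (some k) a b) : meas k a < meas k b := by
  obtain ⟨_, _, _, _, h⟩ := corner_iff.1 h
  have := h.meas_eq
  omega

lemma Corner.in_unique {a' : Edge n} (h : Corner σ (some k) a b) (h' : Corner σ (some k) a' b)
    (ha : Visible σ a) (ha' : Visible σ a') : a = a' := by
  obtain ⟨_, _, _, _, h⟩ := corner_iff.1 h
  obtain ⟨_, _, _, _, h'⟩ := corner_iff.1 h'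
  exact PuncturedPolygon.in_unique h h' ha ha'

lemma LeftOpt.visible {κ : LKind} (H : IsChord σ X Y) (h : LeftOpt σ X Y κ) :
    Visible σ (κ.src X Y .plain) ∧ Visible σ (κ.tgt X Y .plain) := by
  cases κ with
  | right w => exact ⟨visible_chord _ _, visible_chord _ _⟩
  | left w => exact ⟨visible_chord _ _, visible_chord _ _⟩
  | spokes t =>
    exact ⟨visible_of_not_digon h.2 (H.not_digon h.1 h.2).2,
      visible_of_not_digon h.1 (H.not_digon h.1 h.2).1⟩
  | digon₁ => exact ⟨visible_chord _ _, visible_plain _⟩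
  | digon₂ => exact ⟨visible_plain _, visible_chord _ _⟩

lemma in_exists (hb : b ∈ σ.edges) (hv : Visible σ b) (hk : Incident k b) (hs : b ≠ side k) : ∃ i
    J₁ J₂ a c, LArr σ i (some k) J₁ J₂ a b c ∧ Visible σ a := by
  obtain ⟨x, y, H, rfl⟩ | ⟨x, t, H, rfl⟩ := edge_cases hb
  · rcases hk with rfl | rfl
    · have hxy : x + 1 < y := by
        refine lt_of_le_of_ne H.1 ?_
        rintro rfl
        exact hs (side_int x).symm
      obtain ⟨w, -, -, h1, h2⟩ := H.exists_right hxy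
      exact ⟨_, _, _, _, _, .A1 _ _ _ h1 h2 H, visible_chord _ _⟩
    · obtain ⟨κ, h⟩ := H.exists_leftOpt
      exact ⟨_, _, _, _, _, (h.larr H .plain).rotate.rotate, (h.visible H).1⟩
  · have hk : (x : ZMod n) = k := by rcases hk with h | h <;> exact h
    subst hk
    by_cases hd : IsDigon σ x
    · obtain ⟨m, h1, h2⟩ := hd.exists_chord
      exact ⟨_, _, _, _, _, .D2 x m t h1 h2 hd, visible_chord _ _⟩
    · obtain ⟨⟨y, h1, h2⟩, -⟩ := H.exists_next hd
      exact ⟨_, _, _, _, _, .B1 x y t h1 H h2, visible_chord _ _⟩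

lemma out_exists (hb : a ∈ σ.edges) (hv : Visible σ a) (hk : Incident k a) (hs : a ≠ side (k - 1))
    : ∃ i J₁ J₂ b c, LArr σ i (some k) J₁ J₂ a b c ∧ Visible σ b := by
  obtain ⟨x, y, H, rfl⟩ | ⟨x, t, H, rfl⟩ := edge_cases hb
  · rcases hk with rfl | rfl
    · obtain ⟨κ, h⟩ := H.exists_leftOpt
      exact ⟨_, _, _, _, _, h.larr H .plain, (h.visible H).2⟩
    · have hxy : x + 1 < y := by
        refine lt_of_le_of_ne H.1 ?_
        rintro rfl
        apply hs
        rw [snd, side_int_pred]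
        simp
      obtain ⟨w, -, -, h1, h2⟩ := H.exists_right hxy
      exact ⟨_, _, _, _, _, .A2 _ _ _ h1 h2 H, visible_chord _ _⟩
  · have hk : (x : ZMod n) = k := by rcases hk with h | h <;> exact h
    subst hk
    by_cases hd : IsDigon σ x
    · obtain ⟨m, h1, h2⟩ := hd.exists_chord
      exact ⟨_, _, _, _, _, .D3 x m t h1 h2 hd, visible_chord _ _⟩
    · obtain ⟨-, ⟨w, h1, h2⟩⟩ := H.exists_next hd
      exact ⟨_, _, _, _, _, .B3 w x t h1 h2 H, visible_chord _ _⟩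

end

section
variable {n : ℕ} [hn : Fact (2 ≤ n)] {σ : TaggedTriangulation n} {E : Set (ZMod n)}
  {i : Fin 3} {J J₁ J₂ : Option (ZMod n)}

variable {k : ZMod n} {a b c c' : QVert σ E}

/-! ### External cycles and clockwise triangles as cycles of the quiver -/

/-- The internal arrow at a corner. -/
def intArrow {a b : QVert σ E} (J : Option (ZMod n)) (h : Corner σ J a.1 b.1) : a ⟶ b :=
  Arrow.internal J h

lemma intArrow_injective {a' b' : QVert σ E} {J J' : Option (ZMod n)} {h : Corner σ J a.1 b.1} {h'
    : Corner σ J' a'.1 b'.1} : (⟨a, b, intArrow J h⟩ : Total (QVert σ E)) = ⟨a', b', intArrow J' h'⟩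
    ↔ a = a' ∧ b = b' ∧ J = J' := by
  constructor
  · intro e
    injection e with e1 e2 e3
    subst e1 e2
    have e3 := eq_of_heq e3
    injection e3 with e3
    exact ⟨rfl, rfl, e3⟩
  · rintro ⟨rfl, rfl, rfl⟩
    rfl

/-- All the arrows of the path are internal arrows at `P_k`, and the path does not go through the
notched arc of a once-punctured digon. -/
def FanPart (k : ZMod n) {a b : QVert σ E} (p : Path a b) : Prop :=
  (∀ α ∈ arrowList p, IsInternalAt (some k) α) ∧ AvoidsNotched p

lemma fanPart_nil (k : ZMod n) (a : QVert σ E) :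
    FanPart k (Path.nil : Path a a) := by
  constructor <;> intro α hα <;> simp [arrowList] at hα

lemma arrowList_cons {V : Type*} [Quiver V] {a b c : V} (p : Path a b) (α : b ⟶ c) :
    arrowList (p.cons α) = arrowList p ++ [⟨b, c, α⟩] := rfl

lemma fanPart_cons {p : Path a b} {α : b ⟶ c} : FanPart k (p.cons α) ↔ FanPart k p ∧
    IsInternalAt (some k) ⟨b, c, α⟩ ∧ Visible σ b.1 ∧ Visible σ c.1 := by
  simp only [FanPart, AvoidsNotched, arrowList_cons, List.mem_append, List.mem_singleton, or_imp,
    forall_and, forall_eq]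
  constructor
  · rintro ⟨⟨h1, h2⟩, ⟨h3, h3'⟩, h4, h5⟩
    exact ⟨⟨h1, h3, h4⟩, h2, h3', h5⟩
  · rintro ⟨⟨h1, h3, h4⟩, h2, h3', h5⟩
    exact ⟨⟨h1, h2⟩, ⟨h3, h3'⟩, h4, h5⟩

lemma fanPart_comp {p : Path a b}
    {q : Path b c} : FanPart k (p.comp q) ↔ FanPart k p ∧ FanPart k q := by
  induction q with
  | nil => simp [fanPart_nil]
  | cons q α ih => rw [Path.comp_cons, fanPart_cons, fanPart_cons, ih, and_assoc]

lemma IsInternalAt.corner {α : a ⟶ b} (h : IsInternalAt J ⟨a, b, α⟩) :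
    ∃ h' : Corner σ J a.1 b.1, α = intArrow J h' := h

lemma FanPart.meas_le {p : Path a b} (h : FanPart k p) : meas k a.1 ≤ meas k b.1 := by
  induction p with
  | nil => rfl
  | cons p α ih =>
    obtain ⟨h1, h2, -⟩ := fanPart_cons.1 h
    have := h2.corner.choose.meas_lt
    have := ih h1
    omega

lemma FanPart.meas_lt {p : Path a b} (h : FanPart k p) {α : Total (QVert σ E)} (hα : α ∈
    arrowList p) : meas k a.1 ≤ meas k α.left.1 ∧ meas k α.right.1 ≤ meas k b.1 := by
  induction p with
  | nil => simp [arrowList] at hα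
  | cons p β ih =>
    obtain ⟨h1, h2, -⟩ := fanPart_cons.1 h
    have := h2.corner.choose.meas_lt
    rw [arrowList_cons, List.mem_append, List.mem_singleton] at hα
    rcases hα with hα | rfl
    · have := ih h1 hα
      exact ⟨this.1, by omega⟩
    · exact ⟨h1.meas_le, le_rfl⟩

/-- There is at most one path turning around `P_k` between two given edges. -/
lemma FanPart.unique {p q : Path a b} (hp : FanPart k p) (hq : FanPart k q) : p = q := by
  have hlt : ∀ {a b c : QVert σ E} {p : Path a b} {α : b ⟶ c}, FanPart k (p.cons α) →
      meas k a.1 < meas k c.1 := by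
    intro a b c p α h
    obtain ⟨h1, h2, -⟩ := fanPart_cons.1 h
    have := h2.corner.choose.meas_lt
    have := h1.meas_le
    omega
  induction p with
  | nil =>
    cases q with
    | nil => rfl
    | cons q β => exact absurd (hlt hq) (lt_irrefl _)
  | cons p α ih =>
    cases q with
    | nil => exact absurd (hlt hp) (lt_irrefl _)
    | cons q β =>
      obtain ⟨h1, h2, h3, -⟩ := fanPart_cons.1 hp
      obtain ⟨g1, g2, g3, -⟩ := fanPart_cons.1 hq
      obtain ⟨h4, rfl⟩ := h2.corner
      obtain ⟨g4, rfl⟩ := g2.corner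
      obtain rfl := Subtype.ext (h4.in_unique g4 h3 g3)
      rw [ih h1 g1]

variable (σ E) in
/-- A side of the polygon, as a vertex of the quiver. -/
def sideV (k : ZMod n) : QVert σ E := ⟨side k, σ.side_mem k⟩

lemma exists_fanPart_from_side k (b : QVert σ E) (hv : Visible σ b.1)
    (hk : Incident k b.1) : ∃ p : Path (sideV σ E k) b, FanPart k p := by
  induction hm : meas k b.1 using Nat.strong_induction_on generalizing b with
  | _ m ih =>
    by_cases hs : b.1 = side k
    · obtain rfl : b = sideV σ E k := Subtype.ext hs
      exact ⟨_, fanPart_nil _ _⟩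
    · obtain ⟨i, J₁, J₂, a, c, h, ha⟩ := in_exists b.2 hv hk hs
      have := h.meas_eq
      obtain ⟨p, hp⟩ := ih _ (by rw [← hm]; change meas k a < _; omega) ⟨a, h.mem.1⟩ ha
        h.incident.1 rfl
      exact ⟨p.cons (intArrow (some k) h.corner), fanPart_cons.2 ⟨hp, ⟨_, rfl⟩, ha, hv⟩⟩

lemma meas_lt {b : Edge n} (hb : b ∈ σ.edges) (hk : Incident k b) : meas k b < 2 * n := by
  obtain ⟨x, y, H, rfl⟩ | ⟨x, t, H, rfl⟩ := edge_cases hb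
  · have := H.1; have := H.2.1
    rcases hk with rfl | rfl
    · have := meas_fst H
      simp only [fst]
      omega
    · have := meas_snd H
      simp only [snd]
      omega
  · have := hn.out
    rw [meas]
    omega

lemma exists_fanPart_to_side k (a : QVert σ E) (hv : Visible σ a.1)
    (hk : Incident k a.1) : ∃ p : Path a (sideV σ E (k - 1)), FanPart k p := by
  induction hm : 2 * n - meas k a.1 using Nat.strong_induction_on generalizing a with
  | _ m ih =>
    by_cases hs : a.1 = side (k - 1)
    · obtain rfl : a = sideV σ E (k - 1) := Subtype.ext hs
      exact ⟨_, fanPart_nil _ _⟩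
    · obtain ⟨i, J₁, J₂, b, c, h, hb⟩ := out_exists a.2 hv hk hs
      have h1 := h.meas_eq
      have h2 := meas_lt h.mem.2.1 h.incident.2
      obtain ⟨p, hp⟩ := ih _ (by rw [← hm]; change 2 * n - meas k b < _; omega) ⟨b, h.mem.2.1⟩ hb
        h.incident.2 rfl
      refine ⟨(Path.nil.cons (intArrow (some k) h.corner : a ⟶ _)).comp p,
        fanPart_comp.2 ⟨fanPart_cons.2 ⟨fanPart_nil _ _, ⟨_, rfl⟩, hv, hb⟩, hp⟩⟩

lemma visible_sideV (k : ZMod n) : Visible σ (sideV σ E k).1 := visible_chord _ _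

lemma incident_sideV (k : ZMod n) : Incident k (sideV σ E k).1 := Or.inl rfl

lemma exists_fan (k : ZMod n) :
    ∃ p : Path (sideV σ E k) (sideV σ E (k - 1)), FanPart k p :=
  exists_fanPart_to_side k _ (visible_sideV k) (incident_sideV k)

variable (σ E) in
/-- The path turning around `P_k` from a side of the polygon to the other. -/
def fan (k : ZMod n) : Path (sideV σ E k) (sideV σ E (k - 1)) := (exists_fan k).choose

lemma fanPart_fan (k : ZMod n) : FanPart k (fan σ E k) := (exists_fan k).choose_spec

lemma isFan_iff {p : Path (sideV σ E k) (sideV σ E (k - 1))} :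
    IsFan k p ↔ FanPart k p := ⟨fun h => ⟨h.2.2.1, h.2.2.2⟩, fun h => ⟨rfl, rfl, h.1, h.2⟩⟩

/-- The external arrow winding around `P_k`. -/
def extArrow {k : ZMod n} (hk : k ∈ E) : sideV σ E (k - 1) ⟶ sideV σ E k :=
  Arrow.external k hk rfl rfl

variable (σ) in
/-- The anticlockwise external cycle at `P_k`. -/
def extCycle {k : ZMod n} (hk : k ∈ E) : BasedCycle (QVert σ E) :=
  ⟨sideV σ E (k - 1), (extArrow hk).toPath.comp (fan σ E k)⟩

lemma extCycle_unique (hk : k ∈ E) (ha : a.1 = side (k - 1)) (hb : b.1 = side k) {s : Path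
    b a} (hs : IsFan k s) : (⟨a, (Quiver.Hom.toPath (Arrow.external k hk ha hb : a ⟶ b)).comp s⟩ :
    BasedCycle (QVert σ E)) = extCycle σ hk := by
  obtain rfl : a = sideV σ E (k - 1) := Subtype.ext ha
  obtain rfl : b = sideV σ E k := Subtype.ext hb
  rw [(isFan_iff.1 hs).unique (fanPart_fan k)]
  rfl

lemma mem_externalCycles {c : BasedCycle (QVert σ E)} :
    c ∈ externalCycles σ E ↔ ∃ (k : ZMod n) (hk : k ∈ E), c = extCycle σ hk := by
  constructor
  · obtain ⟨a, c⟩ := c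
    rintro ⟨k, b, α, s, ⟨hk, ha, hb, hα⟩, hs, hc⟩
    refine ⟨k, hk, ?_⟩
    simp only at hc hα
    rw [hc, hα]
    exact extCycle_unique hk ha hb hs
  · rintro ⟨k, hk, rfl⟩
    exact ⟨k, _, extArrow hk, fan σ E k, ⟨hk, rfl, rfl, rfl⟩, isFan_iff.2 (fanPart_fan k), rfl⟩

lemma finite_externalCycles : (externalCycles σ E).Finite := by
  refine (Set.finite_range fun k : {k : ZMod n // k ∈ E} => extCycle σ k.2).subset ?_
  intro c hc
  obtain ⟨k, hk, rfl⟩ := mem_externalCycles.1 hc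
  exact ⟨⟨k, hk⟩, rfl⟩

lemma intArrow_not_ext {h : Corner σ J a.1 b.1} {hk : k ∈ E} :
    (⟨a, b, intArrow J h⟩ : Total (QVert σ E)) ≠ ⟨_, _, extArrow hk⟩ := by
  intro e
  injection e with e1 e2 e3
  subst e1 e2
  have e3 := eq_of_heq e3
  injection e3

lemma arrowList_toPath {V : Type*} [Quiver V] {a b : V} (α : a ⟶ b) :
    arrowList α.toPath = [⟨a, b, α⟩] := rfl

/-- The internal arrows in the external cycles. -/
lemma mem_extCycle {h : Corner σ J a.1 b.1} {hk : k ∈ E} (hα : (⟨a, b, intArrow J h⟩ : Total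
    (QVert σ E)) ∈ arrowList (extCycle σ hk).2) : J = some k ∧ Visible σ a.1 ∧ Visible σ b.1 := by
  rw [extCycle, arrowList_comp, arrowList_toPath, List.mem_append, List.mem_singleton] at hα
  rcases hα with hα | hα
  · exact (intArrow_not_ext hα).elim
  · obtain ⟨h', e⟩ := (fanPart_fan k).1 _ hα
    refine ⟨?_, (fanPart_fan k).2 _ hα⟩
    injection e

variable (K : Type*) [Field K]

/-- The derivative of the sum of the external cycles with respect to an internal arrow, if this arrow
is in one of these cycles. -/
lemma cyclicDeriv_external (h : Corner σ (some k) a.1 b.1) (hk : k ∈ E) (ha : Visible σ a.1) (hb :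
    Visible σ b.1) {p : Path (sideV σ E k) a} {q : Path b (sideV σ E (k - 1))} (hp :
    FanPart k p) (hq : FanPart k q) : cyclicDeriv K ⟨a, b, intArrow (some k) h⟩ (∑ᶠ c ∈
    externalCycles σ E, Finsupp.single c 1) = ofPath K (q.comp ((extArrow hk).toPath.comp p)) := by
  rw [cyclicDeriv_finsum_unique finite_externalCycles _ (extCycle σ hk)
    (mem_externalCycles.2 ⟨k, hk, rfl⟩)]
  · have e : fan σ E k = (p.cons (intArrow (some k) h)).comp q :=
      (fanPart_fan k).unique (fanPart_comp.2 ⟨fanPart_cons.2 ⟨hp, ⟨_, rfl⟩, ha, hb⟩, hq⟩)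
    have e' : (extArrow hk).toPath.comp (fan σ E k) =
        (((extArrow hk).toPath.comp p).cons (intArrow (some k) h)).comp q := by
      rw [e, ← Path.comp_assoc, Path.comp_cons]
    change derivAux K _ ((extArrow hk).toPath.comp (fan σ E k))
      (Path.nil : Path (sideV σ E (k - 1)) (sideV σ E (k - 1))) = _
    have h5 := h.meas_lt
    rw [e', derivAux_split]
    · rw [arrowList_comp, arrowList_toPath, List.mem_append, List.mem_singleton]
      rintro (h' | h')
      · exact intArrow_not_ext h'
      · have := (hp.meas_lt h').2
        simp only at this
        omega
    · intro h'
      have := (hq.meas_lt h').1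
      simp only at this
      omega
  · intro c hc hα
    obtain ⟨k', hk', rfl⟩ := mem_externalCycles.1 hc
    obtain ⟨e, -⟩ := mem_extCycle hα
    injection e with e
    subst e
    rfl

lemma cyclicDeriv_external_zero (h : Corner σ J a.1 b.1)
    (hJ : ∀ k ∈ E, J = some k → Visible σ a.1 → Visible σ b.1 → False) :
    cyclicDeriv K ⟨a, b, intArrow J h⟩ (∑ᶠ c ∈ externalCycles σ E, Finsupp.single c 1) = 0 := by
  refine cyclicDeriv_finsum_zero finite_externalCycles _ fun c hc hα => ?_
  obtain ⟨k', hk', rfl⟩ := mem_externalCycles.1 hc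
  obtain ⟨e, h1, h2⟩ := mem_extCycle hα
  exact hJ k' hk' e h1 h2

/-- The path formed by the two arrows following an internal arrow in a clockwise triangle. -/
def triPath {a b c : QVert σ E} (h : LArr σ i J J₁ J₂ a.1 b.1 c.1) : Path b a :=
  (Path.nil.cons (intArrow J₁ h.rotate.corner : b ⟶ c)).cons
    (intArrow J₂ h.rotate.rotate.corner)

/-- A clockwise triangle, with its chosen base point. -/
def triCycle₀ {a b c : QVert σ E} (h : LArr σ 0 J J₁ J₂ a.1 b.1 c.1) : BasedCycle (QVert σ E) :=
  ⟨a, ((Path.nil.cons (intArrow J h.corner : a ⟶ b)).cons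
    (intArrow J₁ h.rotate.corner : b ⟶ c)).cons (intArrow J₂ h.rotate.rotate.corner)⟩

/-- The clockwise triangle going through an internal arrow, with its chosen base point. -/
def triCycle {a b c : QVert σ E} : {i : Fin 3} → LArr σ i J J₁ J₂ a.1 b.1 c.1 →
    BasedCycle (QVert σ E)
  | 0, h => triCycle₀ h
  | 1, h => triCycle₀ h.rotate.rotate
  | 2, h => triCycle₀ h.rotate

lemma mem_clockwiseTriangles {C : BasedCycle (QVert σ E)} : C ∈ clockwiseTriangles σ E ↔ ∃ (a b c
    : QVert σ E) (J J₁ J₂ : Option (ZMod n)) (h : LArr σ 0 J J₁ J₂ a.1 b.1 c.1), C = triCycle₀ h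
    := by
  constructor
  · obtain ⟨a, C⟩ := C
    rintro ⟨b, c, α, β, γ, p, q, r, h, ⟨h1, hα⟩, ⟨h2, hβ⟩, ⟨h3, hγ⟩, hC⟩
    refine ⟨a, b, c, p, q, r, .of_triangle h, ?_⟩
    simp only at hα hβ hγ hC
    rw [hC, hα, hβ, hγ]
    rfl
  · rintro ⟨a, b, c, J, J₁, J₂, h, rfl⟩
    exact ⟨b, c, _, _, _, _, _, _, h.triangle, ⟨_, rfl⟩, ⟨_, rfl⟩, ⟨_, rfl⟩, rfl⟩

lemma triCycle_mem (h : LArr σ i J J₁ J₂ a.1 b.1 c.1) : triCycle h ∈ clockwiseTriangles σ E := by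
  fin_cases i
  · exact mem_clockwiseTriangles.2 ⟨_, _, _, _, _, _, h, rfl⟩
  · exact mem_clockwiseTriangles.2 ⟨_, _, _, _, _, _, h.rotate.rotate, rfl⟩
  · exact mem_clockwiseTriangles.2 ⟨_, _, _, _, _, _, h.rotate, rfl⟩

instance : Finite (QVert σ E) := inferInstance

lemma finite_clockwiseTriangles : (clockwiseTriangles σ E).Finite := by
  refine (Set.finite_range fun x : {x : (QVert σ E × QVert σ E × QVert σ E) ×
    (Option (ZMod n) × Option (ZMod n) × Option (ZMod n)) //
      LArr σ 0 x.2.1 x.2.2.1 x.2.2.2 x.1.1.1 x.1.2.1.1 x.1.2.2.1} => triCycle₀ x.2).subset ?_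
  intro C hC
  obtain ⟨a, b, c, J, J₁, J₂, h, rfl⟩ := mem_clockwiseTriangles.1 hC
  exact ⟨⟨⟨⟨a, b, c⟩, J, J₁, J₂⟩, h⟩, rfl⟩

lemma ne_of_larr (h : LArr σ i J J₁ J₂ a.1 b.1 c.1) : a ≠ b :=
  fun e => h.ne (congrArg Subtype.val e)

lemma derivAux_triCycle (h : LArr σ i J J₁ J₂ a.1 b.1 c.1) : derivAux K ⟨a, b, intArrow J
    h.corner⟩ (triCycle h).2 Path.nil = ofPath K (triPath h) := by
  have h1 := ne_of_larr h
  have h2 := ne_of_larr h.rotate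
  have h3 := ne_of_larr h.rotate.rotate
  fin_cases i
  · refine derivAux_split (p₁ := Path.nil) (p₂ := triPath h) _ ?_ ?_
    · simp [arrowList]
    · simp [arrowList, triPath, intArrow_injective, h1, h3, Ne.symm h3]
  · refine derivAux_split (p₁ := (intArrow J₂ h.rotate.rotate.corner : c ⟶ a).toPath)
      (p₂ := (intArrow J₁ h.rotate.corner : b ⟶ c).toPath) _ ?_ ?_
    · simp [arrowList, Quiver.Hom.toPath, intArrow_injective, h1, Ne.symm h3]
    · simp [arrowList, Quiver.Hom.toPath, intArrow_injective, h1]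
  · refine derivAux_split (p₁ := triPath h) (p₂ := Path.nil) _ ?_ ?_
    · simp [arrowList, triPath, intArrow_injective, h1, h3, Ne.symm h3]
    · simp [arrowList]

lemma mem_triangle {hc : Corner σ J a.1 b.1} {C : BasedCycle (QVert σ E)} (hC : C ∈
    clockwiseTriangles σ E) (hα : (⟨a, b, intArrow J hc⟩ : Total (QVert σ E)) ∈ arrowList C.2) : ∃
    (i : Fin 3) (J₁ J₂ : Option (ZMod n)) (c : QVert σ E) (h : LArr σ i J J₁ J₂ a.1 b.1 c.1), C =
    triCycle h := by
  obtain ⟨x, y, z, p, q, r, h, rfl⟩ := mem_clockwiseTriangles.1 hC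
  simp only [triCycle₀, arrowList, List.nil_append, List.mem_append, List.mem_singleton,
    intArrow_injective] at hα
  rcases hα with (⟨rfl, rfl, rfl⟩ | ⟨rfl, rfl, rfl⟩) | ⟨rfl, rfl, rfl⟩
  · exact ⟨_, _, _, z, h, rfl⟩
  · exact ⟨_, _, _, x, h.rotate, rfl⟩
  · exact ⟨_, _, _, y, h.rotate.rotate, rfl⟩

lemma triCycle_congr {i' : Fin 3} {J₁' J₂' : Option (ZMod n)}
    (h : LArr σ i J J₁ J₂ a.1 b.1 c.1) (h' : LArr σ i' J J₁' J₂' a.1 b.1 c'.1)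
    (e1 : i' = i) (e2 : J₁' = J₁) (e3 : J₂' = J₂) (e4 : c' = c) : triCycle h' = triCycle h := by
  subst e1 e2 e3 e4
  rfl

/-- The derivative of the sum of the clockwise triangles with respect to an arrow contained in only
one of them. -/
lemma cyclicDeriv_triangles (h : LArr σ i J J₁ J₂ a.1 b.1 c.1) (hd : ∀ k t, IsDigon σ k → c.1 ≠ sp
    k t) : cyclicDeriv K ⟨a, b, intArrow J h.corner⟩ (∑ᶠ c ∈ clockwiseTriangles σ E, Finsupp.single
    c 1) = ofPath K (triPath h) := by
  rw [cyclicDeriv_finsum_unique finite_clockwiseTriangles _ (triCycle h) (triCycle_mem h),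
    derivAux_triCycle]
  intro C hC hα
  obtain ⟨i', J₁', J₂', c', h', rfl⟩ := mem_triangle hC hα
  obtain ⟨e1, e2, e3, e4 | ⟨k, t, t', h1, h2, h3⟩⟩ := h.third_unique h'
  · exact triCycle_congr h h' e1 e2 e3 (Subtype.ext e4)
  · exact (hd k t h1 h2).elim

/-- The derivative of the sum of the clockwise triangles with respect to the arrow shared by the two
triangles of a once-punctured digon. -/
lemma cyclicDeriv_triangles_digon {k : ℤ} (h : LArr σ i J J₁ J₂ a.1 b.1 c.1) (h' : LArr σ i J J₁
    J₂ a.1 b.1 c'.1) (hc : c.1 = sp k .plain) (hc' : c'.1 = sp k .notched) : cyclicDeriv K ⟨a, b,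
    intArrow J h.corner⟩ (∑ᶠ c ∈ clockwiseTriangles σ E, Finsupp.single c 1) = ofPath K (triPath h)
    + ofPath K (triPath h') := by
  have hne : triCycle h ≠ triCycle h' := by
    intro e
    have h1 := derivAux_triCycle K h
    have h2 := derivAux_triCycle K h'
    have h3 : ofPath K (triPath h) = ofPath K (triPath h') := by
      rw [← h1, ← h2]
      rw [e]
    have h4 := (basis (K := K) (V := QVert σ E)).injective h3
    injection h4 with _ h4
    injection h4 with _ h4
    injection h4 with e
    rw [e, hc'] at hc
    cases hc
  rw [cyclicDeriv_finsum_pair finite_clockwiseTriangles _ (triCycle h) (triCycle h')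
    (triCycle_mem h) (triCycle_mem h') hne, derivAux_triCycle, derivAux_triCycle]
  intro C hC hα
  obtain ⟨i₁, J₁', J₂', c₁, h₁, rfl⟩ := mem_triangle hC hα
  obtain ⟨e1, e2, e3, e4 | ⟨k', t, t', h5, h6, h7⟩⟩ := h.third_unique h₁
  · exact .inl (triCycle_congr h h₁ e1 e2 e3 (Subtype.ext e4))
  · rw [hc] at h6
    injection h6 with h6 h8
    cases t'
    · refine .inl (triCycle_congr h h₁ e1 e2 e3 (Subtype.ext ?_))
      rw [hc, h7, sp, sp, h6]
    · refine .inr (triCycle_congr h' h₁ e1 e2 e3 (Subtype.ext ?_))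
      rw [hc', h7, sp, sp, h6]

end

section
variable {n : ℕ} [hn : Fact (2 ≤ n)] {σ : TaggedTriangulation n} {E : Set (ZMod n)}
  {i : Fin 3} {J J₁ J₂ : Option (ZMod n)}

variable {x : ℤ} {t : Tag} {a b c : QVert σ E}

/-! ### The punctured cycle -/

/-- The sum of the angles of the arrows of a path, in units of `π / n`. -/
def pathTheta {a : QVert σ E} : {b : QVert σ E} → Path a b → ℕ
  | _, .nil => 0
  | _, .cons (b := b) (c := c) p _ => pathTheta p + theta b.1 c.1

lemma pathTheta_cons (p : Path a b) (α : b ⟶ c) :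
    pathTheta (p.cons α) = pathTheta p + theta b.1 c.1 := rfl

lemma pathTheta_comp (p : Path a b) (q : Path b c) :
    pathTheta (p.comp q) = pathTheta p + pathTheta q := by
  induction q with
  | nil => rfl
  | cons q α ih => rw [Path.comp_cons, pathTheta_cons, pathTheta_cons, ih, add_assoc]

lemma pathTheta_toPath (α : a ⟶ b) : pathTheta α.toPath = theta a.1 b.1 :=
  Nat.zero_add _

/-- The vertex given by an arc to the puncture. -/
def spV (E : Set (ZMod n)) {t : Tag} {x : ℤ} (h : IsSpoke σ t x) : QVert σ E := ⟨sp x t, h⟩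

/-- The vertex given by an edge not incident to the puncture. -/
def chV (E : Set (ZMod n)) {x y : ℤ} (h : IsChord σ x y) : QVert σ E := ⟨ch x y, h.mem⟩

@[simp] lemma spV_val (h : IsSpoke σ t x) : (spV E h).1 = sp x t := rfl

@[simp] lemma chV_val {x y : ℤ} (h : IsChord σ x y) : (chV E h).1 = ch x y := rfl

/-- All the arrows of the path are arrows at the puncture. -/
def PuncPart {a b : QVert σ E} (p : Path a b) : Prop :=
  ∀ α ∈ arrowList p, IsInternalAt none α

lemma puncPart_nil (a : QVert σ E) : PuncPart (Path.nil : Path a a) := by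
  simp [PuncPart, arrowList]

lemma puncPart_cons {p : Path a b} {α : b ⟶ c} :
    PuncPart (p.cons α) ↔ PuncPart p ∧ IsInternalAt none ⟨b, c, α⟩ := by
  simp [PuncPart, arrowList_cons, or_imp, forall_and]

lemma puncPart_comp {p : Path a b} {q : Path b c} :
    PuncPart (p.comp q) ↔ PuncPart p ∧ PuncPart q := by
  simp [PuncPart, arrowList_comp, or_imp, forall_and]

/-- An arrow at the puncture ending at a given arc. -/
lemma in_puncture {a b : Edge n} (h : Corner σ none a b) :
    ∃ t w x, IsChord σ w x ∧ IsSpoke σ t w ∧ IsSpoke σ t x ∧ a = sp w t ∧ b = sp x t := by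
  obtain ⟨i, J₁, J₂, c, h⟩ := corner_iff.1 h
  obtain ⟨x, y, H, rfl⟩ | ⟨x, t, H, rfl⟩ := edge_cases h.mem.2.1
  · rcases h.in_chord H with ⟨e, -⟩ | ⟨e, -⟩ <;> cases e
  · rcases h.in_spoke with ⟨e, -⟩ | ⟨-, w, h1, h2, h3, rfl⟩ | ⟨e, -⟩
    · cases e
    · exact ⟨t, w, x, h1, h2, h3, rfl, rfl⟩
    · cases e

lemma theta_spoke {w : ℤ} (h : IsChord σ w x) :
    (theta (sp w t : Edge n) (sp x t) : ℤ) = 2 * (x - w) := by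
  rw [theta_eq (x := w) (y := w) (x' := x) (y' := x) rfl rfl rfl rfl]
  all_goals have := h.1; have := h.2.1; omega

/-- A path of arrows at the puncture, in terms of lifts. The last arrow `w → X`. -/
lemma puncPart_last {p : Path a b} {α : b ⟶ c} (h : PuncPart (p.cons α)) (X : ℤ) (t : Tag)
    (hX : c.1 = sp X t) : ∃ w, PuncPart p ∧ IsChord σ w X ∧ IsSpoke σ t w ∧ IsSpoke σ t X ∧ b.1 = sp
    w t ∧ (pathTheta (p.cons α) : ℤ) = pathTheta p + 2 * (X - w) ∧ ∃ hc : Corner σ none b.1 c.1, α =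
    intArrow none hc := by
  obtain ⟨h1, h2⟩ := puncPart_cons.1 h
  obtain ⟨hc, rfl⟩ := h2.corner
  obtain ⟨t', w, x, g1, g2, g3, g4, g5⟩ := in_puncture hc
  rw [hX] at g5
  injection g5 with e1 e2
  subst e2
  obtain ⟨j, rfl⟩ := exists_shift e1.symm
  refine ⟨w + n * j, h1, g1.sh j, g2.sh j, g3.sh j, by rw [g4]; simp [sp], ?_, hc, rfl⟩
  rw [pathTheta_cons]
  push_cast
  rw [g4, hX, ← theta_spoke (t := t) (g1.sh j)]
  simp [sp]

lemma puncPart_lift {p : Path a b} (h : PuncPart p) (x : ℤ) (t : Tag)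
    (hx : a.1 = sp x t) : ∃ X, b.1 = sp X t ∧ (pathTheta p : ℤ) = 2 * (X - x) := by
  induction p with
  | nil => exact ⟨x, hx, by simp [pathTheta]⟩
  | cons p α ih =>
    obtain ⟨h1, h2⟩ := puncPart_cons.1 h
    obtain ⟨X, hX, e⟩ := ih h1
    obtain ⟨hc, rfl⟩ := h2.corner
    obtain ⟨t', w, y, g1, g2, g3, g4, g5⟩ := in_puncture hc
    rw [hX] at g4
    injection g4 with e1 e2
    subst e2
    obtain ⟨j, rfl⟩ := exists_shift e1.symm
    refine ⟨y + n * j, by rw [g5]; simp [sp], ?_⟩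
    rw [pathTheta_cons]
    push_cast
    have := theta_spoke (t := t) (g1.sh j)
    rw [hX, g5, e]
    simp only [sp, cast_shift] at this ⊢
    rw [this]
    ring

/-- A path of arrows at the puncture is determined by its ends and its `θ`-length. -/
lemma puncPart_unique {p q : Path a b} (hp : PuncPart p)
    (hq : PuncPart q) (h : pathTheta p = pathTheta q) : p = q := by
  have hpos : ∀ {a b c : QVert σ E} {p : Path a b} {α : b ⟶ c}, PuncPart (p.cons α) →
      0 < pathTheta (p.cons α) := by
    intro a b c p α h
    obtain ⟨hc, -⟩ := (puncPart_cons.1 h).2.corner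
    obtain ⟨t, w, x, -, -, -, -, e⟩ := in_puncture hc
    obtain ⟨w, -, h1, -, -, -, h2, -⟩ := puncPart_last h x t e
    have := h1.1
    omega
  induction p with
  | nil =>
    cases q with
    | nil => rfl
    | cons q β =>
      have := hpos hq
      rw [← h] at this
      exact absurd this (lt_irrefl _)
  | @cons b c p α ih =>
    cases q with
    | nil =>
      have := hpos hp
      rw [h] at this
      exact absurd this (lt_irrefl _)
    | @cons b' _ q β =>
      obtain ⟨hc, -⟩ := (puncPart_cons.1 hp).2.corner
      obtain ⟨t, _, x, -, -, -, -, e⟩ := in_puncture hc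
      obtain ⟨w, h1, h2, h3, -, h4, h5, _, rfl⟩ := puncPart_last hp x t e
      obtain ⟨w', h1', h2', h3', -, h4', h5', _, rfl⟩ := puncPart_last hq x t e
      obtain rfl := h3.prev_unique h2 h2' h3'
      obtain rfl : b = b' := Subtype.ext (h4.trans h4'.symm)
      rw [ih h1 h1' (by omega)]

/-- A path of arrows at the puncture goes through all the arcs on its way. -/
lemma puncPart_split {p : Path a b} (h : PuncPart p) (X : ℤ) (t : Tag) (hX : b.1 = sp X t)
    (y : ℤ) (hy : IsSpoke σ t y) (h1 : y ≤ X) (h2 : 2 * (X - y) ≤ pathTheta p) : ∃ (p₁ : Path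
    a (spV E hy)) (p₂ : Path (spV E hy) b), p = p₁.comp p₂ ∧ (pathTheta p₂ : ℤ) = 2 * (X - y)
    := by
  induction p generalizing X with
  | nil =>
    simp only [pathTheta] at h2
    obtain rfl : X = y := by omega
    obtain rfl : a = spV E hy := Subtype.ext hX
    exact ⟨.nil, .nil, rfl, by simp [pathTheta]⟩
  | @cons b c p α ih =>
    obtain ⟨w, g1, g2, g3, g4, g5, g6, -⟩ := puncPart_last h X t hX
    rcases eq_or_lt_of_le h1 with rfl | h1
    · obtain rfl : c = spV E hy := Subtype.ext hX
      exact ⟨p.cons α, .nil, rfl, by simp [pathTheta]⟩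
    · have := hy.not_cross g2
      obtain ⟨p₁, p₂, e1, e2⟩ := ih g1 w g5 (by omega) (by omega)
      refine ⟨p₁, p₂.cons α, by rw [e1]; rfl, ?_⟩
      rw [pathTheta_cons] at g6 ⊢
      push_cast at g6 ⊢
      rw [e2]
      linarith

/-- A path of arrows at the puncture without repeated arrows makes at most one turn. -/
lemma puncPart_le_of_nodup {p : Path a b} (h : PuncPart p) (hnd : (arrowList p).Nodup) (X :
    ℤ) (t : Tag) (hX : b.1 = sp X t) : pathTheta p ≤ 2 * n := by
  have hnn := two_le_int (n := n)
  by_contra hlt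
  have hs : IsSpoke σ t X := by
    have := b.2
    rw [hX] at this
    exact this
  have hs' := isSpoke_sub.2 hs
  obtain ⟨p₁, p₂, rfl, e⟩ := puncPart_split h X t hX (X - n) hs' (by omega) (by omega)
  obtain ⟨h1, h2⟩ := puncPart_comp.1 h
  rw [pathTheta_comp] at hlt
  cases p₁ with
  | nil => simp only [pathTheta] at hlt; omega
  | @cons d _ p₁ α =>
    cases p₂ with
    | nil => simp only [pathTheta] at e; omega
    | @cons d' _ p₂ β =>
      obtain ⟨w, -, g2, g3, -, g4, -, _, rfl⟩ := puncPart_last h1 (X - n) t rfl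
      obtain ⟨w', -, g2', g3', -, g4', -, _, rfl⟩ := puncPart_last h2 X t hX
      obtain rfl : w' - n = w :=
        (isSpoke_sub.2 g3').prev_unique (isChord_sub.2 g2') g2 g3
      obtain rfl : d = d' := by
        refine Subtype.ext ?_
        rw [g4, g4']
        simp [sp]
      obtain rfl : spV E hs' = b := Subtype.ext (show sp (X - n) t = b.1 by rw [hX]; simp [sp])
      rw [arrowList_comp, arrowList_cons, arrowList_cons, List.nodup_append] at hnd
      exact hnd.2.2 _ (List.mem_append_right _ (List.mem_singleton_self _)) _
        (List.mem_append_right _ (List.mem_singleton_self _)) rfl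

lemma exists_puncPart (hx : IsSpoke σ t x) (hd : ¬ IsDigon σ x) {y : ℤ} (hy : IsSpoke σ t y) (hxy
    : x ≤ y) : ∃ p : Path (spV E hx) (spV E hy), PuncPart p ∧ (pathTheta p : ℤ) = 2 * (y - x)
    := by
  obtain ⟨m, hm⟩ : ∃ m : ℕ, (m : ℤ) = y - x := ⟨(y - x).toNat, by omega⟩
  induction m using Nat.strong_induction_on generalizing y with
  | _ m ih =>
    rcases eq_or_lt_of_le hxy with rfl | hxy
    · exact ⟨.nil, puncPart_nil _, by simp [pathTheta]⟩
    · have hdy : ¬ IsDigon σ y := fun hdy => hd (hdy.of_cast (hdy.isSpoke_cast hx) )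
      obtain ⟨-, w, h1, h2⟩ := hy.exists_next hdy
      have := hx.not_cross h1
      have h3 := h1.1
      obtain ⟨p, hp, e⟩ := ih (w - x).toNat (by omega) h2 (by omega) (by omega)
      refine ⟨p.cons (intArrow none (LArr.B2 w y t h1 h2 hy).corner),
        puncPart_cons.2 ⟨hp, ⟨_, rfl⟩⟩, ?_⟩
      rw [pathTheta_cons]
      push_cast
      rw [e, spV_val, spV_val, theta_spoke h1]
      ring

lemma puncPart_sources {p : Path a b} (h : PuncPart p) (X : ℤ)
    (t : Tag) (hX : b.1 = sp X t) {α : Total (QVert σ E)} (hα : α ∈ arrowList p) :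
    ∃ w, α.left.1 = sp w t ∧ w < X ∧ 2 * (X - w) ≤ pathTheta p := by
  induction p generalizing X with
  | nil => simp [arrowList] at hα
  | @cons b c p β ih =>
    obtain ⟨w, g1, g2, g3, g4, g5, g6, -⟩ := puncPart_last h X t hX
    have := g2.1
    rw [arrowList_cons, List.mem_append, List.mem_singleton] at hα
    grind

lemma puncPart_nodup {p : Path a b} (h : PuncPart p) (X : ℤ) (t : Tag)
    (hX : b.1 = sp X t) (hle : pathTheta p ≤ 2 * n) : (arrowList p).Nodup := by
  induction p generalizing X with
  | nil => simp [arrowList]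
  | @cons b c p β ih =>
    obtain ⟨w, g1, g2, g3, g4, g5, g6, -⟩ := puncPart_last h X t hX
    have := g2.1
    rw [arrowList_cons, List.nodup_append]
    refine ⟨ih g1 w g5 (by omega), by simp, ?_⟩
    intro α hα α' hα' e
    rw [List.mem_singleton] at hα'
    subst e hα'
    obtain ⟨w', e1, e2, e3⟩ := puncPart_sources g1 w t g5 hα
    simp only at e1
    rw [g5] at e1
    injection e1 with e1
    have := eq_of_cast_eq e1
    omega

lemma puncturedCycles_facts : ∀ c ∈ puncturedCycles σ E, ∃ x t, c.1.1 = sp x t ∧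
    IsSpoke σ t x ∧ ¬ IsDigon σ x ∧ PuncPart c.2 ∧ pathTheta c.2 = 2 * n := by
  rintro ⟨a, c⟩ ⟨h1, h2, h3, h4⟩
  cases c with
  | nil => simp [arrowList] at h1
  | @cons d _ p α =>
    have h3 : PuncPart (p.cons α) := h3
    obtain ⟨hc, -⟩ := (puncPart_cons.1 h3).2.corner
    obtain ⟨t, w, x, g1, g2, g3, g4, g5⟩ := in_puncture hc
    have hd := (g1.not_digon g2 g3).2
    refine ⟨x, t, g5, g3, hd, h3, ?_⟩
    have hle := puncPart_le_of_nodup h3 h2 x t g5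
    obtain ⟨X, e1, e2⟩ := puncPart_lift h3 x t g5
    obtain ⟨w, -, k2, -, -, -, k3, -⟩ := puncPart_last h3 x t g5
    have := k2.1
    rw [g5] at e1
    injection e1 with e1
    obtain ⟨j, rfl⟩ := exists_shift e1
    have h0 : (0 : ℤ) < n * j := by omega
    have h1 : n * j ≤ (n : ℤ) := by omega
    have hnn := two_le_int (n := n)
    have hj : 0 < j := by
      by_contra hj
      nlinarith
    have : j = 1 := by
      by_contra hj'
      have : 2 ≤ j := by omega
      nlinarith
    subst this
    simp only at e2 ⊢
    omega

lemma puncturedCycles_subsingleton : (puncturedCycles σ E).Subsingleton := by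
  intro c hc c' hc'
  obtain ⟨x, t, h1, h2, h3, h4, h5⟩ := puncturedCycles_facts c hc
  obtain ⟨x', t', h1', h2', h3', h4', h5'⟩ := puncturedCycles_facts c' hc'
  obtain ⟨a, c⟩ := c
  obtain ⟨a', c'⟩ := c'
  simp only at h1 h1' h4 h4' h5 h5'
  have e1 := hc.2.2.2 _ _ h2'
  have e2 := hc'.2.2.2 _ _ h2
  simp only [h1, h1', fst] at e1 e2
  have e3 : (x : ZMod n) = x' := ZMod.val_injective n (le_antisymm e1 e2)
  have e4 : t' = t := by
    by_contra hne
    have h2' : IsSpoke σ t' x := by rw [IsSpoke, e3]; exact h2'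
    apply h3
    cases t <;> cases t'
    · exact absurd rfl hne
    · exact ⟨h2, h2'⟩
    · exact ⟨h2', h2⟩
    · exact absurd rfl hne
  subst e4
  obtain rfl : a = a' := Subtype.ext (by rw [h1, h1', sp, sp, e3])
  rw [puncPart_unique h4 h4' (h5.trans h5'.symm)]

variable (K : Type*) [Field K]

lemma cyclicDeriv_punctured_zero (h : Corner σ J a.1 b.1) (hJ : J ≠ none) :
    cyclicDeriv K ⟨a, b, intArrow J h⟩ (∑ᶠ c ∈ puncturedCycles σ E, Finsupp.single c 1) = 0 := by
  refine cyclicDeriv_finsum_zero puncturedCycles_subsingleton.finite _ fun c hc hα => ?_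
  obtain ⟨h', e⟩ := hc.2.2.1 _ hα
  injection e with e
  exact hJ e

/-- The derivative of the punctured cycle with respect to one of its arrows. -/
lemma cyclicDeriv_punctured (h : Corner σ none a.1 b.1) {r : Path b a} (hr : PuncPart r)
    (hr' : pathTheta r + theta a.1 b.1 = 2 * n) : cyclicDeriv K ⟨a, b, intArrow none h⟩ (∑ᶠ c ∈
    puncturedCycles σ E, Finsupp.single c 1) = ofPath K r := by
  obtain ⟨t, x, y, h1, h2, h3, h4, h5⟩ := in_puncture h
  have hd := (h1.not_digon h2 h3).1
  have hnn := two_le_int (n := n)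
  obtain ⟨k₀, hk₀, hmin⟩ : ∃ k₀ : ZMod n, spoke k₀ t ∈ σ.edges ∧
      ∀ k, spoke k t ∈ σ.edges → k₀.val ≤ k.val := by
    classical
    have hne : (Finset.univ.filter fun k : ZMod n => spoke k t ∈ σ.edges).Nonempty :=
      ⟨(x : ZMod n), Finset.mem_filter.2 ⟨Finset.mem_univ _, h2⟩⟩
    obtain ⟨k₀, hk, hmin⟩ := Finset.exists_min_image _ ZMod.val hne
    exact ⟨k₀, by simpa using hk, fun k hk => hmin k (by simpa using hk)⟩
  obtain ⟨κ, hκ0, hκ1, rfl⟩ := exists_lift k₀ (x + 1 - n)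
  have hκ : IsSpoke σ t κ := hk₀
  have hκn := hκ.not_cross h1
  have hκn' := (isSpoke_add.2 hκ).not_cross h1
  have hdκ : ¬ IsDigon σ κ := fun hdk => hd (hdk.of_cast (hdk.isSpoke_cast h2))
  have hdy : ¬ IsDigon σ y := (h1.not_digon h2 h3).2
  obtain ⟨p, hp, ep⟩ := exists_puncPart (E := E) hκ hdκ h2 (by omega)
  obtain ⟨q, hq, eq⟩ := exists_puncPart (E := E) h3 hdy (isSpoke_add.2 hκ) (by omega)
  obtain rfl : a = spV E h2 := Subtype.ext h4
  obtain rfl : b = spV E h3 := Subtype.ext h5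
  have eκ : spV E (isSpoke_add.2 hκ) = spV E hκ := Subtype.ext (by simp [sp])
  generalize spV E (isSpoke_add.2 hκ) = z at q hq eq eκ
  subst eκ
  have hθ := theta_spoke (t := t) h1
  simp only [spV_val] at hr'
  have hfull : PuncPart ((p.cons (intArrow none h)).comp q) :=
    puncPart_comp.2 ⟨puncPart_cons.2 ⟨hp, ⟨_, rfl⟩⟩, hq⟩
  have hfull' : pathTheta ((p.cons (intArrow none h)).comp q) = 2 * n := by
    rw [pathTheta_comp, pathTheta_cons]
    simp only [spV_val]
    omega
  have hnd : (arrowList ((p.cons (intArrow none h)).comp q)).Nodup :=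
    puncPart_nodup hfull κ t rfl hfull'.le
  have hnd' := hnd
  rw [arrowList_comp, arrowList_cons, List.nodup_append, List.nodup_append] at hnd'
  have hmem : (⟨spV E hκ, (p.cons (intArrow none h)).comp q⟩ : BasedCycle (QVert σ E)) ∈
      puncturedCycles σ E := by
    refine ⟨by simp [arrowList_comp, arrowList_cons], hnd, hfull, fun k t' hk => ?_⟩
    have : t' = t := by
      by_contra hne
      obtain ⟨z, -, -, rfl⟩ := exists_lift k 0
      have hz : IsSpoke σ t' z := hk
      exact h1.ne_cast ((h2.cast_eq hz (Ne.symm hne)).trans (h3.cast_eq hz (Ne.symm hne)).symm)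
    subst this
    exact hmin k hk
  have hpα : (⟨_, _, intArrow none h⟩ : Total (QVert σ E)) ∉ arrowList p := fun hm =>
    hnd'.1.2.2 _ hm _ (List.mem_singleton_self _) rfl
  have hqα : (⟨_, _, intArrow none h⟩ : Total (QVert σ E)) ∉ arrowList q := fun hm =>
    hnd'.2.2 _ (List.mem_append_right _ (List.mem_singleton_self _)) _ hm rfl
  rw [cyclicDeriv_finsum_unique puncturedCycles_subsingleton.finite _ _ hmem fun c hc _ =>
    puncturedCycles_subsingleton hc hmem]
  rw [derivAux_split _ hpα hqα]
  congr 1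
  refine puncPart_unique (puncPart_comp.2 ⟨hq, hp⟩) hr ?_
  rw [pathTheta_comp]
  omega

end

section
/-! ### Relations of the Jacobian algebras -/

/-- Elements of a ring attached to the vertices, to the internal arrows (with their joint vertex) and
to the external arrows of the quiver of a tagged triangulation. -/
structure ArrowData (n : ℕ) (B : Type*) where
  ide : Edge n → B
  ar : Option (ZMod n) → Edge n → Edge n → B
  ex : ZMod n → B

variable {n : ℕ} [hn : Fact (2 ≤ n)]
variable {x y : ℤ} {t : Tag} {J : Option (ZMod n)} {a b : Edge n}

/-- The image of `D` by a map. -/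
def ArrowData.map {B B' : Type*} (D : ArrowData n B) (f : B → B') : ArrowData n B' :=
  ⟨fun a => f (D.ide a), fun J a b => f (D.ar J a b), fun k => f (D.ex k)⟩

/-- The conditions under which `D` defines a morphism from a path algebra. -/
structure ArrowData.Lawful {B : Type*} [Ring B] (D : ArrowData n B) (σ : TaggedTriangulation n)
    (E : Set (ZMod n)) : Prop where
  idem : ∀ a ∈ σ.edges, D.ide a * D.ide a = D.ide a
  orth : ∀ a ∈ σ.edges, ∀ b ∈ σ.edges, a ≠ b → D.ide a * D.ide b = 0
  one : ∑ a ∈ σ.edges, D.ide a = 1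
  ide_ar : ∀ {J a b}, Corner σ J a b → D.ide a * D.ar J a b = D.ar J a b
  ar_ide : ∀ {J a b}, Corner σ J a b → D.ar J a b * D.ide b = D.ar J a b
  ide_ex : ∀ k ∈ E, D.ide (side (k - 1)) * D.ex k = D.ex k
  ex_ide : ∀ k ∈ E, D.ex k * D.ide (side k) = D.ex k

variable (K : Type*) [Field K] (σ : TaggedTriangulation n) (E : Set (ZMod n))

variable {σ} in
/-- An edge of `σ`, as a vertex of the quiver. -/
def vtx {a : Edge n} (h : a ∈ σ.edges) : QVert σ E := ⟨a, h⟩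

open Classical in
/-- The trivial paths and the arrows. -/
def pathData : ArrowData n (PathAlgebra K (QVert σ E)) where
  ide a := if h : a ∈ σ.edges then
    ofPath K (Path.nil : Path (vtx E h) (vtx E h)) else 0
  ar J a b := if h : a ∈ σ.edges ∧ b ∈ σ.edges ∧ Corner σ J a b then
    ofPath K (intArrow J h.2.2 : vtx E h.1 ⟶ vtx E h.2.1).toPath else 0
  ex k := if h : k ∈ E then ofPath K (extArrow (σ := σ) h).toPath else 0

variable {K σ E}

lemma pathData_ide (a : QVert σ E) :
    (pathData K σ E).ide a.1 = ofPath K (Path.nil : Path a a) := dif_pos a.2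

lemma pathData_ide_of_mem (h : a ∈ σ.edges) : (pathData K σ E).ide a =
    ofPath K (Path.nil : Path (vtx E h) (vtx E h)) := dif_pos h

lemma pathData_ar {a b : QVert σ E} (h : Corner σ J a.1 b.1) :
    (pathData K σ E).ar J a.1 b.1 = ofPath K (intArrow J h : a ⟶ b).toPath :=
  dif_pos ⟨a.2, b.2, h⟩

lemma pathData_ar_of_corner (h : Corner σ J a b) : (pathData K σ E).ar J a b =
    ofPath K (intArrow J h : vtx E h.mem.1 ⟶ vtx E h.mem.2).toPath :=
  dif_pos ⟨h.mem.1, h.mem.2, h⟩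

lemma pathData_ex {k : ZMod n} (h : k ∈ E) :
    (pathData K σ E).ex k = ofPath K (extArrow (σ := σ) h).toPath := dif_pos h

variable {B : Type*} [Ring B] [Algebra K B]

namespace ArrowData

variable (D : ArrowData n B)

/-- The element attached to an arrow. -/
def onArrow {a b : QVert σ E} : Arrow σ E a b → B
  | .internal J _ => D.ar J a.1 b.1
  | .external k _ _ _ => D.ex k

lemma onArrow_ide {D : ArrowData n B} (hD : D.Lawful σ E) {a b : QVert σ E} (α : a ⟶ b) :
    D.onArrow α * D.ide b.1 = D.onArrow α := by
  change Arrow σ E a b at α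
  rcases α with ⟨J, h⟩ | ⟨k, hk, ha, hb⟩
  · exact hD.ar_ide h
  · simp only [onArrow]
    rw [hb, hD.ex_ide k hk]

variable (K) in
/-- The morphism from the path algebra defined by `D`. -/
def lift (hD : D.Lawful σ E) : PathAlgebra K (QVert σ E) →ₐ[K] B :=
  PathAlgebra.lift K (fun a : QVert σ E => D.ide a.1) (fun {_ _} α => D.onArrow α)
    (fun a b h => hD.orth _ a.2 _ b.2 fun e => h (Subtype.ext e)) (fun a => hD.idem _ a.2)
    (by rw [← hD.one]; exact Finset.sum_coe_sort σ.edges D.ide) (fun α => onArrow_ide hD α)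

variable {D} (hD : D.Lawful σ E)
include hD

lemma lift_path {a b : QVert σ E} (p : Path a b) : D.lift K hD (ofPath K p) =
    evalPath (fun a : QVert σ E => D.ide a.1) (fun {_ _} α => D.onArrow α) p :=
  lift_ofPath _ _ _ _ p

lemma lift_ide (h : a ∈ σ.edges) : D.lift K hD ((pathData K σ E).ide a) = D.ide a := by
  rw [pathData_ide_of_mem h, lift_path]
  rfl

lemma lift_ar (h : Corner σ J a b) : D.lift K hD ((pathData K σ E).ar J a b) = D.ar J a b := by
  rw [pathData_ar_of_corner h, lift_path]
  exact hD.ide_ar h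

lemma lift_ex {k : ZMod n} (h : k ∈ E) : D.lift K hD ((pathData K σ E).ex k) = D.ex k := by
  rw [pathData_ex h, lift_path]
  exact hD.ide_ex k h

end ArrowData

variable (σ) in
/-- The products of internal arrows at `P_k` along the visible edges, from `a` to `b`. -/
inductive Fan (D : ArrowData n B) (k : ZMod n) (a : Edge n) : Edge n → B → Prop
  | nil : Fan D k a a (D.ide a)
  | cons {b c : Edge n} {g : B} (hg : Fan D k a b g) (h : Corner σ (some k) b c)
      (hb : Visible σ b) (hc : Visible σ c) : Fan D k a c (g * D.ar (some k) b c)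

variable (σ) in
/-- The products of arrows at the puncture, from the arc at `P_x` to the arc at `P_y`. -/
inductive Wind (D : ArrowData n B) (t : Tag) (x : ℤ) : ℤ → B → Prop
  | nil : Wind D t x x (D.ide (sp x t))
  | cons {y z : ℤ} {g : B} (hg : Wind D t x y g) (h : IsChord σ y z) (hy : IsSpoke σ t y)
      (hz : IsSpoke σ t z) : Wind D t x z (g * D.ar none (sp y t) (sp z t))

lemma Fan.lift {D : ArrowData n B} (hD : D.Lawful σ E) {k : ZMod n}
    {g : PathAlgebra K (QVert σ E)} (ha : a ∈ σ.edges) (h : Fan σ (pathData K σ E) k a b g) :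
    Fan σ D k a b (D.lift K hD g) := by
  induction h with
  | nil => rw [ArrowData.lift_ide hD ha]; exact .nil
  | cons hg h hb hc ih =>
    rw [map_mul, ArrowData.lift_ar hD h]
    exact .cons ih h hb hc

lemma Wind.lift {D : ArrowData n B} (hD : D.Lawful σ E) {g : PathAlgebra K (QVert σ E)} (hx :
    IsSpoke σ t x) (h : Wind σ (pathData K σ E) t x y g) : Wind σ D t x y (D.lift K hD g) := by
  induction h with
  | nil => rw [ArrowData.lift_ide hD hx]; exact .nil
  | cons hg h hy hz ih =>
    rw [map_mul, ArrowData.lift_ar hD (LArr.B2 _ _ _ h hy hz).corner]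
    exact .cons ih h hy hz

lemma Fan.exists_path {k : ZMod n} {g : PathAlgebra K (QVert σ E)} (a : QVert σ E) (h : Fan σ
    (pathData K σ E) k a.1 b g) : ∃ (hb : b ∈ σ.edges) (p : Path a (vtx E hb)), FanPart k p ∧
    g = ofPath K p := by
  induction h with
  | nil => exact ⟨a.2, .nil, fanPart_nil _ _, pathData_ide a⟩
  | @cons b c g hg h hb hc ih =>
    obtain ⟨hb', p, hp, rfl⟩ := ih
    refine ⟨h.mem.2, p.cons (intArrow (some k) h), fanPart_cons.2 ⟨hp, ⟨_, rfl⟩, hb, hc⟩, ?_⟩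
    rw [pathData_ar_of_corner h, ofPath_mul_ofPath]
    rfl

lemma Wind.exists_path {g : PathAlgebra K (QVert σ E)} (hx : IsSpoke σ t x) (h : Wind σ (pathData
    K σ E) t x y g) : ∃ (hy : IsSpoke σ t y) (p : Path (spV E hx) (spV E hy)), PuncPart p ∧ g
    = ofPath K p ∧ (pathTheta p : ℤ) = 2 * (y - x) := by
  induction h with
  | nil => exact ⟨hx, .nil, puncPart_nil _, pathData_ide (spV E hx), by simp [pathTheta]⟩
  | @cons y z g hg h hy hz ih =>
    obtain ⟨hy', p, hp, rfl, e⟩ := ih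
    have hc : Corner σ none (sp y t) (sp z t) := (LArr.B2 _ _ _ h hy hz).corner
    refine ⟨hz, p.cons (intArrow none hc), puncPart_cons.2 ⟨hp, ⟨_, rfl⟩⟩, ?_, ?_⟩
    · rw [pathData_ar_of_corner hc]
      exact ofPath_mul_ofPath _ _
    · rw [pathTheta_cons]
      push_cast
      rw [e, spV_val, spV_val, theta_spoke h]
      ring

/-- The sum of the paths through the plain and the notched arc of a once-punctured digon. -/
abbrev ArrowData.digonSum (D : ArrowData n B) (k m : ℤ) : B :=
  D.ar pt(k) (ch k m) (sp k .plain) * D.ar pt(k) (sp k .plain) (ch m k) +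
    D.ar pt(k) (ch k m) (sp k .notched) * D.ar pt(k) (sp k .notched) (ch m k)

variable (σ) in
/-- The relations given by the cyclic derivatives of the potential with respect to the internal
arrows `a → b` with joint vertex `J` such that `S J a b`. -/
structure ArrowData.Relations (D : ArrowData n B)
    (S : Option (ZMod n) → Edge n → Edge n → Prop) : Prop where
  fan : ∀ {i k J₁ J₂ a b c p q}, LArr σ i (some k) J₁ J₂ a b c → S (some k) a b → Visible σ a →
    Visible σ b → (∀ k t, IsDigon σ k → c ≠ sp k t) → Fan σ D k (side k) a p →
    Fan σ D k b (side (k - 1)) q → D.ar J₁ b c * D.ar J₂ c a = q * D.ex k * p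
  digon : ∀ {k m : ℤ} {p q}, IsChord σ k m → IsChord σ m (k + n) → IsDigon σ k →
    S pt(m) (ch m k) (ch k m) → Fan σ D m (side m) (ch m k) p →
    Fan σ D m (ch k m) (side (m - 1)) q →
    D.digonSum k m = q * D.ex m * p
  invisible : ∀ {i k J₁ J₂ a b c}, LArr σ i (some k) J₁ J₂ a b c → S (some k) a b →
    ¬ (Visible σ a ∧ Visible σ b) → D.ar J₁ b c * D.ar J₂ c a = 0
  wind : ∀ {t} {x y : ℤ} {r}, IsChord σ x y → IsSpoke σ t x → IsSpoke σ t y →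
    S none (sp x t) (sp y t) → Wind σ D t y (x + n) r →
    D.ar pt(y) (sp y t) (ch x y) * D.ar pt(x) (ch x y) (sp x t) = r

section Derivative
variable {i : Fin 3} {k : ZMod n} {J₁ J₂ : Option (ZMod n)}

lemma ofPath_triPath {a b c : QVert σ E} (h : LArr σ i J J₁ J₂ a.1 b.1 c.1) : ofPath K (triPath h)
    = (pathData K σ E).ar J₁ b.1 c.1 * (pathData K σ E).ar J₂ c.1 a.1 := by
  rw [pathData_ar h.rotate.corner, pathData_ar h.rotate.rotate.corner, ofPath_mul_ofPath]
  rfl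

lemma deriv_external {a b : QVert σ E} (h : Corner σ (some k) a.1 b.1) (hk : k ∈ E) (ha : Visible
    σ a.1) (hb : Visible σ b.1) {p q : PathAlgebra K (QVert σ E)} (hp : Fan σ (pathData K σ E) k
    (side k) a.1 p) (hq : Fan σ (pathData K σ E) k b.1 (side (k - 1)) q) : cyclicDeriv K ⟨a, b,
    intArrow (some k) h⟩ (∑ᶠ c ∈ externalCycles σ E, Finsupp.single c 1) = q * (pathData K σ E).ex k
    * p := by
  obtain ⟨p, hp', rfl⟩ : ∃ p : Path (sideV σ E k) a, FanPart k p ∧ _ = ofPath K p :=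
    (hp.exists_path (sideV σ E k)).choose_spec
  obtain ⟨q, hq', rfl⟩ : ∃ q : Path b (sideV σ E (k - 1)), FanPart k q ∧ _ = ofPath K q :=
    (hq.exists_path b).choose_spec
  refine (cyclicDeriv_external K h hk ha hb hp' hq').trans ?_
  rw [pathData_ex hk, ← ofPath_mul_ofPath, ← ofPath_mul_ofPath, mul_assoc]

lemma cyclicDeriv_potential (α : Total (QVert σ E)) : cyclicDeriv K α (potential σ E K) =
    cyclicDeriv K α (∑ᶠ c ∈ clockwiseTriangles σ E, Finsupp.single c 1) -
    cyclicDeriv K α (∑ᶠ c ∈ externalCycles σ E, Finsupp.single c 1) -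
    cyclicDeriv K α (∑ᶠ c ∈ puncturedCycles σ E, Finsupp.single c 1) := by
  rw [potential, map_sub, map_sub]

lemma deriv_fan {a b c : QVert σ E} (h : LArr σ i (some k) J₁ J₂ a.1 b.1 c.1) (hk : k ∈ E) (ha :
    Visible σ a.1) (hb : Visible σ b.1) (hc : ∀ k t, IsDigon σ k → c.1 ≠ sp k t) {p q : PathAlgebra
    K (QVert σ E)} (hp : Fan σ (pathData K σ E) k (side k) a.1 p) (hq : Fan σ (pathData K σ E) k b.1
    (side (k - 1)) q) : cyclicDeriv K ⟨a, b, intArrow (some k) h.corner⟩ (potential σ E K) =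
    (pathData K σ E).ar J₁ b.1 c.1 * (pathData K σ E).ar J₂ c.1 a.1 - q * (pathData K σ E).ex k * p
    := by
  rw [cyclicDeriv_potential, deriv_external h.corner hk ha hb hp hq, cyclicDeriv_triangles K h hc,
    cyclicDeriv_punctured_zero K _ (by simp), ofPath_triPath, sub_zero]

lemma deriv_digon {k m : ℤ} (h1 : IsChord σ k m) (h2 : IsChord σ m (k + n)) (h3 : IsDigon σ k) {a
    b : QVert σ E} (ha : a.1 = ch m k) (hb : b.1 = ch k m) (h : Corner σ pt(m) a.1
    b.1) (hk : (m : ZMod n) ∈ E) {p q : PathAlgebra K (QVert σ E)} (hp : Fan σ (pathData K σ E) m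
    (side m) a.1 p) (hq : Fan σ (pathData K σ E) m b.1 (side (m - 1)) q) : cyclicDeriv K ⟨a, b,
    intArrow pt(m) h⟩ (potential σ E K) = (pathData K σ E).digonSum k m - q * (pathData K σ E).ex m * p := by
  have va : Visible σ a.1 := ha ▸ visible_chord _ _
  have vb : Visible σ b.1 := hb ▸ visible_chord _ _
  have H : ∀ t (ht : IsSpoke σ t k), LArr σ 0 pt(m) pt(k) pt(k) a.1 b.1
      (spV E ht).1 := fun t ht => by
    rw [ha, hb]
    exact .D1 k m t h1 h2 h3
  rw [cyclicDeriv_potential, deriv_external h hk va vb hp hq,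
    cyclicDeriv_triangles_digon K (k := k) (H .plain h3.1) (H .notched h3.2) rfl rfl,
    cyclicDeriv_punctured_zero K _ (by simp), ofPath_triPath, ofPath_triPath, sub_zero, ha, hb]
  rfl

lemma deriv_invisible {a b c : QVert σ E} (h : LArr σ i (some k) J₁ J₂ a.1 b.1 c.1) (hv : ¬
    (Visible σ a.1 ∧ Visible σ b.1)) : cyclicDeriv K ⟨a, b, intArrow (some k) h.corner⟩ (potential σ
    E K) = (pathData K σ E).ar J₁ b.1 c.1 * (pathData K σ E).ar J₂ c.1 a.1 := by
  have hc : ∀ k t, IsDigon σ k → c.1 ≠ sp k t := by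
    intro k' t hk hc
    apply hv
    rw [hc] at h
    obtain ⟨_, -, -, -, e⟩ := h.rotate.in_digon hk
    obtain ⟨_, -, -, -, e', -⟩ := h.rotate.rotate.out_digon hk
    rw [e, e']
    exact ⟨visible_chord _ _, visible_chord _ _⟩
  rw [cyclicDeriv_potential, cyclicDeriv_triangles K h hc, ofPath_triPath,
    cyclicDeriv_punctured_zero K _ (by simp), sub_zero,
    cyclicDeriv_external_zero K _ fun _ _ _ ha hb => hv ⟨ha, hb⟩, sub_zero]

lemma deriv_wind (h1 : IsChord σ x y) (h2 : IsSpoke σ t x) (h3 : IsSpoke σ t y) {a b : QVert σ E}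
    (ha : a.1 = sp x t) (hb : b.1 = sp y t) (h : Corner σ none a.1 b.1) {r : PathAlgebra K (QVert σ
    E)} (hr : Wind σ (pathData K σ E) t y (x + n) r) : cyclicDeriv K ⟨a, b, intArrow none h⟩
    (potential σ E K) = (pathData K σ E).ar pt(y) (sp y t) (ch x y) * (pathData K σ
    E).ar pt(x) (ch x y) (sp x t) - r := by
  obtain ⟨h4, r, hr', rfl, e⟩ := hr.exists_path h3
  clear hr
  obtain rfl : a = spV E h2 := Subtype.ext ha
  obtain rfl : b = spV E h3 := Subtype.ext hb
  have ex : spV E h4 = spV E h2 := Subtype.ext (by simp [sp])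
  generalize spV E h4 = z at ex r hr' e
  subst ex
  have hθ := theta_spoke (t := t) h1
  have H : LArr σ 1 none pt(y) pt(x) (spV E h2).1 (spV E h3).1 (chV E h1).1 :=
    .B2 x y t h1 h2 h3
  rw [cyclicDeriv_potential, cyclicDeriv_external_zero K h (by simp), sub_zero,
    cyclicDeriv_triangles K H (by simp), ofPath_triPath,
    cyclicDeriv_punctured K h hr' (by simp only [spV_val]; omega)]
  rfl

/-- In a triangle at a corner `a → b` between visible edges, the third edge is an arc of a
once-punctured digon only if the corner is the one opposite to these arcs. -/
lemma LArr.third_digon {c : Edge n} (h : LArr σ i J J₁ J₂ a b c) {k : ℤ} (hk : IsDigon σ k) (hc :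
    c = sp k t) : ∃ k m : ℤ, IsChord σ k m ∧ IsChord σ m (k + n) ∧ IsDigon σ k ∧ J = some (m : ZMod
    n) ∧ a = ch m k ∧ b = ch k m := by
  cases h <;> try cases hc
  case B1 x y t h1 h2 h3 =>
    injection hc with e
    exact absurd (hk.of_cast e.symm) (h1.not_digon h2 h3).2
  case B3 x y t h1 h2 h3 =>
    injection hc with e
    exact absurd (hk.of_cast e.symm) (h1.not_digon h2 h3).1
  case D1 k m t h1 h2 h3 => exact ⟨k, m, h1, h2, h3, rfl, rfl, rfl⟩

lemma FanPart.fan {k : ZMod n} {a b : QVert σ E} {p : Path a b} (h : FanPart k p) :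
    Fan σ (pathData K σ E) k a.1 b.1 (ofPath K p) := by
  induction p with
  | nil => rw [← pathData_ide]; exact .nil
  | cons p α ih =>
    obtain ⟨h1, h2, h3, h4⟩ := fanPart_cons.1 h
    obtain ⟨hc, rfl⟩ := h2.corner
    have := (ih h1).cons hc h3 h4
    rwa [pathData_ar hc, ofPath_mul_ofPath] at this

lemma Fan.transfer {B' : Type*} [Ring B'] {D : ArrowData n B} {D' : ArrowData n B'} {k : ZMod n}
    {g : B} (h : Fan σ D k a b g) : ∃ g', Fan σ D' k a b g' := by
  induction h with
  | nil => exact ⟨_, .nil⟩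
  | cons hg h hb hc ih => exact ⟨_, .cons ih.choose_spec h hb hc⟩

lemma exists_fan_from_side (D : ArrowData n B) {k : ZMod n}
    (hb : b ∈ σ.edges) (hv : Visible σ b) (hk : Incident k b) : ∃ g, Fan σ D k (side k) b g := by
  obtain ⟨p, hp⟩ := exists_fanPart_from_side k (vtx Set.univ hb) hv hk
  exact (hp.fan (K := ℚ)).transfer

lemma exists_fan_to_side (D : ArrowData n B) {k : ZMod n} (ha : a ∈ σ.edges) (hv : Visible σ a)
    (hk : Incident k a) : ∃ g, Fan σ D k a (side (k - 1)) g := by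
  obtain ⟨p, hp⟩ := exists_fanPart_to_side k (vtx Set.univ ha) hv hk
  exact (hp.fan (K := ℚ)).transfer

lemma Fan.meas_lt {D : ArrowData n B} {k : ZMod n} {g : B}
    (h : Fan σ D k a b g) : a = b ∧ g = D.ide a ∨ meas k a < meas k b := by
  induction h with
  | nil => exact .inl ⟨rfl, rfl⟩
  | cons hg h hb hc ih =>
    have := h.meas_lt
    right
    rcases ih with ⟨rfl, -⟩ | ih <;> omega

/-- There is at most one path turning around `P_k` between two given edges. -/
lemma Fan.unique {D : ArrowData n B} {k : ZMod n} {g g' : B}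
    (h : Fan σ D k a b g) (h' : Fan σ D k a b g') : g = g' := by
  induction h generalizing g' with
  | nil =>
    rcases h'.meas_lt with ⟨-, e⟩ | e
    · exact e.symm
    · exact absurd e (lt_irrefl _)
  | cons hg h hb hc ih =>
    cases h' with
    | nil =>
      rcases (hg.cons h hb hc).meas_lt with ⟨-, e⟩ | e
      · exact e
      · exact absurd e (lt_irrefl _)
    | cons hg' h' hb' hc' =>
      obtain rfl := h.in_unique h' hb hb'
      rw [ih hg']

lemma exists_wind (D : ArrowData n B) (hx : IsSpoke σ t x)
    (hd : ¬ IsDigon σ x) (hy : IsSpoke σ t y) (hxy : x ≤ y) : ∃ g, Wind σ D t x y g := by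
  obtain ⟨m, hm⟩ : ∃ m : ℕ, (m : ℤ) = y - x := ⟨(y - x).toNat, by omega⟩
  induction m using Nat.strong_induction_on generalizing y with
  | _ m ih =>
    rcases eq_or_lt_of_le hxy with rfl | hxy
    · exact ⟨_, .nil⟩
    · have hdy : ¬ IsDigon σ y := fun hdy => hd (hdy.of_cast (hdy.isSpoke_cast hx))
      obtain ⟨-, w, h1, h2⟩ := hy.exists_next hdy
      have := hx.not_cross h1
      have h3 := h1.1
      obtain ⟨g, hg⟩ := ih (w - x).toNat (by omega) h2 (by omega) (by omega)
      exact ⟨_, hg.cons h1 h2 hy⟩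

section Hom
variable {B' : Type*} [Ring B'] [Algebra K B'] {D : ArrowData n B'} {f : B' →ₐ[K] B}

lemma Fan.map {k : ZMod n} {g : B'} (h : Fan σ D k a b g) : Fan σ (D.map f) k a b (f g) := by
  induction h with
  | nil => exact .nil
  | cons hg h hb hc ih => rw [map_mul]; exact .cons ih h hb hc

lemma Fan.of_map {k : ZMod n} {g : B} (h : Fan σ (D.map f) k a b g) :
    ∃ g', Fan σ D k a b g' ∧ f g' = g := by
  obtain ⟨g', hg'⟩ := h.transfer (D' := D)
  exact ⟨g', hg', (hg'.map (f := f)).unique h⟩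

lemma Wind.of_map {g : B} (h : Wind σ (D.map f) t x y g) :
    ∃ g', Wind σ D t x y g' ∧ f g' = g := by
  induction h with
  | nil => exact ⟨_, .nil, rfl⟩
  | cons hg h hb hc ih =>
    obtain ⟨g', h1, rfl⟩ := ih
    exact ⟨_, .cons h1 h hb hc, map_mul _ _ _⟩

end Hom

/-- The relations in a quotient of the path algebra. -/
lemma relations_of_hom {S : Option (ZMod n) → Edge n → Edge n → Prop} {f : PathAlgebra K (QVert σ
    E) →ₐ[K] B} (hE : ∀ {k a b}, Corner σ (some k) a b → S (some k) a b → k ∈ E) (hf : ∀ {J} {a b :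
    QVert σ E} (h : Corner σ J a.1 b.1), S J a.1 b.1 → f (cyclicDeriv K ⟨a, b, intArrow J h⟩
    (potential σ E K)) = 0) : ((pathData K σ E).map f).Relations σ S where
  fan := by
    intro i k J₁ J₂ a b c p q h hS ha hb hc hp hq
    obtain ⟨p, hp', rfl⟩ := hp.of_map
    obtain ⟨q, hq', rfl⟩ := hq.of_map
    have h1 := hf (a := vtx E h.mem.1) (b := vtx E h.mem.2.1) h.corner hS
    have h2 : LArr σ i (some k) J₁ J₂ (vtx E h.mem.1).1 (vtx E h.mem.2.1).1
      (vtx E h.mem.2.2).1 := h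
    rwa [deriv_fan h2 (hE h.corner hS) ha hb hc hp' hq', map_sub, sub_eq_zero, map_mul, map_mul,
      map_mul] at h1
  digon := by
    intro k m p q h1 h2 h3 hS hp hq
    obtain ⟨p, hp', rfl⟩ := hp.of_map
    obtain ⟨q, hq', rfl⟩ := hq.of_map
    have h := (LArr.D1 k m .plain h1 h2 h3)
    have h4 := hf (a := vtx E h.mem.1) (b := vtx E h.mem.2.1) h.corner hS
    rw [deriv_digon (a := vtx E h.mem.1) (b := vtx E h.mem.2.1) h1 h2 h3 rfl rfl h.corner
      (hE h.corner hS) hp' hq', map_sub, sub_eq_zero] at h4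
    simp only [map_mul, map_add] at h4
    exact h4
  invisible := by
    intro i k J₁ J₂ a b c h hS hv
    have h1 := hf (a := vtx E h.mem.1) (b := vtx E h.mem.2.1) h.corner hS
    have h2 : LArr σ i (some k) J₁ J₂ (vtx E h.mem.1).1 (vtx E h.mem.2.1).1
      (vtx E h.mem.2.2).1 := h
    rwa [deriv_invisible h2 hv, map_mul] at h1
  wind := by
    intro t x y r h1 h2 h3 hS hr
    obtain ⟨r, hr', rfl⟩ := hr.of_map
    have h := (LArr.B2 x y t h1 h2 h3).corner
    have h4 := hf (a := spV E h2) (b := spV E h3) h hS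
    rwa [deriv_wind h1 h2 h3 rfl rfl h hr', map_sub, sub_eq_zero, map_mul] at h4

/-- The relations hold for `D` as soon as the corresponding cyclic derivatives vanish. -/
lemma ArrowData.Relations.deriv {S : Option (ZMod n) → Edge n → Edge n → Prop} {D : ArrowData n B}
    (hR : D.Relations σ S) (hD : D.Lawful σ E) (hE : ∀ {k a b}, Corner σ (some k) a b → S (some k) a
    b → k ∈ E) {a b : QVert σ E} (h : Corner σ J a.1 b.1) (hS : S J a.1 b.1) : D.lift K hD
    (cyclicDeriv K ⟨a, b, intArrow J h⟩ (potential σ E K)) = 0 := by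
  obtain ⟨i, J₁, J₂, c, h'⟩ := corner_iff.1 h
  obtain ⟨c, rfl⟩ : ∃ c' : QVert σ E, c'.1 = c := ⟨vtx E h'.mem.2.2, rfl⟩
  cases J with
  | some k =>
    by_cases hv : Visible σ a.1 ∧ Visible σ b.1
    · obtain ⟨p, hp⟩ := exists_fan_from_side (pathData K σ E) a.2 hv.1 h'.incident.1
      obtain ⟨q, hq⟩ := exists_fan_to_side (pathData K σ E) b.2 hv.2 h'.incident.2
      have hp' := hp.lift hD (σ.side_mem k)
      have hq' := hq.lift hD b.2
      by_cases hc : ∀ k t, IsDigon σ k → c.1 ≠ sp k t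
      · rw [deriv_fan h' (hE h hS) hv.1 hv.2 hc hp hq, map_sub, map_mul, map_mul, map_mul,
          ArrowData.lift_ar hD h'.rotate.corner,
          ArrowData.lift_ar hD h'.rotate.rotate.corner,
          ArrowData.lift_ex hD (hE h hS), sub_eq_zero]
        exact hR.fan h' hS hv.1 hv.2 hc hp' hq'
      · push Not at hc
        obtain ⟨k', t, hk', hc⟩ := hc
        obtain ⟨k₀, m, h1, h2, h3, e1, ha, hb⟩ := h'.third_digon hk' hc
        injection e1 with e1
        subst e1
        have H := fun t => LArr.D1 k₀ m t h1 h2 h3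
        rw [deriv_digon h1 h2 h3 ha hb h (hE h hS) hp hq, map_sub, map_add, map_mul, map_mul,
          map_mul, map_mul,
          ArrowData.lift_ar hD (H .plain).rotate.corner,
          ArrowData.lift_ar hD (H .plain).rotate.rotate.corner,
          ArrowData.lift_ar hD (H .notched).rotate.corner,
          ArrowData.lift_ar hD (H .notched).rotate.rotate.corner,
          ArrowData.lift_ex hD (hE h hS), sub_eq_zero]
        rw [ha, hb] at hS
        rw [ha] at hp'
        rw [hb] at hq'
        exact hR.digon h1 h2 h3 hS hp' hq'
    · rw [deriv_invisible h' hv, map_mul,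
        ArrowData.lift_ar hD h'.rotate.corner,
        ArrowData.lift_ar hD h'.rotate.rotate.corner]
      exact hR.invisible h' hS hv
  | none =>
    obtain ⟨t, x, y, h1, h2, h3, ha, hb⟩ := in_puncture h
    have hd := (h1.not_digon h2 h3).2
    have := h1.2.1
    obtain ⟨r, hr⟩ := exists_wind (pathData K σ E) h3 hd (isSpoke_add.2 h2) (by omega)
    have hr' := hr.lift hD h3
    have H := LArr.B2 x y t h1 h2 h3
    rw [deriv_wind h1 h2 h3 ha hb h hr, map_sub, map_mul,
        ArrowData.lift_ar hD H.rotate.corner,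
        ArrowData.lift_ar hD H.rotate.rotate.corner, sub_eq_zero]
    rw [ha, hb] at hS
    exact hR.wind h1 h2 h3 hS hr'

end Derivative

end

section
variable {n : ℕ} [hn : Fact (2 ≤ n)] {K : Type*} [Field K] {σ : TaggedTriangulation n}
  {E : Set (ZMod n)} {B B' : Type*} [Ring B] [Algebra K B] [Ring B'] [Algebra K B']

variable {k : ZMod n} {J : Option (ZMod n)} {a b : Edge n} {g : B} {D : ArrowData n B}

/-! ### The universal property of the Jacobian algebras -/

lemma pathData_lawful : (pathData K σ E).Lawful σ E where
  idem a ha := by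
    rw [pathData_ide_of_mem ha, ofPath_mul_ofPath]
    rfl
  orth a ha b hb h := by
    rw [pathData_ide_of_mem ha, pathData_ide_of_mem hb, ofPath_mul_ofPath_of_ne]
    exact fun e => h (congrArg Subtype.val e)
  one := by
    rw [one_def, ← Finset.sum_coe_sort]
    exact Finset.sum_congr rfl fun a _ => pathData_ide (E := E) a
  ide_ar {J a b} h := by
    rw [pathData_ide_of_mem h.mem.1, pathData_ar_of_corner h, ofPath_mul_ofPath, Path.nil_comp]
  ar_ide {J a b} h := by
    rw [pathData_ide_of_mem h.mem.2, pathData_ar_of_corner h, ofPath_mul_ofPath, Path.comp_nil]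
  ide_ex k hk := by
    rw [pathData_ide_of_mem (σ.side_mem _), pathData_ex hk]
    exact ofPath_mul_ofPath _ _
  ex_ide k hk := by
    rw [pathData_ide_of_mem (σ.side_mem _), pathData_ex hk]
    exact ofPath_mul_ofPath _ _

lemma ArrowData.Lawful.map {D : ArrowData n B'} (hD : D.Lawful σ E) (f : B' →ₐ[K] B) :
    (D.map f).Lawful σ E where
  idem a ha := by simp only [ArrowData.map, ← map_mul, hD.idem a ha]
  orth a ha b hb h := by simp only [ArrowData.map, ← map_mul, hD.orth a ha b hb h, map_zero]
  one := by simp only [ArrowData.map, ← map_sum, hD.one, map_one]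
  ide_ar h := by simp only [ArrowData.map, ← map_mul, hD.ide_ar h]
  ar_ide h := by simp only [ArrowData.map, ← map_mul, hD.ar_ide h]
  ide_ex k hk := by simp only [ArrowData.map, ← map_mul, hD.ide_ex k hk]
  ex_ide k hk := by simp only [ArrowData.map, ← map_mul, hD.ex_ide k hk]

lemma ArrowData.Lawful.mono (hD : D.Lawful σ E) {E' : Set (ZMod n)}
    (h : E' ⊆ E) : D.Lawful σ E' where
  idem := hD.idem
  orth := hD.orth
  one := hD.one
  ide_ar := hD.ide_ar
  ar_ide := hD.ar_ide
  ide_ex k hk := hD.ide_ex k (h hk)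
  ex_ide k hk := hD.ex_ide k (h hk)

lemma ArrowData.Relations.mono
    {S S' : Option (ZMod n) → Edge n → Edge n → Prop} (hR : D.Relations σ S)
    (h : ∀ J a b, S' J a b → S J a b) : D.Relations σ S' where
  fan h1 hS := hR.fan h1 (h _ _ _ hS)
  digon h1 h2 h3 hS := hR.digon h1 h2 h3 (h _ _ _ hS)
  invisible h1 hS := hR.invisible h1 (h _ _ _ hS)
  wind h1 h2 h3 hS := hR.wind h1 h2 h3 (h _ _ _ hS)

section Jacobian
variable {T : Set (Total (QVert σ E))} {S : Option (ZMod n) → Edge n → Edge n → Prop}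

variable (S T) in
/-- `T` is the set of internal arrows `a → b` with joint vertex `J` such that `S J a b`; the external
cycles at their joint vertices belong to the potential. -/
structure Describes : Prop where
  mem_iff : ∀ {J} {a b : QVert σ E} (h : Corner σ J a.1 b.1),
    (⟨a, b, intArrow J h⟩ : Total (QVert σ E)) ∈ T ↔ S J a.1 b.1
  int : ∀ α ∈ T, ∃ J, IsInternalAt J α
  mem_ext : ∀ {k a b}, Corner σ (some k) a b → S (some k) a b → k ∈ E

variable (K T) in
/-- The classes of the trivial paths and of the arrows in a Jacobian algebra. -/
def jacData : ArrowData n (JacobianAlgebra (potential σ E K) T) :=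
  (pathData K σ E).map (RingQuot.mkAlgHom K (JacobianRel (potential σ E K) T))

lemma jacData_lawful : (jacData K T).Lawful σ E := pathData_lawful.map _

lemma Describes.relations (hT : Describes T S) : (jacData K T).Relations σ S :=
  relations_of_hom hT.mem_ext fun h hS => mk_cyclicDeriv ((hT.mem_iff h).2 hS)

/-- The morphism from a Jacobian algebra defined by `D`. -/
def Describes.lift (hT : Describes T S) {D : ArrowData n B} (hD : D.Lawful σ E)
    (hR : D.Relations σ S) : JacobianAlgebra (potential σ E K) T →ₐ[K] B :=
  jacLift (D.lift K hD) (by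
    rintro ⟨a, b, α⟩ hα
    obtain ⟨J, h, rfl⟩ : ∃ J, ∃ h : Corner σ J a.1 b.1, α = intArrow J h := hT.int _ hα
    exact hR.deriv hD hT.mem_ext h ((hT.mem_iff h).1 hα))

lemma Describes.lift_mk (hT : Describes T S) (hD : D.Lawful σ E)
    (hR : D.Relations σ S) (x : PathAlgebra K (QVert σ E)) :
    hT.lift hD hR (RingQuot.mkAlgHom K (JacobianRel (potential σ E K) T) x) = D.lift K hD x := by
  simp [Describes.lift, jacLift]

lemma Describes.lift_ide (hT : Describes T S) (hD : D.Lawful σ E) (hR : D.Relations σ S) (ha : a ∈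
    σ.edges) : hT.lift hD hR ((jacData K T).ide a) = D.ide a :=
  (hT.lift_mk hD hR _).trans (ArrowData.lift_ide hD ha)

lemma Describes.lift_ar (hT : Describes T S) (hD : D.Lawful σ E) (hR : D.Relations σ S) (h :
    Corner σ J a b) : hT.lift hD hR ((jacData K T).ar J a b) = D.ar J a b :=
  (hT.lift_mk hD hR _).trans (ArrowData.lift_ar hD h)

lemma Describes.lift_ex (hT : Describes T S) (hD : D.Lawful σ E) (hR : D.Relations σ S) (hk : k ∈
    E) : hT.lift hD hR ((jacData K T).ex k) = D.ex k :=
  (hT.lift_mk hD hR _).trans (ArrowData.lift_ex hD hk)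

lemma jacData_ide (a : QVert σ E) : (jacData K T).ide a.1 =
    pathClass (potential σ E K) T (Path.nil : Path a a) :=
  congrArg _ (pathData_ide a)

lemma jacData_ar {a b : QVert σ E} (h : Corner σ J a.1 b.1) : (jacData K T).ar J a.1 b.1 =
    pathClass (potential σ E K) T (intArrow J h : a ⟶ b).toPath :=
  congrArg _ (pathData_ar h)

lemma jacData_ex (h : k ∈ E) : (jacData K T).ex k =
    pathClass (potential σ E K) T (extArrow (σ := σ) h).toPath :=
  congrArg _ (pathData_ex h)

lemma arrow_cases {a b : QVert σ E} (α : a ⟶ b) : (∃ J, ∃ h : Corner σ J a.1 b.1, α = intArrow J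
    h) ∨ (∃ k, ∃ hk : k ∈ E, ∃ (ha : a.1 = side (k - 1)) (hb : b.1 = side k), α = Arrow.external k
    hk ha hb) := by
  change Arrow σ E a b at α
  rcases α with ⟨J, h⟩ | ⟨k, hk, ha, hb⟩
  · exact .inl ⟨J, h, rfl⟩
  · exact .inr ⟨k, hk, ha, hb, rfl⟩

lemma pathClass_external {a b : QVert σ E} (hk : k ∈ E) (ha : a.1 = side (k - 1)) (hb : b.1 = side
    k) : pathClass (potential σ E K) T (Quiver.Hom.toPath (Arrow.external k hk ha hb : a ⟶ b)) =
    (jacData K T).ex k := by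
  obtain rfl : a = sideV σ E (k - 1) := Subtype.ext ha
  obtain rfl : b = sideV σ E k := Subtype.ext hb
  exact (jacData_ex hk).symm

/-- Induction principle for the classes of paths. -/
lemma pathClass_induction {a : QVert σ E} {P : Edge n → JacobianAlgebra (potential σ E K) T →
    Prop} (nil : P a.1 ((jacData K T).ide a.1)) (ar : ∀ {J b c g}, Corner σ J b c → P b g → P c (g *
    (jacData K T).ar J b c)) (ex : ∀ {k g}, k ∈ E → P (side (k - 1)) g → P (side k) (g * (jacData K
    T).ex k)) {b : QVert σ E} (p : Path a b) : P b.1 (pathClass (potential σ E K) T p) := by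
  induction p with
  | nil => rw [← jacData_ide]; exact nil
  | @cons b c p α ih =>
    rw [pathClass_cons]
    obtain ⟨J, h, rfl⟩ | ⟨k, hk, hb, hc, rfl⟩ := arrow_cases α
    · rw [← jacData_ar]
      exact ar h ih
    · rw [pathClass_external, hc]
      rw [hb] at ih
      exact ex hk ih

/-- Two morphisms from a Jacobian algebra with the same values on the vertices and on the arrows are
equal. -/
lemma jac_hom_ext {f g : JacobianAlgebra (potential σ E K) T →ₐ[K] B}
    (h1 : ∀ a ∈ σ.edges, f ((jacData K T).ide a) = g ((jacData K T).ide a))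
    (h2 : ∀ {J a b}, Corner σ J a b → f ((jacData K T).ar J a b) = g ((jacData K T).ar J a b))
    (h3 : ∀ k ∈ E, f ((jacData K T).ex k) = g ((jacData K T).ex k)) : f = g := by
  have : f.toLinearMap = g.toLinearMap := by
    refine LinearMap.ext_on span_pathClass ?_
    rintro _ ⟨a, b, p, rfl⟩
    refine pathClass_induction (P := fun _ x => f x = g x) (h1 _ a.2) ?_ ?_ p
    all_goals grind
  exact AlgHom.toLinearMap_injective this

end Jacobian

/-! ### Removing the external arrows at the vertices without arcs -/

lemma describes_internal :
    Describes (internalArrows σ Set.univ) (fun _ _ _ => True) where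
  mem_iff h := iff_of_true ⟨_, h, rfl⟩ trivial
  int _ h := h
  mem_ext _ _ := Set.mem_univ _

lemma not_isArc_side (k : ZMod n) : ¬ IsArc (side k) := fun h => h.2 rfl

lemma eq_side_of_incident (ha : IsSide a) (hk : Incident k a) :
    a = side k ∨ a = side (k - 1) := by
  obtain ⟨j, rfl⟩ := ha
  rcases hk with rfl | rfl
  · exact .inl rfl
  · right
    simp [side, snd]

/-- A vertex with an internal arrow between two sides has no incident arc. -/
lemma side_corner (h : Corner σ (some k) a b) (ha : IsSide a)
    (hb : IsSide b) : a = side k ∧ b = side (k - 1) ∧ k ∉ arcVertices σ := by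
  obtain ⟨i, J₁, J₂, c, h'⟩ := corner_iff.1 h
  have h1 := h'.meas_eq
  obtain ⟨κ, -, -, rfl⟩ := exists_lift k 0
  have m1 := meas_fst (isChord_side (σ := σ) κ)
  have m2 := meas_snd (isChord_side (σ := σ) (κ - 1))
  rw [sub_add_cancel] at m2
  rw [← side_int] at m1
  rw [← side_int_pred] at m2
  have hn2 := two_le_int (n := n)
  obtain ⟨rfl, rfl⟩ : a = side κ ∧ b = side ((κ : ZMod n) - 1) := by
    rcases eq_side_of_incident ha h'.incident.1 with rfl | rfl <;>
    rcases eq_side_of_incident hb h'.incident.2 with rfl | rfl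
    · omega
    · exact ⟨rfl, rfl⟩
    · omega
    · omega
  refine ⟨rfl, rfl, ?_⟩
  rintro ⟨e, he, hea, hek⟩
  obtain ⟨e, he, hea, hek, hv⟩ : ∃ e ∈ σ.edges, IsArc e ∧ Incident κ e ∧ Visible σ e := by
    by_cases hv : Visible σ e
    · exact ⟨e, he, hea, hek, hv⟩
    · obtain ⟨j, rfl, hj⟩ := not_not.1 hv
      exact ⟨_, hj, trivial, hek, visible_plain _⟩
  obtain ⟨p, hp⟩ := exists_fanPart_from_side κ (vtx Set.univ he) hv hek
  obtain ⟨q, hq⟩ := exists_fanPart_to_side κ (vtx Set.univ he) hv hek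
  have hω : FanPart κ (Path.nil.cons
      (intArrow pt(κ) h : sideV σ Set.univ (κ : ZMod n) ⟶ sideV σ _ ((κ : ZMod n) - 1))) :=
    fanPart_cons.2 ⟨fanPart_nil _ _, ⟨_, rfl⟩, visible_sideV _, visible_sideV _⟩
  have e1 := congrArg Path.length ((fanPart_comp.2 ⟨hp, hq⟩).unique hω)
  rw [Path.length_comp, Path.length_cons, Path.length_nil] at e1
  rcases Nat.eq_zero_or_pos p.length with e2 | e2
  · have := congrArg (fun v : QVert σ Set.univ => v.1) (Path.eq_of_length_zero p e2)
    exact not_isArc_side _ ((show side _ = e from this) ▸ hea)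
  · have := congrArg (fun v : QVert σ Set.univ => v.1) (Path.eq_of_length_zero q (by omega))
    exact not_isArc_side _ ((show e = side _ from this) ▸ hea)

lemma mem_arcVertices_of_corner (h : Corner σ (some k) a b)
    (hS : ¬ IsSide a ∨ ¬ IsSide b) : k ∈ arcVertices σ := by
  obtain ⟨_, _, _, _, h'⟩ := corner_iff.1 h
  rcases hS with hS | hS
  · exact ⟨a, h.mem.1, (σ.side_or_arc _ h.mem.1).resolve_left hS, h'.incident.1⟩
  · exact ⟨b, h.mem.2, (σ.side_or_arc _ h.mem.2).resolve_left hS, h'.incident.2⟩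

/-- The condition on the arrows with respect to which the potential of `Γ_σ` is differentiated. -/
def Unfrozen (_J : Option (ZMod n)) (a b : Edge n) : Prop := ¬ IsSide a ∨ ¬ IsSide b

lemma describes_unfrozen :
    Describes (unfrozenArrows (frozen σ (arcVertices σ))) (Unfrozen (n := n)) where
  mem_iff h := Iff.rfl
  int := by
    rintro ⟨a, b, α⟩ h
    obtain ⟨J, hc, rfl⟩ | ⟨k, hk, ha, hb, rfl⟩ := arrow_cases α
    · exact ⟨J, hc, rfl⟩
    · rcases h with h | h
      · exact absurd ⟨_, ha⟩ h
      · exact absurd ⟨_, hb⟩ h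
  mem_ext := mem_arcVertices_of_corner

lemma exists_ear (hk : k ∉ arcVertices σ) :
    ∃ i J₁ J₂ c, LArr σ i (some k) J₁ J₂ (side k) (side (k - 1)) c := by
  have hne : side k ≠ side (k - 1) := by
    intro h
    injection h with h
    obtain ⟨κ, -, -, rfl⟩ := exists_lift k 0
    have hn2 := two_le_int (n := n)
    have := eq_of_cast_eq (x := κ) (y := κ - 1) (n := n) (by push_cast; exact h)
    omega
  obtain ⟨i, J₁, J₂, b, c, h, -⟩ := out_exists (σ.side_mem k) (visible_chord _ _) (.inl rfl) hne
  have hS : IsSide b := by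
    by_contra hb
    exact hk (mem_arcVertices_of_corner h.corner (.inr hb))
  obtain ⟨-, rfl, -⟩ := side_corner h.corner ⟨k, rfl⟩ hS
  exact ⟨i, J₁, J₂, c, h⟩

/-- If no arc is incident to `P_k`, the sides at `P_k` belong to exactly one triangle or digon; the
path which completes it at `P_k` plays the role of the external arrow. -/
lemma exists_missing (D : ArrowData n B) (hD : D.Lawful σ E) (hk : k ∉ arcVertices σ) : ∃ x : B,
    D.ide (side (k - 1)) * x = x ∧ x * D.ide (side k) = x ∧ (∀ i J₁ J₂ c, LArr σ i (some k) J₁ J₂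
    (side k) (side (k - 1)) c → (∀ k t, IsDigon σ k → c ≠ sp k t) → D.ar J₁ (side (k - 1)) c * D.ar
    J₂ c (side k) = x) ∧ ∀ κ m : ℤ, IsChord σ κ m → IsChord σ m (κ + n) → IsDigon σ κ → (m : ZMod n)
    = k → D.digonSum κ m = x := by
  have hD1 : ∀ κ m : ℤ, IsChord σ κ m → IsChord σ m (κ + n) → IsDigon σ κ → (m : ZMod n) = k →
      side k = ch m κ ∧ side (k - 1) = ch κ m := by
    rintro κ m h1 h2 h3 rfl
    have h := (LArr.D1 κ m .plain h1 h2 h3).corner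
    have hS : ¬ Unfrozen pt(m) (ch m κ : Edge n) (ch κ m) := fun hS =>
      hk (mem_arcVertices_of_corner h hS)
    rw [Unfrozen, not_or, not_not, not_not] at hS
    obtain ⟨e1, e2, -⟩ := side_corner h hS.1 hS.2
    exact ⟨e1.symm, e2.symm⟩
  obtain ⟨i, J₁, J₂, c, h⟩ := exists_ear hk
  by_cases hc : ∀ k t, IsDigon σ k → c ≠ sp k t
  · refine ⟨D.ar J₁ (side (k - 1)) c * D.ar J₂ c (side k), ?_, ?_, ?_, ?_⟩
    · rw [← mul_assoc, hD.ide_ar h.rotate.corner]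
    · rw [mul_assoc, hD.ar_ide h.rotate.rotate.corner]
    · intro i' J₁' J₂' c' h' hc'
      obtain ⟨-, rfl, rfl, rfl | ⟨k', t, t', h1, rfl, -⟩⟩ := h.third_unique h'
      · rfl
      · exact absurd rfl (hc k' t h1)
    · intro κ m h1 h2 h3 hm
      obtain ⟨e1, e2⟩ := hD1 κ m h1 h2 h3 hm
      have h' := LArr.D1 κ m .plain h1 h2 h3
      rw [← e1, ← e2, hm] at h'
      obtain ⟨-, -, -, rfl | ⟨k', t, t', h4, rfl, -⟩⟩ := h.third_unique h'
      · exact absurd rfl (hc κ _ h3)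
      · exact absurd rfl (hc k' t h4)
  · push Not at hc
    obtain ⟨k', t, hk', hc⟩ := hc
    obtain ⟨κ, m, h1, h2, h3, e1, e2, e3⟩ := h.third_digon hk' hc
    have H := fun t => LArr.D1 κ m t h1 h2 h3
    refine ⟨D.digonSum κ m, ?_, ?_, ?_, ?_⟩
    · rw [e3, mul_add, ← mul_assoc, ← mul_assoc, hD.ide_ar (H _).rotate.corner,
        hD.ide_ar (H _).rotate.corner]
    · rw [e2, add_mul, mul_assoc, mul_assoc, hD.ar_ide (H _).rotate.rotate.corner,
        hD.ar_ide (H _).rotate.rotate.corner]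
    · intro i' J₁' J₂' c' h' hc'
      obtain ⟨-, rfl, rfl, rfl | ⟨k', t, t', h1, -, rfl⟩⟩ := h.third_unique h'
      · exact absurd hc (hc' k' t hk')
      · exact absurd rfl (hc' k' t' h1)
    · grind

open Classical in
/-- In `D`, the missing external arrows are replaced by the paths completing the corresponding
corners to triangles. -/
def ArrowData.complete (D : ArrowData n B) (hD : D.Lawful σ E) : ArrowData n B where
  ide := D.ide
  ar := D.ar
  ex k := if hk : k ∈ arcVertices σ then D.ex k else (exists_missing D hD hk).choose

lemma Fan.of_complete {hD : D.Lawful σ E}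
    (h : Fan σ (D.complete hD) k a b g) : Fan σ D k a b g := by
  induction h with
  | nil => exact .nil
  | cons hg h hb hc ih => exact .cons ih h hb hc

lemma Wind.of_complete {hD : D.Lawful σ E} {t : Tag} {x y : ℤ}
    (h : Wind σ (D.complete hD) t x y g) : Wind σ D t x y g := by
  induction h with
  | nil => exact .nil
  | cons hg h hb hc ih => exact .cons ih h hb hc

lemma complete_lawful (hD : D.Lawful σ (arcVertices σ)) :
    (D.complete hD).Lawful σ Set.univ where
  idem := hD.idem
  orth := hD.orth
  one := hD.one
  ide_ar := hD.ide_ar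
  ar_ide := hD.ar_ide
  ide_ex k _ := by
    simp only [ArrowData.complete]
    split_ifs with hk
    · exact hD.ide_ex k hk
    · exact (exists_missing D hD hk).choose_spec.1
  ex_ide k _ := by
    simp only [ArrowData.complete]
    split_ifs with hk
    · exact hD.ex_ide k hk
    · exact (exists_missing D hD hk).choose_spec.2.1

lemma complete_relations (hD : D.Lawful σ (arcVertices σ)) (hR : D.Relations σ Unfrozen) :
    (D.complete hD).Relations σ (fun _ _ _ => True) where
  fan := by
    intro i k J₁ J₂ a b c p q h _ ha hb hc hp hq
    have hp := hp.of_complete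
    have hq := hq.of_complete
    by_cases hS : Unfrozen (some k) a b
    · have hk := mem_arcVertices_of_corner h.corner hS
      simp only [ArrowData.complete, dif_pos hk]
      exact hR.fan h hS ha hb hc hp hq
    · rw [Unfrozen, not_or, not_not, not_not] at hS
      obtain ⟨rfl, rfl, hk⟩ := side_corner h.corner hS.1 hS.2
      obtain rfl := hp.unique .nil
      obtain rfl := hq.unique .nil
      simp only [ArrowData.complete, dif_neg hk]
      grind
  digon := by
    intro k m p q h1 h2 h3 _ hp hq
    have hp := hp.of_complete
    have hq := hq.of_complete
    have h := LArr.D1 k m .plain h1 h2 h3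
    by_cases hS : Unfrozen pt(m) (ch m k : Edge n) (ch k m)
    · have hk := mem_arcVertices_of_corner h.corner hS
      simp only [ArrowData.complete, dif_pos hk]
      exact hR.digon h1 h2 h3 hS hp hq
    · rw [Unfrozen, not_or, not_not, not_not] at hS
      obtain ⟨ha, hb, hk⟩ := side_corner h.corner hS.1 hS.2
      rw [ha] at hp
      rw [hb] at hq
      obtain rfl := hp.unique .nil
      obtain rfl := hq.unique .nil
      simp only [ArrowData.complete, dif_neg hk]
      grind
  invisible := by
    intro i k J₁ J₂ a b c h _ hv
    refine hR.invisible h ?_ hv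
    by_contra hS
    rw [Unfrozen, not_or, not_not, not_not] at hS
    obtain ⟨⟨_, rfl⟩, ⟨_, rfl⟩⟩ := hS
    exact hv ⟨visible_chord _ _, visible_chord _ _⟩
  wind := by
    intro t x y r h1 h2 h3 _ hr
    refine hR.wind h1 h2 h3 (.inl ?_) hr.of_complete
    rintro ⟨_, h⟩
    cases h

section Iota

variable (K σ)

/-- The classes of the arrows in `Γ_σ`. -/
def gammaData : ArrowData n (Gamma K σ) := jacData K (unfrozenArrows (frozen σ (arcVertices σ)))

/-- The classes of the arrows in the realisation of `Γ_σ` with all the external arrows. -/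
def gammaData' : ArrowData n (Gamma' K σ) := jacData K (internalArrows σ Set.univ)

variable {K σ}

lemma gammaData_lawful : (gammaData K σ).Lawful σ (arcVertices σ) := jacData_lawful

lemma gammaData'_lawful : (gammaData' K σ).Lawful σ Set.univ := jacData_lawful

lemma gammaData_relations : (gammaData K σ).Relations σ Unfrozen := describes_unfrozen.relations

lemma gammaData'_relations : (gammaData' K σ).Relations σ (fun _ _ _ => True) :=
  describes_internal.relations

lemma missing_eq (hk : k ∉ arcVertices σ) {hD : D.Lawful σ (arcVertices σ)} {D' : ArrowData n B'}
    (hD' : D'.Lawful σ Set.univ) (hR : D'.Relations σ (fun _ _ _ => True)) {f : B →ₐ[K] B'} (hf : ∀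
    {J a b}, Corner σ J a b → f (D.ar J a b) = D'.ar J a b) : f ((D.complete hD).ex k) = D'.ex k
    := by
  have H := (exists_missing D hD hk).choose_spec
  simp only [ArrowData.complete, dif_neg hk]
  have hex : D'.ide (side (k - 1)) * D'.ex k * D'.ide (side k) = D'.ex k := by
    rw [hD'.ide_ex k trivial, hD'.ex_ide k trivial]
  rw [← hex]
  obtain ⟨i, J₁, J₂, c, h⟩ := exists_ear hk
  by_cases hc : ∀ k t, IsDigon σ k → c ≠ sp k t
  · rw [← H.2.2.1 _ _ _ _ h hc, map_mul, hf h.rotate.corner, hf h.rotate.rotate.corner]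
    exact hR.fan h trivial (visible_chord _ _) (visible_chord _ _) hc .nil .nil
  · push Not at hc
    obtain ⟨k', t, hk', hc⟩ := hc
    obtain ⟨κ, m, h1, h2, h3, e1, e2, e3⟩ := h.third_digon hk' hc
    injection e1 with e1
    subst e1
    have G := fun t => LArr.D1 κ m t h1 h2 h3
    rw [← H.2.2.2 _ _ h1 h2 h3 rfl, map_add, map_mul, map_mul, hf (G _).rotate.corner,
      hf (G _).rotate.rotate.corner, hf (G _).rotate.corner, hf (G _).rotate.rotate.corner]
    refine hR.digon h1 h2 h3 trivial ?_ ?_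
    · rw [← e2]; exact .nil
    · rw [← e3]; exact .nil

variable (K σ) in
/-- The canonical identification of `Γ_σ` with the quotient of the path algebra of `Q'_σ`. -/
def iota : Gamma K σ ≃ₐ[K] Gamma' K σ :=
  AlgEquiv.ofAlgHom
    (describes_unfrozen.lift (gammaData'_lawful.mono (Set.subset_univ _))
      (gammaData'_relations.mono fun _ _ _ _ => trivial))
    (describes_internal.lift (complete_lawful gammaData_lawful)
      (complete_relations gammaData_lawful gammaData_relations))
    (jac_hom_ext
      (fun a ha => (congrArg _ (Describes.lift_ide _ _ _ ha)).trans (Describes.lift_ide _ _ _ ha))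
      (fun h => (congrArg _ (Describes.lift_ar _ _ _ h)).trans (Describes.lift_ar _ _ _ h))
      (fun k _ => by
        rw [AlgHom.comp_apply, Describes.lift_ex _ _ _ (Set.mem_univ k)]
        by_cases hk : k ∈ arcVertices σ
        · simp only [ArrowData.complete, dif_pos hk]
          exact Describes.lift_ex _ _ _ hk
        · exact missing_eq hk gammaData'_lawful gammaData'_relations
            fun h => Describes.lift_ar _ _ _ h))
    (jac_hom_ext
      (fun a ha => (congrArg _ (Describes.lift_ide _ _ _ ha)).trans (Describes.lift_ide _ _ _ ha))
      (fun h => (congrArg _ (Describes.lift_ar _ _ _ h)).trans (Describes.lift_ar _ _ _ h))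
      (fun k hk => by
        rw [AlgHom.comp_apply, Describes.lift_ex _ _ _ hk]
        refine (Describes.lift_ex _ _ _ (Set.mem_univ k)).trans ?_
        simp only [ArrowData.complete, dif_pos hk]
        rfl))

lemma iota_idem (a : Q σ) :
    iota K σ (idem K a) = cls' K (Path.nil : Path (full a) (full a)) := by
  rw [idem, cls, ← jacData_ide]
  exact (Describes.lift_ide _ _ _ a.2).trans (jacData_ide (full a))

lemma iota_arrow {a b : Q σ} (α : a ⟶ b) :
    iota K σ (cls K α.toPath) = cls' K (fullArrow α).toPath := by
  obtain ⟨J, h, rfl⟩ | ⟨k, hk, hb, hc, rfl⟩ := arrow_cases α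
  · rw [cls, ← jacData_ar]
    exact (Describes.lift_ar _ _ _ h).trans (jacData_ar (a := full a) (b := full b) h)
  · rw [cls, pathClass_external]
    refine (Describes.lift_ex _ _ _ hk).trans ?_
    exact (pathClass_external (a := full a) (b := full b) _ hb hc).symm

end Iota

end

section
variable {n : ℕ} [hn : Fact (2 ≤ n)] {σ : TaggedTriangulation n}

variable {X Y x y z : ℤ}

/-! ### Lifts of the visible edges to the universal cover -/

variable (σ) in
open Classical in
/-- The tag of the visible arcs to the puncture. -/
def mainTag : Tag := if HasPlain σ then .plain else .notched

variable (σ) in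
/-- The visible edge with a given lift `(x, y)`, where `x < y ≤ x + n`; the lifts with `y = x + n` are
those of the arcs to the puncture. -/
def ed (x y : ℤ) : Edge n := if y = x + n then sp x (mainTag σ) else ch x y

lemma ed_spoke (x : ℤ) : ed σ x (x + n) = sp x (mainTag σ) := if_pos rfl

lemma ed_chord (h : y ≠ x + n) : ed σ x y = ch x y := if_neg h

@[simp] lemma ed_add (x y : ℤ) : ed σ (x + n) (y + n) = ed σ x y := by
  simp [ed, sp, ch]

@[simp] lemma ed_sub (x y : ℤ) : ed σ (x - n) (y - n) = ed σ x y := by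
  rw [← ed_add, sub_add_cancel, sub_add_cancel]

lemma IsChord.ed {x y : ℤ} (h : IsChord σ x y) : ed σ x y = ch x y := ed_chord h.2.1.ne

lemma visible_main (x : ℤ) : Visible σ (sp x (mainTag σ)) := by
  rintro ⟨k, h, hk⟩
  injection h with h1 h2
  rw [mainTag, if_pos ⟨k, hk⟩] at h2
  cases h2

lemma IsDigon.mainTag (h : IsDigon σ x) : mainTag σ = .plain := if_pos ⟨_, h.1⟩

lemma tag_eq_of_visible {t : Tag} (h : IsSpoke σ t x) (hv : Visible σ (sp x t)) :
    t = mainTag σ := by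
  by_cases hp : HasPlain σ
  · rw [mainTag, if_pos hp]
    obtain ⟨k, hk⟩ := hp
    cases t
    · rfl
    · obtain ⟨y, -, -, rfl⟩ := exists_lift k 0
      have := h.cast_eq (t' := .plain) (y := y) hk (by simp)
      exact (hv ⟨y, by rw [sp, this], hk⟩).elim
  · rw [mainTag, if_neg hp]
    cases t
    · exact (hp ⟨_, h⟩).elim
    · rfl

lemma visible_ed (x y : ℤ) : Visible σ (ed σ x y) := by
  rw [ed]
  split_ifs
  · exact visible_main x
  · exact visible_chord _ _

variable (σ) in
/-- `(x, y)` is the lift of a visible edge. -/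
def V (x y : ℤ) : Prop := x < y ∧ y ≤ x + n ∧ ed σ x y ∈ σ.edges

lemma IsChord.V (h : IsChord σ x y) : V σ x y :=
  ⟨h.1, h.2.1.le, by rw [h.ed]; exact h.mem⟩

lemma V.chord (h : V σ x y) (hne : y ≠ x + n) : IsChord σ x y :=
  ⟨h.1, lt_of_le_of_ne h.2.1 hne, by have := h.2.2; rwa [ed_chord hne] at this⟩

lemma V.spoke (h : V σ x (x + n)) : IsSpoke σ (mainTag σ) x := by
  have := h.2.2
  rwa [ed_spoke] at this

lemma IsSpoke.V (h : IsSpoke σ (mainTag σ) x) : V σ x (x + n) := by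
  have := two_le_int (n := n)
  exact ⟨by omega, le_rfl, by rw [ed_spoke]; exact h⟩

lemma V.add (h : V σ x y) : V σ (x + n) (y + n) := by
  refine ⟨by linarith [h.1], by linarith [h.2.1], ?_⟩
  rw [ed_add]; exact h.2.2

lemma V.sub (h : V σ x y) : V σ (x - n) (y - n) := by
  refine ⟨by linarith [h.1], by linarith [h.2.1], ?_⟩
  rw [ed_sub]; exact h.2.2

/-- Two lifts cross only if both are lifts of arcs to the puncture. -/
lemma V.cross {p q : ℤ} (h : V σ x y) (h' : V σ p q) (h1 : x < p) (h2 : p < y) (h3 : y < q) :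
    y = x + n ∧ q = p + n := by
  by_cases hy : y = x + n
  · refine ⟨hy, ?_⟩
    by_contra hq
    subst hy
    exact (isSpoke_add.2 h.spoke).not_cross (h'.chord hq) ⟨by omega, by omega⟩
  · by_cases hq : q = p + n
    · subst hq
      exact (h'.spoke.not_cross (h.chord hy) ⟨h1, h2⟩).elim
    · exact ((h.chord hy).not_cross (h'.chord hq) ⟨h1, h2, h3⟩).elim

variable (σ) in
/-- The triangles formed by visible edges, where the vertex of a once-punctured digon `(P_x, P_y)`
containing both arcs from `P_x` to the puncture is seen as a triangle with vertices `x`, `y` and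
`x + n`. -/
structure Tri (x y z : ℤ) : Prop where
  xy : V σ x y
  yz : V σ y z
  xz : V σ x z
  digon : z = x + n → IsDigon σ x

lemma Tri.add (h : Tri σ x y z) : Tri σ (x + n) (y + n) (z + n) :=
  ⟨h.xy.add, h.yz.add, h.xz.add, fun e => (h.digon (by omega)).add⟩

lemma IsChord.tri {z : ℤ} (h : IsChord σ x y) (h' : IsChord σ y z) (h'' : IsChord σ x z) :
    Tri σ x y z := ⟨h.V, h'.V, h''.V, fun e => absurd e h''.2.1.ne⟩

lemma IsDigon.tri (h : IsDigon σ x) (h1 : IsChord σ x y) (h2 : IsChord σ y (x + n)) :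
    Tri σ x y (x + n) := ⟨h1.V, h2.V, IsSpoke.V (h.mainTag ▸ h.1), fun _ => h⟩

lemma ch_add_n (x y : ℤ) : (ch x (y + n) : Edge n) = ch x y := by simp [ch]

lemma Tri.sub (h : Tri σ x y z) : Tri σ (x - n) (y - n) (z - n) :=
  ⟨h.xy.sub, h.yz.sub, h.xz.sub, fun e => (h.digon (by omega)).sub⟩

variable (σ) in
/-- The lifts of the triangles with a vertex at the puncture. -/
structure PTri (x y : ℤ) : Prop where
  xy : IsChord σ x y
  x_spoke : IsSpoke σ (mainTag σ) x
  y_spoke : IsSpoke σ (mainTag σ) y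

lemma PTri.add (h : PTri σ x y) : PTri σ (x + n) (y + n) :=
  ⟨isChord_add.2 h.xy, isSpoke_add.2 h.x_spoke, isSpoke_add.2 h.y_spoke⟩

lemma PTri.sub (h : PTri σ x y) : PTri σ (x - n) (y - n) :=
  ⟨isChord_sub.2 h.xy, isSpoke_sub.2 h.x_spoke, isSpoke_sub.2 h.y_spoke⟩

lemma Tri.lt (h : Tri σ x y z) : x < y ∧ y < z ∧ z ≤ x + n :=
  ⟨h.xy.1, h.yz.1, h.xz.2.1⟩

lemma Tri.chord₁ (h : Tri σ x y z) : IsChord σ x y :=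
  h.xy.chord (by have := h.lt; omega)

lemma Tri.chord₂ (h : Tri σ x y z) : IsChord σ y z :=
  h.yz.chord (by have := h.lt; omega)

lemma Tri.larr (h : Tri σ x y z) : ∃ i, LArr σ i pt(x) pt(z) pt(y
   ) (ed σ x y) (ed σ x z) (ed σ y z) := by
  have h1 := h.chord₁
  have h2 := h.chord₂
  rw [h1.ed, h2.ed]
  by_cases hz : z = x + n
  · have hd := h.digon hz
    subst hz
    have := LArr.D2 x y .plain h1 h2 hd
    refine ⟨1, ?_⟩
    rw [ed_spoke, hd.mainTag]
    simpa [ch] using this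
  · have := h.xz.chord hz
    rw [this.ed]
    exact ⟨0, .A1 _ _ _ h1 h2 this⟩

lemma PTri.larr (h : PTri σ x y) : LArr σ 0 pt(x) none pt(y) (ed σ x
    y) (ed σ x (x + n)) (ed σ y (y + n)) := by
  rw [h.xy.ed, ed_spoke, ed_spoke]
  exact .B1 _ _ _ h.xy h.x_spoke h.y_spoke

lemma V.exists_right (h : V σ X Y) (hne : Y ≠ X + n) (h1 : Y ≠ X + 1) : ∃ u, Tri σ X u Y := by
  have H := h.chord hne
  obtain ⟨u, -, -, h2, h3⟩ := H.exists_right (lt_of_le_of_ne H.1 (Ne.symm h1))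
  exact ⟨u, h2.V, h3.V, h, fun e => (hne e).elim⟩

lemma V.exists_left (h : V σ X Y) (hne : Y ≠ X + n) :
    (∃ w, Tri σ w X Y) ∨ (∃ z, Tri σ X Y z) ∨ PTri σ X Y := by
  have H := h.chord hne
  obtain ⟨κ, hκ⟩ := H.exists_leftOpt
  cases κ with
  | right w => exact .inl ⟨w, hκ.1.V, h, hκ.2.V, fun e => (hκ.2.2.1.ne e).elim⟩
  | left z => exact .inr (.inl ⟨z, h, hκ.1.V, hκ.2.V, fun e => (hκ.2.2.1.ne e).elim⟩)
  | spokes t =>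
    obtain rfl := tag_eq_of_visible hκ.1 (visible_of_not_digon hκ.1 (H.not_digon hκ.1 hκ.2).1)
    exact .inr (.inr ⟨H, hκ.1, hκ.2⟩)
  | digon₁ =>
    have hs : IsSpoke σ (mainTag σ) X := by rw [hκ.1.mainTag]; exact hκ.1.1
    exact .inr (.inl ⟨X + n, h, hκ.2.V, hs.V, fun _ => hκ.1⟩)
  | digon₂ =>
    have hs : IsSpoke σ (mainTag σ) (Y - n) := by
      rw [hκ.1.mainTag]; exact isSpoke_sub.2 hκ.1.1
    have := hs.V
    rw [sub_add_cancel] at this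
    exact .inl ⟨Y - n, hκ.2.V, h, this, fun _ => hκ.1.sub⟩

/-- The lift of an arc to the puncture ends a triangle on each side. -/
lemma V.exists_spoke (h : V σ X (X + n)) :
    (∃ m, Tri σ X m (X + n)) ∨ ((∃ u, PTri σ X u) ∧ ∃ v, PTri σ v X) := by
  by_cases hd : IsDigon σ X
  · obtain ⟨m, h1, h2⟩ := hd.exists_chord
    exact .inl ⟨m, h1.V, h2.V, h, fun _ => hd⟩
  · obtain ⟨⟨u, h1, h2⟩, v, h3, h4⟩ := h.spoke.exists_next hd
    exact .inr ⟨⟨u, h1, h.spoke, h2⟩, v, h3, h4, h.spoke⟩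

lemma PTri.not_digon (h : PTri σ x y) : ¬ IsDigon σ x ∧ ¬ IsDigon σ y :=
  h.xy.not_digon h.x_spoke h.y_spoke

lemma Tri.right_unique {u u' : ℤ} (h : Tri σ X u Y) (h' : Tri σ X u' Y) : u = u' :=
  h.chord₁.right_unique h.chord₂ h'.chord₁ h'.chord₂

end

section
variable {n : ℕ} [hn : Fact (2 ≤ n)] {σ : TaggedTriangulation n} {B : Type*} [Ring B]

variable {X X₀ X₁ Y Y₀ Y₁ w x y z : ℤ} {b b' s : Bool} {g g' h h' : B}

/-! ### Visible paths and their lifts -/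

section Def
variable (σ) (D : ArrowData n B)

/-- The arrow at `P_Y` ending at the visible edge with lift `(X, Y)`, where `Y ≠ X + n`: its source
has lift `(X₀, Y₀)`. The arrow is marked `true` if it passes in front of the puncture. -/
inductive Lam (X Y : ℤ) : ℤ → ℤ → Bool → B → Prop
  | right (w : ℤ) (h : Tri σ w X Y) :
      Lam X Y w Y (decide (Y = w + n)) (D.ar pt(Y) (ed σ w Y) (ed σ X Y))
  | left (z : ℤ) (h : Tri σ X Y z) :
      Lam X Y (Y - n) (z - n) true (D.ar pt(Y) (ed σ Y z) (ed σ X Y))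
  | punc (h : PTri σ X Y) :
      Lam X Y (Y - n) Y true (D.ar pt(Y) (ed σ Y (Y + n)) (ed σ X Y))

/-- The arrow at `P_X` ending at the visible edge with lift `(X, Y)`, where `Y ≠ X + n`: its source
has lift `(X₀, Y₀)`. -/
inductive Rho (X Y : ℤ) : ℤ → ℤ → B → Prop
  | tri (u : ℤ) (h : Tri σ X u Y) : Rho X Y X u (D.ar pt(X) (ed σ X u) (ed σ X Y))
  | ext (h : Y = X + 1) : Rho X Y (X - 1) X (D.ex X)

/-- The arrows ending at the visible arc from `P_X` to the puncture. -/
inductive Sig (X : ℤ) : ℤ → ℤ → B → Prop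
  | digon (m : ℤ) (h : Tri σ X m (X + n)) :
      Sig X X m (D.ar pt(X) (ed σ X m) (ed σ X (X + n)))
  | chord (u : ℤ) (h : PTri σ X u) :
      Sig X X u (D.ar pt(X) (ed σ X u) (ed σ X (X + n)))
  | spoke (v : ℤ) (h : PTri σ v X) :
      Sig X v (v + n) (D.ar none (ed σ v (v + n)) (ed σ X (X + n)))

/-- The arrows between visible edges, from `(X₀, Y₀)` to `(X, Y)`; they are marked `true` if they
pass in front of the puncture, or start or end at an arc to the puncture. -/
inductive Step (X₀ Y₀ X Y : ℤ) : Bool → B → Prop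
  | lam {s : Bool} {h : B} (H : Lam σ D X Y X₀ Y₀ s h) : Step X₀ Y₀ X Y s h
  | rho {h : B} (hne : Y ≠ X + n) (H : Rho σ D X Y X₀ Y₀ h) : Step X₀ Y₀ X Y false h
  | sig {h : B} (he : Y = X + n) (H : Sig σ D X X₀ Y₀ h) : Step X₀ Y₀ X Y true h

/-- The visible paths from `(x, y)` to `(X, Y)`, with their values; they are marked `true` if they
contain an arrow marked `true`. -/
inductive Run (x y : ℤ) : ℤ → ℤ → Bool → B → Prop
  | nil (h : V σ x y) : Run x y x y false (D.ide (ed σ x y))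
  | cons {X Y X' Y' : ℤ} {b s : Bool} {g h : B} (hg : Run x y X Y b g)
      (hs : Step σ D X Y X' Y' s h) : Run x y X' Y' (b || s) (g * h)

end Def

variable {D : ArrowData n B}

lemma V.nc {p q : ℤ} (h : V σ x y) (h' : V σ p q) :
    ¬ (x < p ∧ p < y ∧ y < q ∧ (y ≠ x + n ∨ q ≠ p + n)) := by
  rintro ⟨h1, h2, h3, h4⟩
  have := h.cross h' h1 h2 h3
  omega

lemma V.lt (h : V σ x y) : x < y ∧ y ≤ x + n := ⟨h.1, h.2.1⟩

lemma PTri.V (h : PTri σ x y) : V σ x y ∧ V σ x (x + n) ∧ V σ y (y + n) ∧ y < x + n :=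
  ⟨h.xy.V, h.x_spoke.V, h.y_spoke.V, h.xy.2.1⟩

lemma IsDigon.not_between (hx : IsDigon σ x) (hy : V σ y (y + n)) (h1 : x < y := by omega)
    (h2 : y < x + n := by omega) : False := by
  have := eq_of_cast_eq (hx.isSpoke_cast hy.spoke)
  omega

lemma Tri.left_unique {w' : ℤ} (h : Tri σ w X Y) (h' : Tri σ w' X Y) : w = w' := by
  have := h.lt; have := h'.lt
  have := h.xy.nc h'.xz; have := h'.xy.nc h.xz
  have := h.yz.lt
  omega

lemma Tri.left_unique' {z' : ℤ} (h : Tri σ X Y z) (h' : Tri σ X Y z') : z = z' := by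
  have := h.lt; have := h'.lt
  have := h.xz.nc h'.yz; have := h'.xz.nc h.yz
  have := h.yz.lt; have := h'.yz.lt
  omega

lemma Tri.not_left (h : Tri σ w X Y) (h' : Tri σ X Y z) : False := by
  have h1 := h.lt; have h2 := h'.lt
  have h3 := h.xz.cross h'.xz h1.1 h1.2.1 h2.2.1
  obtain ⟨e, rfl⟩ := h3
  exact (h.digon e).not_between h'.xz h1.1

lemma Tri.not_punc (h : Tri σ w X Y) (h' : PTri σ X Y) : False := by
  have h1 := h.lt; have h2 := h'.V
  have h3 := h.xz.cross h2.2.1 h1.1 h1.2.1 h2.2.2.2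
  exact (h.digon h3.1).not_between h2.2.1 h1.1

lemma Tri.not_punc' (h : Tri σ X Y z) (h' : PTri σ X Y) : False := by
  have h1 := h.lt; have h2 := h'.V
  have := h.chord₂.2.1
  have h3 := h.xz.cross h2.2.2.1 h1.1 h1.2.1 (by omega)
  exact (h.digon h3.1).not_between h2.2.2.1 h1.1

lemma Lam.unique {s' : Bool} (H : Lam σ D X Y X₀ Y₀ s h)
    (H' : Lam σ D X Y X₁ Y₁ s' h') : X₁ = X₀ ∧ Y₁ = Y₀ ∧ s' = s ∧ h' = h := by
  cases H with
  | right w t =>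
    cases H' with
    | right w' t' =>
      obtain rfl := t.left_unique t'
      exact ⟨rfl, rfl, rfl, rfl⟩
    | left z t' => exact (t.not_left t').elim
    | punc t' => exact (t.not_punc t').elim
  | left z t =>
    cases H' with
    | right w' t' => exact (t'.not_left t).elim
    | left z t' =>
      obtain rfl := t.left_unique' t'
      exact ⟨rfl, rfl, rfl, rfl⟩
    | punc t' => exact (t.not_punc' t').elim
  | punc t =>
    cases H' with
    | right w' t' => exact (t'.not_punc t).elim
    | left z t' => exact (t'.not_punc' t).elim
    | punc t' => exact ⟨rfl, rfl, rfl, rfl⟩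

lemma Rho.unique (H : Rho σ D X Y X₀ Y₀ h)
    (H' : Rho σ D X Y X₁ Y₁ h') : X₁ = X₀ ∧ Y₁ = Y₀ ∧ h' = h := by
  cases H with
  | tri u t =>
    have := t.lt
    cases H' with
    | tri u' t' =>
      obtain rfl := t.right_unique t'
      exact ⟨rfl, rfl, rfl⟩
    | ext e => omega
  | ext e =>
    cases H' with
    | tri u' t' => have := t'.lt; omega
    | ext e => exact ⟨rfl, rfl, rfl⟩

lemma V.exists_lam (h : V σ X Y) (hne : Y ≠ X + n) : ∃ X₀ Y₀ s g, Lam σ D X Y X₀ Y₀ s g := by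
  rcases h.exists_left hne with ⟨w, t⟩ | ⟨z, t⟩ | t
  · exact ⟨_, _, _, _, .right w t⟩
  · exact ⟨_, _, _, _, .left z t⟩
  · exact ⟨_, _, _, _, .punc t⟩

lemma V.exists_rho (h : V σ X Y) (hne : Y ≠ X + n) : ∃ X₀ Y₀ g, Rho σ D X Y X₀ Y₀ g := by
  by_cases h1 : Y = X + 1
  · exact ⟨_, _, _, .ext h1⟩
  · obtain ⟨u, t⟩ := h.exists_right hne h1
    exact ⟨_, _, _, .tri u t⟩

/-- The numerical properties of an arrow. -/
lemma Step.facts {X₀ Y₀ X Y : ℤ} {s : Bool} {h : B} (H : Step σ D X₀ Y₀ X Y s h) : V σ X₀ Y₀ ∧ V σ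
    X Y ∧ X₀ ≤ X ∧ Y₀ ≤ Y ∧ X₀ + Y₀ < X + Y ∧ (s = true → X₀ + n ≤ Y) ∧ (s = false → Y₀ ≠ X₀ + n ∧ Y
    ≠ X + n) := by
  have hn2 := two_le_int (n := n)
  cases H with
  | lam H =>
    cases H with
    | right w t =>
      have := t.lt
      have := t.chord₂.2.1
      refine ⟨t.xz, t.yz, by omega, by omega, by omega, ?_, ?_⟩
      all_goals grind
    | left z t =>
      have := t.lt
      have := t.chord₁.2.1
      have := t.chord₂.2.1
      exact ⟨t.yz.sub, t.xy, by omega, by omega, by omega, fun _ => by omega, by simp⟩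
    | punc t =>
      have tv := t.V
      have := t.xy.1
      refine ⟨?_, t.xy.V, by omega, by omega, by omega, fun _ => by omega, by simp⟩
      have := tv.2.2.1.sub
      rwa [add_sub_cancel_right] at this
  | rho hne H =>
    cases H with
    | tri u t =>
      have := t.lt
      exact ⟨t.xy, t.xz, by omega, by omega, by omega, by simp, fun _ => by omega⟩
    | ext e =>
      have h1 := (isChord_side (σ := σ) (Y₀ - 1)).V
      have h2 := (isChord_side (σ := σ) Y₀).V
      grind
  | sig he H =>
    subst he
    cases H with
    | digon m t =>
      have := t.lt
      exact ⟨t.xy, t.xz, by omega, by omega, by omega, fun _ => by omega, by simp⟩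
    | chord u t =>
      have := t.V
      exact ⟨this.1, this.2.1, by omega, by omega, by omega, fun _ => by omega, by simp⟩
    | spoke v t =>
      have tv := t.V
      have := t.xy.1
      exact ⟨tv.2.1, tv.2.2.1, by omega, by omega, by omega, fun _ => by omega, by simp⟩

/-- The numerical properties of a visible path. -/
lemma Run.facts (H : Run σ D x y X Y b g) : V σ x y ∧ V σ X Y ∧ x ≤ X ∧ y ≤ Y ∧ (b = true → x + n
    ≤ Y ∧ x + y < X + Y) ∧ (b = false → (X = x ∧ Y = y ∧ g = D.ide (ed σ x y)) ∨ (y ≠ x + n ∧ Y ≠ X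
    + n)) := by
  induction H with
  | nil h => exact ⟨h, h, le_rfl, le_rfl, by simp, fun _ => .inl ⟨rfl, rfl, rfl⟩⟩
  | @cons X Y X' Y' b s g h hg hs ih =>
    obtain ⟨h1, h2, h3, h4, h5, h6⟩ := ih
    obtain ⟨g1, g2, g3, g4, g5, g6, g7⟩ := hs.facts
    grind

/-- A path ending at an arc to the puncture is marked, unless it is trivial. -/
lemma Run.spoke_flag (H : Run σ D x y X (X + n) b g)
    (H' : Run σ D x y X (X + n) b' g') : b = b' := by
  have h := H.facts
  have h' := H'.facts
  cases b <;> cases b' <;> simp only [forall_const, reduceCtorEq, false_imp_iff, true_and, ne_eq,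
    not_true_eq_false, and_false, or_false] at h h' ⊢
  all_goals grind

section Laws
variable (hD : D.Lawful σ Set.univ)
include hD

lemma Step.ide_mul {X₀ Y₀ X Y : ℤ} {s : Bool} {h : B} (H : Step σ D X₀ Y₀ X Y s h) :
    D.ide (ed σ X₀ Y₀) * h = h := by
  cases H with
  | lam H =>
    cases H with
    | right w t =>
      obtain ⟨_, t⟩ := t.larr
      exact hD.ide_ar t.rotate.corner
    | left z t =>
      obtain ⟨_, t⟩ := t.larr
      rw [ed_sub]
      exact hD.ide_ar t.rotate.rotate.corner
    | punc t =>
      have e : ed σ (Y₀ - n) Y₀ = ed σ Y₀ (Y₀ + n) := by rw [← ed_add, sub_add_cancel]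
      rw [e]
      exact hD.ide_ar t.larr.rotate.rotate.corner
  | rho hne H =>
    cases H with
    | tri u t =>
      obtain ⟨_, t⟩ := t.larr
      exact hD.ide_ar t.corner
    | ext e =>
      have h1 := (isChord_side (σ := σ) (Y₀ - 1))
      rw [sub_add_cancel] at h1
      rw [h1.ed, ← side_int_pred]
      exact hD.ide_ex _ trivial
  | sig he H =>
    subst he
    cases H with
    | digon m t =>
      obtain ⟨_, t⟩ := t.larr
      exact hD.ide_ar t.corner
    | chord u t => exact hD.ide_ar t.larr.corner
    | spoke v t => exact hD.ide_ar t.larr.rotate.corner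

lemma Step.mul_ide {X₀ Y₀ X Y : ℤ} {s : Bool} {h : B} (H : Step σ D X₀ Y₀ X Y s h) :
    h * D.ide (ed σ X Y) = h := by
  cases H with
  | lam H =>
    cases H with
    | right w t =>
      obtain ⟨_, t⟩ := t.larr
      exact hD.ar_ide t.rotate.corner
    | left z t =>
      obtain ⟨_, t⟩ := t.larr
      exact hD.ar_ide t.rotate.rotate.corner
    | punc t => exact hD.ar_ide t.larr.rotate.rotate.corner
  | rho hne H =>
    cases H with
    | tri u t =>
      obtain ⟨_, t⟩ := t.larr
      exact hD.ar_ide t.corner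
    | ext e =>
      subst e
      rw [(isChord_side Y₀).ed, ← side_int]
      exact hD.ex_ide _ trivial
  | sig he H =>
    subst he
    cases H with
    | digon m t =>
      obtain ⟨_, t⟩ := t.larr
      exact hD.ar_ide t.corner
    | chord u t => exact hD.ar_ide t.larr.corner
    | spoke v t => exact hD.ar_ide t.larr.rotate.corner

lemma Run.mul_ide (H : Run σ D x y X Y b g) : g * D.ide (ed σ X Y) = g := by
  cases H with
  | nil h => exact hD.idem _ h.2.2
  | cons hg hs => rw [mul_assoc, hs.mul_ide hD]

lemma Run.trans {X' Y' : ℤ} (H : Run σ D x y X Y b g)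
    (H' : Run σ D X Y X' Y' b' g') : Run σ D x y X' Y' (b || b') (g * g') := by
  induction H' with
  | nil h => rw [H.mul_ide hD, Bool.or_false]; exact H
  | cons hg hs ih =>
    rw [← mul_assoc, ← Bool.or_assoc]
    exact ih.cons hs

lemma Step.run (H : Step σ D X₀ Y₀ X Y s h) : Run σ D X₀ Y₀ X Y s h := by
  have := (Run.nil H.facts.1).cons H
  rwa [H.ide_mul hD, Bool.false_or] at this

end Laws

end

section
variable {n : ℕ} [hn : Fact (2 ≤ n)] {σ : TaggedTriangulation n} {B : Type*} [Ring B]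
  {D : ArrowData n B}

variable {X Y x x' y y' κ : ℤ} {g : B}

lemma V.ed_fst : (ed σ x y).fst = x := by
  rw [ed]; split_ifs <;> rfl

lemma V.ed_snd : (ed σ x y).snd = y := by
  rw [ed]; split_ifs with h
  · simp [h, snd]
  · rfl

/-- Two lifts of the same edge with the same first end, or close enough first ends, are equal. -/
lemma V.eq_of_ed_eq (h : V σ x y) (h' : V σ x' y') (e : ed σ x y = ed σ x' y')
    (h1 : x < x' + n) (h2 : x' < x + n) : x = x' ∧ y = y' := by
  obtain rfl : x = x' := eq_of_cast_eq (n := n)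
    (by rw [← V.ed_fst (σ := σ) (y := y), e, V.ed_fst]) h1 h2
  refine ⟨rfl, ?_⟩
  have l := h.lt
  have l' := h'.lt
  by_cases hy : y = x + n
  · by_contra hne
    rw [ed, if_pos hy, ed, if_neg (by omega)] at e
    cases e
  · by_cases hy' : y' = x + n
    · rw [ed, if_neg hy, ed, if_pos hy'] at e
      cases e
    · exact eq_of_cast_eq (n := n) (by rw [← V.ed_snd (σ := σ) (x := x), e, V.ed_snd])

lemma V.at_unique (h : V σ x y) (h' : V σ x' y') (e : ed σ x y = ed σ x' y')
    (h1 : x = κ ∨ y = κ + n) (h2 : x' = κ ∨ y' = κ + n) : x = x' ∧ y = y' := by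
  have := h.lt
  have := h'.lt
  exact h.eq_of_ed_eq h' e (by omega) (by omega)

/-! ### Paths turning around a vertex of the polygon -/

lemma Lam.larr {X₀ Y₀ : ℤ} {s : Bool} {h : B} (H : Lam σ D X Y X₀ Y₀ s h) : (∃ i J₁ J₂ c, LArr σ i
    pt(Y) J₁ J₂ (ed σ X₀ Y₀) (ed σ X Y) c) ∧ h = D.ar pt(Y) (ed σ X₀ Y₀)
    (ed σ X Y) := by
  cases H with
  | right w t =>
    obtain ⟨_, t⟩ := t.larr
    exact ⟨⟨_, _, _, _, t.rotate⟩, rfl⟩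
  | left z t =>
    obtain ⟨_, t⟩ := t.larr
    rw [ed_sub]
    exact ⟨⟨_, _, _, _, t.rotate.rotate⟩, rfl⟩
  | punc t =>
    have e : ∀ Y : ℤ, ed σ (Y - n) Y = ed σ Y (Y + n) := fun Y => by
      rw [← ed_add, sub_add_cancel]
    rw [e]
    exact ⟨⟨_, _, _, _, t.larr.rotate.rotate⟩, rfl⟩

/-- A product of arrows turning around `P_κ` is a visible path; it is marked if it passes from the
edges starting at `κ` to those ending at `κ + n`. -/
lemma Fan.run' {a b : Edge n} (H : Fan σ D (κ : ZMod n) a b g) (hV : V σ X Y) (hb : b = ed σ X Y)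
    (hκ : X = κ ∨ Y = κ + n) : ∃ x y f, V σ x y ∧ (x = κ ∨ y = κ + n) ∧ a = ed σ x y ∧ Run σ D x y X
    Y f g ∧ (f = true ↔ x = κ ∧ Y = κ + n ∧ x + y ≠ X + Y) := by
  induction H generalizing X Y with
  | nil => exact ⟨X, Y, false, hV, hκ, hb, by rw [hb]; exact .nil hV, by simp⟩
  | @cons b c g hg h hb' hc ih =>
    subst hb
    obtain ⟨i, J₁, J₂, d, hL⟩ := corner_iff.1 h
    have hlt := hV.lt
    -- the last arrow is the arrow ending at `(X, Y)` at the corresponding end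
    obtain ⟨X₀, Y₀, s, l, hst, hb₀, hl, hpos, hs⟩ : ∃ X₀ Y₀ s l, Step σ D X₀ Y₀ X Y s l ∧
        b = ed σ X₀ Y₀ ∧ l = D.ar pt(κ) b (ed σ X Y) ∧
        (X₀ = κ ∨ Y₀ = κ + n) ∧ (s = true ↔ X₀ = κ ∧ Y = κ + n) := by
      by_cases hne : Y = X + n
      · obtain rfl : X = κ := by omega
        subst hne
        rcases hV.exists_spoke with ⟨m, t⟩ | ⟨⟨u, t⟩, -⟩
        · obtain ⟨_, t'⟩ := t.larr
          obtain rfl := in_unique hL t' hb' (visible_ed _ _)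
          exact ⟨_, _, _, _, .sig rfl (.digon m t), rfl, rfl, .inl rfl, by simp⟩
        · obtain rfl := in_unique hL t.larr hb' (visible_ed _ _)
          exact ⟨_, _, _, _, .sig rfl (.chord u t), rfl, rfl, .inl rfl, by simp⟩
      · rcases hκ with rfl | rfl
        · by_cases h1 : Y = X + 1
          · exfalso
            rw [(hV.chord hne).ed] at hL
            rcases hL.in_chord (hV.chord hne) with ⟨-, w, g1, g2, -⟩ | ⟨e, -⟩
            · have := g1.1; have := g2.1; omega
            · exact (hV.chord hne).ne_cast (Option.some.inj e)
          · obtain ⟨u, t⟩ := hV.exists_right hne h1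
            have := t.lt
            obtain ⟨_, t'⟩ := t.larr
            obtain rfl := in_unique hL t' hb' (visible_ed _ _)
            exact ⟨_, _, _, _, .rho hne (.tri u t), rfl, rfl, .inl rfl, by simp; omega⟩
        · obtain ⟨X₀, Y₀, s, l, hl⟩ := hV.exists_lam (D := D) hne
          obtain ⟨⟨_, _, _, _, t'⟩, e⟩ := hl.larr
          push_cast at t'
          rw [CharP.cast_eq_zero, add_zero] at t'
          obtain rfl := in_unique hL t' hb' (visible_ed _ _)
          refine ⟨_, _, _, _, .lam hl, rfl, ?_, ?_⟩
          · rw [e]; simp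
          · cases hl with
            | right w t => have := t.lt; simp; omega
            | left z t => simp
            | punc t => simp
    obtain ⟨x, y, f, h1, h2, h3, h4, h5⟩ := ih hst.facts.1 hb₀ hpos
    refine ⟨x, y, f || s, h1, h2, h3, ?_, ?_⟩
    · rw [← hl]; exact h4.cons hst
    · have F := h4.facts
      have G := hst.facts
      grind

lemma Fan.run (H : Fan σ D (κ : ZMod n) (ed σ x y) (ed σ X Y) g)
    (h : V σ x y) (h' : V σ X Y) (hκ : x = κ ∨ y = κ + n) (hκ' : X = κ ∨ Y = κ + n) :
    ∃ f, Run σ D x y X Y f g ∧ (f = true ↔ x = κ ∧ Y = κ + n ∧ x + y ≠ X + Y) := by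
  obtain ⟨x', y', f, h1, h2, h3, h4, h5⟩ := H.run' h' rfl hκ'
  obtain ⟨rfl, rfl⟩ := h.at_unique h1 h3 hκ h2
  exact ⟨f, h4, h5⟩

/-- The path going around `P_κ`, with the external arrow at `P_κ`. -/
lemma exists_turn (hD : D.Lawful σ Set.univ) {p q : B} (h : V σ x y) (h' : V σ X Y) (hκ : x = κ -
    n ∨ y = κ) (hκ' : X = κ ∨ Y = κ + n) (hq : Fan σ D (κ : ZMod n) (ed σ x y) (side ((κ : ZMod n) -
    1)) q) (hp : Fan σ D (κ : ZMod n) (side κ) (ed σ X Y) p) : ∃ f, Run σ D x y X Y f (q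
    * D.ex κ * p) ∧ (f = true ↔ x = κ - n ∨ Y = κ + n) := by
  have hn2 := two_le_int (n := n)
  have s1 := isChord_side (σ := σ) (κ - 1)
  have s2 := isChord_side (σ := σ) κ
  rw [sub_add_cancel] at s1
  have l := h.lt
  have l' := h'.lt
  rw [side_int_pred, ← s1.ed] at hq
  rw [side_int, ← s2.ed] at hp
  have hc : ((κ - n : ℤ) : ZMod n) = κ := by simp
  rw [← hc] at hq
  obtain ⟨f, r, hf⟩ := hq.run h s1.V (by omega) (by omega)
  obtain ⟨f', r', hf'⟩ := hp.run s2.V h' (by omega) (by omega)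
  refine ⟨f || f', ?_, ?_⟩
  · have r1 : Run σ D x y κ (κ + 1) f (q * D.ex κ) := by
      have := r.cons (X' := κ) (Y' := κ + 1) (.rho (by omega) (.ext rfl))
      rwa [Bool.or_false] at this
    exact r1.trans hD r'
  · rw [Bool.or_eq_true_iff, hf, hf']
    omega

end

section
variable {n : ℕ} [hn : Fact (2 ≤ n)] {σ : TaggedTriangulation n} {B : Type*} [Ring B]
  {D : ArrowData n B}

variable {X X₀ X₁ Y Y₀ Y₁ x y κ : ℤ} {s : Bool} {h h' : B}

/-! ### Squares of visible paths -/

lemma ed_incident_left : Incident x (ed σ x y) := .inl V.ed_fst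

lemma ed_incident_right : Incident y (ed σ x y) := .inr V.ed_snd

lemma ed_incident (h : x = κ ∨ y = κ + n) : Incident κ (ed σ x y) := by
  rcases h with rfl | rfl
  · exact ed_incident_left
  · have := ed_incident_right (σ := σ) (x := x) (y := κ + n)
    rwa [cast_add_n] at this

lemma ed_incident' (h : x = κ - n ∨ y = κ) : Incident κ (ed σ x y) := by
  have := ed_incident (σ := σ) (κ := κ) (x := x + n) (y := y + n) (by omega)
  rwa [ed_add] at this

lemma Lam.pos (H : Lam σ D X Y X₀ Y₀ s h) : (X₀ = Y - n ∨ Y₀ = Y) ∧ (s = false → Y₀ = Y) := by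
  cases H <;> simp

section Laws
variable (hD : D.Lawful σ Set.univ)
include hD

/-- A path going around `P_κ` and ending with a given arrow at `P_κ`. -/
lemma turn_cons {b : Edge n} (h : V σ x y) (h' : V σ X Y) (hκ : x = κ - n ∨ y = κ) (hκ' : X = κ ∨
    Y = κ + n) (hv : Visible σ b) (hb : Corner σ pt(κ) (ed σ X Y) b) : ∃ q p r f, Fan
    σ D (κ : ZMod n) (ed σ x y) (side ((κ : ZMod n) - 1)) q ∧ Fan σ D (κ : ZMod n) (side (κ : ZMod
    n)) b p ∧ Run σ D x y X Y f r ∧ (f = true ↔ x = κ - n ∨ Y = κ + n) ∧ q * D.ex κ * p = r * D.ar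
    pt(κ) (ed σ X Y) b := by
  obtain ⟨q, hq⟩ := exists_fan_to_side D h.2.2 (visible_ed x y) (ed_incident' hκ)
  obtain ⟨p, hp⟩ := exists_fan_from_side D h'.2.2 (visible_ed X Y) (ed_incident hκ')
  obtain ⟨f, hr, hf⟩ := exists_turn hD h h' hκ hκ' hq hp
  exact ⟨q, _, _, f, hq, hp.cons hb (visible_ed _ _) hv, hr, hf, (mul_assoc _ _ _).symm⟩

/-- A path going around `P_X` and ending at the edge with lift `(X, Y)` factors through the arrow at
`P_X` ending at this edge. -/
lemma turn_rho (h : V σ x y) (hκ : x = X - n ∨ y = X) (hV : V σ X Y) (H : Rho σ D X Y X₁ Y₁ h') :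
    ∃ q p r f, Fan σ D (X : ZMod n) (ed σ x y) (side ((X : ZMod n) - 1)) q ∧ Fan σ D (X : ZMod n)
    (side X) (ed σ X Y) p ∧ Run σ D x y X₁ Y₁ f r ∧ (f = true ↔ x = X - n) ∧ q * D.ex X *
    p = r * h' := by
  have hn2 := two_le_int (n := n)
  cases H with
  | tri u t =>
    obtain ⟨_, t'⟩ := t.larr
    obtain ⟨q, p, r, f, h1, h2, h3, h4, h5⟩ := turn_cons (D := D) hD h t.xy hκ (.inl rfl)
      (visible_ed X Y) t'.corner
    have := t.lt
    exact ⟨q, p, r, f, h1, h2, h3, by rw [h4]; omega, h5⟩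
  | ext e =>
    subst e
    rename_i X
    obtain ⟨q, hq⟩ := exists_fan_to_side D h.2.2 (visible_ed x y) (ed_incident' hκ)
    have s1 := isChord_side (σ := σ) (X - 1)
    rw [sub_add_cancel] at s1
    have hq' := hq
    rw [side_int_pred, ← s1.ed, ← sub_add_cancel X (n : ℤ), cast_add_n, sub_add_cancel] at hq'
    have l := h.lt
    obtain ⟨f, r, hf⟩ := hq'.run h s1.V (by omega) (by omega)
    have s2 := isChord_side (σ := σ) X
    have e : ed σ X (X + 1) = side X := by rw [side_int, s2.ed]
    refine ⟨q, D.ide (side X), q, f, hq, ?_, r, ?_, ?_⟩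
    · rw [e]; exact .nil
    · rw [hf]; omega
    · rw [mul_assoc, hD.ex_ide _ trivial]

variable (hR : D.Relations σ fun _ _ _ => True)
include hR

/-- The square completing the two arrows ending at a visible edge, on the side of the first end of
this edge. -/
lemma Lam.square (H : Lam σ D X Y X₀ Y₀ s h) (H' : Rho σ D X Y X₁ Y₁ h') (hx : ¬ (X₀ = Y - n ∧ Y₀
    = Y ∧ IsDigon σ Y)) : ∃ x y s₁ h₁ r f, Step σ D x y X₀ Y₀ s₁ h₁ ∧ Run σ D x y X₁ Y₁ f r ∧ f =
    (s₁ || s) ∧ h₁ * h = r * h' ∧ (s = false ∧ s₁ = false ∧ Y₀ = Y ∧ x = X₀ ∧ y = X ∨ s = true ∧ X₀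
    = Y - n ∧ x = X - n ∧ y ≤ X ∧ (y = Y₀ ∨ Y₀ = Y ∧ y = X)) := by
  cases H with
  | right w t =>
    have hne : Y ≠ X₀ + n := fun e => hx ⟨by omega, rfl, e ▸ (t.digon e).add⟩
    obtain ⟨_, t'⟩ := t.larr
    have hlt := t.lt
    obtain ⟨q, p, r, f, hq, hp, hr, hf, e⟩ := turn_rho hD t.xy (.inr rfl) t.yz H'
    refine ⟨X₀, X, false, _, r, f, .rho hne (.tri X t), hr, ?_, ?_, .inl ?_⟩
    · rw [Bool.false_or, Bool.eq_iff_iff, hf, decide_eq_true_iff]; omega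
    · rw [← e]
      refine hR.fan t'.rotate.rotate trivial (visible_ed _ _) (visible_ed _ _) ?_ hp hq
      rintro k t - e
      rw [ed_chord hne] at e
      cases e
    · simp [hne]
  | left z t =>
    obtain ⟨_, t'⟩ := t.larr
    have hlt := t.lt
    obtain ⟨q, p, r, f, hq, hp, hr, hf, e⟩ := turn_rho hD t.xz.sub (.inl rfl) t.xy H'
    refine ⟨X - n, z - n, decide (z - n = X - n + n), _, r, f, .lam (.right _ t.sub), hr, ?_, ?_,
      .inr ⟨rfl, rfl, rfl, by omega, .inl rfl⟩⟩
    · rw [Bool.or_true, hf]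
    · rw [← e, ed_sub, ed_sub]
      have := t.chord₂
      rw [ed_sub] at hq
      have hz : ((z - n : ℤ) : ZMod n) = z := by simp
      rw [hz]
      refine hR.fan t' trivial (visible_ed _ _) (visible_ed _ _) ?_ hp hq
      rintro k t - e
      rw [this.ed] at e
      cases e
  | punc t =>
    have tv := t.V
    obtain ⟨q, p, r, f, hq, hp, hr, hf, e⟩ := turn_rho hD tv.2.1.sub (.inl rfl) tv.1 H'
    have hs : Step σ D (X - n) X (Y - n) Y true
        (D.ar none (ed σ X (X + n)) (ed σ Y (Y + n))) := by
      have := Step.sig (D := D) (Y := Y) (by omega) (.spoke _ t.sub)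
      simp only [sub_add_cancel] at this
      rw [← ed_add (X - n) X, ← ed_add (Y - n) Y, sub_add_cancel, sub_add_cancel] at this
      exact this
    rw [add_sub_cancel_right] at hq hr
    refine ⟨X - n, X, true, _, r, f, hs, hr, ?_, ?_, .inr ⟨rfl, rfl, rfl, le_rfl, .inr ⟨rfl, rfl⟩⟩⟩
    · rw [Bool.or_true, hf]
    · rw [← e]
      rw [← ed_add, sub_add_cancel] at hq
      refine hR.fan t.larr trivial (visible_ed _ _) (visible_ed _ _) ?_ hp hq
      rintro k τ hk e
      rw [ed_spoke] at e
      injection e with e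
      exact t.not_digon.2 (hk.of_cast e.symm)

/-- The square completing the two arrows ending at a visible edge, on the side of the second end of
this edge. -/
lemma Tri.square {u : ℤ} (t : Tri σ X u Y) (H : Lam σ D X Y X₀ Y₀ s h) : ∃ h₁ r f, Step σ D (u -
    n) (Y - n) X u true h₁ ∧ Run σ D (u - n) (Y - n) X₀ Y₀ f r ∧ (f || s) = true ∧ h₁ * D.ar (some
    (X : ZMod n)) (ed σ X u) (ed σ X Y) = r * h := by
  obtain ⟨⟨_, _, _, _, hl⟩, e⟩ := H.larr
  have hpos := H.pos
  obtain ⟨_, t'⟩ := t.larr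
  have hc := hl.corner
  have hY : ((Y - n : ℤ) : ZMod n) = Y := by simp
  rw [← hY] at hc
  obtain ⟨q, p, r, f, hq, hp, hr, hf, e'⟩ := turn_cons (D := D) (κ := Y - n) hD t.yz.sub
    (Step.lam H).facts.1 (.inr rfl) (by omega) (visible_ed X Y) hc
  rw [hY, ed_sub] at hq
  rw [hY] at hp e'
  have hs : Step σ D (u - n) (Y - n) X u true _ := .lam (.left Y t)
  refine ⟨_, r, f, hs, hr, ?_, ?_⟩
  · rw [Bool.or_eq_true_iff, hf]
    cases s
    · have := hpos.2 rfl; omega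
    · simp
  · rw [e, ← e']
    refine hR.fan t'.rotate trivial (visible_ed _ _) (visible_ed _ _) ?_ hp hq
    rintro k τ - e
    rw [t.chord₁.ed] at e
    cases e

end Laws

end

section
variable {n : ℕ} [hn : Fact (2 ≤ n)] {σ : TaggedTriangulation n} {B : Type*} [Ring B]
  {D : ArrowData n B}

variable {X Y x y : ℤ}

/-! ### Existence of visible paths -/

lemma V.side (x : ℤ) : V σ x (x + 1) := (isChord_side x).V

/-- Existence of unmarked paths. The last arrow is taken at `P_X` if the inequalities still hold for
its source, and at `P_Y` otherwise. -/
lemma Run.exists_false (h : V σ x y) (h' : V σ X Y) (hc : y ≠ x + n := by omega)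
    (hc' : Y ≠ X + n := by omega) (hx : x ≤ X := by omega) (hy : y ≤ Y := by omega) :
    ∃ g, Run σ D x y X Y false g := by
  have hn2 := two_le_int (n := n)
  obtain ⟨m, hm⟩ : ∃ m : ℕ, X + Y - (x + y) < m := ⟨(X + Y - (x + y) + 1).toNat, by omega⟩
  induction m generalizing X Y with
  | zero => omega
  | succ m ih =>
    push_cast at hm
    have l := h.lt
    have l' := h'.lt
    by_cases heq : X = x ∧ Y = y
    · obtain ⟨rfl, rfl⟩ := heq
      exact ⟨_, .nil h⟩
    by_cases hρ : ∃ X₀ Y₀ g, Rho σ D X Y X₀ Y₀ g ∧ x ≤ X₀ ∧ y ≤ Y₀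
    · obtain ⟨X₀, Y₀, g, hg, h1, h2⟩ := hρ
      have hs := Step.rho hc' hg
      have f := hs.facts
      obtain ⟨g', hg'⟩ := ih f.1 (f.2.2.2.2.2.2 rfl).1 h1 h2 (by omega)
      exact ⟨_, hg'.cons hs⟩
    have key : x < X ∧ y = Y := by
      by_cases h1 : Y = X + 1
      · have : ¬ y ≤ X := fun hyX => hρ ⟨_, _, _, .ext h1, by omega, hyX⟩
        omega
      · obtain ⟨u, t⟩ := h'.exists_right hc' h1
        have : ¬ y ≤ u := fun hyu => hρ ⟨_, _, _, .tri u t, by omega, hyu⟩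
        have := t.lt
        have := h.nc t.yz
        omega
    rcases h'.exists_left hc' with ⟨w, t⟩ | ⟨z, t⟩ | t
    · have := t.lt
      have := t.xy.nc h
      have e : decide (Y = w + n) = false := by rw [decide_eq_false_iff_not]; omega
      have hs : Step σ D w Y X Y _ _ := .lam (.right w t)
      rw [e] at hs
      obtain ⟨g', hg'⟩ := ih t.xz (by omega) (by omega) (by omega) (by omega)
      exact ⟨_, hg'.cons hs⟩
    · have := t.lt
      have := h.nc t.xz
      omega
    · have tv := t.V
      have := h.nc tv.2.1
      omega

/-- Existence of marked paths, if their ends are separated by the puncture. -/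
lemma Run.exists_true (h : V σ x y) (h' : V σ X Y) (hx : x ≤ X := by omega)
    (hy : x + n ≤ Y := by omega) (hne : ¬ (X = x ∧ Y = y) := by omega) :
    ∃ g, Run σ D x y X Y true g := by
  have hn2 := two_le_int (n := n)
  have l := h.lt
  obtain ⟨m, hm⟩ : ∃ m : ℕ, X + Y - (x + y) < m := ⟨(X + Y - (x + y) + 1).toNat, by omega⟩
  induction m generalizing X Y with
  | zero => omega
  | succ m ih =>
    push_cast at hm
    have l' := h'.lt
    -- a path ending with a marked arrow
    have main : ∀ {X₀ Y₀ : ℤ} {g : B}, Step σ D X₀ Y₀ X Y true g →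
        (X₀ = x ∧ Y₀ = y ∨ (x ≤ X₀ ∧ x + n ≤ Y₀) ∨
          (y ≠ x + n ∧ Y₀ ≠ X₀ + n ∧ x ≤ X₀ ∧ y ≤ Y₀)) → ∃ g, Run σ D x y X Y true g := by
      intro X₀ Y₀ g hs hr
      have f := hs.facts
      obtain ⟨b, g', hg'⟩ : ∃ b g', Run σ D x y X₀ Y₀ b g' := by
        by_cases heq : X₀ = x ∧ Y₀ = y
        · obtain ⟨rfl, rfl⟩ := heq
          exact ⟨_, _, .nil h⟩
        rcases hr with hr | hr | hr
        · exact absurd hr heq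
        · obtain ⟨g', hg'⟩ := ih f.1 hr.1 hr.2 heq (by omega)
          exact ⟨_, _, hg'⟩
        · obtain ⟨g', hg'⟩ := Run.exists_false (D := D) h f.1 hr.1 hr.2.1 hr.2.2.1 hr.2.2.2
          exact ⟨_, _, hg'⟩
      have := hg'.cons hs
      rw [Bool.or_true] at this
      exact ⟨_, this⟩
    by_cases hc' : Y = X + n
    · subst hc'
      rcases h'.exists_spoke with ⟨k, t⟩ | ⟨⟨u, t⟩, v, t'⟩
      · have := t.lt
        refine main (.sig rfl (.digon k t)) ?_
        have h1 := h.nc h'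
        have h2 := h.nc t.yz
        grind
      · have tv := t.V
        have tv' := t'.V
        have := t.xy.1
        have := t'.xy.1
        by_cases hv : x ≤ v
        · exact main (.sig rfl (.spoke v t')) (by omega)
        · refine main (.sig rfl (.chord u t)) ?_
          have h1 := h.nc tv.2.2.1
          have h2 := tv'.1.nc h
          omega
    · by_cases hρ : ∃ X₀ Y₀ g, Rho σ D X Y X₀ Y₀ g ∧ x + n ≤ Y₀
      · obtain ⟨X₀, Y₀, g, hg, h1⟩ := hρ
        have hs := Step.rho hc' hg
        have f := hs.facts
        have f' := (f.2.2.2.2.2.2 rfl).1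
        have := f.1.lt
        obtain ⟨g', hg'⟩ := ih f.1 (by omega) h1 (by omega) (by omega)
        exact ⟨_, hg'.cons hs⟩
      have key : (x + n = Y ∧ Y = X + 1) ∨ ∃ u, Tri σ X u Y ∧ u < x + n := by
        by_cases h1 : Y = X + 1
        · have : ¬ x + n ≤ X := fun hyX => hρ ⟨_, _, _, .ext h1, hyX⟩
          omega
        · obtain ⟨u, t⟩ := h'.exists_right hc' h1
          exact .inr ⟨u, t, not_le.1 fun hyu => hρ ⟨_, _, _, .tri u t, hyu⟩⟩
      rcases h'.exists_left hc' with ⟨w, t⟩ | ⟨z, t⟩ | t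
      · have := t.lt
        by_cases e : Y = w + n
        · have hs : Step σ D w Y X Y _ _ := .lam (.right w t)
          rw [decide_eq_true e] at hs
          exact main hs (by omega)
        · have hs : Step σ D w Y X Y _ _ := .lam (.right w t)
          rw [decide_eq_false e] at hs
          obtain ⟨g', hg'⟩ := ih t.xz (by omega) hy (by omega) (by omega)
          exact ⟨_, hg'.cons hs⟩
      · have := t.lt
        refine main (.lam (.left z t)) ?_
        have h0 := t.chord₂.2.1
        have h1 := t.xz.sub.nc h
        have h2 : y = x + n → ¬ (X < x + n ∧ z = X + n ∧ x < X) := by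
          rintro e ⟨h3, h4, h5⟩
          exact (t.digon h4).sub.not_between (e ▸ h)
        rcases key with key | ⟨u, t', hu⟩
        · omega
        · have := t'.lt
          have h4 := t'.yz.sub.nc h
          have h5 := h.nc t'.yz.sub
          omega
      · have tv := t.V
        refine main (.lam (.punc t)) (by omega)

end

section
variable {n : ℕ} [hn : Fact (2 ≤ n)] {σ : TaggedTriangulation n} {B : Type*} [Ring B]
  {D : ArrowData n B}

variable {X X₀ Y Y₀ m u v x y : ℤ} {b s : Bool} {g g' h : B}

/-! ### Uniqueness of visible paths -/

lemma Run.exists_any (h : V σ x y) (h' : V σ X Y) (hx : x ≤ X := by omega)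
    (hy : y ≤ Y := by omega) (hc : (y ≠ x + n ∧ Y ≠ X + n) ∨ x + n ≤ Y := by omega) :
    ∃ b g, Run σ D x y X Y b g := by
  by_cases he : X = x ∧ Y = y
  · obtain ⟨rfl, rfl⟩ := he
    exact ⟨_, _, .nil h⟩
  rcases hc with hc | hc
  · exact ⟨_, Run.exists_false h h' hc.1 hc.2 hx hy⟩
  · exact ⟨_, Run.exists_true h h' hx hc he⟩

lemma Lam.ne (H : Lam σ D X Y X₀ Y₀ s h) :
    Y ≠ X + n ∧ (s = false → X₀ ≠ Y - n) ∧ V σ X Y ∧ X₀ < X := by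
  cases H with
  | right w t =>
    have := t.lt
    refine ⟨by omega, ?_, t.yz, by omega⟩
    intro e
    rw [decide_eq_false_iff_not] at e
    omega
  | left z t =>
    have := t.chord₁.2.1
    exact ⟨by omega, by simp, t.xy, by omega⟩
  | punc t =>
    have := t.xy.2.1
    exact ⟨by omega, by simp, t.xy.V, by omega⟩

lemma Rho.lt (H : Rho σ D X Y X₀ Y₀ h) : Y₀ < Y := by
  cases H with
  | tri u t => exact t.lt.2.1
  | ext e => omega

lemma PTri.unique {u' : ℤ} (t : PTri σ X u) (t' : PTri σ X u') : u = u' := by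
  have h1 := t.V; have h2 := t'.V
  have := t.xy.1; have := t'.xy.1
  have := h1.1.nc h2.2.2.1
  have := h2.1.nc h1.2.2.1
  omega

lemma PTri.unique' {v' : ℤ} (t : PTri σ v X) (t' : PTri σ v' X) : v = v' := by
  have h1 := t.V; have h2 := t'.V
  have := t.xy.1; have := t'.xy.1
  have := h1.1.nc h2.2.1
  have := h2.1.nc h1.2.1
  omega

lemma Wind.run (H : Wind σ D (mainTag σ) x y g) (h : V σ x (x + n)) :
    ∃ f, Run σ D x (x + n) y (y + n) f g := by
  induction H with
  | nil => exact ⟨_, by rw [← ed_spoke]; exact .nil h⟩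
  | cons hg hc hy hz ih =>
    obtain ⟨f, hf⟩ := ih
    have := hf.cons (.sig rfl (.spoke _ ⟨hc, hy, hz⟩))
    rw [ed_spoke, ed_spoke] at this
    exact ⟨_, this⟩

lemma Tri.step_in (t : Tri σ X m (X + n)) : Step σ D (X - n) (m - n) (X - n) X true
    (D.ar pt(X) (ed σ X m) (ed σ X (X + n))) := by
  have t' := t.sub
  rw [add_sub_right_comm] at t'
  have := Step.sig (D := D) rfl (.digon _ t')
  rw [ed_sub, sub_add_cancel, ← ed_add (X - n) X, sub_add_cancel] at this
  simpa using this

lemma Tri.step_out (t : Tri σ X m (X + n)) : Step σ D (X - n) X (m - n) X true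
    (D.ar pt(X) (ed σ X (X + n)) (ed σ m (X + n))) := by
  have t' := t.sub
  rw [add_sub_right_comm] at t'
  have := Step.lam (Lam.right (D := D) _ t')
  rwa [decide_eq_true rfl, sub_add_cancel, ← ed_add (X - n) X, ← ed_add (m - n) X, sub_add_cancel,
    sub_add_cancel] at this

variable (σ D) in
/-- The visible paths from `(x, y)` to `(X, Y)` with the same mark are equal. -/
def UniqueRun (x y X Y : ℤ) : Prop :=
  ∀ b g g', Run σ D x y X Y b g → Run σ D x y X Y b g' → g = g'

section Laws
variable (hD : D.Lawful σ Set.univ) (hR : D.Relations σ fun _ _ _ => True)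
include hD hR

/-- A marked path to the side of a once-punctured digon cannot be continued along the notched
arc. -/
lemma Run.mul_notched (t : Tri σ X m (X + n)) (H : Run σ D x y X m true g) (hu : UniqueRun σ D x y
    X m) : g * D.ar pt(X) (ed σ X m) (sp X .notched) = 0 := by
  have hd := t.digon rfl
  obtain ⟨h1, h2, h3, h4, h5, -⟩ := H.facts
  have := h5 rfl
  have hlt := t.lt
  have l := h1.lt
  have hs : Step σ D (m - n) (X + n - n) X m true _ := .lam (.left (X + n) t)
  have hv := hs.facts.1
  have n1 := h1.nc t.xz
  have n2 : ¬ (y = x + n ∧ X < y ∧ x < X) := fun ⟨e, h3, h4⟩ =>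
    hd.sub.not_between (e ▸ h1)
  obtain ⟨b, r, hr⟩ := Run.exists_any (D := D) h1 hv
  have := hr.cons hs
  rw [Bool.or_true] at this
  rw [hu _ _ _ H this, mul_assoc]
  have L := LArr.D3 X m .notched t.chord₁ t.chord₂ hd
  have := hR.invisible L trivial fun hv => (hd.visible_iff.1 hv.1) |> fun e => by cases e
  rw [t.chord₂.ed, t.chord₁.ed]
  rw [ch_add_n, this, mul_zero]

/-- Around the puncture, a path ending with an arrow at `P_X` can be replaced by a path ending with
an arrow at the puncture. -/
lemma Run.exchange (t : PTri σ X u) (t' : PTri σ v X) (H : Run σ D x y X u b g) (hx : x ≤ v) (hu :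
    UniqueRun σ D x y X u) : ∃ b' r, Run σ D x y v (v + n) b' r ∧ g * D.ar pt(X) (ed σ
    X u) (ed σ X (X + n)) = r * D.ar none (ed σ v (v + n)) (ed σ X (X + n)) := by
  have tv := t.V
  have tv' := t'.V
  have := t.xy.1
  have := t'.xy.1
  obtain ⟨h1, h2, h3, h4, h5, h6⟩ := H.facts
  have l := h1.lt
  cases b with
  | false =>
    have h6 := h6 rfl
    have n1 := h1.nc tv.2.1
    obtain ⟨r, hr⟩ := Run.exists_false (D := D) h1 tv'.1 (by omega) (by omega) hx
    obtain ⟨q, p, r', f, hq, hp, hr', hf, e⟩ := turn_cons (D := D) hD tv'.1 tv.1 (.inr rfl)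
      (.inl rfl) (visible_ed X (X + n)) t.larr.corner
    have R := hR.fan t'.larr.rotate.rotate trivial (visible_ed _ _) (visible_ed _ _) (by
      rintro k τ hk e
      rw [ed_spoke] at e
      injection e with e
      exact t'.not_digon.1 (hk.of_cast e.symm)) hp hq
    have hrun := hr.trans hD hr'
    obtain rfl : f = false := Bool.eq_false_iff.2 fun e => by have := hf.1 e; omega
    refine ⟨_, _, hr.cons (.sig rfl (.chord X t')), ?_⟩
    rw [hu _ _ _ H hrun, mul_assoc, ← e, ← R, mul_assoc]
  | true =>
    have := h5 rfl
    have hs : Step σ D (u - n) u X u true _ := .lam (.punc t)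
    have hv := hs.facts.1
    obtain ⟨b, r, hr⟩ := Run.exists_any (D := D) h1 hv
    have hrun := hr.cons hs
    rw [Bool.or_true] at hrun
    have n1 := tv'.1.nc tv.2.2.1.sub
    obtain ⟨w, hw⟩ := exists_wind D (t.sub.y_spoke) (t.sub.not_digon.2) t'.x_spoke (by omega)
    obtain ⟨f, hf⟩ := hw.run t.sub.y_spoke.V
    have R := hR.wind t.sub.xy t.sub.x_spoke t.sub.y_spoke trivial (by
      rw [sub_add_cancel]
      exact hw.cons t'.xy t'.x_spoke t'.y_spoke)
    rw [sub_add_cancel] at hf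
    refine ⟨_, _, hr.trans hD hf, ?_⟩
    rw [hu _ _ _ H hrun, mul_assoc, mul_assoc]
    congr 1
    simp only [ch, sp, Int.cast_sub, Int.cast_natCast, CharP.cast_eq_zero, sub_zero] at R
    rw [ed_spoke, ed_spoke, ed_spoke, t.xy.ed]
    exact R

/-- Before a marked arrow, the mark of a path does not matter. Both paths are rewritten so that they
end with the same arrow, and the completing square moves the difference of marks to shorter paths.
-/
lemma Step.mul_eq_aux {x y X₀ Y₀ X Y : ℤ} {h g g' : B} (H : Step σ D X₀ Y₀ X Y true h)
    (hg : Run σ D x y X₀ Y₀ false g) (hg' : Run σ D x y X₀ Y₀ true g')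
    (ih : ∀ X' Y', X' + Y' < X + Y → UniqueRun σ D x y X' Y') : g * h = g' * h := by
  have hn2 := two_le_int (n := n)
  have F := H.facts
  obtain ⟨g1, g2, g3, g4, -, g6⟩ := hg.facts
  obtain ⟨-, -, -, -, g5', -⟩ := hg'.facts
  have g6 := g6 rfl
  have g5' := g5' rfl
  have l := g1.lt
  have hsp : Y₀ ≠ X₀ + n := by rintro rfl; exact absurd (hg.spoke_flag hg') (by simp)
  have u0 := ih _ _ F.2.2.2.2.1
  generalize hs : true = s at H
  cases H with
  | lam HL =>
    have hne := HL.ne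
    obtain ⟨X₁, Y₁, h', hρ⟩ := hne.2.2.1.exists_rho (D := D) hne.1
    have hpos := HL.pos
    -- from a side of a once-punctured digon to the other, its relations are used instead of a square
    by_cases hdig : Y₀ = X
    · cases HL with
      | right w t => rw [eq_comm, decide_eq_true_iff] at hs; omega
      | left z t =>
        have hlt := t.lt
        have hz : z = X + n := by omega
        subst hz
        have hd := t.digon rfl
        -- the path turns around `P_Y`
        have n1 := g1.nc t.xz.sub
        have n2 := g1.nc t.yz.sub
        have c1 := t.chord₁.2.1
        obtain ⟨r, hr⟩ := Run.exists_false (D := D) g1 t.xy.sub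
        have tz := t.yz.sub
        obtain ⟨q, hq⟩ := exists_fan_to_side D t.xy.2.2 (visible_ed X Y) ed_incident_right
        obtain ⟨p, hp⟩ := exists_fan_from_side D t.yz.2.2 (visible_ed Y (X + n)) ed_incident_left
        have R := hR.digon t.chord₁ t.chord₂ hd trivial
          (by rw [t.chord₂.ed] at hp; simpa [ch] using hp) (by rw [t.chord₁.ed] at hq; exact hq)
        have hY : ((Y - n : ℤ) : ZMod n) = Y := by simp
        obtain ⟨f, hturn, hf⟩ := exists_turn (κ := Y - n) hD t.xy.sub tz (by omega) (by omega)
          (by rw [ed_sub, hY]; exact hq) (by rw [ed_sub, hY]; exact hp)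
        obtain rfl : f = false := Bool.eq_false_iff.2 fun e => by have := hf.1 e; omega
        rw [hY, ← R] at hturn
        have e1 := u0 _ _ _ hg (hr.trans hD hturn)
        have hrun := (hr.cons t.step_in).cons t.step_out
        rw [Bool.or_true] at hrun
        rw [add_sub_cancel_right] at u0 hg'
        have e2 := u0 _ _ _ hg' hrun
        have L := LArr.D2 X Y .notched t.chord₁ t.chord₂ hd
        have Z := hR.invisible L trivial fun hv => (hd.visible_iff.1 hv.2) |> fun e => by cases e
        rw [e1, e2, mul_assoc, mul_assoc, mul_assoc]
        congr 1
        simp only [ch, sp, cast_add_n] at Z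
        rw [t.chord₂.ed, t.chord₁.ed, add_mul, mul_assoc, mul_assoc, ed_spoke, hd.mainTag]
        simp only [ch, sp, cast_add_n]
        rw [Z, mul_zero, add_zero]
      | punc t => omega
    · obtain ⟨x₁, y₁, s₁, h₁, r', f, k1, k2, k3, k4, k5⟩ := HL.square hD hR hρ (by
        rintro ⟨e1, e2, -⟩; omega)
      have K := k1.facts
      have k5 : X₀ = Y - n ∧ x₁ = X - n ∧ y₁ = Y₀ := by
        rcases k5 with k5 | k5
        · exact absurd (hs.trans k5.1) (by simp)
        · omega
      have Kl := K.1.lt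
      have hX := hne.2.2.1.lt
      have F2 := F.2.2.2.2.2.1 rfl
      obtain rfl : s₁ = false := Bool.eq_false_iff.2 fun e => by have := K.2.2.2.2.2.1 e; omega
      have Kc := (K.2.2.2.2.2.2 rfl)
      obtain ⟨r, hr⟩ := Run.exists_false (D := D) g1 K.1 (by omega) Kc.1
      obtain ⟨r₁, hr₁⟩ := Run.exists_true (D := D) g1 K.1
      have e1 := u0 _ _ _ hg (hr.cons k1)
      have e2 := u0 _ _ _ hg' (hr₁.cons k1)
      subst hs
      rw [Bool.false_or] at k3
      subst k3
      have e3 := ih _ _ (by have := Step.facts (.rho (D := D) hne.1 hρ); omega) _ _ _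
        (hr.trans hD k2) (by have := hr₁.trans hD k2; exact this)
      rw [e1, e2, mul_assoc, mul_assoc, k4, ← mul_assoc, ← mul_assoc, e3]
  | rho hne HR => cases hs
  | sig he HS =>
    subst he
    cases HS with
    | digon m t =>
      have hlt := t.lt
      have hd := t.digon rfl
      have n1 := g1.nc t.xz
      have hs' : Step σ D (Y₀ - n) (X₀ + n - n) X₀ Y₀ true _ := .lam (.left (X₀ + n) t)
      have hv := hs'.facts.1
      obtain ⟨r, hr⟩ := Run.exists_false (D := D) g1 hv
      have e2 := u0 _ _ _ hg' (hr.cons hs')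
      obtain ⟨_, t'⟩ := t.larr
      obtain ⟨q, p, r', f, hq, hp, hr', hf, e⟩ := turn_cons (D := D) hD hv t.xy (.inr (by omega))
        (.inl rfl) (visible_ed X₀ (X₀ + n)) t'.corner
      obtain rfl : f = false := Bool.eq_false_iff.2 fun e => by have := hf.1 e; omega
      have e1 := u0 _ _ _ hg (hr.trans hD hr')
      have t'' := t'.rotate
      rw [cast_add_n] at t''
      rw [ed_sub] at hq
      have R := hR.fan t'' trivial (visible_ed _ _) (visible_ed _ _) (by
        rintro k τ hk e
        rw [t.chord₁.ed] at e
        cases e) hp hq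
      rw [e1, e2, mul_assoc, mul_assoc, R, e]
    | chord u t =>
      have tv := t.V
      have := t.xy.1
      rcases tv.2.1.exists_spoke with ⟨m, t'⟩ | ⟨-, v, t'⟩
      · exact absurd (t'.digon rfl) t.not_digon.1
      have n1 := t'.V.1.nc tv.2.2.1.sub
      have := t'.V.2.2.2
      obtain ⟨b₁, r₁, hr₁, e₁⟩ := hg.exchange hD hR t t' (by omega) u0
      obtain ⟨b₂, r₂, hr₂, e₂⟩ := hg'.exchange hD hR t t' (by omega) u0
      obtain rfl := hr₁.spoke_flag hr₂
      have := t'.xy.1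
      rw [e₁, e₂, ih _ _ (by omega) _ _ _ hr₁ hr₂]
    | spoke v t => exact absurd rfl hsp

/-- The value of a visible path ending with a given arrow depends only on its mark. -/
lemma Step.mul_eq {b' : Bool} (H : Step σ D X₀ Y₀ X Y s h) (hg : Run σ D x y X₀ Y₀ b g) (hg' : Run
    σ D x y X₀ Y₀ b' g') (hb : (b || s) = (b' || s)) (ih : ∀ X' Y', X' + Y' < X + Y → UniqueRun σ D
    x y X' Y') : g * h = g' * h := by
  have F := H.facts
  cases s with
  | false =>
    rw [Bool.or_false, Bool.or_false] at hb
    subst hb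
    rw [ih _ _ F.2.2.2.2.1 _ _ _ hg hg']
  | true =>
    cases b <;> cases b'
    · rw [ih _ _ F.2.2.2.2.1 _ _ _ hg hg']
    · exact H.mul_eq_aux hD hR hg hg' ih
    · exact (H.mul_eq_aux hD hR hg' hg ih).symm
    · rw [ih _ _ F.2.2.2.2.1 _ _ _ hg hg']

end Laws

end

section
variable {n : ℕ} [hn : Fact (2 ≤ n)] {σ : TaggedTriangulation n} {B : Type*} [Ring B]
  {D : ArrowData n B}

variable {X X₁ Y₁ : ℤ} {h' : B}

/-! ### Equality of visible paths with the same ends and mark -/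

section Laws
variable (hD : D.Lawful σ Set.univ) (hR : D.Relations σ fun _ _ _ => True)
include hD hR

/-- The paths going around `P_X` from a side of a once-punctured digon to the arc leaving it on the
other side. -/
lemma Tri.digon_rel {w : ℤ} (t : Tri σ w X (w + n)) (H : Rho σ D X (w + n) X₁ Y₁ h') : ∃ r, Run σ
    D w X X₁ Y₁ false r ∧ D.ar pt(w) (ed σ w X) (ed σ w (w + n)) * D.ar (some (w :
    ZMod n)) (ed σ w (w + n)) (ed σ X (w + n)) + D.ar pt(w) (ed σ w X) (sp w .notched)
    * D.ar pt(w) (sp w .notched) (ed σ X (w + n)) = r * h' := by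
  have hlt := t.lt
  have hd := t.digon rfl
  obtain ⟨q, p, r, f, hq, hp, hr, hf, e⟩ := turn_rho hD t.xy (.inr rfl) t.yz H
  obtain rfl : f = false := Bool.eq_false_iff.2 fun e => by have := hf.1 e; omega
  refine ⟨r, hr, ?_⟩
  have R := hR.digon t.chord₁ t.chord₂ hd trivial
    (by rw [t.chord₂.ed] at hp; simpa [ch] using hp) (by rw [t.chord₁.ed] at hq; exact hq)
  rw [← e, ← R, t.chord₁.ed, t.chord₂.ed, ed_spoke, hd.mainTag]
  simp only [ch, sp, cast_add_n]

/-- Paths with the same mark ending with the two different arrows are equal: both are equal to paths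
through a square completing these arrows. -/
lemma Lam.mul_eq_rho {x y Y X₀ Y₀ : ℤ} {s b b' : Bool} {h g g' : B} (H : Lam σ D X Y X₀ Y₀ s h)
    (H' : Rho σ D X Y X₁ Y₁ h') (hg : Run σ D x y X₀ Y₀ b g) (hg' : Run σ D x y X₁ Y₁ b' g') (hb :
    (b || s) = b') (ih : ∀ X' Y', X' + Y' < X + Y → UniqueRun σ D x y X' Y') : g * h = g' * h' := by
  have hn2 := two_le_int (n := n)
  have hne := H.ne
  have hpos := H.pos
  have hV := hne.2.2.1
  have lV := hV.lt
  have F := Step.facts (.lam H)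
  have F' := Step.facts (.rho hne.1 H')
  obtain ⟨g1, g2, g3, g4, g5, g6⟩ := hg.facts
  obtain ⟨-, k2, k3, k4, k5, k6⟩ := hg'.facts
  have l := g1.lt
  have lρ := H'.lt
  have u0 := ih _ _ F.2.2.2.2.1
  have u1 := ih _ _ F'.2.2.2.2.1
  cases b' with
  | false =>
    obtain ⟨rfl, rfl⟩ := Bool.or_eq_false_iff.1 hb
    have hpos' := hpos.2 rfl
    have g6 := g6 rfl
    obtain ⟨x₁, y₁, s₁, h₁, r', f, m1, m2, m3, m4, m5⟩ := H.square hD hR H' (by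
      rintro ⟨e1, -, -⟩; exact hne.2.1 rfl e1)
    rcases m5 with ⟨-, rfl, -, rfl, rfl⟩ | m5
    · have m3 : f = false := m3
      subst m3
      have := m1.facts.2.2.2.2.2.2 rfl
      have n1 := g1.nc hV
      obtain ⟨r, hr⟩ := Run.exists_false (D := D) g1 m1.facts.1 (by omega) this.1
      rw [u0 _ _ _ hg (hr.cons m1), mul_assoc, m4, ← mul_assoc, u1 _ _ _ (hr.trans hD m2) hg']
    · exact absurd m5.1 (by simp)
  | true =>
    have k5 := k5 rfl
    -- the square at the second end is used if a path reaches its corner, else the one at the first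
    by_cases hρ : ∃ u, Tri σ X u Y ∧ X₁ = X ∧ Y₁ = u ∧ y ≤ Y - n ∧
        h' = D.ar pt(X) (ed σ X u) (ed σ X Y)
    · obtain ⟨u, t, rfl, rfl, hy, rfl⟩ := hρ
      obtain ⟨h₁, r', f, m1, m2, m3, m4⟩ := t.square hD hR H
      have hlt := t.lt
      have lV' := m1.facts.1.lt
      obtain ⟨c, r, hr⟩ := Run.exists_any (D := D) g1 m1.facts.1 (by omega) hy
      have e1 := hr.cons m1
      rw [Bool.or_true] at e1
      rw [u1 _ _ _ hg' e1, mul_assoc, m4, ← mul_assoc]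
      refine Step.mul_eq hD hR (.lam H) hg (hr.trans hD m2) ?_ ih
      rw [hb, Bool.or_assoc, m3, Bool.or_true]
    · have hxX : x + n ≤ X := by
        cases H' with
        | tri u t =>
          have := t.lt
          have : ¬ y ≤ Y - n := fun hy => hρ ⟨_, t, rfl, rfl, hy, rfl⟩
          have := hV.sub.nc g1
          omega
        | ext e => omega
      by_cases hd : X₀ = Y - n ∧ Y₀ = Y ∧ IsDigon σ Y
      · cases H with
        | right w t =>
          obtain ⟨rfl, -, hd⟩ := hd
          obtain ⟨w, rfl⟩ : ∃ w, Y = w + n := ⟨Y - n, by omega⟩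
          rw [add_sub_cancel_right] at *
          obtain ⟨r', hr', e⟩ := t.digon_rel hD hR H'
          have lt := t.lt
          have lV := t.xy.lt
          obtain ⟨r, hr⟩ := Run.exists_true (D := D) g1 t.xy
          have hs := hr.cons (.sig rfl (.digon X t))
          rw [Bool.or_true] at hs
          have hflag : b = true := hg.spoke_flag hs
          subst hflag
          have Z := hr.mul_notched hD hR t (ih _ _ (by omega))
          rw [cast_add_n, u0 _ _ _ hg hs, mul_assoc, eq_sub_of_add_eq e, mul_sub, ← mul_assoc, ← mul_assoc, Z,
            zero_mul, sub_zero]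
          rw [u1 _ _ _ (hr.trans hD hr') hg']
        | left z t => have := t.lt; omega
        | punc t => exact absurd hd.2.2 t.not_digon.2
      · obtain ⟨x₁, y₁, s₁, h₁, r', f, m1, m2, m3, m4, m5⟩ := H.square hD hR H' hd
        have lV' := m1.facts.1.lt
        have m7 := m1.facts.2.2.2.2.2.2
        rcases m5 with ⟨rfl, rfl, -, rfl, rfl⟩ | ⟨rfl, -, m5, -, m6⟩
        · have m3 : f = false := m3
          subst m3
          rw [Bool.or_false] at hb
          subst hb
          have m7 := m7 rfl
          obtain ⟨r, hr⟩ := Run.exists_true (D := D) g1 m1.facts.1 g3 hxX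
          rw [u0 _ _ _ hg (hr.cons m1), mul_assoc, m4, ← mul_assoc,
            u1 _ _ _ (hr.trans hD m2) hg']
        · rw [Bool.or_true] at m3
          subst m3
          have hy1 : y ≤ y₁ := by omega
          obtain ⟨c, r, hr⟩ := Run.exists_any (D := D) g1 m1.facts.1 (by omega) hy1
          have e1 := Step.mul_eq hD hR (.lam H) hg (hr.cons m1) (by simp) ih
          have e2 := hr.trans hD m2
          rw [Bool.or_true] at e2
          rw [e1, mul_assoc, m4, ← mul_assoc, u1 _ _ _ e2 hg']

/-- Two visible paths with the same lifted ends and the same mark are equal. -/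
lemma Run.unique (x y X Y : ℤ) : UniqueRun σ D x y X Y := by
  obtain ⟨m, hm⟩ : ∃ m : ℕ, X + Y - (x + y) < m := ⟨(X + Y - (x + y) + 1).toNat, by omega⟩
  induction m generalizing X Y with
  | zero =>
    intro b g g' hg
    have := hg.facts
    omega
  | succ m ihm =>
    have ih : ∀ X' Y', X' + Y' < X + Y → UniqueRun σ D x y X' Y' := fun X' Y' h =>
      ihm X' Y' (by push_cast at hm; omega)
    intro b g g' hg hg'
    obtain ⟨b', hb⟩ : ∃ b', b = b' := ⟨b, rfl⟩
    rw [hb] at hg'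
    cases hg with
    | nil h =>
      cases hg' with
      | nil => rfl
      | cons k s => have := k.facts; have := s.facts; omega
    | cons k s =>
      rename_i X₀ Y₀ c d g₀ h₀
      cases hg' with
      | nil => have := k.facts; have := s.facts; omega
      | cons k' s' =>
        cases s with
        | lam H =>
          cases s' with
          | lam H' =>
            obtain ⟨rfl, rfl, rfl, rfl⟩ := H.unique H'
            exact Step.mul_eq hD hR (.lam H) k k' hb ih
          | rho hne H' => exact H.mul_eq_rho hD hR H' k k' (by simpa using hb) ih
          | sig he H' => exact absurd he H.ne.1
        | rho hne H =>
          cases s' with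
          | lam H' => exact (H'.mul_eq_rho hD hR H k' k (by simpa using hb.symm) ih).symm
          | rho hne H' =>
            obtain ⟨rfl, rfl, rfl⟩ := H.unique H'
            exact Step.mul_eq hD hR (.rho hne H) k k' hb ih
          | sig he H' => exact absurd he hne
        | sig he H =>
          cases s' with
          | lam H' => exact absurd he H'.ne.1
          | rho hne H' => exact absurd he hne
          | sig _ H' =>
            have main : ∀ {X₀ Y₀ X₁ Y₁ : ℤ} {c c' : Bool} {g g' h h' : B},
                Run σ D x y X₀ Y₀ c g → Run σ D x y X₁ Y₁ c' g' → Sig σ D X X₀ Y₀ h →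
                Sig σ D X X₁ Y₁ h' → X₀ = X → g * h = g' * h' := by
              intro X₀ Y₀ X₁ Y₁ c c' g g' h h' k k' H H' hX
              have F := Step.facts (.sig he H)
              have F' := Step.facts (.sig he H')
              cases H with
              | digon u t =>
                cases H' with
                | digon u' t' =>
                  obtain rfl := t.right_unique t'
                  exact Step.mul_eq hD hR (.sig he (.digon _ t)) k k' (by simp) ih
                | chord u' t' => exact absurd (t.digon rfl) t'.not_digon.1
                | spoke v t' => exact absurd (t.digon rfl) t'.not_digon.2
              | chord u t =>
                cases H' with
                | digon u' t' => exact absurd (t'.digon rfl) t.not_digon.1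
                | chord u' t' =>
                  obtain rfl := t.unique t'
                  exact Step.mul_eq hD hR (.sig he (.chord _ t)) k k' (by simp) ih
                | spoke v t' =>
                  obtain ⟨b₁, r, hr, e⟩ := k.exchange hD hR t t' k'.facts.2.2.1
                    (ih _ _ F.2.2.2.2.1)
                  rw [e]
                  exact Step.mul_eq hD hR (.sig he (.spoke _ t')) hr k' (by simp) ih
              | spoke v t => have := t.xy.1; omega
            rename_i X₁ Y₁ _ _ _ _
            by_cases h1 : X₀ = X
            · exact main k k' H H' h1
            · by_cases h2 : X₁ = X
              · exact (main k' k H' H h2).symm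
              · cases H with
                | digon u t => exact absurd rfl h1
                | chord u t => exact absurd rfl h1
                | spoke v t =>
                  cases H' with
                  | digon u t => exact absurd rfl h2
                  | chord u t => exact absurd rfl h2
                  | spoke v' t' =>
                    obtain rfl := t.unique' t'
                    exact Step.mul_eq hD hR (.sig he (.spoke _ t)) k k' (by simp) ih

end Laws

end

section
/-! ### The algebra `K[u^{±1}, v] / (v u - v ^ 2)` -/

section Script
variable (K : Type*) [Field K]
variable {m m' : ℤ} {x : ScriptR K}

/-- The idempotents `u⁻¹ v` and `1 - u⁻¹ v`. -/
def eps : Tag → ScriptR K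
  | .plain => uPow K (-1) * vElt K
  | .notched => 1 - uPow K (-1) * vElt K

lemma uPow_zero : uPow K 0 = 1 := by
  rw [uPow, LaurentPolynomial.T_zero, map_one, map_one]

lemma uPow_add (i j : ℤ) : uPow K (i + j) = uPow K i * uPow K j := by
  rw [uPow, uPow, uPow, LaurentPolynomial.T_add, map_mul, map_mul]

lemma uPow_mul_neg (i : ℤ) : uPow K i * uPow K (-i) = 1 := by
  rw [← uPow_add, add_neg_cancel, uPow_zero]

lemma vElt_eq : vElt K = uPow K 1 * eps K .plain := by
  rw [eps, ← mul_assoc, uPow_mul_neg, one_mul]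

lemma eps_add : eps K .plain + eps K .notched = 1 := by simp [eps]

lemma eps_plain_sq : eps K .plain * eps K .plain = eps K .plain := by
  have h := vElt_mul_uPow_one K
  have h1 := uPow_mul_neg K 1
  simp only [eps]
  grind

lemma eps_idem (t : Tag) : eps K t * eps K t = eps K t := by
  cases t
  · exact eps_plain_sq K
  · have h := eps_plain_sq K
    have h1 : eps K .notched = 1 - eps K .plain := by rw [← eps_add K, add_sub_cancel_left]
    rw [h1, mul_sub, sub_mul, sub_mul, h]
    ring

lemma eps_mul : eps K .plain * eps K .notched = 0 := by
  have h1 : eps K .notched = 1 - eps K .plain := by rw [← eps_add K, add_sub_cancel_left]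
  rw [h1, mul_sub, eps_plain_sq, mul_one, sub_self]

lemma vElt_pow {j : ℕ} (hj : j ≠ 0) : vElt K ^ j = uPow K j * eps K .plain := by
  rw [vElt_eq, mul_pow, uPow_one_pow, IsIdempotentElem.pow_eq (eps_plain_sq K) hj]

/-- The element `u ^ m`, or `u ^ m` times one of the two idempotents. -/
def mono (t : Tag) (f : Bool) (m : ℤ) : ScriptR K := uPow K m * if f then eps K t else 1

lemma mono_mul (t : Tag) (f f' : Bool) (m m' : ℤ) :
    mono K t f m * mono K t f' m' = mono K t (f || f') (m + m') := by
  have h := eps_idem K t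
  cases f <;> cases f' <;> simp only [mono, uPow_add, Bool.or_false, Bool.or_true, Bool.false_or,
    if_true, if_false, Bool.false_eq_true, mul_one]
  all_goals grind

lemma mono_zero (t : Tag) : mono K t false 0 = 1 := by simp [mono, uPow_zero]

open LaurentPolynomial in
/-- The evaluation of `v` at a root of `v u - v ^ 2`. -/
def evalScript (x : K[T;T⁻¹]) (h : x * T 1 - x ^ 2 = 0) : ScriptR K →ₐ[K] K[T;T⁻¹] :=
  Ideal.Quotient.liftₐ (Ideal.span {_})
    ((Polynomial.aeval x).restrictScalars K : Polynomial K[T;T⁻¹] →ₐ[K] K[T;T⁻¹]) (by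
    intro a ha
    obtain ⟨b, rfl⟩ := Ideal.mem_span_singleton'.1 ha
    rw [map_mul]
    simp [h])

open LaurentPolynomial in
lemma evalScript_uPow (x : K[T;T⁻¹]) (h : x * T 1 - x ^ 2 = 0) (m : ℤ) :
    evalScript K x h (uPow K m) = T m := by
  change (Polynomial.aeval x) (Polynomial.C (T m : K[T;T⁻¹])) = T m
  simp

open LaurentPolynomial in
lemma evalScript_vElt (x : K[T;T⁻¹]) (h : x * T 1 - x ^ 2 = 0) :
    evalScript K x h (vElt K) = x := by
  change (Polynomial.aeval x) (Polynomial.X : Polynomial K[T;T⁻¹]) = x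
  simp

open LaurentPolynomial in
/-- The morphism killing the idempotent `eps t`. -/
def killEps (t : Tag) : ScriptR K →ₐ[K] K[T;T⁻¹] :=
  match t with
  | .plain => evalScript K 0 (by simp)
  | .notched => evalScript K (T 1) (by ring)

open LaurentPolynomial in
lemma killEps_uPow (t : Tag) (m : ℤ) : killEps K t (uPow K m) = T m := by
  cases t
  · exact evalScript_uPow K 0 (by simp) m
  · exact evalScript_uPow K (T 1) (by ring) m

open LaurentPolynomial in
lemma killEps_eps (t t' : Tag) [Decidable (t = t')] :
    killEps K t (eps K t') = if t = t' then 0 else 1 := by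
  have h : (T (-1) * T 1 : K[T;T⁻¹]) = 1 := by rw [← T_add]; simp
  cases t <;> cases t' <;> simp [killEps, eps, evalScript_uPow, evalScript_vElt, h]

/-- The other tag. -/
def Tag.other : Tag → Tag
  | .plain => .notched
  | .notched => .plain

open LaurentPolynomial in
open Classical in
/-- The coefficient of `mono t f m`. -/
def coef (t : Tag) (f : Bool) (m : ℤ) : ScriptR K →ₗ[K] K :=
  (Finsupp.lapply m ∘ₗ (AddMonoidAlgebra.coeffLinearEquiv K).toLinearMap) ∘ₗ
    (if f then (killEps K t.other).toLinearMap - (killEps K t).toLinearMap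
    else (killEps K t).toLinearMap)

open Classical in
lemma coef_mono (t : Tag) (f f' : Bool) (m m' : ℤ) :
    coef K t f m (mono K t f' m') = if f = f' ∧ m = m' then 1 else 0 := by
  have e : ∀ a : LaurentPolynomial K, (AddMonoidAlgebra.coeffLinearEquiv K a) m = a.coeff m :=
    fun _ => rfl
  cases t <;> cases f <;> cases f' <;>
    simp [coef, mono, killEps_uPow, killEps_eps, Tag.other, e, eq_comm]

lemma linearIndependent_mono (t : Tag) :
    LinearIndependent K fun i : Bool × ℤ => mono K t i.1 i.2 := by
  classical
  rw [linearIndependent_iff']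
  intro s c hc i hi
  have := congrArg (coef K t i.1 i.2) hc
  rw [map_sum, map_zero, Finset.sum_eq_single i] at this
  · simpa [coef_mono] using this
  · intro j _ hj
    rw [map_smul, coef_mono, if_neg fun h => hj (Prod.ext h.1.symm h.2.symm), smul_zero]
  · exact fun h => absurd hi h

lemma mono_notched (f : Bool) (m : ℤ) : mono K .notched f m =
    mono K .plain false m - if f then mono K .plain true m else 0 := by
  cases f
  · simp [mono]
  · simp [mono, ← eps_add K, mul_add]

lemma uPow_mul_vElt_pow (i : ℤ) (j : ℕ) :
    ∃ f, uPow K i * vElt K ^ j = mono K .plain f (i + j) := by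
  by_cases hj : j = 0
  · exact ⟨false, by simp [hj, mono]⟩
  · exact ⟨true, by rw [vElt_pow K hj, ← mul_assoc, ← uPow_add]; rfl⟩

lemma scriptPiece_eq (t : Tag) (m : ℤ) :
    scriptPiece K m = Submodule.span K (Set.range fun f => mono K t f m) := by
  have h1 : scriptPiece K m = Submodule.span K (Set.range fun f => mono K .plain f m) := by
    apply le_antisymm
    · refine Submodule.span_le.2 ?_
      rintro _ ⟨i, j, rfl, rfl⟩
      obtain ⟨f, hf⟩ := uPow_mul_vElt_pow K i j
      rw [hf]
      exact Submodule.subset_span ⟨f, rfl⟩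
    · refine Submodule.span_le.2 ?_
      rintro _ ⟨f, rfl⟩
      cases f
      · exact Submodule.subset_span ⟨m, 0, by simp, by simp [mono]⟩
      · refine Submodule.subset_span ⟨m - 1, 1, by simp, ?_⟩
        rw [pow_one, vElt_eq, ← mul_assoc, ← uPow_add, sub_add_cancel]
        rfl
  cases t with
  | plain => exact h1
  | notched =>
    rw [h1]
    have e : ∀ f, mono K .plain f m =
        mono K .notched false m - if f then mono K .notched true m else 0 := by
      intro f; cases f <;> simp [mono_notched]
    apply le_antisymm <;> refine Submodule.span_le.2 ?_ <;> rintro _ ⟨f, rfl⟩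
    · simp only [e]
      refine Submodule.sub_mem _ (Submodule.subset_span ⟨_, rfl⟩) ?_
      split_ifs
      · exact Submodule.subset_span ⟨_, rfl⟩
      · exact Submodule.zero_mem _
    · simp only [mono_notched]
      refine Submodule.sub_mem _ (Submodule.subset_span ⟨_, rfl⟩) ?_
      split_ifs
      · exact Submodule.subset_span ⟨_, rfl⟩
      · exact Submodule.zero_mem _

lemma mono_mem (t : Tag) (f : Bool) (m : ℤ) : mono K t f m ∈ scriptPiece K m := by
  rw [scriptPiece_eq K t]
  exact Submodule.subset_span ⟨f, rfl⟩

lemma mul_mem_scriptPiece {y : ScriptR K} (hx : x ∈ scriptPiece K m)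
    (hy : y ∈ scriptPiece K m') : x * y ∈ scriptPiece K (m + m') := by
  rw [scriptPiece_eq K .plain] at hx hy
  induction hx, hy using Submodule.span_induction₂ with
  | mem_mem x y hx hy =>
    obtain ⟨f, rfl⟩ := hx
    obtain ⟨f', rfl⟩ := hy
    simp only [mono_mul]
    exact mono_mem K _ _ _
  | zero_left y hy => rw [zero_mul]; exact zero_mem _
  | zero_right x hx => rw [mul_zero]; exact zero_mem _
  | add_left x y z _ _ _ h1 h2 => rw [add_mul]; exact add_mem h1 h2
  | add_right x y z _ _ _ h1 h2 => rw [mul_add]; exact add_mem h1 h2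
  | smul_left r x y _ _ h => rw [smul_mul_assoc]; exact Submodule.smul_mem _ _ h
  | smul_right r x y _ _ h => rw [mul_smul_comm]; exact Submodule.smul_mem _ _ h

/-- The projection onto the part of degree `m`. -/
def scriptProj (m : ℤ) : ScriptR K →ₗ[K] ScriptR K :=
  (coef K .plain false m).smulRight (mono K .plain false m) +
    (coef K .plain true m).smulRight (mono K .plain true m)

lemma scriptProj_of_mem (hx : x ∈ scriptPiece K m) : scriptProj K m x = x := by
  classical
  rw [scriptPiece_eq K .plain] at hx
  induction hx using Submodule.span_induction with
  | mem x hx =>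
    obtain ⟨f, rfl⟩ := hx
    cases f <;> simp [scriptProj, coef_mono]
  | zero => simp
  | add x y _ _ h1 h2 => rw [map_add, h1, h2]
  | smul r x _ h => rw [map_smul, h]

lemma scriptProj_of_ne (hm : m' ≠ m) (hx : x ∈ scriptPiece K m) : scriptProj K m' x = 0 := by
  classical
  rw [scriptPiece_eq K .plain] at hx
  induction hx using Submodule.span_induction with
  | mem x hx =>
    obtain ⟨f, rfl⟩ := hx
    cases f <;> simp [scriptProj, coef_mono, hm]
  | zero => simp
  | add x y _ _ h1 h2 => rw [map_add, h1, h2, add_zero]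
  | smul r x _ h => rw [map_smul, h, smul_zero]

/-! ### The algebra `K[X, Y] / (Y X - Y ^ 2)` -/

variable {K}

lemma RPrime.Y_mul_X (n : ℕ) : RPrime.Y K n * RPrime.X K n = RPrime.Y K n ^ 2 := by
  have := Ideal.Quotient.eq (I := Ideal.span {(MvPolynomial.X 1 * MvPolynomial.X 0 -
    MvPolynomial.X 1 ^ 2 : MvPolynomial (Fin 2) K)}) |>.2 (Ideal.subset_span rfl)
  exact this

lemma RPrime.mem_span (n : ℕ) (r : RPrime K n) : r ∈ Submodule.span K (Set.range fun i : Bool × ℕ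
    => RPrime.X K n ^ i.2 * if i.1 then RPrime.Y K n else 1) := by
  obtain ⟨p, rfl⟩ := Ideal.Quotient.mk_surjective r
  induction p using MvPolynomial.induction_on' with
  | monomial d a =>
    have e : (Ideal.Quotient.mk _ (MvPolynomial.monomial d a) : RPrime K n) =
        a • (RPrime.X K n ^ d 0 * RPrime.Y K n ^ d 1) := by
      rw [MvPolynomial.monomial_eq, Finsupp.prod_fintype _ _ (by simp), Fin.prod_univ_two]
      rw [map_mul, map_mul, map_pow, map_pow, Algebra.smul_def]
      rfl
    rw [e]
    refine Submodule.smul_mem _ _ ?_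
    by_cases h : d 1 = 0
    · rw [h]
      exact Submodule.subset_span ⟨(false, d 0), by simp⟩
    · obtain ⟨j, hj⟩ := Nat.exists_eq_succ_of_ne_zero h
      rw [hj]
      have : ∀ j : ℕ, RPrime.Y K n ^ (j + 1) = RPrime.X K n ^ j * RPrime.Y K n := by
        intro j
        induction j with
        | zero => simp
        | succ j ih =>
          rw [pow_succ (RPrime.Y K n), ih, mul_assoc, ← sq, ← RPrime.Y_mul_X]
          ring
      rw [Nat.succ_eq_add_one, this, ← mul_assoc, ← pow_add]
      exact Submodule.subset_span ⟨(true, d 0 + j), by simp⟩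
  | add p q hp hq => rw [map_add]; exact add_mem hp hq

lemma embed_X (n : ℕ) : embed K n (RPrime.X K n) = mono K .plain false (2 * n) := by
  have : embed K n (RPrime.X K n) = MvPolynomial.aeval ![uPow K (2 * n), vElt K ^ (2 * n)]
    (MvPolynomial.X 0 : MvPolynomial (Fin 2) K) := rfl
  rw [this, MvPolynomial.aeval_X]
  simp [mono]

lemma embed_Y (n : ℕ) (hn : 2 ≤ n) : embed K n (RPrime.Y K n) = mono K .plain true (2 * n) := by
  have : embed K n (RPrime.Y K n) = MvPolynomial.aeval ![uPow K (2 * n), vElt K ^ (2 * n)]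
    (MvPolynomial.X 1 : MvPolynomial (Fin 2) K) := rfl
  rw [this, MvPolynomial.aeval_X]
  simp only [Matrix.cons_val_one, Matrix.cons_val_zero]
  rw [vElt_pow K (by omega)]
  simp [mono]

lemma embed_basis (n : ℕ) (hn : 2 ≤ n) (f : Bool) (i : ℕ) : embed K n (RPrime.X K n ^ i * if f
    then RPrime.Y K n else 1) = mono K .plain f (2 * n * (i + if f then 1 else 0)) := by
  have hX : embed K n (RPrime.X K n ^ i) = mono K .plain false (2 * n * i) := by
    rw [map_pow, embed_X]
    simp only [mono, Bool.false_eq_true, if_false, mul_one]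
    induction i with
    | zero => simp [uPow_zero]
    | succ i ih =>
      rw [pow_succ, ih, ← uPow_add]
      push_cast
      ring_nf
  rw [map_mul, hX]
  cases f
  · simp
  · simp only [if_true, embed_Y n hn, mono_mul]
    ring_nf
    simp

lemma embed_injective (n : ℕ) (hn : 2 ≤ n) : Function.Injective (embed K n) := by
  have hinj : Function.Injective fun i : Bool × ℕ =>
      ((i.1, 2 * (n : ℤ) * (i.2 + if i.1 then 1 else 0)) : Bool × ℤ) := by
    rintro ⟨f, i⟩ ⟨f', i'⟩ h
    simp only [Prod.mk.injEq] at h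
    obtain ⟨rfl, h⟩ := h
    have := mul_left_cancel₀ (by positivity) h
    simp at this
    rw [this]
  have hli := (linearIndependent_mono K .plain).comp _ hinj
  rw [injective_iff_map_eq_zero]
  intro r hr
  obtain ⟨c, rfl⟩ := (Finsupp.mem_span_range_iff_exists_finsupp).1 (RPrime.mem_span n r)
  rw [linearIndependent_iff] at hli
  have := hli c (by
    rw [Finsupp.linearCombination_apply, ← hr, Finsupp.sum, Finsupp.sum, map_sum]
    refine Finset.sum_congr rfl fun i _ => ?_
    rw [map_smul, embed_basis n hn]
    rfl)
  rw [this]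
  simp

end Script

end

section
variable {n : ℕ} [hn : Fact (2 ≤ n)] {σ : TaggedTriangulation n}

variable {X X₀ Y Y₀ x y : ℤ} {f s : Bool} {a b c : Edge n}

section Third
variable {B : Type*} [Ring B] {D : ArrowData n B}

lemma PTri.step_none (t : PTri σ X Y) : Step σ D (X - n) X (Y - n) Y true
    (D.ar none (ed σ X (X + n)) (ed σ Y (Y + n))) := by
  have := Step.sig (D := D) (Y := Y) (by omega) (.spoke _ t.sub)
  simp only [sub_add_cancel] at this
  rw [← ed_add (X - n) X, ← ed_add (Y - n) Y, sub_add_cancel, sub_add_cancel] at this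
  exact this

variable (hD : D.Lawful σ Set.univ)
include hD

lemma Step.run₂ {X₁ Y₁ : ℤ} {s' : Bool} {h h' : B} (H : Step σ D X₀ Y₀ X₁ Y₁ s h)
    (H' : Step σ D X₁ Y₁ X Y s' h') : Run σ D X₀ Y₀ X Y (s || s') (h * h') :=
  (H.run hD).cons H'

/-- The two other arrows of a triangle with a corner `a → b` at `P_κ`, as a visible path going from
`b` to `a` around `P_κ`. -/
lemma LArr.third_run {i : Fin 3} {k : ZMod n} {J₁ J₂ : Option (ZMod n)} (h : LArr σ i (some k) J₁
    J₂ a b c) (ha : Visible σ a) (hb : Visible σ b) (hc : ∀ k t, IsDigon σ k → c ≠ sp k t) : ∃ (κ x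
    y X Y : ℤ) (f : Bool), (κ : ZMod n) = k ∧ V σ x y ∧ V σ X Y ∧ a = ed σ X Y ∧ b = ed σ x y ∧ (x =
    κ - n ∨ y = κ) ∧ (X = κ ∨ Y = κ + n) ∧ Run σ D x y X Y f (D.ar J₁ b c * D.ar J₂ c a) ∧ (f = true
    ↔ x = κ - n ∨ Y = κ + n) := by
  have hn2 := two_le_int (n := n)
  generalize hJ : some k = J at h
  have hcast : ∀ x : ℤ, ((x - n : ℤ) : ZMod n) = x := fun x => by simp
  cases h with
  | A1 x y z h1 h2 h3 =>
    have t : Tri σ x y z := h1.tri h2 h3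
    have l := t.lt
    have s1 : Step σ D _ _ _ _ _ _ := .lam (.right _ t.sub)
    have := s1.run₂ hD (.lam (.left _ t))
    rw [ed_sub, ed_sub, hcast, Bool.or_true, h3.ed, h2.ed, h1.ed] at this
    exact ⟨x, _, _, _, _, _, (Option.some.inj hJ).symm, t.xz.sub, t.xy, h1.ed.symm,
      by rw [ed_sub, h3.ed], .inl rfl, .inl rfl, this, by simp⟩
  | A2 x y z h1 h2 h3 =>
    have t : Tri σ x y z := h1.tri h2 h3
    have l := t.lt
    have s1 : Step σ D _ _ _ _ _ _ := .lam (.left _ t)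
    have := s1.run₂ hD (.rho h3.2.1.ne (.tri _ t))
    rw [h3.ed, h2.ed, h1.ed, Bool.or_false] at this
    exact ⟨z - n, _, _, _, _, _, by rw [hcast]; exact (Option.some.inj hJ).symm, t.yz.sub, t.xz,
      h3.ed.symm, by rw [ed_sub, h2.ed], .inr rfl, .inr (by omega), this, by simp⟩
  | A3 x y z h1 h2 h3 =>
    have t : Tri σ x y z := h1.tri h2 h3
    have l := t.lt
    have s1 : Step σ D _ _ _ _ _ _ := .rho h3.2.1.ne (.tri _ t)
    have := s1.run₂ hD (.lam (.right _ t))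
    rw [h3.ed, h2.ed, h1.ed, Bool.false_or] at this
    have c1 := h1.2.1
    have c3 := h3.2.1
    exact ⟨y, _, _, _, _, _, (Option.some.inj hJ).symm, t.xy, t.yz, h2.ed.symm, h1.ed.symm,
      .inr rfl, .inl rfl, this, by rw [decide_eq_true_iff]; omega⟩
  | B1 x y τ h1 h2 h3 =>
    obtain rfl := tag_eq_of_visible h2 hb
    have t : PTri σ x y := ⟨h1, h2, h3⟩
    have := t.step_none.run₂ hD (.lam (.punc t))
    rw [h1.ed, ed_spoke, ed_spoke] at this
    have e := h2.V.sub
    rw [add_sub_cancel_right] at e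
    exact ⟨x, _, _, _, _, _, (Option.some.inj hJ).symm, e, h1.V, h1.ed.symm,
      by rw [← ed_add, sub_add_cancel, ed_spoke], .inl rfl, .inl rfl, this, by simp⟩
  | B2 => cases hJ
  | B3 x y τ h1 h2 h3 =>
    obtain rfl := tag_eq_of_visible h3 ha
    have t : PTri σ x y := ⟨h1, h2, h3⟩
    have s1 : Step σ D _ _ _ _ _ _ := .sig rfl (.chord _ t)
    have := s1.run₂ hD (.sig rfl (.spoke _ t))
    rw [h1.ed, ed_spoke, ed_spoke] at this
    exact ⟨y, _, _, _, _, _, (Option.some.inj hJ).symm, h1.V, h3.V, (ed_spoke _).symm,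
      h1.ed.symm, .inr rfl, .inl rfl, this, by simp⟩
  | D1 x m τ h1 h2 h3 => exact absurd rfl (hc _ _ h3)
  | D2 x m τ h1 h2 h3 =>
    obtain rfl := h3.visible_iff.1 hb
    have t := h3.tri h1 h2
    have s2 : Step σ D _ _ _ _ _ _ := .lam (.left _ t)
    rw [add_sub_cancel_right] at s2
    have := t.step_out.run₂ hD s2
    rw [h1.ed, h2.ed, ed_spoke, h3.mainTag] at this
    have e := t.xz.sub
    rw [add_sub_cancel_right] at e
    simp only [ch, cast_add_n] at this
    exact ⟨x, _, _, _, _, _, (Option.some.inj hJ).symm, e, h1.V, h1.ed.symm,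
      by rw [← ed_add, sub_add_cancel, ed_spoke, h3.mainTag], .inl rfl, .inl rfl, this, by simp⟩
  | D3 x m τ h1 h2 h3 =>
    obtain rfl := h3.visible_iff.1 ha
    have t := h3.tri h1 h2
    have s1 : Step σ D _ _ _ _ _ _ := .lam (.left _ t)
    have := s1.run₂ hD (.sig rfl (.digon _ t))
    rw [h1.ed, h2.ed, ed_spoke, h3.mainTag] at this
    have e := h2.V.sub
    simp only [ch, cast_add_n] at this
    exact ⟨x, _, _, _, _, _, (Option.some.inj hJ).symm, e, t.xz, by rw [ed_spoke, h3.mainTag],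
      by rw [ed_sub, h2.ed, ch_add_n], .inr (by omega), .inl rfl, this, by simp⟩

end Third

/-! ### The matrices attached to the arrows -/

section Mat
variable (K : Type*) [Field K] (σ) (E : Set (ZMod n))

/-- The matrices over `𝓡'` indexed by the edges of `σ`. -/
abbrev EdgeMat := Matrix (QVert σ E) (QVert σ E) (ScriptR K)

instance : DecidableEq (QVert σ E) := Classical.decEq _

open Classical in
/-- The matrix with entry `w` at `(a, b)`. -/
def eUnit (a b : Edge n) (w : ScriptR K) : EdgeMat σ K E :=
  Matrix.of fun i j => if i.1 = a ∧ j.1 = b then w else 0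

open Classical in
/-- The factor attached to an internal arrow: an idempotent if the arrow passes in front of the
puncture, or starts or ends at an arc to the puncture. -/
def factor (J : Option (ZMod n)) (a b : Edge n) : ScriptR K :=
  if Visible σ a ∧ Visible σ b then
    if J = none ∨ J = some a.fst ∧ J = some b.snd then eps K (mainTag σ) else 1
  else eps K .notched

/-- The matrices attached to the vertices and to the arrows. -/
def matData : ArrowData n (EdgeMat σ K E) where
  ide a := eUnit σ K E a a 1
  ar J a b := eUnit σ K E a b (uPow K (theta a b) * factor σ K J a b)
  ex k := eUnit σ K E (side (k - 1)) (side k) (uPow K 2)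

variable {σ K E}

open Classical in
lemma eUnit_apply (a b : Edge n) (w : ScriptR K) (i j : QVert σ E) :
    eUnit σ K E a b w i j = if i.1 = a ∧ j.1 = b then w else 0 := rfl

lemma eUnit_mul (hb : b ∈ σ.edges) (w w' : ScriptR K) :
    eUnit σ K E a b w * eUnit σ K E b c w' = eUnit σ K E a c (w * w') := by
  ext i j
  rw [Matrix.mul_apply, Finset.sum_eq_single (vtx E hb)]
  · have e : (vtx E hb).1 = b := rfl
    rw [eUnit_apply, eUnit_apply, eUnit_apply, e]
    by_cases h1 : i.1 = a <;> by_cases h2 : j.1 = c <;> simp [h1, h2]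
  · intro l _ hl
    have : l.1 ≠ b := fun h => hl (Subtype.ext h)
    simp [eUnit, this]
  · simp

lemma eUnit_mul_of_ne {b' : Edge n} (hb : b ≠ b') (w w' : ScriptR K) :
    eUnit σ K E a b w * eUnit σ K E b' c w' = 0 := by
  ext i j
  refine Finset.sum_eq_zero fun l _ => ?_
  by_cases h : l.1 = b
  · have : l.1 ≠ b' := fun h' => hb (h.symm.trans h')
    simp [eUnit, this]
  · simp [eUnit, h]

lemma eUnit_add (a b : Edge n) (w w' : ScriptR K) :
    eUnit σ K E a b (w + w') = eUnit σ K E a b w + eUnit σ K E a b w' := by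
  ext i j; simp only [eUnit, Matrix.of_apply, Matrix.add_apply]; split_ifs <;> simp

lemma eUnit_zero (a b : Edge n) : eUnit σ K E a b 0 = 0 := by
  ext i j; simp [eUnit]

lemma matData_lawful : (matData σ K E).Lawful σ Set.univ where
  idem a ha := by simp only [matData]; rw [eUnit_mul ha, mul_one]
  orth a _ b _ h := eUnit_mul_of_ne h _ _
  one := by
    ext i j
    rw [Matrix.sum_apply]
    by_cases h : i = j
    · subst h
      rw [Matrix.one_apply_eq, Finset.sum_eq_single i.1]
      · simp [matData, eUnit]
      · intro b _ hb
        simp [matData, eUnit, Ne.symm hb]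
      · exact fun h => absurd i.2 h
    · rw [Matrix.one_apply_ne h]
      refine Finset.sum_eq_zero fun a _ => ?_
      exact if_neg fun h' => h (Subtype.ext (h'.1.trans h'.2.symm))
  ide_ar h := by
    simp only [matData]
    rw [eUnit_mul h.mem.1, one_mul]
  ar_ide h := by
    simp only [matData]
    rw [eUnit_mul h.mem.2, mul_one]
  ide_ex k _ := by simp only [matData]; rw [eUnit_mul (σ.side_mem _), one_mul]
  ex_ide k _ := by simp only [matData]; rw [eUnit_mul (σ.side_mem _), mul_one]

lemma factor_visible (ha : Visible σ a) (hb : Visible σ b) (J : Option (ZMod n)) (s : Bool) (m :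
    ℤ) (hs : s = true ↔ J = none ∨ J = some a.fst ∧ J = some b.snd) : uPow K m * factor σ K J a b =
    mono K (mainTag σ) s m := by
  rw [factor, if_pos ⟨ha, hb⟩, mono]
  grind

lemma cast_eq_iff_of_lt (h1 : x < y + n := by omega) (h2 : y < x + n := by omega) :
    (x : ZMod n) = y ↔ x = y := ⟨fun h => eq_of_cast_eq h h1 h2, fun h => h ▸ rfl⟩

/-- The matrix of an arrow records its `θ`-length and its mark. -/
lemma Step.value {X₀ Y₀ X Y : ℤ} {s : Bool} {h : EdgeMat σ K E} (H :
    Step σ (matData σ K E) X₀ Y₀ X Y s h) : h = eUnit σ K E (ed σ X₀ Y₀) (ed σ X Y) (mono K (mainTag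
    σ) s (X + Y - X₀ - Y₀)) := by
  have F := H.facts
  -- the angle and the mark of an internal arrow
  have key : ∀ (J : Option (ZMod n)), X < X₀ + n → Y < Y₀ + n →
      (s = true ↔ J = none ∨ J = pt(X₀) ∧ J = pt(Y)) →
      (matData σ K E).ar J (ed σ X₀ Y₀) (ed σ X Y) = eUnit σ K E (ed σ X₀ Y₀) (ed σ X Y)
        (mono K (mainTag σ) s (X + Y - X₀ - Y₀)) := by
    intro J h1 h2 h3
    refine congrArg (eUnit σ K E _ _) ?_
    rw [theta_eq V.ed_fst V.ed_snd V.ed_fst V.ed_snd F.2.2.1 h1 F.2.2.2.1 h2,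
      show X - X₀ + (Y - Y₀) = X + Y - X₀ - Y₀ by ring]
    exact factor_visible (visible_ed _ _) (visible_ed _ _) J s _ (by rw [V.ed_fst, V.ed_snd]; exact h3)
  have e1 : ∀ x : ℤ, ((x - n : ℤ) : ZMod n) = x := fun x => by simp
  cases H with
  | lam H =>
    rw [H.larr.2]
    have b : X < X₀ + n ∧ Y < Y₀ + n := by
      cases H with
      | right w t => have := t.lt; omega
      | left z t => have := t.lt; omega
      | punc t => have := t.xy.1; omega
    refine key _ b.1 b.2 ?_
    · cases H with
      | right w t =>
        have := t.lt
        rw [decide_eq_true_iff]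
        constructor
        · rintro rfl
          simp
        · rintro (h | ⟨h, -⟩)
          · cases h
          · have h := Option.some.inj h
            rw [← e1] at h
            have := (cast_eq_iff_of_lt).1 h
            omega
      | left z t => simp
      | punc t => simp
  | rho hne H =>
    cases H with
    | tri u t =>
      have := t.lt
      apply key _ (by omega) (by omega)
      constructor
      · intro h; cases h
      · rintro (h | ⟨-, h⟩)
        · cases h
        · have := (cast_eq_iff_of_lt).1 (Option.some.inj h)
          omega
    | ext e =>
      subst e
      have s1 := isChord_side (σ := σ) (Y₀ - 1)
      rw [sub_add_cancel] at s1
      have s2 := isChord_side (σ := σ) Y₀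
      simp only [matData]
      rw [s1.ed, s2.ed, side_int, side_int_pred]
      congr 1
      rw [mono, if_neg (by simp), mul_one]
      congr 1
      ring
  | sig he H =>
    subst he
    cases H with
    | digon m t =>
      have := t.lt
      exact key _ (by omega) (by omega) (by simp)
    | chord u t =>
      have := t.xy.1
      exact key _ (by omega) (by omega) (by simp)
    | spoke v t =>
      have := t.V.2.2.2
      have := t.xy.1
      exact key _ (by omega) (by omega) (by simp)

lemma Run.value {g : EdgeMat σ K E} (H : Run σ (matData σ K E) x y X
    Y f g) : g = eUnit σ K E (ed σ x y) (ed σ X Y) (mono K (mainTag σ) f (X + Y - x - y)) := by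
  induction H with
  | nil h =>
    rw [show x + y - x - y = 0 by ring, mono_zero]
    rfl
  | cons hg hs ih =>
    have hV := hg.facts.2.1
    rw [ih, hs.value, eUnit_mul hV.2.2, mono_mul]
    ring_nf

lemma Run.eq_of_flag {f' : Bool} {g g' : EdgeMat σ K E} (H : Run σ
    (matData σ K E) x y X Y f g) (H' : Run σ (matData σ K E) x y X Y f' g') (h : f = f') : g = g'
    := by
  subst h
  rw [H.value, H'.value]

end Mat

end

section
variable {n : ℕ} [hn : Fact (2 ≤ n)] {σ : TaggedTriangulation n}

variable {m x : ℤ} {a b : Edge n}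

variable {K : Type*} [Field K] {E : Set (ZMod n)}

/-! ### The matrices satisfy the relations -/

lemma factor_invisible (h : ¬ (Visible σ a ∧ Visible σ b))
    (J : Option (ZMod n)) : factor σ K J a b = eps K .notched := if_neg h

lemma IsDigon.invisible (h : IsDigon σ x) : ¬ Visible σ (sp x .notched) := fun hv => by
  have := h.visible_iff.1 hv
  cases this

lemma theta_digon_in (h1 : IsChord σ x m) (t : Tag) :
    (theta (ch x m : Edge n) (sp x t) : ℤ) = x + n - m := by
  have h := h1.1
  have h' := h1.2.1
  rw [theta_eq (x := x) (y := m) (x' := x) (y' := x + n) rfl rfl rfl (by simp [snd]) le_rfl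
    (by omega) (by omega) (by omega)]
  ring

lemma theta_digon_out (h1 : IsChord σ x m) (t : Tag) :
    (theta (sp x t : Edge n) (ch m x) : ℤ) = m - x := by
  have h := h1.1
  have h' := h1.2.1
  rw [theta_eq (x := x) (y := x + n) (x' := m) (y' := x + n) rfl (by simp [snd]) rfl
    (by simp [snd]) (by omega) (by omega) le_rfl (by omega)]
  ring

lemma matData_invisible {i : Fin 3} {k : ZMod n} {J₁ J₂ : Option (ZMod n)} {c : Edge n}
    (h : LArr σ i (some k) J₁ J₂ a b c) (hv : ¬ (Visible σ a ∧ Visible σ b)) :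
    (matData σ K E).ar J₁ b c * (matData σ K E).ar J₂ c a = 0 := by
  simp only [matData]
  rw [eUnit_mul h.mem.2.2]
  have e : ∀ (m : ℤ) (d : IsDigon σ m), mainTag σ = .plain := fun m d => d.mainTag
  suffices h : factor σ K J₁ b c * factor σ K J₂ c a = 0 by
    rw [mul_mul_mul_comm, h, mul_zero, eUnit_zero]
  have hε := eps_mul K
  generalize hJ : some k = J at h
  cases h with
  | A1 => exact absurd ⟨visible_chord _ _, visible_chord _ _⟩ hv
  | A2 => exact absurd ⟨visible_chord _ _, visible_chord _ _⟩ hv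
  | A3 => exact absurd ⟨visible_chord _ _, visible_chord _ _⟩ hv
  | B1 x y τ h1 h2 h3 =>
    exact absurd ⟨visible_chord _ _, visible_of_not_digon h2 (h1.not_digon h2 h3).1⟩ hv
  | B2 => cases hJ
  | B3 x y τ h1 h2 h3 =>
    exact absurd ⟨visible_of_not_digon h3 (h1.not_digon h2 h3).2, visible_chord _ _⟩ hv
  | D1 => exact absurd ⟨visible_chord _ _, visible_chord _ _⟩ hv
  | D2 x m τ h1 h2 h3 =>
    rw [factor_invisible fun h => hv ⟨visible_chord _ _, h.1⟩, factor,
      if_pos ⟨visible_chord _ _, visible_chord _ _⟩, if_pos (.inr ⟨rfl, rfl⟩), h3.mainTag, mul_comm]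
    exact hε
  | D3 x m τ h1 h2 h3 =>
    rw [factor_invisible fun h => hv ⟨h.2, visible_chord _ _⟩, factor,
      if_pos ⟨visible_chord _ _, visible_chord _ _⟩, if_pos (.inr ⟨rfl, rfl⟩), h3.mainTag]
    exact hε

lemma matData_digon (h1 : IsChord σ x m) (h3 : IsDigon σ x) :
    (matData σ K E).digonSum x m = eUnit σ K E (ch x m) (ch m x) (uPow K n) := by
  simp only [ArrowData.digonSum, matData]
  rw [eUnit_mul h3.1, eUnit_mul h3.2, ← eUnit_add]
  congr 1
  simp only [theta_digon_in h1, theta_digon_out h1]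
  have f1 : factor σ K pt(x) (ch x m) (sp x .plain) = eps K .plain := by
    rw [factor, if_pos ⟨visible_chord _ _, visible_plain _⟩, if_pos (.inr ⟨rfl, rfl⟩), h3.mainTag]
  have f2 : factor σ K pt(x) (sp x .plain) (ch m x) = eps K .plain := by
    rw [factor, if_pos ⟨visible_plain _, visible_chord _ _⟩, if_pos (.inr ⟨rfl, rfl⟩), h3.mainTag]
  have key : ∀ (t : Tag) (i j : ℤ),
      uPow K i * eps K t * (uPow K j * eps K t) = uPow K (i + j) * eps K t := fun t i j => by
    rw [mul_mul_mul_comm, ← uPow_add, eps_idem]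
  rw [f1, f2, factor_invisible fun h => h3.invisible h.2, factor_invisible fun h => h3.invisible h.1,
    key, key, ← mul_add, eps_add, mul_one]
  congr 1
  ring

lemma matData_relations : (matData σ K E).Relations σ fun _ _ _ => True where
  fan h _ ha hb hc hp hq := by
    obtain ⟨κ, x, y, X, Y, f, rfl, h1, h2, rfl, rfl, h3, h4, h5, h6⟩ :=
      h.third_run (matData_lawful (K := K) (E := E)) ha hb hc
    obtain ⟨f', hr, hf⟩ := exists_turn matData_lawful h1 h2 h3 h4 hq hp
    exact h5.eq_of_flag hr (by rw [Bool.eq_iff_iff, h6, hf])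
  digon := by
    intro x m p q h1 h2 h3 _ hp hq
    have l1 := h1.1
    have l2 := h2.1
    rw [matData_digon h1 h3]
    obtain ⟨f, hr, hf⟩ := exists_turn matData_lawful h1.V h2.V (.inr rfl) (.inl rfl)
      (by rw [h1.ed]; exact hq) (by rw [h2.ed]; simpa [ch] using hp)
    obtain rfl : f = false := Bool.eq_false_iff.2 fun e => by have := hf.1 e; omega
    rw [hr.value, h1.ed, h2.ed, mono, if_neg (by simp), mul_one]
    simp only [ch, cast_add_n]
    congr 2
    ring
  invisible h _ hv := matData_invisible h hv
  wind := by
    intro t x y r h1 h2 h3 _ hr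
    obtain rfl := tag_eq_of_visible h2 (visible_of_not_digon h2 (h1.not_digon h2 h3).1)
    have T : PTri σ x y := ⟨h1, h2, h3⟩
    have s1 : Step σ (matData σ K E) _ _ _ _ _ _ := .lam (.punc T)
    have hrun := s1.run₂ matData_lawful (.sig rfl (.chord _ T))
    obtain ⟨f, hf⟩ := hr.run h3.V
    have l := h1.2.1
    obtain rfl : f = true := by
      have := hf.facts.2.2.2.2.2
      cases f
      · have := this rfl; omega
      · rfl
    have e1 := hrun.value
    rw [h1.ed, ed_spoke, ed_spoke] at e1
    rw [e1, hf.value, ← ed_sub (x + n) (x + n + n), ← ed_sub y (y + n)]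
    simp only [add_sub_cancel_right, ed_spoke, Bool.or_true]
    congr 2
    ring

variable (K σ E) in
/-- The representation of `Γ_σ` by matrices. -/
def matRep : Gamma' K σ →ₐ[K] EdgeMat σ K E :=
  describes_internal.lift matData_lawful matData_relations

end

section
variable {n : ℕ} [hn : Fact (2 ≤ n)] {σ : TaggedTriangulation n} {B : Type*} [Ring B]
  {D : ArrowData n B}

variable {X Y k m x y : ℤ} {f : Bool} {J : Option (ZMod n)} {a b c : Edge n} {g : B}

/-! ### A spanning set of the algebra -/

lemma LArr.exists_step {i : Fin 3} {J₁ J₂ : Option (ZMod n)}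
    (hV : V σ X Y) (h : LArr σ i J J₁ J₂ (ed σ X Y) b c) (hb : Visible σ b) :
    ∃ X' Y' s, Step σ D X Y X' Y' s (D.ar J (ed σ X Y) b) ∧ b = ed σ X' Y' := by
  by_cases hY : Y = X + n
  · subst hY
    rw [ed_spoke] at h
    rcases h.out_spoke with ⟨y, h1, h2, h3, rfl, rfl, -, -, rfl, -⟩ |
      ⟨w, h1, h2, h3, rfl, rfl, -, -, rfl, -⟩ | ⟨m, h0, h1, h2, rfl, rfl, -, -, rfl, -⟩
    · have := Step.sig (D := D) rfl (.spoke X ⟨h1, h2, h3⟩)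
      rw [ed_spoke, ed_spoke] at this
      rw [ed_spoke]
      exact ⟨_, _, _, this, (ed_spoke y).symm⟩
    · have := Step.lam (D := D) (.punc (PTri.add ⟨h1, h2, h3⟩))
      simp only [add_sub_cancel_right, ed_add, cast_add_n] at this
      rw [h1.ed] at this
      exact ⟨_, _, _, this, by rw [ed_add, h1.ed]⟩
    · have t := h0.tri h1 h2
      have := Step.lam (D := D) (.right X t)
      simp only [cast_add_n] at this
      rw [h2.ed, ch_add_n] at this
      exact ⟨_, _, _, this, by rw [h2.ed, ch_add_n]⟩
  · have H := hV.chord hY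
    rw [H.ed] at h ⊢
    rcases h.out_chord H with ⟨κ, t, hκ, -, rfl, -, -, rfl, -⟩ | ⟨w, h1, h2, -, rfl, -, -, rfl, -⟩
    · cases κ with
      | right w =>
        have t := hκ.1.tri H hκ.2
        have := Step.lam (D := D) (.left _ t.add)
        simp only [add_sub_cancel_right, ed_add, cast_add_n] at this
        rw [H.ed, hκ.1.ed] at this
        exact ⟨_, _, _, this, by rw [ed_add, hκ.1.ed]; rfl⟩
      | left z =>
        have t := H.tri hκ.1 hκ.2
        have := Step.rho (D := D) hκ.2.2.1.ne (.tri _ t)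
        rw [H.ed, hκ.2.ed] at this
        exact ⟨_, _, _, this, by rw [hκ.2.ed]; rfl⟩
      | spokes τ =>
        obtain rfl := tag_eq_of_visible hκ.1 hb
        have := Step.sig (D := D) rfl (.chord _ ⟨H, hκ.1, hκ.2⟩)
        rw [H.ed, ed_spoke] at this
        exact ⟨_, _, _, this, by rw [ed_spoke]; rfl⟩
      | digon₁ =>
        obtain rfl := hκ.1.visible_iff.1 hb
        have t := hκ.1.tri H hκ.2
        have := Step.sig (D := D) rfl (.digon _ t)
        rw [H.ed, ed_spoke, hκ.1.mainTag] at this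
        exact ⟨_, _, _, this, by rw [ed_spoke, hκ.1.mainTag]; rfl⟩
      | digon₂ =>
        have h2 := isChord_add.2 hκ.2
        rw [sub_add_cancel] at h2
        have t := hκ.1.tri h2 (isChord_add.2 H)
        have := Step.lam (D := D) (.left _ t)
        simp only [add_sub_cancel_right, ed_add, cast_add_n] at this
        rw [H.ed, h2.ed, ch_add_n] at this
        exact ⟨_, _, _, this, by rw [h2.ed, ch_add_n]; rfl⟩
    · have t := h1.tri h2 H
      have := Step.lam (D := D) (.right _ t)
      rw [H.ed, h2.ed] at this
      exact ⟨_, _, _, this, h2.ed.symm⟩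

lemma exists_digon_of_not_visible (ha : a ∈ σ.edges) (hv : ¬ Visible σ a) :
    ∃ k m : ℤ, a = sp k .notched ∧ Tri σ k m (k + n) := by
  rw [Visible, not_not] at hv
  obtain ⟨r, rfl, hp⟩ := hv
  obtain ⟨k, -, -, rfl⟩ := exists_lift r 0
  have hd : IsDigon σ k := ⟨hp, ha⟩
  obtain ⟨m, h1, h2⟩ := hd.exists_chord
  exact ⟨k, m, rfl, hd.tri h1 h2⟩

lemma exists_ed_of_visible (ha : a ∈ σ.edges) (hv : Visible σ a) :
    ∃ x y : ℤ, a = ed σ x y ∧ V σ x y := by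
  obtain ⟨x, y, H, rfl⟩ | ⟨x, t, H, rfl⟩ := edge_cases ha
  · exact ⟨x, y, H.ed.symm, H.V⟩
  · obtain rfl := tag_eq_of_visible H hv
    exact ⟨x, _, (ed_spoke x).symm, H.V⟩

section Def
variable (σ D)

/-- `Start a x y x' y' c`: a path starting at the edge `a` with lift `(x, y)` begins with the path
`c`, followed by a visible path starting at `(x', y')`. The path `c` is trivial if `a` is visible,
and an arrow otherwise. -/
inductive Start : Edge n → ℤ → ℤ → ℤ → ℤ → B → Prop
  | vis {x y : ℤ} (h : V σ x y) : Start (ed σ x y) x y x y (D.ide (ed σ x y))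
  | notched {k m : ℤ} (t : Tri σ k m (k + n)) : Start (sp k .notched) k (k + n) m (k + n)
      (D.ar pt(k) (sp k .notched) (ed σ m (k + n)))

/-- `Stop b X Y X' Y' d`: a path ending at the edge `b` with lift `(X, Y)` consists of a visible path
ending at `(X', Y')`, followed by `d`. -/
inductive Stop : Edge n → ℤ → ℤ → ℤ → ℤ → B → Prop
  | vis {X Y : ℤ} (h : V σ X Y) : Stop (ed σ X Y) X Y X Y (D.ide (ed σ X Y))
  | notched {k m : ℤ} (t : Tri σ k m (k + n)) : Stop (sp k .notched) k (k + n) k m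
      (D.ar pt(k) (ed σ k m) (sp k .notched))

/-- The standard elements: the classes of certain paths from the edge `a` with lift `(x, y)` to
the edge `b` with lift `(X, Y)`. -/
inductive Std (a b : Edge n) (x y : ℤ) : ℤ → ℤ → Bool → B → Prop
  | run {x' y' X' Y' X Y : ℤ} {f : Bool} {c r d : B} (hc : Start σ D a x y x' y' c)
      (hr : Run σ D x' y' X' Y' f r) (hd : Stop σ D b X Y X' Y' d) : Std a b x y X Y f (c * r * d)
  | ide (k : ℤ) (hk : IsDigon σ k) (ha : a = sp k .notched) (hb : b = a) (hx : x = k)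
      (hy : y = k + n) : Std a b x y x y false (D.ide a)

end Def

lemma mul_mem_of_forall {K M : Type*} [Field K] [Ring M] [Algebra K M] {S : Set M} {N : Submodule
    K M} {x h : M} (hx : x ∈ Submodule.span K S) (H : ∀ g ∈ S, g * h ∈ N) : x * h ∈ N := by
  induction hx using Submodule.span_induction with
  | mem g hg => exact H g hg
  | zero => rw [zero_mul]; exact N.zero_mem
  | add u v _ _ hu hv => rw [add_mul]; exact N.add_mem hu hv
  | smul c u _ hu => rw [smul_mul_assoc]; exact N.smul_mem c hu

section Span
variable {K : Type*} [Field K] [Algebra K B]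
variable (K σ D) in
/-- The span of the standard elements. -/
def stdSpan (a b : Edge n) (x y : ℤ) : Submodule K B :=
  Submodule.span K {g | ∃ X Y f, Std σ D a b x y X Y f g}

lemma Std.mem (h : Std σ D a b x y X Y f g) :
    g ∈ stdSpan σ D K a b x y := Submodule.subset_span ⟨_, _, _, h⟩

variable (hD : D.Lawful σ Set.univ) (hR : D.Relations σ fun _ _ _ => True)
include hD hR

/-- The span is stable under multiplication by internal arrows. The composition of the two arrows
through the notched arc of a digon is rewritten by the relations. -/
lemma Std.mul_ar {a b c : Edge n} {x y X Y : ℤ} {f : Bool} {g : B} {J : Option (ZMod n)} (h : Std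
    σ D a b x y X Y f g) (H : Corner σ J b c) : g * D.ar J b c ∈ stdSpan σ D K a c x y := by
  obtain ⟨i, J₁, J₂, e, L⟩ := corner_iff.1 H
  cases h with
  | @run x' y' X' Y' X Y f _ r _ hc hr hd =>
    cases hd with
    | vis hV =>
      rw [mul_assoc _ (D.ide _), hD.ide_ar H, mul_assoc]
      by_cases hv : Visible σ c
      · obtain ⟨X', Y', s, hs, rfl⟩ := L.exists_step (D := D) hV hv
        have := Std.run hc (hr.cons hs) (.vis hs.facts.2.1)
        rw [mul_assoc, (hr.cons hs).mul_ide hD] at this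
        exact this.mem
      · obtain ⟨k, m, rfl, t⟩ := exists_digon_of_not_visible L.mem.2.1 hv
        have hk := t.digon rfl
        obtain ⟨m', h1, h2, rfl, h3⟩ := L.in_digon hk
        · have hne : Y ≠ X + n := by
            rintro rfl
            rw [ed_spoke] at h3
            cases h3
          obtain ⟨j, rfl, rfl⟩ := h1.exists_shift (hV.chord hne)
            ((congrArg Edge.fst h3).symm.trans V.ed_fst) ((congrArg Edge.snd h3).symm.trans V.ed_snd)
          have h4 := h2.sh j
          rw [add_right_comm] at h4
          have := Std.run hc hr (.notched ((hk.shift j).tri (h1.sh j) h4))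
          rw [cast_shift, sp, cast_shift, mul_assoc] at this
          exact this.mem
    | notched t =>
      have hk := t.digon rfl
      obtain ⟨m', h1, h2, rfl, rfl, -⟩ := L.out_digon hk
      · obtain rfl := t.right_unique (hk.tri h1 h2)
        obtain ⟨X₁, Y₁, h', H'⟩ := t.yz.exists_rho (D := D) t.chord₂.2.1.ne
        obtain ⟨r', hr', e⟩ := t.digon_rel hD hR H'
        have s1 := Std.run hc ((hr.trans hD hr').cons (.rho t.chord₂.2.1.ne H')) (.vis t.yz)
        have hs : Step σ D X (X + n) Y' (X + n) _ _ := .lam (.right X t)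
        have s2 := Std.run hc ((hr.cons (.sig rfl (.digon Y' t))).cons hs) (.vis t.yz)
        have hr1 := ((hr.trans hD hr').cons (.rho t.chord₂.2.1.ne H')).mul_ide hD
        have hr2 := ((hr.cons (.sig rfl (.digon Y' t))).cons hs).mul_ide hD
        rw [mul_assoc, hr1] at s1
        rw [mul_assoc, hr2] at s2
        rw [cast_add_n] at s2
        have e3 : (ed σ Y' (X + n) : Edge n) = ch Y' X := by rw [t.chord₂.ed, ch_add_n]
        rw [e3] at s1 s2 e
        have := (stdSpan σ D K _ _ x y).sub_mem s1.mem s2.mem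
        convert this using 1
        rw [mul_assoc r r' h', ← e]
        noncomm_ring
  | ide k hk ha hb hx hy =>
    subst hb hx hy
    subst ha
    obtain ⟨m', h1, h2, rfl, rfl, -⟩ := L.out_digon hk
    · have t := hk.tri h1 h2
      have := Std.run (.notched t) (Run.nil (D := D) h2.V) (.vis h2.V)
      have e3 : (ed σ m' (x + n) : Edge n) = ch m' x := by rw [h2.ed, ch_add_n]
      rw [mul_assoc, hD.idem _ h2.V.2.2, e3, hD.ar_ide H] at this
      rw [hD.ide_ar H]
      exact this.mem

lemma Std.mul_ex {k : ZMod n}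
    (h : Std σ D a (side (k - 1)) x y X Y f g) : g * D.ex k ∈ stdSpan σ D K a (side k) x y := by
  generalize hb : side (k - 1) = b at h
  cases h with
  | run hc hr hd =>
    cases hd with
    | @vis X Y hV =>
      have hne : Y ≠ X + n := by
        rintro rfl
        rw [ed_spoke] at hb
        cases hb
      have e1 : ((X + 1 : ℤ) : ZMod n) = k := by
        have := congrArg Edge.fst hb
        rw [V.ed_fst, side, fst] at this
        push_cast
        rw [← this, sub_add_cancel]
      obtain ⟨-, rfl⟩ := (V.side X).eq_of_ed_eq hV (by
        rw [← hb, (isChord_side X).ed, ← e1, side_int_pred]; simp) (by have := two_le_int (n := n); omega)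
        (by have := two_le_int (n := n); omega)
      have hs : Step σ D X (X + 1) (X + 1) (X + 1 + 1) false (D.ex ((X + 1 : ℤ) : ZMod n)) := by
        have := Step.rho (D := D) (σ := σ) (isChord_side (σ := σ) (X + 1)).2.1.ne (.ext rfl)
        rwa [add_sub_cancel_right] at this
      have := Std.run hc (hr.cons hs) (.vis (V.side (X + 1)))
      rw [mul_assoc, (hr.cons hs).mul_ide hD, e1, (isChord_side (X + 1)).ed, ← side_int, e1] at this
      rw [← hb, mul_assoc _ (D.ide _), hD.ide_ex _ trivial, mul_assoc]
      exact this.mem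
    | notched t => cases hb
  | ide k hk ha hb' hx hy =>
    rw [hb', ha] at hb
    cases hb

end Span

lemma exists_start (D : ArrowData n B) (ha : a ∈ σ.edges) :
    ∃ x y x' y' c, Start σ D a x y x' y' c := by
  by_cases hv : Visible σ a
  · obtain ⟨x, y, rfl, h⟩ := exists_ed_of_visible ha hv
    exact ⟨_, _, _, _, _, .vis h⟩
  · obtain ⟨k, m, rfl, t⟩ := exists_digon_of_not_visible ha hv
    exact ⟨_, _, _, _, _, .notched t⟩

/-- The standard elements span the algebra. -/
lemma pathClass_mem_stdSpan {K : Type*} [Field K] {a b : Q' σ} {x' y' : ℤ} {c : Gamma' K σ}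
    (hs : Start σ (gammaData' K σ) a.1 x y x' y' c) (p : Path a b) :
    cls' K p ∈ stdSpan σ (gammaData' K σ) K a.1 b.1 x y := by
  have hD := gammaData'_lawful (K := K) (σ := σ)
  have hR := gammaData'_relations (K := K) (σ := σ)
  refine pathClass_induction (P := fun b g => g ∈ stdSpan σ (gammaData' K σ) K a.1 b x y)
    ?_ (fun H h => mul_mem_of_forall h fun g ⟨_, _, _, hg⟩ => hg.mul_ar hD hR H)
    (fun _ h => mul_mem_of_forall h fun g ⟨_, _, _, hg⟩ => hg.mul_ex hD hR) p
  generalize a.1 = a at hs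
  cases hs with
  | vis h =>
    have := Std.run (D := gammaData' K σ) (.vis h) (.nil h) (.vis h)
    rw [hD.idem _ h.2.2, hD.idem _ h.2.2] at this
    exact this.mem
  | notched t => exact (Std.ide _ (t.digon rfl) rfl rfl rfl rfl).mem

/-! ### Uniqueness of the standard elements -/

section Unique
variable (hD : D.Lawful σ Set.univ) (hR : D.Relations σ fun _ _ _ => True)
include hD hR

lemma Run.notched_mul {r : B} (t : Tri σ k m (k + n)) (H : Run σ D m (k + n) X Y true r) : D.ar
    pt(k) (sp k .notched) (ed σ m (k + n)) * r = 0 := by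
  have hk := t.digon rfl
  have hlt := t.lt
  obtain ⟨h1, h2, h3, h4, h5, -⟩ := H.facts
  have := h5 rfl
  have l := h2.lt
  have n1 := h1.nc h2
  have n2 : ¬ (Y = X + n ∧ k < X ∧ X < k + n) := fun ⟨e, h3, h4⟩ =>
    hk.not_between (e ▸ h2) h3 h4
  have hs : Step σ D _ _ _ _ _ _ := .lam (.left _ t.add)
  simp only [add_sub_cancel_right] at hs
  obtain ⟨b, r', hr⟩ := Run.exists_any (D := D) hs.facts.2.1 h2
  have := (hs.run hD).trans hD hr
  rw [Bool.true_or] at this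
  rw [Run.unique hD hR _ _ _ _ _ _ _ H this, ← mul_assoc]
  have L := LArr.D2 k m .notched t.chord₁ t.chord₂ hk
  have := hR.invisible L trivial fun hv => by cases hk.visible_iff.1 hv.2
  rw [ed_add, ed_add, t.chord₂.ed, t.chord₁.ed, cast_add_n, ch_add_n, this, zero_mul]

end Unique

end

section
variable {n : ℕ} [hn : Fact (2 ≤ n)] {σ : TaggedTriangulation n} {B : Type*} [Ring B]
  {D : ArrowData n B}

variable {X Y x x' y y' : ℤ} {f : Bool} {t : Tag} {a b : Edge n} {c g : B}

lemma not_visible_of_tri {k m : ℤ} (t : Tri σ k m (k + n)) : ¬ Visible σ (sp k .notched) :=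
  (t.digon rfl).invisible

lemma Start.unique {x₁ y₁ x₂ y₂ : ℤ} {c₁ c₂ : B} (h₁ : Start σ D a x y x₁ y₁ c₁) (h₂ : Start σ D a
    x y x₂ y₂ c₂) : x₂ = x₁ ∧ y₂ = y₁ ∧ c₂ = c₁ := by
  generalize hb : a = b at h₂
  cases h₁ with
  | vis h =>
    cases h₂ with
    | vis h' => exact ⟨rfl, rfl, rfl⟩
    | notched t => exact (not_visible_of_tri t (hb ▸ visible_ed _ _)).elim
  | notched t =>
    cases h₂ with
    | vis h' => exact (not_visible_of_tri t (hb ▸ visible_ed _ _)).elim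
    | notched t' =>
      obtain rfl := t.right_unique t'
      exact ⟨rfl, rfl, rfl⟩

lemma Stop.unique {X₁ Y₁ X₂ Y₂ : ℤ} {d₁ d₂ : B} (h₁ : Stop σ D b X Y X₁ Y₁ d₁) (h₂ : Stop σ D b X
    Y X₂ Y₂ d₂) : X₂ = X₁ ∧ Y₂ = Y₁ ∧ d₂ = d₁ := by
  generalize hb : b = b' at h₂
  cases h₁ with
  | vis h =>
    cases h₂ with
    | vis h' => exact ⟨rfl, rfl, rfl⟩
    | notched t => exact (not_visible_of_tri t (hb ▸ visible_ed _ _)).elim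
  | notched t =>
    cases h₂ with
    | vis h' => exact (not_visible_of_tri t (hb ▸ visible_ed _ _)).elim
    | notched t' =>
      obtain rfl := t.right_unique t'
      exact ⟨rfl, rfl, rfl⟩

/-- A lift of an edge: a pair of integers representing its ends, where the lifts of the arcs to the
puncture are the pairs `(x, x + n)`. -/
inductive Lift (σ : TaggedTriangulation n) : Edge n → ℤ → ℤ → Prop
  | chord {x y : ℤ} (h : IsChord σ x y) : Lift σ (ch x y) x y
  | spoke {x : ℤ} {t : Tag} (h : IsSpoke σ t x) : Lift σ (sp x t) x (x + n)

lemma V.lift (h : V σ x y) : Lift σ (ed σ x y) x y := by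
  by_cases hy : y = x + n
  · subst hy
    rw [ed_spoke]
    exact .spoke h.spoke
  · rw [ed_chord hy]
    exact .chord (h.chord hy)

lemma Lift.facts (h : Lift σ a x y) :
    a ∈ σ.edges ∧ a.fst = x ∧ a.snd = y ∧ x < y ∧ y ≤ x + n := by
  have := two_le_int (n := n)
  cases h with
  | chord h => exact ⟨h.2.2, rfl, rfl, h.1, h.2.1.le⟩
  | spoke h => exact ⟨h, rfl, by simp [snd], by omega, le_rfl⟩

lemma Lift.eq_shift (h : Lift σ a x y) (H : Lift σ a X Y) :
    ∃ i : ℤ, X = x + n * i ∧ Y = y + n * i := by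
  generalize hb : a = b at H
  cases h with
  | chord h =>
    cases H with
    | chord H => exact h.exists_shift H (congrArg Edge.fst hb) (congrArg Edge.snd hb)
    | spoke H => cases hb
  | spoke h =>
    cases H with
    | chord H => cases hb
    | spoke H =>
      obtain ⟨i, rfl⟩ := exists_shift (congrArg Edge.fst hb)
      exact ⟨i, rfl, by ring⟩

lemma Lift.sh (h : Lift σ a x y) (i : ℤ) : Lift σ a (x + n * i) (y + n * i) := by
  cases h with
  | chord h => simpa [ch] using Lift.chord (h.sh i)
  | spoke h => simpa [sp, add_right_comm] using Lift.spoke (h.sh i)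

lemma exists_lift_edge (ha : a ∈ σ.edges) : ∃ x y, Lift σ a x y := by
  obtain ⟨x, y, H, rfl⟩ | ⟨x, t, H, rfl⟩ := edge_cases ha
  · exact ⟨_, _, .chord H⟩
  · exact ⟨_, _, .spoke H⟩

lemma Start.lift (h : Start σ D a x y x' y' c) : Lift σ a x y := by
  cases h with
  | vis h => exact h.lift
  | notched t => exact .spoke (t.digon rfl).2

lemma Stop.lift (h : Stop σ D a x y x' y' c) : Lift σ a x y := by
  cases h with
  | vis h => exact h.lift
  | notched t => exact .spoke (t.digon rfl).2

lemma Std.lift (h : Std σ D a b x y X Y f g) : Lift σ a x y ∧ Lift σ b X Y := by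
  cases h with
  | run hc hr hd => exact ⟨hc.lift, hd.lift⟩
  | ide k hk ha hb hx hy =>
    subst ha hb hx hy
    exact ⟨.spoke hk.2, .spoke hk.2⟩

lemma Lift.start_stop (D : ArrowData n B) (h : Lift σ a x y) :
    (∃ x' y' c, Start σ D a x y x' y' c ∧ x ≤ x' ∧ y ≤ y') ∧
      ∃ x' y' c, Stop σ D a x y x' y' c := by
  have vis : ∀ {x y}, V σ x y → ed σ x y = a → (∃ x' y' c, Start σ D a x y x' y' c ∧ x ≤ x' ∧
      y ≤ y') ∧ ∃ x' y' c, Stop σ D a x y x' y' c := by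
    rintro x y hV rfl
    exact ⟨⟨_, _, _, .vis hV, le_rfl, le_rfl⟩, _, _, _, .vis hV⟩
  cases h with
  | chord h => exact vis h.V h.ed
  | @spoke x t h =>
    by_cases hv : Visible σ (sp x t)
    · obtain rfl := tag_eq_of_visible h hv
      exact vis h.V (ed_spoke _)
    · obtain ⟨k, m, e, T⟩ := exists_digon_of_not_visible h hv
      injection e with e1 e2
      subst e2
      have hd := (T.digon rfl).of_cast e1.symm
      obtain ⟨m', h1, h2⟩ := hd.exists_chord
      have t := hd.tri h1 h2
      exact ⟨⟨_, _, _, .notched t, h1.1.le, le_rfl⟩, _, _, _, .notched t⟩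

/-! ### The marks of the standard elements -/

/-- The edge is an arc to the puncture with tag `t`. -/
def HasTag (t : Tag) (a : Edge n) : Prop := ∃ r, a = spoke r t

/-- Neither edge is incident to the puncture. -/
def BothChords (a b : Edge n) : Prop := ∀ t, ¬ HasTag t a ∧ ¬ HasTag t b

lemma Std.le (h : Std σ D a b x y X Y f g) : x ≤ X ∧ y ≤ Y := by
  cases h with
  | run hc hr hd =>
    have F := hr.facts
    cases hc with
    | vis h =>
      cases hd with
      | vis h' => omega
      | notched t => have := t.lt; omega
    | notched t =>
      have := t.lt
      cases hd with
      | vis h' => omega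
      | notched t' => have := t'.lt; omega
  | ide => omega

lemma ed_hasTag (h : HasTag t (ed σ x y)) : t = mainTag σ ∧ y = x + n := by
  obtain ⟨r, h⟩ := h
  by_cases hy : y = x + n
  · subst hy
    rw [ed_spoke] at h
    injection h with _ h
    exact ⟨h.symm, rfl⟩
  · rw [ed_chord hy] at h
    cases h

/-- If both ends are visible, the mark is determined by the lifts, unless neither edge is incident to
the puncture. -/
lemma Std.flag_of_visible (h : Std σ D a b x y X Y f g) (ha : Visible σ a) (hb : Visible σ b) (hc
    : ¬ BothChords a b) : (f = true ↔ x + y < X + Y) ∧ (f = false → a = b) := by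
  cases h with
  | run hs hr hd =>
    cases hs with
    | notched t => exact (not_visible_of_tri t ha).elim
    | vis h =>
      cases hd with
      | notched t => exact (not_visible_of_tri t hb).elim
      | vis h' =>
        have F := hr.facts
        obtain ⟨t, ht⟩ := not_forall.1 hc
        have : y = x + n ∨ Y = X + n := by
          by_contra hne
          exact ht ⟨fun h => hne (.inl (ed_hasTag h).2), fun h => hne (.inr (ed_hasTag h).2)⟩
        grind
  | ide k hk h1 hb' hx hy => exact (hk.invisible (h1 ▸ ha)).elim

/-- A path between arcs with different tags is marked and has an invisible end: it vanishes. -/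
lemma Std.flag_of_conflict (h : Std σ D a b x y X Y f g) {t' : Tag} (ha : HasTag t a) (hb : HasTag
    t' b) (ht : t ≠ t') : f = true ∧ ¬ (Visible σ a ∧ Visible σ b) := by
  cases h with
  | run hs hr hd =>
    have F := hr.facts
    cases hs with
    | notched T =>
      refine ⟨?_, fun h => not_visible_of_tri T h.1⟩
      cases f with
      | true => rfl
      | false =>
        cases hd with
        | vis h' =>
          have := T.lt
          have := (ed_hasTag hb).2
          obtain ⟨e1, e2, -⟩ | h6 := F.2.2.2.2.2 rfl <;> omega
        | notched T' =>
          obtain ⟨_, ha⟩ := ha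
          obtain ⟨_, hb⟩ := hb
          grind
    | vis h =>
      have e := ed_hasTag ha
      cases hd with
      | notched T =>
        refine ⟨?_, fun h => not_visible_of_tri T h.2⟩
        have := T.lt
        grind
      | vis h' => exact (ht (e.1.trans (ed_hasTag hb).1.symm)).elim
  | ide k hk h1 h2 hx hy =>
    subst h2
    obtain ⟨_, ha⟩ := ha
    obtain ⟨_, hb⟩ := hb
    rw [ha] at hb
    injection hb with _ e
    exact (ht e).elim

/-- Existence of standard elements. -/
lemma Std.exists (ha : Lift σ a x y) (hb : Lift σ b X Y)
    (hx : x ≤ X) (hy : y ≤ Y) (hc : ∀ t t', HasTag t a → HasTag t' b → t = t') :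
    ∃ f g, Std σ D a b x y X Y f g ∧ (f = true → Visible σ a ∧ Visible σ b) := by
  obtain ⟨x', y', c, hs, -, -⟩ := (ha.start_stop D).1
  obtain ⟨X', Y', d, hd⟩ := (hb.start_stop D).2
  cases hs with
  | vis h =>
    have l := h.lt
    cases hd with
    | vis h' =>
      obtain ⟨f, r, hr⟩ := Run.exists_any (D := D) h h' hx hy (by have := h'.lt; omega)
      exact ⟨_, _, .run (.vis h) hr (.vis h'), fun _ => ⟨visible_ed _ _, visible_ed _ _⟩⟩
    | notched t =>
      have l' := t.lt
      have hk := t.digon rfl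
      have hy' : y ≠ x + n := fun e => by
        have e1 := hc _ _ ⟨_, by rw [e]; exact ed_spoke x⟩ ⟨_, rfl⟩
        rw [hk.mainTag] at e1
        cases e1
      have n1 := h.nc t.yz
      have n2 := t.chord₂.2.1
      obtain ⟨r, hr⟩ := Run.exists_false (D := D) h t.xy hy' (by omega) hx
      exact ⟨_, _, .run (.vis h) hr (.notched t), by simp⟩
  | @notched k m t =>
    have l := t.lt
    have hk := t.digon rfl
    have l2 := t.chord₂.2.1
    cases hd with
    | vis h' =>
      have l' := h'.lt
      have hY : Y ≠ X + n := fun e => by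
        have e1 := hc _ _ ⟨_, rfl⟩ ⟨_, by rw [e]; exact ed_spoke X⟩
        rw [hk.mainTag] at e1
        cases e1
      have n1 := t.xy.nc h'
      obtain ⟨r, hr⟩ := Run.exists_false (D := D) t.yz h' (by omega) hY (by omega) hy
      exact ⟨_, _, .run (.notched t) hr (.vis h'), by simp⟩
    | notched t' =>
      have l' := t'.lt
      have e := hk.isSpoke_cast (t'.digon rfl).2
      by_cases hX : X < x + n
      · obtain rfl := eq_of_cast_eq e
        exact ⟨_, _, .ide _ hk rfl rfl rfl rfl, by simp⟩
      · have := t'.chord₁.2.1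
        obtain ⟨r, hr⟩ := Run.exists_false (D := D) t.yz t'.xy
        exact ⟨_, _, .run (.notched t) hr (.notched t'), by simp⟩

/-- Existence of standard elements of both marks between edges not incident to the puncture. -/
lemma IsChord.exists_std (ha : IsChord σ x y) (hb : IsChord σ X Y) (hx : x ≤ X) (hy : y ≤ Y) (f :
    Bool) (hf : f = true → x + n ≤ Y) : ∃ g, Std σ D (ch x y) (ch X Y) x y X Y f g := by
  have h1 := Start.vis (D := D) ha.V
  have h2 := Stop.vis (D := D) hb.V
  rw [ha.ed] at h1
  rw [hb.ed] at h2
  have := ha.2.1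
  cases f with
  | true =>
    obtain ⟨r, hr⟩ := Run.exists_true (D := D) ha.V hb.V hx (hf rfl) (by have := hf rfl; omega)
    exact ⟨_, .run h1 hr h2⟩
  | false =>
    obtain ⟨r, hr⟩ := Run.exists_false (D := D) ha.V hb.V ha.2.1.ne hb.2.1.ne hx hy
    exact ⟨_, .run h1 hr h2⟩

lemma Std.passing {p q r s : ℤ}
    (h : Std σ D (ch p q) (ch r s) x y X Y f g) (hf : f = true) : x + n ≤ Y := by
  generalize e1 : ch p q = a at h
  generalize e2 : ch r s = b at h
  cases h with
  | run hs hr hd =>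
    cases hs with
    | notched T => cases e1
    | vis h =>
      cases hd with
      | notched T => cases e2
      | vis h' => exact (hr.facts.2.2.2.2.1 hf).1
  | ide => cases hf

section Unique
variable (hD : D.Lawful σ Set.univ) (hR : D.Relations σ fun _ _ _ => True)
include hD hR

lemma Std.eq_zero
    (h : Std σ D a b x y X Y true g) (hv : ¬ (Visible σ a ∧ Visible σ b)) : g = 0 := by
  generalize hf : true = f at h
  cases h with
  | run hc hr hd =>
    subst hf
    cases hc with
    | vis h =>
      cases hd with
      | vis h' => exact (hv ⟨visible_ed _ _, visible_ed _ _⟩).elim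
      | notched t => rw [mul_assoc, hr.mul_notched hD hR t (Run.unique hD hR _ _ _ _), mul_zero]
    | notched t => rw [hr.notched_mul hD hR t, zero_mul]
  | ide => cases hf

/-- A standard element is determined by the lifts of its ends and its mark. -/
lemma Std.unique {g' : B}
    (h : Std σ D a b x y X Y f g) (h' : Std σ D a b x y X Y f g') : g = g' := by
  have key : ∀ {a b : Edge n} {k : ℤ} {f : Bool} (hk : IsDigon σ k)
      (ha : a = sp k .notched) (hb : b = a), ¬ ∃ x' y' X' Y' c r d,
      Start σ D a k (k + n) x' y' c ∧ Run σ D x' y' X' Y' f r ∧ Stop σ D b k (k + n) X' Y' d := by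
    rintro a b k f hk ha hb ⟨x', y', X', Y', c, r, d, hc, hr, hd⟩
    subst hb ha
    obtain ⟨m, h1, h2⟩ := hk.exists_chord
    obtain ⟨rfl, rfl, -⟩ := hc.unique (.notched (hk.tri h1 h2))
    obtain ⟨rfl, rfl, -⟩ := hd.unique (.notched (hk.tri h1 h2))
    have := hr.facts.2.2.1
    have := h1.1
    omega
  cases h with
  | run hc hr hd =>
    cases h' with
    | run hc' hr' hd' =>
      obtain ⟨rfl, rfl, rfl⟩ := hc.unique hc'
      obtain ⟨rfl, rfl, rfl⟩ := hd.unique hd'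
      rw [Run.unique hD hR _ _ _ _ _ _ _ hr hr']
    | ide k hk ha hb hx hy =>
      subst hx hy
      exact (key hk ha hb ⟨_, _, _, _, _, _, _, hc, hr, hd⟩).elim
  | ide k hk ha hb hx hy =>
    cases h' with
    | run hc' hr' hd' =>
      subst hx hy
      exact (key hk ha hb ⟨_, _, _, _, _, _, _, hc', hr', hd'⟩).elim
    | ide => rfl

end Unique

end

section
variable {n : ℕ} [hn : Fact (2 ≤ n)] {σ : TaggedTriangulation n}

variable {X Y k m x y : ℤ} {s : Bool} {J J₁ J₂ : Option (ZMod n)} {i : Fin 3} {a b c : Edge n}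

/-! ### The values of the standard elements -/

lemma Tri.larr_out (t : Tri σ k m (k + n)) (τ : Tag) : LArr σ 2 pt(k) (some (m :
    ZMod n)) pt(k) (sp k τ) (ed σ m (k + n)) (ed σ k m) := by
  rw [t.chord₁.ed, t.chord₂.ed, ch_add_n]
  exact .D3 k m τ t.chord₁ t.chord₂ (t.digon rfl)

lemma Tri.larr_in (t : Tri σ k m (k + n)) (τ : Tag) :
    LArr σ 1 pt(k) pt(k) pt(m) (ed σ k m) (sp k τ)
      (ed σ m (k + n)) := (t.larr_out τ).rotate.rotate

section Map
variable {B B' : Type*} [Ring B] [Ring B']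

variable (σ) in
/-- The ring morphism `f` sends the elements attached to the vertices and to the arrows by `D` to
those attached by `D'`. -/
structure ArrowData.Compat (D : ArrowData n B) (D' : ArrowData n B') (f : B →+* B') : Prop where
  ide : ∀ a ∈ σ.edges, f (D.ide a) = D'.ide a
  ar : ∀ {J a b}, Corner σ J a b → f (D.ar J a b) = D'.ar J a b
  ex : ∀ k, f (D.ex k) = D'.ex k

variable {D : ArrowData n B} {D' : ArrowData n B'} {f : B →+* B'} (hf : D.Compat σ D' f)
include hf

lemma Step.map {X₀ Y₀ : ℤ} {h : B} (H : Step σ D X₀ Y₀ X Y s h) :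
    Step σ D' X₀ Y₀ X Y s (f h) := by
  cases H with
  | lam H =>
    cases H with
    | right w t =>
      obtain ⟨_, l⟩ := t.larr
      rw [hf.ar l.rotate.corner]
      exact .lam (.right _ t)
    | left z t =>
      obtain ⟨_, l⟩ := t.larr
      rw [hf.ar l.rotate.rotate.corner]
      exact .lam (.left z t)
    | punc t =>
      rw [hf.ar t.larr.rotate.rotate.corner]
      exact .lam (.punc t)
  | rho hne H =>
    cases H with
    | tri u t =>
      obtain ⟨_, l⟩ := t.larr
      rw [hf.ar l.corner]
      exact .rho hne (.tri _ t)
    | ext e =>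
      rw [hf.ex]
      exact .rho hne (.ext e)
  | sig he H =>
    refine .sig he ?_
    subst he
    cases H with
    | digon m t =>
      obtain ⟨_, l⟩ := t.larr
      rw [hf.ar l.corner]
      exact .digon _ t
    | chord u t =>
      rw [hf.ar t.larr.corner]
      exact .chord _ t
    | spoke v t =>
      rw [hf.ar t.larr.rotate.corner]
      exact .spoke _ t

lemma Run.map {b : Bool} {g : B} (H : Run σ D x y X Y b g) : Run σ D' x y X Y b (f g) := by
  induction H with
  | nil h =>
    rw [hf.ide _ h.2.2]
    exact .nil h
  | cons hg hs ih =>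
    rw [map_mul]
    exact ih.cons (hs.map hf)

lemma Std.map {g : B} (H : Std σ D a b x y X Y s g) : Std σ D' a b x y X Y s (f g) := by
  cases H with
  | run hc hr hd =>
    rw [map_mul, map_mul]
    refine .run ?_ (hr.map hf) ?_
    · cases hc with
      | vis h =>
        rw [hf.ide _ h.2.2]
        exact .vis h
      | notched t =>
        rw [hf.ar (t.larr_out .notched).corner]
        exact .notched t
    · cases hd with
      | vis h =>
        rw [hf.ide _ h.2.2]
        exact .vis h
      | notched t =>
        rw [hf.ar (t.larr_in .notched).corner]
        exact .notched t
  | ide k hk ha hb hx hy =>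
    rw [hf.ide a (ha ▸ hk.2)]
    exact .ide k hk ha hb hx hy

end Map

/-- The idempotent attached to an edge. -/
def unitEps (K : Type*) [Field K] : Edge n → ScriptR K
  | chord _ _ => 1
  | spoke _ t => eps K t

section Values
variable (K : Type*) [Field K] (σ) (E : Set (ZMod n))

/-- The diagonal matrix whose entries are the idempotents attached to the edges. -/
def unitMat : EdgeMat σ K E :=
  Matrix.diagonal fun a => unitEps K a.1

variable {σ K E}

lemma unitMat_mul_eUnit (a b : Edge n) (w : ScriptR K) :
    unitMat σ K E * eUnit σ K E a b w = eUnit σ K E a b (unitEps K a * w) := by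
  ext i j
  rw [unitMat, Matrix.diagonal_mul, eUnit_apply, eUnit_apply]
  grind

lemma eUnit_mul_unitMat (a b : Edge n) (w : ScriptR K) :
    eUnit σ K E a b w * unitMat σ K E = eUnit σ K E a b (w * unitEps K b) := by
  ext i j
  rw [unitMat, Matrix.mul_diagonal, eUnit_apply, eUnit_apply]
  grind

lemma LArr.factor_eq (h : LArr σ i J J₁ J₂ a b c) {t : Tag} (ht : HasTag t a ∨ HasTag t b) :
    factor σ K J a b = eps K t := by
  have key : ∀ {x : ℤ} {τ : Tag}, IsSpoke σ τ x → Visible σ (sp x τ) → mainTag σ = τ :=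
    fun h h' => (tag_eq_of_visible h h').symm
  have key' : ∀ {x : ℤ} {τ : Tag}, IsSpoke σ τ x → ¬ Visible σ (sp x τ) → τ = .notched :=
    fun h h' => by
      obtain ⟨_, _, e, _⟩ := exists_digon_of_not_visible h h'
      injection e
  -- `factor` for an arrow starting or ending at an arc to the puncture
  have main : ∀ {x : ℤ} {τ : Tag} {J : Option (ZMod n)} {a b : Edge n}, IsSpoke σ τ x →
      (Visible σ a ∧ Visible σ b ↔ Visible σ (sp x τ)) →
      (J = none ∨ J = some a.fst ∧ J = some b.snd) → factor σ K J a b = eps K τ := by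
    intro x τ J a b h1 h2 h3
    by_cases hv : Visible σ (sp x τ)
    · rw [factor, if_pos (h2.2 hv), if_pos h3, ← tag_eq_of_visible h1 hv]
    · rw [factor_invisible fun h => hv (h2.1 h)]
      grind
  have hc : ∀ r s, Visible σ (chord r s) := visible_chord
  cases h with
  | A1 | A2 | A3 | D1 => rcases ht with ⟨r, h⟩ | ⟨r, h⟩ <;> cases h
  | B1 x y τ h1 h2 h3 | D2 x m τ h1 h2 h3 =>
    rcases ht with ⟨r, h⟩ | ⟨r, h⟩ <;> cases h
    first
    | exact main h2 (by simp [hc]) (.inr ⟨rfl, rfl⟩)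
    | exact main (h3.mem _) (by simp [hc]) (.inr ⟨rfl, rfl⟩)
  | B3 x y τ h1 h2 h3 | D3 x m τ h1 h2 h3 =>
    rcases ht with ⟨r, h⟩ | ⟨r, h⟩ <;> cases h
    first
    | exact main h3 (by simp [hc]) (.inr ⟨rfl, rfl⟩)
    | exact main (h3.mem _) (by simp [hc]) (.inr ⟨rfl, rfl⟩)
  | B2 x y τ h1 h2 h3 =>
    have hd := h1.not_digon h2 h3
    have : Visible σ (sp x τ) := visible_of_not_digon h2 hd.1
    have : Visible σ (sp y τ) := visible_of_not_digon h3 hd.2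
    rcases ht with ⟨r, h⟩ | ⟨r, h⟩ <;> cases h
    · exact main h2 (by simp [*]) (.inl rfl)
    · exact main h3 (by simp [*]) (.inl rfl)

lemma unitEps_idem (a : Edge n) : unitEps K a * unitEps K a = unitEps K a := by
  cases a with
  | chord => exact mul_one 1
  | spoke _ t => exact eps_idem K t

lemma LArr.unitEps_mul (h : LArr σ i J J₁ J₂ a b c) : unitEps K a * factor σ K J a b = factor σ K
    J a b ∧ factor σ K J a b * unitEps K b = factor σ K J a b := by
  constructor
  · cases a with
    | chord => exact one_mul _
    | spoke r t => rw [h.factor_eq (.inl ⟨r, rfl⟩)]; exact eps_idem K t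
  · cases b with
    | chord => exact mul_one _
    | spoke r t => rw [h.factor_eq (.inr ⟨r, rfl⟩)]; exact eps_idem K t

lemma Tri.value_in (t : Tri σ k m (k + n)) : (matData σ K E).ar pt(k) (ed σ k m) (sp
    k .notched) = eUnit σ K E (ed σ k m) (sp k .notched) (uPow K (k + n - m) * eps K .notched) := by
  simp only [matData]
  rw [(t.larr_in .notched).factor_eq (.inr ⟨_, rfl⟩), t.chord₁.ed, theta_digon_in t.chord₁]

lemma Tri.value_out (t : Tri σ k m (k + n)) : (matData σ K E).ar pt(k) (sp k
    .notched) (ed σ m (k + n)) = eUnit σ K E (sp k .notched) (ed σ m (k + n)) (uPow K (m - k) * eps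
    K .notched) := by
  simp only [matData]
  rw [(t.larr_out .notched).factor_eq (.inl ⟨_, rfl⟩), t.chord₂.ed,
    ch_add_n, theta_digon_out t.chord₁]

/-- The monomial of a standard element; its degree is the `θ`-length of the path. -/
lemma Std.value {a b : Edge n} {x y X Y : ℤ} {f : Bool} {g : EdgeMat σ K E} (h : Std σ (matData σ K E) a b x y X Y f g) (hf : f = true → Visible σ a ∧ Visible
    σ b) : unitMat σ K E * g = eUnit σ K E a b (unitEps K a * unitEps K b * mono K (mainTag σ) f (X
    + Y - x - y)) := by
  have hN : ∀ k : ℤ, unitEps K (sp k .notched : Edge n) = eps K .notched := fun _ => rfl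
  have hm : ∀ m : ℤ, mono K (mainTag σ) false m = uPow K m := fun m => mul_one _
  cases h with
  | run hc hr hd =>
    have hF := hr.facts
    cases hc with
    | vis h =>
      cases hd with
      | @vis X Y h' =>
        simp only [matData]
        rw [hr.value, eUnit_mul h.2.2, eUnit_mul h'.2.2, unitMat_mul_eUnit, one_mul, mul_one]
        congr 1
        by_cases hY : Y = X + n
        · cases f with
          | true =>
            subst hY
            rw [ed_spoke, mono, if_pos rfl, mul_comm (uPow K _),
              show unitEps K (sp X (mainTag σ)) = eps K (mainTag σ) from rfl, mul_assoc,
              ← mul_assoc (eps K _) (eps K _), eps_idem]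
          | false =>
            obtain ⟨rfl, rfl, -⟩ | h6 := hF.2.2.2.2.2 rfl
            · rw [unitEps_idem]
            · exact absurd hY h6.2
        · rw [ed_chord hY, show unitEps K (ch X Y : Edge n) = 1 from rfl, mul_one]
      | notched t =>
        obtain rfl : f = false := by
          by_contra hf'
          exact not_visible_of_tri t (hf (by simpa using hf')).2
        rw [t.value_in]
        simp only [matData]
        rw [hr.value, eUnit_mul h.2.2, eUnit_mul t.xy.2.2, unitMat_mul_eUnit, one_mul, hN, hm, hm,
          ← mul_assoc (uPow K _), ← uPow_add, mul_comm (uPow K _), mul_assoc]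
        congr 4
        ring
    | notched t =>
      obtain rfl : f = false := by
        by_contra hf'
        exact not_visible_of_tri t (hf (by simpa using hf')).1
      rw [t.value_out]
      cases hd with
      | @vis X Y h' =>
        have hY : Y ≠ X + n := by
          obtain ⟨rfl, rfl, -⟩ | h6 := hF.2.2.2.2.2 rfl
          · exact t.chord₂.2.1.ne
          · exact h6.2
        simp only [matData]
        rw [hr.value, eUnit_mul t.yz.2.2, eUnit_mul h'.2.2, unitMat_mul_eUnit, mul_one, hN, hm, hm,
          ed_chord hY, show unitEps K (ch X Y : Edge n) = 1 from rfl, mul_one, mul_right_comm,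
          ← uPow_add, mul_comm (uPow K _), ← mul_assoc, eps_idem]
        congr 3
        ring
      | notched t' =>
        rw [t'.value_in, hr.value, eUnit_mul t.yz.2.2, eUnit_mul t'.xy.2.2, unitMat_mul_eUnit, hN, hN,
          hm, hm, mul_right_comm (uPow K _), ← mul_assoc _ (uPow K _) (eps K _),
          mul_right_comm _ _ (uPow K _), ← uPow_add, ← uPow_add, mul_assoc (uPow K _), eps_idem,
          mul_comm (uPow K _), ← mul_assoc, eps_idem]
        congr 3
        ring
  | ide k hk ha hb hx hy =>
    subst hb
    simp only [matData]
    rw [unitMat_mul_eUnit, unitEps_idem, show x + y - x - y = 0 by ring, mono_zero]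

lemma matRep_compat :
    (gammaData' K σ).Compat σ (matData σ K E) (matRep σ K E : Gamma' K σ →+* _) where
  ide _ ha := Describes.lift_ide _ _ _ ha
  ar h := Describes.lift_ar _ _ _ h
  ex k := Describes.lift_ex _ _ _ (Set.mem_univ k)

/-- The diagonal matrix of idempotents commutes with the image of the representation. -/
lemma unitMat_comm (z : Gamma' K σ) :
    unitMat σ K E * matRep σ K E z = matRep σ K E z * unitMat σ K E := by
  have hc := matRep_compat (K := K) (σ := σ) (E := E)
  have hz : z ∈ Submodule.span K {x : Gamma' K σ | ∃ (a b : Q' σ) (p : Path a b),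
      x = cls' K p} := (span_pathClass (K := K) (W := potential σ Set.univ K)).ge trivial
  induction hz using Submodule.span_induction with
  | zero => rw [map_zero, mul_zero, zero_mul]
  | add u v _ _ hu hv => rw [map_add, mul_add, add_mul, hu, hv]
  | smul c u _ hu => rw [map_smul, mul_smul_comm, smul_mul_assoc, hu]
  | mem z h =>
    obtain ⟨a, b, p, rfl⟩ := h
    have main : ∀ {g : Gamma' K σ} {a b : Edge n} {w : ScriptR K}, matRep σ K E g =
        eUnit σ K E a b w → unitEps K a * w = w * unitEps K b →
        unitMat σ K E * matRep σ K E g = matRep σ K E g * unitMat σ K E := by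
      intro g a b w h h'
      rw [h, unitMat_mul_eUnit, eUnit_mul_unitMat, h']
    refine pathClass_induction (P := fun b g => unitMat σ K E * matRep σ K E g =
      matRep σ K E g * unitMat σ K E) ?_ ?_ ?_ p
    · exact main (hc.ide _ a.2) ((mul_one _).trans (one_mul _).symm)
    · intro J b c g H ih
      obtain ⟨_, _, _, _, L⟩ := corner_iff.1 H
      rw [map_mul, ← mul_assoc, ih, mul_assoc, mul_assoc]
      refine congrArg _ (main (hc.ar H) ?_)
      rw [mul_left_comm, L.unitEps_mul.1, mul_assoc, L.unitEps_mul.2]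
    · intro k g _ ih
      rw [map_mul, ← mul_assoc, ih, mul_assoc, mul_assoc]
      exact congrArg _ (main (hc.ex k) ((one_mul _).trans (mul_one _).symm))

end Values

end

section
variable {n : ℕ} [hn : Fact (2 ≤ n)] {σ : TaggedTriangulation n}

variable {t : Tag} {a b : Edge n}

/-! ### The modules `A_{a,b}` -/

lemma mem_openInterval {r s t : ZMod n} : t ∈ openInterval r s ↔ ccwDist s r < ccwDist s t := by
  simp [openInterval, closedInterval]

/-- Among the lifts `(X, Y)` of `b` with `x ≤ X` and `y ≤ Y`, where `(x, y)` is a lift of `a`, the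
smallest one computes `ℓ_{a,b}` and the relation `a ⊢ b`. -/
lemma Lift.exists_ell {x y : ℤ} (ha : Lift σ a x y) (hb : b ∈ σ.edges) : ∃ X Y, Lift σ b X Y ∧
    (ell a b : ℤ) = X + Y - x - y ∧ x ≤ X ∧ y ≤ Y ∧ (X < x + n ∨ Y < y + n) ∧ (y ≠ x + n → Y ≠ X + n
    → (Turn a b ↔ x + n ≤ Y)) := by
  have hn2 := two_le_int (n := n)
  obtain ⟨-, a1, a2, l1, l2⟩ := ha.facts
  obtain ⟨p₀, q₀, hb₀⟩ := exists_lift_edge hb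
  obtain ⟨p, hp1, hp2, hp⟩ := exists_lift b.fst x
  obtain ⟨i, rfl⟩ := exists_shift (hb₀.facts.2.1.symm.trans hp.symm)
  have hb := hb₀.sh i
  generalize p₀ + n * i = p at hb hp hp1 hp2
  generalize q₀ + n * i = r at hb
  obtain ⟨-, b1, b2, l3, l4⟩ := hb.facts
  obtain ⟨q, hq1, hq2, hq⟩ := exists_lift b.snd y
  obtain ⟨j, hj⟩ := exists_shift (hq.trans b2)
  have e1 : (ccwDist a.fst b.fst : ℤ) = p - x := by rw [a1, b1, ccwDist_of_le hp1 hp2]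
  have e2 : (ccwDist a.snd b.snd : ℤ) = q - y := by rw [a2, ← hq, ccwDist_of_le hq1 hq2]
  have e3 : (ccwDist a.snd a.fst : ℤ) = x + n - y := by
    rw [a1, a2, ← cast_add_n x, ccwDist_of_le (by omega) (by omega)]
  have e4 : (ccwDist a.snd b.fst : ℤ) = if y ≤ p then p - y else p + n - y := by
    split_ifs with h
    · rw [a2, b1, ccwDist_of_le h (by omega)]
    · rw [a2, b1, ← cast_add_n p, ccwDist_of_le (by omega) (by omega)]
  have e5 : (ccwDist a.fst b.snd : ℤ) = if q < x + n then q - x else q - n - x := by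
    split_ifs with h
    · rw [a1, ← hq, ccwDist_of_le (by omega) h]
    · rw [a1, ← hq, ← cast_sub_n q, ccwDist_of_le (by omega) (by omega)]
  have e6 : y ≠ x + n → (ccwDist a.fst a.snd : ℤ) = y - x := fun h => by
    rw [a1, a2, ccwDist_of_le (by omega) (by omega)]
  have hell : ∀ k : ℤ, (k = 0 ∧ (ccwDist a.snd b.fst < ccwDist a.snd a.fst ↔
      ccwDist a.snd b.fst < ccwDist a.snd b.snd)) ∨ (k = n ∧
      ¬ (ccwDist a.snd b.fst < ccwDist a.snd a.fst ↔
      ccwDist a.snd b.fst < ccwDist a.snd b.snd)) → (ell a b : ℤ) = p - x + (q - y) + k := by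
    intro k hk
    rw [ell]
    simp only [mem_openInterval]
    grind
  have hT : Turn a b ↔ ccwDist a.fst b.snd < ccwDist a.fst a.snd ∨
      ccwDist a.fst b.snd < ccwDist a.fst b.fst := by
    rw [Turn, mem_openInterval, mem_openInterval]
  have hj' : j = 0 ∨ j = -1 ∨ j = 1 := by
    have h1 : (n : ℤ) * j < n * 2 := by omega
    have h2 : (n : ℤ) * (-2) < n * j := by omega
    have h1' := lt_of_mul_lt_mul_left h1 (by omega)
    have h2' := lt_of_mul_lt_mul_left h2 (by omega)
    omega
  rcases hj' with rfl | rfl | rfl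
  · refine ⟨p, r, hb, ?_, hp1, by omega, by omega, fun h1 h2 => ?_⟩
    · rw [hell 0 (.inl ⟨rfl, by split_ifs at e4 <;> omega⟩)]
      omega
    · have := e6 h1
      rw [hT]
      split_ifs at e5 <;> omega
  · have := hb.sh 1
    rw [mul_one] at this
    refine ⟨p + n, r + n, this, ?_, by omega, by omega, by omega, fun h1 h2 => ?_⟩
    all_goals grind
  · grind

section Entry
variable (K : Type*) [Field K]

lemma rPrime_smul (r : RPrime K n) (s : ScriptR K) : r • s = embed K n r * s := rfl

lemma uPow_mul_vElt (m : ℤ) : uPow K (m - 1) * vElt K = mono K .plain true m := by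
  rw [vElt_eq, ← mul_assoc, ← uPow_add, sub_add_cancel]
  rfl

lemma uPow_mul_sub_vElt (m : ℤ) : uPow K (m - 1) * (uPow K 1 - vElt K) =
    mono K .notched true m := by
  have h : uPow K 1 - vElt K = uPow K 1 * eps K .notched := by
    rw [vElt_eq, ← mul_one_sub, ← eps_add K, add_sub_cancel_left]
  rw [h, ← mul_assoc, ← uPow_add, sub_add_cancel]
  rfl

lemma entry_spoke (h : ∀ t', HasTag t' a ∨ HasTag t' b → t' = t) (h' : ¬ BothChords a b) : entry K
    a b = Submodule.span _ {mono K t true (ell a b)} := by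
  have e := uPow_mul_vElt K (ell a b)
  have e' := uPow_mul_sub_vElt K (ell a b)
  rcases a with ⟨r, s⟩ | ⟨r, t₁⟩ <;> rcases b with ⟨r', s'⟩ | ⟨r', t₂⟩
  · exact (h' fun t => ⟨(fun ⟨_, h⟩ => nomatch h), (fun ⟨_, h⟩ => nomatch h)⟩).elim
  · obtain rfl := h t₂ (.inr ⟨r', rfl⟩)
    cases t₂ <;> simp only [← e, ← e'] <;> rfl
  all_goals obtain rfl := h t₁ (.inl ⟨r, rfl⟩)
  · cases t₁ <;> simp only [← e, ← e'] <;> rfl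
  · obtain rfl := h t₂ (.inr ⟨r', rfl⟩)
    cases t₂ <;> simp only [← e, ← e'] <;> rfl

lemma entry_conflict {t' : Tag} (ha : HasTag t a) (hb : HasTag t' b)
    (h : t ≠ t') : entry K a b = ⊥ := by
  obtain ⟨r, rfl⟩ := ha
  obtain ⟨r', rfl⟩ := hb
  cases t <;> cases t' <;> first | exact absurd rfl h | rfl

lemma mem_of_mem_span_rPrime {G : Set (ScriptR K)} {N : Submodule K (ScriptR K)} (hG : ∀ g ∈ G, g
    ∈ N) (hN : ∀ g ∈ N, ∀ (f : Bool) (i : ℕ), mono K .plain f (2 * n * (i + if f then 1 else 0)) * g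
    ∈ N) {w : ScriptR K} (hw : w ∈ Submodule.span (RPrime K n) G) : w ∈ N := by
  induction hw using Submodule.span_induction with
  | mem g hg => exact hG g hg
  | zero => exact N.zero_mem
  | add _ _ _ _ h1 h2 => exact N.add_mem h1 h2
  | smul r x _ hx =>
    rw [rPrime_smul]
    refine Submodule.span_le (p := N.comap (LinearMap.mulRight K x ∘ₗ (embed K n).toLinearMap)).2
      ?_ (RPrime.mem_span n r)
    rintro _ ⟨i, rfl⟩
    rw [SetLike.mem_coe, Submodule.mem_comap]
    change embed K n _ * x ∈ N
    rw [embed_basis n hn.out]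
    exact hN x hx i.1 i.2

lemma smul_mem_rPrime {N : Submodule (RPrime K n) (ScriptR K)} (c : K) {w : ScriptR K}
    (h : w ∈ N) : c • w ∈ N := by
  have := N.smul_mem (algebraMap K (RPrime K n) c) h
  rwa [rPrime_smul, AlgHom.commutes, ← Algebra.smul_def] at this

lemma span_le_rPrime {G : Set (ScriptR K)} {N : Submodule (RPrime K n) (ScriptR K)}
    (hG : ∀ g ∈ G, g ∈ N) {w : ScriptR K} (hw : w ∈ Submodule.span K G) : w ∈ N := by
  induction hw using Submodule.span_induction with
  | mem g hg => exact hG g hg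
  | zero => exact N.zero_mem
  | add _ _ _ _ h1 h2 => exact N.add_mem h1 h2
  | smul c _ _ h => exact smul_mem_rPrime K c h

lemma mono_plain_mul_mem {N : Submodule (RPrime K n) (ScriptR K)} {w : ScriptR K} (h : w ∈ N)
    (f : Bool) (i : ℕ) : mono K .plain f (2 * n * (i + if f then 1 else 0)) * w ∈ N := by
  rw [← embed_basis n hn.out, ← rPrime_smul]
  exact N.smul_mem _ h

lemma mono_plain_false_mul (t : Tag) (f : Bool) (m m' : ℤ) :
    mono K .plain false m * mono K t f m' = mono K t f (m + m') := by
  simp only [mono, uPow_add, if_false, Bool.false_eq_true, mul_one, mul_assoc]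

lemma mono_plain_mul_true (t : Tag) (f : Bool) (m m' : ℤ) : mono K .plain f m * mono K t true m' =
    mono K t true (m + m') ∨ mono K .plain f m * mono K t true m' = 0 := by
  cases f with
  | false => exact .inl (mono_plain_false_mul K t true m m')
  | true =>
    cases t with
    | plain => exact .inl (mono_mul K _ _ _ _ _)
    | notched =>
      right
      simp only [mono, if_true]
      rw [mul_mul_mul_comm, eps_mul, mul_zero]

/-- A `K`-basis of `A_{a,b}`, if `a` or `b` is incident to the puncture. -/
lemma mem_entry_spoke (h : ∀ t', HasTag t' a ∨ HasTag t' b → t' = t) (h' : ¬ BothChords a b) {w :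
    ScriptR K} : w ∈ entry K a b ↔ w ∈ Submodule.span K {w | ∃ i : ℕ, w = mono K t true (ell a b + 2
    * n * i)} := by
  rw [entry_spoke K h h']
  constructor
  · refine mem_of_mem_span_rPrime K ?_ ?_
    · rintro _ rfl
      exact Submodule.subset_span ⟨0, by simp⟩
    · intro g hg f i
      rw [mul_comm _ g]
      refine mul_mem_of_forall hg ?_
      rintro _ ⟨j, rfl⟩
      rw [mul_comm (mono K t true _)]
      rcases mono_plain_mul_true K t f (2 * n * (i + if f then 1 else 0))
        (ell a b + 2 * n * j) with e | e <;> rw [e]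
      · refine Submodule.subset_span ⟨i + (if f then 1 else 0) + j, ?_⟩
        congr 1
        push_cast
        ring
      · exact Submodule.zero_mem _
  · refine span_le_rPrime K ?_
    rintro _ ⟨i, rfl⟩
    have := mono_plain_mul_mem K (Submodule.subset_span (R := RPrime K n)
      (Set.mem_singleton (mono K t true (ell a b)))) false i
    rw [mono_plain_false_mul] at this
    convert this using 2
    simp
    ring

/-- A `K`-basis of `A_{a,b}`, if neither `a` nor `b` is incident to the puncture. -/
lemma mem_entry_chord (t : Tag) (h : BothChords a b) (hT : Turn a b → ell a b ≠ 0) {w : ScriptR K}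
    : w ∈ entry K a b ↔ w ∈ Submodule.span K {w | ∃ (f : Bool) (i : ℕ), (f = true → Turn a b ∨ 1 ≤
    i) ∧ w = mono K t f (ell a b + 2 * n * i)} := by
  have hu : uPow K (ell a b) = mono K .plain false (ell a b) := (mul_one _).symm
  have he : entry K a b = Submodule.span _ ({w | w = mono K .plain false (ell a b) ∨
      Turn a b ∧ w = mono K .plain true (ell a b)}) := by
    rcases a with ⟨r, s⟩ | ⟨r, t₁⟩
    · rcases b with ⟨r', s'⟩ | ⟨r', t₂⟩
      · rw [entry]
        split_ifs with hT'
        · rw [hu, vElt_pow K (hT hT')]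
          congr 1
          ext w
          simp [hT', mono]
        · rw [hu]
          congr 1
          ext w
          simp [hT']
      · exact ((h t₂).2 ⟨r', rfl⟩).elim
    · exact ((h t₁).1 ⟨r, rfl⟩).elim
  have hplain : w ∈ entry K a b ↔
      w ∈ Submodule.span K {w | ∃ (f : Bool) (i : ℕ), (f = true → Turn a b ∨ 1 ≤ i) ∧
        w = mono K .plain f (ell a b + 2 * n * i)} := by
    rw [he]
    constructor
    · refine mem_of_mem_span_rPrime K ?_ ?_
      · rintro _ (rfl | ⟨hT', rfl⟩)
        · exact Submodule.subset_span ⟨false, 0, by simp, by simp⟩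
        · exact Submodule.subset_span ⟨true, 0, by simp [hT'], by simp⟩
      · intro g hg f i
        rw [mul_comm _ g]
        refine mul_mem_of_forall hg ?_
        rintro _ ⟨f', j, hf', rfl⟩
        refine Submodule.subset_span ⟨f || f', i + (if f then 1 else 0) + j, by grind, ?_⟩
        rw [mul_comm, mono_mul]
        congr 1
        push_cast
        ring
    · refine span_le_rPrime K ?_
      rintro _ ⟨f, i, hf, rfl⟩
      have m0 : mono K .plain false (ell a b) ∈ Submodule.span (RPrime K n)
        {w | w = mono K .plain false (ell a b) ∨ Turn a b ∧ w = mono K .plain true (ell a b)} :=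
        Submodule.subset_span (.inl rfl)
      cases f with
      | false =>
        have := mono_plain_mul_mem K m0 false i
        rw [mono_plain_false_mul] at this
        convert this using 2
        simp
        ring
      | true =>
        rcases hf rfl with hT' | hi
        · have := mono_plain_mul_mem K (Submodule.subset_span (R := RPrime K n) (s := {w |
            w = mono K .plain false (ell a b) ∨ Turn a b ∧ w = mono K .plain true (ell a b)})
            (.inr ⟨hT', rfl⟩)) false i
          rw [mono_plain_false_mul] at this
          convert this using 2
          simp
          ring
        · obtain ⟨j, rfl⟩ := Nat.exists_eq_add_of_le' hi
          have := mono_plain_mul_mem K m0 true j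
          rw [mono_mul, if_pos rfl, Bool.or_false] at this
          convert this using 2
          push_cast
          ring
  rw [hplain]
  cases t with
  | plain => rfl
  | notched =>
    have e : ∀ m, mono K .notched true m = mono K .plain false m - mono K .plain true m :=
      fun m => by simpa using mono_notched K true m
    have e' : ∀ m, mono K .plain true m = mono K .notched false m - mono K .notched true m :=
      fun m => by rw [e, show mono K .notched false m = mono K .plain false m from rfl, sub_sub_cancel]
    constructor <;> intro hw <;> refine Submodule.span_le.2 ?_ hw <;>
      rintro _ ⟨_ | _, i, hf, rfl⟩
    on_goal 2 => rw [e']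
    on_goal 4 => rw [e]
    · exact Submodule.subset_span ⟨false, i, by simp, rfl⟩
    · exact Submodule.sub_mem _ (Submodule.subset_span ⟨false, i, by simp, rfl⟩)
        (Submodule.subset_span ⟨true, i, hf, rfl⟩)
    · exact Submodule.subset_span ⟨false, i, by simp, rfl⟩
    · exact Submodule.sub_mem _ (Submodule.subset_span ⟨false, i, by simp, rfl⟩)
        (Submodule.subset_span ⟨true, i, hf, rfl⟩)

end Entry

end

section
variable {n : ℕ} [hn : Fact (2 ≤ n)] {σ : TaggedTriangulation n} {K : Type*} [Field K]
  {E : Set (ZMod n)}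

variable {X Y x y : ℤ} {f : Bool} {t : Tag} {a b : Edge n} {g : Gamma' K σ}

/-! ### The isomorphism with the algebra of matrices -/

lemma unitMat_idem : unitMat σ K E * unitMat σ K E = unitMat σ K E := by
  rw [unitMat, Matrix.diagonal_mul_diagonal]
  congr 1
  ext a
  exact unitEps_idem _

variable (σ K E) in
/-- The representation of `Γ_σ`, cut down by the idempotents attached to the edges. -/
def psi : Gamma' K σ →ₗ[K] EdgeMat σ K E :=
  LinearMap.mulLeft K (unitMat σ K E) ∘ₗ (matRep σ K E).toLinearMap

lemma psi_apply (z : Gamma' K σ) : psi σ K E z = unitMat σ K E * matRep σ K E z := rfl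

lemma psi_mul (z z' : Gamma' K σ) : psi σ K E (z * z') = psi σ K E z * psi σ K E z' := by
  rw [psi_apply, psi_apply, psi_apply, map_mul, mul_assoc (unitMat σ K E), ← mul_assoc _ (unitMat σ K E),
    ← unitMat_comm, ← mul_assoc, ← mul_assoc, ← mul_assoc, unitMat_idem]

lemma psi_one : psi σ K E 1 = unitMat σ K E := by rw [psi_apply, map_one, mul_one]

lemma psi_idem (ha : a ∈ σ.edges) :
    psi σ K E ((gammaData' K σ).ide a) = eUnit σ K E a a (unitEps K a) := by
  have e : matRep σ K E ((gammaData' K σ).ide a) = eUnit σ K E a a 1 := matRep_compat.ide a ha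
  rw [psi_apply, e, unitMat_mul_eUnit, mul_one]

@[simp] lemma hasTag_chord {r s : ZMod n} : ¬ HasTag t (chord r s) := fun ⟨_, h⟩ => nomatch h

@[simp] lemma hasTag_spoke {t' : Tag} {r : ZMod n} : HasTag t (spoke r t') ↔ t = t' :=
  ⟨fun ⟨_, h⟩ => by injection h with _ h; exact h.symm, fun h => ⟨r, by rw [h]⟩⟩

lemma unitEps_eq_one (h : ∀ t, ¬ HasTag t a) : unitEps K a = 1 := by
  cases a with
  | chord => rfl
  | spoke r t => exact (h t ⟨r, rfl⟩).elim

/-- The possible positions of two edges with respect to the puncture. -/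
lemma tag_cases (a b : Edge n) : BothChords a b ∨
    (∃ t, (HasTag t a ∨ HasTag t b) ∧ (∀ t', HasTag t' a ∨ HasTag t' b → t' = t) ∧
      unitEps K a * unitEps K b = eps K t) ∨
    ∃ t t', HasTag t a ∧ HasTag t' b ∧ t ≠ t' := by
  rcases a with _ | ⟨_, t⟩ <;> rcases b with _ | ⟨_, t'⟩
  · exact .inl fun t => by simp
  · exact .inr (.inl ⟨t', by simp, by simp, one_mul _⟩)
  · exact .inr (.inl ⟨t, by simp, by simp, mul_one _⟩)
  · by_cases h : t = t'
    · exact .inr (.inl ⟨t, by simp, by simp [h], h ▸ eps_idem K _⟩)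
    · exact .inr (.inr ⟨t, t', by simp, by simp, h⟩)

lemma visible_hasTag (ha : a ∈ σ.edges) (hv : Visible σ a) (h : HasTag t a) : t = mainTag σ := by
  obtain ⟨x, y, rfl, -⟩ := exists_ed_of_visible ha hv
  exact (ed_hasTag h).1

/-- The values of the standard elements. -/
lemma Std.psi (h : Std σ (gammaData' K σ) a b x y X Y f g) (hf : f = true → Visible σ a ∧ Visible
    σ b) : (BothChords a b → psi σ K E g = eUnit σ K E a b (mono K (mainTag σ) f (X + Y - x - y))) ∧
    ∀ t, (HasTag t a ∨ HasTag t b) → (∀ t', HasTag t' a ∨ HasTag t' b → t' = t) → unitEps K a *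
    unitEps K b = eps K t → psi σ K E g = eUnit σ K E a b (mono K t true (X + Y - x - y)) := by
  have hv := (h.map (matRep_compat (E := E))).value hf
  have hv : PuncturedPolygon.psi σ K E g = _ := hv
  refine ⟨fun hc => ?_, fun t h1 h2 h3 => ?_⟩
  · rw [hv, unitEps_eq_one fun t => (hc t).1, unitEps_eq_one fun t => (hc t).2, one_mul, one_mul]
  · rw [hv, h3]
    congr 1
    cases f with
    | false => simp only [mono, if_true, if_false, Bool.false_eq_true, mul_one, one_mul, mul_comm]
    | true =>
      obtain rfl : t = mainTag σ := by
        rcases h1 with h1 | h1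
        · exact visible_hasTag h.lift.1.facts.1 (hf rfl).1 h1
        · exact visible_hasTag h.lift.2.facts.1 (hf rfl).2 h1
      rw [mono, if_pos rfl, mul_left_comm, eps_idem]

lemma turn_ell (ha : a ∈ σ.edges) (hb : b ∈ σ.edges) (hc : BothChords a b)
    (hT : Turn a b) : ell a b ≠ 0 := by
  obtain ⟨x, y, hx⟩ := exists_lift_edge ha
  obtain ⟨X, Y, hX, h1, h2, h3, h4, h5⟩ := hx.exists_ell hb
  cases hx with
  | spoke h => exact ((hc _).1 ⟨_, rfl⟩).elim
  | chord h =>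
    cases hX with
    | spoke h => exact ((hc _).2 ⟨_, rfl⟩).elim
    | chord h' =>
      have := (h5 h.2.1.ne h'.2.1.ne).1 hT
      have := h.2.1
      omega

/-- The lifts reached from a given lift. -/
lemma Lift.reach (ha : Lift σ a x y) (hb : Lift σ b X Y) (hx : x ≤ X) (hy : y ≤ Y) : ∃ i : ℕ, X +
    Y - x - y = ell a b + 2 * n * i ∧ (BothChords a b → x + n ≤ Y → Turn a b ∨ 1 ≤ i) := by
  obtain ⟨X₀, Y₀, hX, h1, h2, h3, h4, h5⟩ := ha.exists_ell hb.facts.1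
  obtain ⟨i, rfl, rfl⟩ := hX.eq_shift hb
  have hi : 0 ≤ i := by
    by_contra hi
    have : (n : ℤ) * i ≤ n * (-1) := mul_le_mul_of_nonneg_left (by omega) (by omega)
    omega
  lift i to ℕ using hi
  refine ⟨i, by rw [h1]; ring, fun hc h => ?_⟩
  by_cases hi : 1 ≤ i
  · exact .inr hi
  · obtain rfl : i = 0 := by omega
    left
    rw [h5]
    · simpa using h
    · cases ha with
      | chord h => exact h.2.1.ne
      | spoke h => exact ((hc _).1 ⟨_, rfl⟩).elim
    · cases hX with
      | chord h => exact h.2.1.ne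
      | spoke h => exact ((hc _).2 ⟨_, rfl⟩).elim

lemma Std.passing' (hc : BothChords a b)
    (h : Std σ (gammaData' K σ) a b x y X Y true g) : x + n ≤ Y := by
  cases a with
  | spoke r t => exact ((hc t).1 ⟨_, rfl⟩).elim
  | chord r s =>
    cases b with
    | spoke r t => exact ((hc t).2 ⟨_, rfl⟩).elim
    | chord r' s' =>
      obtain ⟨r, rfl⟩ := ZMod.intCast_surjective r
      obtain ⟨s, rfl⟩ := ZMod.intCast_surjective s
      obtain ⟨r', rfl⟩ := ZMod.intCast_surjective r'
      obtain ⟨s', rfl⟩ := ZMod.intCast_surjective s'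
      exact h.passing rfl

lemma BothChords.visible (h : BothChords a b) : Visible σ a ∧ Visible σ b :=
  ⟨fun ⟨k, hk, _⟩ => (h _).1 ⟨k, hk⟩, fun ⟨k, hk, _⟩ => (h _).2 ⟨k, hk⟩⟩

variable (σ K E) in
/-- The matrices with a single entry, as a linear map. -/
def eLin (a b : Edge n) : ScriptR K →ₗ[K] EdgeMat σ K E where
  toFun := eUnit σ K E a b
  map_add' := eUnit_add a b
  map_smul' c w := by
    ext i j
    simp [eUnit_apply]

variable (σ K E) in
/-- The matrices with a single entry, which belongs to `A_{a,b}`. -/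
def entryMat (a b : Edge n) : Submodule K (EdgeMat σ K E) :=
  .map (eLin σ K E a b)
    { (entry K a b).toAddSubmonoid with smul_mem' := fun c _ h => smul_mem_rPrime K c h }

lemma Std.psi_mem (h : Std σ (gammaData' K σ) a b x y X Y f g) :
    PuncturedPolygon.psi σ K E g ∈ entryMat σ K E a b := by
  have hD := gammaData'_lawful (K := K) (σ := σ)
  have hR := gammaData'_relations (K := K) (σ := σ)
  obtain ⟨i, hi, hT⟩ := h.lift.1.reach h.lift.2 h.le.1 h.le.2
  by_cases hf : f = true → Visible σ a ∧ Visible σ b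
  · have hp := h.psi (E := E) hf
    rcases tag_cases (K := K) a b with hc | ⟨t, h1, h2, h3⟩ | ⟨t, t', h1, h2, h3⟩
    · refine ⟨_, show _ ∈ entry K a b from ?_, (hp.1 hc).symm⟩
      rw [mem_entry_chord K (mainTag σ) hc (turn_ell h.lift.1.facts.1 h.lift.2.facts.1 hc), hi]
      refine Submodule.subset_span ⟨f, i, fun e => hT hc ?_, rfl⟩
      subst e
      exact h.passing' hc
    · refine ⟨_, show _ ∈ entry K a b from ?_, (hp.2 t h1 h2 h3).symm⟩
      rw [mem_entry_spoke K h2 fun hc => h1.elim (hc t).1 (hc t).2, hi]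
      exact Submodule.subset_span ⟨i, rfl⟩
    · have := h.flag_of_conflict h1 h2 h3
      exact (this.2 (hf this.1)).elim
  · push Not at hf
    obtain ⟨rfl, hf⟩ := hf
    rw [h.eq_zero hD hR fun hv => hf hv.1 hv.2, map_zero]
    exact Submodule.zero_mem _

/-- Each element of the basis of `A_{a,b}` is the value of a standard element. -/
lemma exists_psi_eq (ha : a ∈ σ.edges) (hb : b ∈ σ.edges) {w : ScriptR K}
    (hw : w ∈ entry K a b) : ∃ z, psi σ K E z = eUnit σ K E a b w := by
  obtain ⟨x, y, hx⟩ := exists_lift_edge ha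
  obtain ⟨X, Y, hX, h1, h2, h3, h4, h5⟩ := hx.exists_ell hb
  have key : ∀ S : Set (ScriptR K), (∀ w ∈ S, ∃ z, psi σ K E z = eUnit σ K E a b w) →
      ∀ w ∈ Submodule.span K S, ∃ z, psi σ K E z = eUnit σ K E a b w := fun S hS w hw =>
    (Submodule.span_le.2 hS : _ ≤ (LinearMap.range (psi σ K E)).comap (eLin σ K E a b)) hw
  have hlift : ∀ i : ℕ, Lift σ b (X + n * i) (Y + n * i) := fun i => hX.sh i
  have hpos : ∀ i : ℕ, (0 : ℤ) ≤ n * i := fun i => by positivity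
  have hsum : ∀ i : ℕ, X + n * i + (Y + n * i) - x - y = ell a b + 2 * n * i := fun i => by
    rw [h1]; ring
  rcases tag_cases (K := K) a b with hc | ⟨t, ht, ht2, ht3⟩ | ⟨t, t', ht, ht2, ht3⟩
  · rw [mem_entry_chord K (mainTag σ) hc (turn_ell ha hb hc)] at hw
    refine key _ ?_ _ hw
    rintro _ ⟨f, i, hf, rfl⟩
    have hp := hpos i
    cases hx with
    | spoke h => exact ((hc _).1 ⟨_, rfl⟩).elim
    | chord h =>
      have hl := hlift i
      generalize hb' : b = b' at hl
      generalize hP : X + n * i = P at hl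
      generalize hQ : Y + n * i = Q at hl
      cases hl with
      | spoke h' => exact ((hc _).2 ⟨_, hb'⟩).elim
      | chord h' =>
        have := h.1
        have := h.2.1
        have := h'.2.1
        subst hb'
        obtain ⟨g, hg⟩ := h.exists_std (D := gammaData' K σ) h' (by omega) (by omega) f (by
          intro e
          rcases hf e with hT | hi
          · have := (h5 h.2.1.ne (by omega)).1 hT
            omega
          · have : (n : ℤ) * 1 ≤ n * i := mul_le_mul_of_nonneg_left (by omega) (by omega)
            omega)
        refine ⟨g, ?_⟩
        rw [(hg.psi fun _ => hc.visible).1 hc]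
        have := hsum i
        rw [hP, hQ] at this
        rw [this]
  · rw [mem_entry_spoke K ht2 fun hc => ht.elim (hc t).1 (hc t).2] at hw
    refine key _ ?_ _ hw
    rintro _ ⟨i, rfl⟩
    have hp := hpos i
    obtain ⟨f, g, hg, hf⟩ := Std.exists (D := gammaData' K σ) hx (hlift i) (by omega) (by omega)
      fun _ _ ha hb => (ht2 _ (.inl ha)).trans (ht2 _ (.inr hb)).symm
    refine ⟨g, ?_⟩
    rw [(hg.psi hf).2 t ht ht2 ht3, hsum]
  · rw [entry_conflict K ht ht2 ht3] at hw
    obtain rfl := (Submodule.mem_bot _).1 hw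
    exact ⟨0, by rw [map_zero, eUnit_zero]⟩

end

section
variable {n : ℕ} [hn : Fact (2 ≤ n)] {σ : TaggedTriangulation n} {K : Type*} [Field K]
  {E : Set (ZMod n)}

/-! ### Injectivity and image -/

/-- The nonzero standard elements are mapped to distinct monomials. -/
lemma psi_injective_stdSpan {a b : Edge n} (ha : a ∈ σ.edges) (hb : b ∈ σ.edges) {x y : ℤ} {z :
    Gamma' K σ} (hz : z ∈ stdSpan σ (gammaData' K σ) K a b x y) (h0 : psi σ K E z = 0) : z = 0 := by
  have hD := gammaData'_lawful (K := K) (σ := σ)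
  have hR := gammaData'_relations (K := K) (σ := σ)
  -- the flag of the monomial attached to a standard element is the one of this element for two
  -- chords, and is `true` if there is a spoke
  obtain ⟨t, ht⟩ : ∃ t, ∀ X Y f (g : Gamma' K σ), Std σ (gammaData' K σ) a b x y X Y f g → g ≠ 0 →
      ∃ f', psi σ K E g = eUnit σ K E a b (mono K t f' (X + Y - x - y)) ∧
        ((BothChords a b ∧ f' = f) ∨
          ¬ BothChords a b ∧ (f = true → Visible σ a ∧ Visible σ b)) := by
    have hv : ∀ {X Y f} {g : Gamma' K σ}, Std σ (gammaData' K σ) a b x y X Y f g → g ≠ 0 →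
        f = true → Visible σ a ∧ Visible σ b := by
      rintro X Y f g h hg rfl
      by_contra hv
      exact hg (h.eq_zero hD hR hv)
    rcases tag_cases (K := K) a b with hc | ⟨t, h1, h2, h3⟩ | ⟨t, t', h1, h2, h3⟩
    · exact ⟨mainTag σ, fun X Y f g h hg => ⟨f, (h.psi (hv h hg)).1 hc, .inl ⟨hc, rfl⟩⟩⟩
    · exact ⟨t, fun X Y f g h hg => ⟨true, (h.psi (hv h hg)).2 t h1 h2 h3,
        .inr ⟨fun hc => h1.elim (hc t).1 (hc t).2, hv h hg⟩⟩⟩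
    · exact ⟨t, fun X Y f g h hg => by
        have := h.flag_of_conflict h1 h2 h3
        exact (this.2 (hv h hg this.1)).elim⟩
  let G : Set (Gamma' K σ) := {g | ∃ X Y f, Std σ (gammaData' K σ) a b x y X Y f g} \ {0}
  let L : Gamma' K σ →ₗ[K] ScriptR K :=
    { toFun := fun z => psi σ K E z (vtx E ha) (vtx E hb)
      map_add' := fun _ _ => by rw [map_add]; rfl
      map_smul' := fun _ _ => by rw [map_smul]; rfl }
  have hL : ∀ g : G, ∃ k : Bool × ℤ, L g = mono K t k.1 k.2 ∧ ∃ X Y f,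
      Std σ (gammaData' K σ) a b x y X Y f g.1 ∧ k.2 = X + Y - x - y ∧
      ((BothChords a b ∧ k.1 = f) ∨
          ¬ BothChords a b ∧ (f = true → Visible σ a ∧ Visible σ b)) := by
    rintro ⟨g, ⟨X, Y, f, h⟩, hg⟩
    obtain ⟨f', h1, h2⟩ := ht X Y f g h hg
    refine ⟨(f', X + Y - x - y), ?_, X, Y, f, h, rfl, h2⟩
    change psi σ K E g _ _ = _
    rw [h1, eUnit_apply, if_pos ⟨rfl, rfl⟩]
  choose k hk hk' using hL
  have hinj : Function.Injective k := by
    intro g g' e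
    obtain ⟨X, Y, f, h, h1, h2⟩ := hk' g
    obtain ⟨X', Y', f', h', h1', h2'⟩ := hk' g'
    obtain ⟨i, rfl, rfl⟩ := h.lift.2.eq_shift h'.lift.2
    obtain rfl : i = 0 := by
      have : (n : ℤ) * i = 0 := by rw [e] at h1; omega
      have := two_le_int (n := n)
      rcases mul_eq_zero.1 ‹(n : ℤ) * i = 0› with _ | _ <;> omega
    simp only [mul_zero, add_zero] at h'
    have hf : f = f' := by
      rcases h2 with ⟨hc, e1⟩ | ⟨hc, hv⟩
      · rcases h2' with ⟨_, e2⟩ | ⟨hc', _⟩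
        · rw [← e1, ← e2, e]
        · exact (hc' hc).elim
      · rcases h2' with ⟨hc', _⟩ | ⟨_, hv'⟩
        · exact (hc hc').elim
        · by_cases hvis : Visible σ a ∧ Visible σ b
          · have e1 := (h.flag_of_visible hvis.1 hvis.2 hc).1
            have e2 := (h'.flag_of_visible hvis.1 hvis.2 hc).1
            exact Bool.eq_iff_iff.2 (e1.trans e2.symm)
          · cases f <;> cases f' <;> simp_all
    subst hf
    exact Subtype.ext (h.unique hD hR h')
  have hli : LinearIndependent K fun g : G => L g := by
    rw [show (fun g : G => L g) = (fun i : Bool × ℤ => mono K t i.1 i.2) ∘ k from funext hk]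
    exact (linearIndependent_mono (K := K) t).comp k hinj
  rw [stdSpan, ← Submodule.span_sdiff_singleton_zero] at hz
  obtain ⟨l, rfl⟩ := (Finsupp.mem_span_iff_linearCombination K G z).1 hz
  have : Finsupp.linearCombination K (fun g : G => L g) l = 0 := by
    have e : L (Finsupp.linearCombination K (Subtype.val : G → Gamma' K σ) l) = 0 := by
      change psi σ K E _ _ _ = 0
      rw [h0]
      rfl
    rwa [Finsupp.apply_linearCombination] at e
  rw [linearIndependent_iff.1 hli l this, map_zero]

lemma gammaIde (a : Q' σ) :
    (gammaData' K σ).ide a.1 = cls' K (Path.nil : Path a a) := jacData_ide a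

/-- A subspace that contains the classes of the paths from `a` to `b` contains the component at
`(a, b)` of each element. -/
lemma component_mem {N : Submodule K (Gamma' K σ)} (a b : Q' σ)
    (hp : ∀ p : Path a b, cls' K p ∈ N) (z : Gamma' K σ) :
    (gammaData' K σ).ide a.1 * z * (gammaData' K σ).ide b.1 ∈ N := by
  have hz := Submodule.mem_top (R := K) (x := z)
  rw [← span_pathClass (K := K) (W := potential σ Set.univ K) (S := internalArrows σ Set.univ)] at hz
  rw [gammaIde, gammaIde]
  refine (Submodule.span_le.2 ?_ : _ ≤ N.comap (LinearMap.mulRight K (cls' K (.nil : Path b b)) ∘ₗ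
    LinearMap.mulLeft K (cls' K (.nil : Path a a)))) hz
  rintro _ ⟨c, d, p, rfl⟩
  change cls' K (.nil : Path a a) * cls' K p * cls' K (.nil : Path b b) ∈ N
  by_cases e : a = c
  · subst e
    by_cases e : d = b
    · subst e
      rw [cls', cls', cls', nil_mul_pathClass, pathClass_mul_nil]
      exact hp p
    · rw [mul_assoc, cls', cls', cls', pathClass_mul_of_ne _ _ e, mul_zero]
      exact N.zero_mem
  · rw [cls', cls', cls', pathClass_mul_of_ne _ _ e, zero_mul]
    exact N.zero_mem

lemma sum_components (z : Gamma' K σ) :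
    ∑ a : Q' σ, ∑ b : Q' σ, (gammaData' K σ).ide a.1 * z * (gammaData' K σ).ide b.1 = z := by
  have h : ∑ a : Q' σ, (gammaData' K σ).ide a.1 = 1 := by
    simp only [gammaIde]
    exact sum_pathClass_nil
  simp only [← Finset.mul_sum, h, mul_one, ← Finset.sum_mul, one_mul]

lemma psi_injective : Function.Injective (psi σ K E) := by
  rw [← LinearMap.ker_eq_bot, LinearMap.ker_eq_bot']
  intro z hz
  rw [← sum_components z]
  refine Finset.sum_eq_zero fun a _ => Finset.sum_eq_zero fun b _ => ?_
  obtain ⟨x, y, x', y', c, hs⟩ := exists_start (gammaData' K σ) a.2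
  refine psi_injective_stdSpan (E := E) a.2 b.2
    (component_mem a b (fun p => pathClass_mem_stdSpan hs p) z) ?_
  rw [psi_mul, psi_mul, hz, mul_zero, zero_mul]

/-- The entries of the matrix of an element. -/
lemma psi_component_mem (a b : Q' σ) (z : Gamma' K σ) : psi σ K E ((gammaData' K σ).ide a.1 * z *
    (gammaData' K σ).ide b.1) ∈ entryMat σ K E a.1 b.1 := by
  refine component_mem (N := (entryMat σ K E a.1 b.1).comap (psi σ K E)) a b (fun p => ?_) z
  obtain ⟨x, y, x', y', c, hs⟩ := exists_start (gammaData' K σ) a.2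
  refine (Submodule.span_le.2 ?_ : stdSpan _ _ K _ _ _ _ ≤ _) (pathClass_mem_stdSpan hs p)
  exact fun _ ⟨_, _, _, h⟩ => h.psi_mem

lemma psi_entry_mem (z : Gamma' K σ) (a b : QVert σ E) : psi σ K E z a b ∈ entry K a.1 b.1 := by
  rw [← sum_components z, map_sum, Matrix.sum_apply]
  refine Submodule.sum_mem _ fun c _ => ?_
  rw [map_sum, Matrix.sum_apply]
  refine Submodule.sum_mem _ fun d _ => ?_
  obtain ⟨w, hw, e⟩ := psi_component_mem (E := E) c d z
  rw [← e]
  change eUnit σ K E _ _ w _ _ ∈ _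
  rw [eUnit_apply]
  split_ifs with h
  · rw [h.1, h.2]
    exact hw
  · exact Submodule.zero_mem _

lemma matrix_eq_sum (M : EdgeMat σ K E) :
    M = ∑ a, ∑ b, eUnit σ K E a.1 b.1 (M a b) := by
  ext c d
  simp only [Matrix.sum_apply, eUnit_apply]
  rw [Finset.sum_eq_single c, Finset.sum_eq_single d]
  · simp
  · exact fun b _ hb => if_neg fun h => hb (Subtype.ext h.2.symm)
  · simp
  · exact fun a _ ha => Finset.sum_eq_zero fun b _ => if_neg fun h => ha (Subtype.ext h.1.symm)
  · simp

lemma psi_surjective {M : EdgeMat σ K E}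
    (hM : ∀ a b, M a b ∈ entry K a.1 b.1) : ∃ z, psi σ K E z = M := by
  choose z hz using fun a b => exists_psi_eq (E := E) a.2 b.2 (hM a b)
  refine ⟨∑ a, ∑ b, z a b, ?_⟩
  simp only [map_sum, hz]
  exact (matrix_eq_sum M).symm

variable {a b : Edge n} {w : ScriptR K}

/-! ### The centre -/

lemma uPow_mul_unitEps_mem (ha : a ∈ σ.edges) (hb : b ∈ σ.edges)
    (h : ∀ t, ¬ HasTag t a) : uPow K (ell a b) * unitEps K b ∈ entry K a b := by
  cases b with
  | spoke r t =>
    rw [mem_entry_spoke (t := t) K (by simp [h]) fun hc => (hc t).2 (by simp)]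
    exact Submodule.subset_span ⟨0, by simp [mono, unitEps]⟩
  | chord r s =>
    have hc : BothChords a (chord r s) := fun t => ⟨h t, hasTag_chord⟩
    rw [mem_entry_chord K .plain hc (turn_ell ha hb hc), unitEps_eq_one fun t => hasTag_chord]
    exact Submodule.subset_span ⟨false, 0, by simp, by simp [mono]⟩

lemma side_not_hasTag (k : ZMod n) (t : Tag) : ¬ HasTag t (side k) := hasTag_chord

lemma ell_self (ha : a ∈ σ.edges) : ell a a = 0 := by
  obtain ⟨x, y, hx⟩ := exists_lift_edge ha
  obtain ⟨i, hi, -⟩ := hx.reach hx le_rfl le_rfl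
  have : (0 : ℤ) ≤ 2 * n * i := by positivity
  omega

lemma exists_embed_of_mem (σ : TaggedTriangulation n) {k : ZMod n}
    (h : w ∈ entry K (side k) (side k)) : ∃ r, w = embed K n r := by
  have h0 := ell_self (σ.side_mem k)
  have hT : ¬ Turn (side k) (side k) := fun hT =>
    turn_ell (σ.side_mem k) (σ.side_mem k)
      (fun t => ⟨side_not_hasTag k t, side_not_hasTag k t⟩) hT h0
  change w ∈ entry K (chord _ _) (chord _ _) at h
  rw [entry, if_neg (show ¬ Turn (chord k (k + 1)) (chord k (k + 1)) from hT)] at h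
  obtain ⟨r, rfl⟩ := Submodule.mem_span_singleton.1 h
  exact ⟨r, by
    rw [rPrime_smul, show ell (chord k (k + 1)) (chord k (k + 1)) = 0 from h0, Nat.cast_zero,
      uPow_zero, mul_one]⟩

open Classical in
lemma eUnit_mul_apply (hb : b ∈ σ.edges) (w : ScriptR K)
    (M : EdgeMat σ K E) (i j : QVert σ E) :
    (eUnit σ K E a b w * M) i j = if i.1 = a then w * M (vtx E hb) j else 0 := by
  rw [Matrix.mul_apply, Finset.sum_eq_single (vtx E hb)]
  · simp only [eUnit_apply, show (vtx E hb).1 = b from rfl, and_true]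
    split_ifs <;> simp
  · intro c _ hc
    rw [eUnit_apply, if_neg fun h => hc (Subtype.ext h.2), zero_mul]
  · simp

open Classical in
lemma mul_eUnit_apply (ha : a ∈ σ.edges) (w : ScriptR K)
    (M : EdgeMat σ K E) (i j : QVert σ E) :
    (M * eUnit σ K E a b w) i j = if j.1 = b then M i (vtx E ha) * w else 0 := by
  rw [Matrix.mul_apply, Finset.sum_eq_single (vtx E ha)]
  · simp only [eUnit_apply, show (vtx E ha).1 = a from rfl, true_and]
    split_ifs <;> simp
  · intro c _ hc
    rw [eUnit_apply, if_neg fun h => hc (Subtype.ext h.1), mul_zero]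
  · simp

lemma eUnit_mem (hw : w ∈ entry K a b) (c d : QVert σ E) :
    eUnit σ K E a b w c d ∈ entry K c.1 d.1 := by
  rw [eUnit_apply]
  split_ifs with h
  · rwa [h.1, h.2]
  · exact Submodule.zero_mem _

lemma unitEps_mem (ha : a ∈ σ.edges) : unitEps K a ∈ entry K a a := by
  have := psi_entry_mem (E := Set.univ) (K := K) ((gammaData' K σ).ide a) (vtx _ ha) (vtx _ ha)
  rwa [psi_idem ha, eUnit_apply, if_pos ⟨rfl, rfl⟩] at this

lemma unitEps_mul_of_mem (ha : a ∈ σ.edges) (hb : b ∈ σ.edges)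
    (hw : w ∈ entry K a b) : unitEps K a * w = w ∧ w * unitEps K b = w := by
  obtain ⟨z, hz⟩ := exists_psi_eq (E := Set.univ) ha hb hw
  have h1 : unitMat σ K Set.univ * psi σ K Set.univ z = psi σ K Set.univ z := by
    rw [← psi_one, ← psi_mul, one_mul]
  have h2 : psi σ K Set.univ z * unitMat σ K Set.univ = psi σ K Set.univ z := by
    rw [← psi_one, ← psi_mul, mul_one]
  rw [hz, unitMat_mul_eUnit] at h1
  rw [hz, eUnit_mul_unitMat] at h2
  have e := congrFun₂ h1 (vtx _ ha) (vtx _ hb)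
  have e' := congrFun₂ h2 (vtx _ ha) (vtx _ hb)
  simp only [eUnit_apply, show (vtx Set.univ ha).1 = a from rfl,
    show (vtx Set.univ hb).1 = b from rfl, and_self, if_true] at e e'
  exact ⟨e, e'⟩

/-- The matrices commuting with all the matrices with entries in the `A_{a,b}`: they are diagonal,
and comparison with a side shows that they come from an element of `R'`. -/
lemma central_matrix {M : EdgeMat σ K E} (hM : ∀ a b, M a b ∈ entry K
    a.1 b.1) (hc : ∀ N : EdgeMat σ K E, (∀ a b, N a b ∈ entry K a.1
    b.1) → M * N = N * M) : ∃ r, M = embed K n r • unitMat σ K E := by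
  obtain ⟨r, hr⟩ := exists_embed_of_mem σ (hM (sideV σ E 0) (sideV σ E 0))
  refine ⟨r, ?_⟩
  ext a b
  rw [Matrix.smul_apply, unitMat, Matrix.diagonal_apply, smul_eq_mul]
  by_cases hab : a = b
  · subst hab
    rw [if_pos rfl]
    have hw := uPow_mul_unitEps_mem (K := K) (σ.side_mem 0) a.2 (side_not_hasTag 0)
    have h := congrFun₂ (hc _ (eUnit_mem hw)) (sideV σ E 0) a
    rw [mul_eUnit_apply (σ.side_mem 0), if_pos rfl, eUnit_mul_apply a.2,
      if_pos (show (sideV σ E 0).1 = side 0 from rfl), show vtx E (σ.side_mem 0) = sideV σ E 0 from rfl, hr, show vtx E a.2 = a from rfl, mul_assoc,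
      (unitEps_mul_of_mem a.2 a.2 (hM a a)).1, mul_left_comm] at h
    have hu := uPow_mul_neg K (ell (side 0) a.1 : ℤ)
    linear_combination (-uPow K (-(ell (side 0) a.1 : ℤ))) * h -
      (M a a - embed K n r * unitEps K a.1) * hu
  · rw [if_neg hab, mul_zero]
    have h := congrFun₂ (hc _ (eUnit_mem (unitEps_mem (K := K) a.2))) a b
    rwa [mul_eUnit_apply a.2, if_neg fun h : b.1 = a.1 => hab (Subtype.ext h.symm), eUnit_mul_apply a.2,
      if_pos rfl, show vtx E a.2 = a from rfl, (unitEps_mul_of_mem a.2 b.2 (hM a b)).1, eq_comm] at h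

lemma smul_unitMat_mem (r : RPrime K n) (a b : QVert σ E) :
    (embed K n r • unitMat σ K E) a b ∈ entry K a.1 b.1 := by
  rw [Matrix.smul_apply, unitMat, Matrix.diagonal_apply, smul_eq_mul, ← rPrime_smul]
  split_ifs with h
  · subst h
    exact Submodule.smul_mem _ _ (unitEps_mem a.2)
  · simp

/-! ### The isomorphisms -/

variable (σ K) in
/-- The map from `Γ_σ` to the matrices. -/
def toMat : Gamma K σ →ₗ[K] Matrix (Q σ) (Q σ) (ScriptR K) :=
  psi σ K (arcVertices σ) ∘ₗ (iota K σ).toLinearMap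

lemma toMat_mul (x y : Gamma K σ) : toMat σ K (x * y) = toMat σ K x * toMat σ K y := by
  change psi σ K _ (iota K σ (x * y)) = _
  rw [map_mul, psi_mul]
  rfl

lemma toMat_one : toMat σ K 1 = unitMat σ K _ := by
  change psi σ K _ (iota K σ 1) = _
  rw [map_one, psi_one]

lemma toMat_symm (z : Gamma' K σ) : toMat σ K ((iota K σ).symm z) = psi σ K _ z := by
  change psi σ K _ (iota K σ _) = _
  rw [AlgEquiv.apply_symm_apply]

lemma iota_idem' (a : Q σ) : iota K σ (idem K a) = (gammaData' K σ).ide a.1 :=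
  (iota_idem a).trans (gammaIde (full a)).symm

lemma toMat_idem (a : Q σ) : toMat σ K (idem K a) = eUnit σ K _ a.1 a.1 (unitEps K a.1) := by
  change psi σ K _ (iota K σ _) = _
  rw [iota_idem', psi_idem a.2]

lemma toMat_injective : Function.Injective (toMat σ K) :=
  psi_injective.comp (iota K σ).injective

lemma toMat_entry_mem (x : Gamma K σ) (a b : Q σ) : toMat σ K x a b ∈ entry K a.1 b.1 :=
  psi_entry_mem _ a b

lemma toMat_surjective {M : Matrix (Q σ) (Q σ) (ScriptR K)}
    (hM : ∀ a b, M a b ∈ entry K a.1 b.1) : ∃ x, toMat σ K x = M := by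
  obtain ⟨z, hz⟩ := psi_surjective hM
  exact ⟨(iota K σ).symm z, (toMat_symm z).trans hz⟩

lemma unitMat_mul_toMat (x : Gamma K σ) : unitMat σ K _ * toMat σ K x = toMat σ K x := by
  rw [← toMat_one, ← toMat_mul, one_mul]

lemma toMat_mul_unitMat (x : Gamma K σ) : toMat σ K x * unitMat σ K _ = toMat σ K x := by
  rw [← toMat_one, ← toMat_mul, mul_one]

lemma exists_center (r : RPrime K n) : ∃ z : Subalgebra.center K (Gamma K σ),
    toMat σ K z = embed K n r • unitMat σ K _ := by
  obtain ⟨z, hz⟩ := toMat_surjective (smul_unitMat_mem (σ := σ) r)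
  refine ⟨⟨z, Subalgebra.mem_center_iff.2 fun x => toMat_injective ?_⟩, hz⟩
  rw [toMat_mul, toMat_mul, hz, Matrix.mul_smul, Matrix.smul_mul, unitMat_mul_toMat,
    toMat_mul_unitMat]

variable (σ) in
/-- The central element attached to an element of `R'`. -/
def central (r : RPrime K n) : Subalgebra.center K (Gamma K σ) := (exists_center r).choose

lemma toMat_central (r : RPrime K n) :
    toMat σ K (central σ r) = embed K n r • unitMat σ K _ := (exists_center (σ := σ) r).choose_spec

lemma smul_unitMat_injective {r r' : RPrime K n}
    (h : embed K n r • unitMat σ K E = embed K n r' • unitMat σ K E) : r = r' := by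
  have := congrFun₂ h (sideV σ E 0) (sideV σ E 0)
  simp only [Matrix.smul_apply, unitMat, Matrix.diagonal_apply_eq, smul_eq_mul] at this
  rw [show unitEps K (sideV σ E 0).1 = 1 from rfl, mul_one, mul_one] at this
  exact embed_injective (K := K) n hn.out this

variable (K σ) in
/-- The isomorphism from `R'` to the centre of `Γ_σ`. -/
def phi : RPrime K n ≃ₐ[K] Subalgebra.center K (Gamma K σ) :=
  have inj : ∀ {x y : Subalgebra.center K (Gamma K σ)},
      toMat σ K x = toMat σ K y → x = y := fun h => Subtype.ext (toMat_injective h)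
  AlgEquiv.ofBijective
    { toFun := central σ
      map_one' := inj (by
        rw [toMat_central, map_one, one_smul, Subalgebra.coe_one, toMat_one])
      map_mul' := fun r r' => inj (by
        rw [toMat_central, map_mul, Subalgebra.coe_mul, toMat_mul, toMat_central, toMat_central, Matrix.smul_mul,
          Matrix.mul_smul, unitMat_idem, smul_smul])
      map_zero' := inj (by rw [toMat_central, map_zero, zero_smul, Subalgebra.coe_zero, map_zero])
      map_add' := fun r r' => inj (by
        rw [toMat_central, map_add, add_smul, Subalgebra.coe_add, map_add, toMat_central, toMat_central])
      commutes' := fun c => inj (by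
        rw [toMat_central, AlgHom.commutes, Subalgebra.coe_algebraMap, Algebra.algebraMap_eq_smul_one,
          Algebra.algebraMap_eq_smul_one, map_smul, toMat_one, smul_assoc, one_smul]) }
    ⟨fun r r' h => smul_unitMat_injective (σ := σ) (E := arcVertices σ) (by
      rw [← toMat_central, ← toMat_central]; exact congrArg (fun x => toMat σ K x.1) h),
    fun z => by
      obtain ⟨r, hr⟩ := central_matrix (toMat_entry_mem z.1) fun N hN => by
        obtain ⟨x, rfl⟩ := toMat_surjective hN
        rw [← toMat_mul, ← toMat_mul, (Subalgebra.mem_center_iff.1 z.2 x)]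
      exact ⟨r, inj ((toMat_central r).trans hr.symm)⟩⟩

lemma toMat_phi (r : RPrime K n) : toMat σ K (phi σ K r) = embed K n r • unitMat σ K _ :=
  toMat_central r

lemma toMat_phi_mul (r : RPrime K n) (x : Gamma K σ) :
    toMat σ K (phi σ K r * x) = embed K n r • toMat σ K x := by
  rw [toMat_mul, toMat_phi, Matrix.smul_mul, unitMat_mul_toMat]

variable (K σ) in
/-- The algebra of the matrices with entries in the `A_{a,b}`. -/
def matAlg : NonUnitalSubalgebra (RPrime K n) (Matrix (Q σ) (Q σ) (ScriptR K)) where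
  carrier := {M | ∀ a b, M a b ∈ entry K a.1 b.1}
  zero_mem' := fun _ _ => Submodule.zero_mem _
  add_mem' := fun h h' a b => Submodule.add_mem (entry K a.1 b.1) (h a b) (h' a b)
  smul_mem' := fun r _ h a b => Submodule.smul_mem (entry K a.1 b.1) r (h a b)
  mul_mem' := by
    intro M N hM hN
    obtain ⟨x, rfl⟩ := toMat_surjective hM
    obtain ⟨y, rfl⟩ := toMat_surjective hN
    rw [← toMat_mul]
    exact toMat_entry_mem _

variable (K σ) in
/-- The isomorphism from the algebra of matrices to `Γ_σ`. -/
def matIso : matAlg σ K ≃+* Gamma K σ :=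
  RingEquiv.symm <| RingEquiv.ofBijective
    ({ toFun := fun x => ⟨toMat σ K x, toMat_entry_mem x⟩
       map_mul' := fun _ _ => Subtype.ext (toMat_mul _ _)
       map_zero' := Subtype.ext (map_zero _)
       map_add' := fun _ _ => Subtype.ext (map_add _ _ _) } : Gamma K σ →ₙ+* matAlg σ K)
    ⟨fun _ _ h => toMat_injective (congrArg Subtype.val h), fun M => by
      obtain ⟨x, hx⟩ := toMat_surjective M.2
      exact ⟨x, Subtype.ext hx⟩⟩

lemma toMat_matIso (M : matAlg σ K) : toMat σ K (matIso σ K M) = M :=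
  congrArg Subtype.val ((matIso σ K).symm_apply_apply M)

lemma idem_mul_idem (a : Q σ) : idem K a * idem K a = idem K a := by
  apply (iota K σ).injective
  rw [map_mul, iota_idem]
  exact nil_mul_pathClass _

lemma toMat_component (a b : Q σ) (x : Gamma K σ) : toMat σ K (idem K a * x * idem K b) =
    eUnit σ K _ a.1 b.1 (toMat σ K x a b) := by
  have h := unitEps_mul_of_mem a.2 b.2 (toMat_entry_mem x a b)
  ext i j
  rw [toMat_mul, toMat_mul, toMat_idem, toMat_idem, mul_eUnit_apply b.2, eUnit_mul_apply a.2,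
    eUnit_apply, show vtx _ a.2 = a from rfl, show vtx _ b.2 = b from rfl]
  by_cases hi : i.1 = a.1 <;> by_cases hj : j.1 = b.1 <;> simp [hi, hj, h]

lemma toMat_of_mem_peirce {a b : Q σ} {x : Gamma K σ} (hx : x ∈ peirce K a b) :
    toMat σ K x = eUnit σ K _ a.1 b.1 (toMat σ K x a b) := by
  obtain ⟨y, rfl⟩ := hx
  rw [← toMat_component, LinearMap.mulLeftRight_apply]
  simp only [← mul_assoc, idem_mul_idem]
  rw [mul_assoc _ (idem K b), idem_mul_idem]

variable (K) in
/-- The isomorphism from `A_{a,b}` to `e_a Γ_σ e_b`. -/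
def peirceIso (a b : Q σ) : entry K a.1 b.1 ≃+ peirce K a b :=
  AddEquiv.symm <| AddEquiv.ofBijective
    ({ toFun := fun x => ⟨toMat σ K x.1 a b, toMat_entry_mem _ _ _⟩
       map_zero' := Subtype.ext (by simp)
       map_add' := fun _ _ => Subtype.ext (by simp) } : peirce K a b →+ entry K a.1 b.1)
    ⟨fun x y h => Subtype.ext (toMat_injective (by
      rw [toMat_of_mem_peirce x.2, toMat_of_mem_peirce y.2]
      exact congrArg (fun w => eUnit σ K _ a.1 b.1 (Subtype.val w)) h)), fun w => by
      obtain ⟨x, hx⟩ := toMat_surjective (eUnit_mem (σ := σ) (E := arcVertices σ) w.2)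
      refine ⟨⟨idem K a * x * idem K b, x, rfl⟩, Subtype.ext ?_⟩
      change toMat σ K _ a b = _
      rw [toMat_component, eUnit_apply, if_pos ⟨rfl, rfl⟩, hx, eUnit_apply, if_pos ⟨rfl, rfl⟩]⟩

lemma toMat_peirceIso (a b : Q σ) (w : entry K a.1 b.1) :
    toMat σ K (peirceIso K a b w) = eUnit σ K _ a.1 b.1 w := by
  rw [toMat_of_mem_peirce (peirceIso K a b w).2]
  congr 1
  exact congrArg Subtype.val ((peirceIso K a b).symm_apply_apply w)

end

section
variable {n : ℕ} [hn : Fact (2 ≤ n)] {σ : TaggedTriangulation n} {K : Type*} [Field K]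
  {E : Set (ZMod n)}

variable {m x y : ℤ} {J : Option (ZMod n)} {a b : Edge n}

/-! ### The grading by the `θ`-length -/

lemma point_cast (x : ℤ) :
    point (x : ZMod n) = Complex.exp (2 * Real.pi * Complex.I * (x : ℂ) / (n : ℂ)) := by
  have hn0 : (n : ℂ) ≠ 0 := by exact_mod_cast (NeZero.ne n)
  obtain ⟨i, hi⟩ : ∃ i : ℤ, (x : ℤ) = (x : ZMod n).val + n * i := by
    obtain ⟨i, hi⟩ := (ZMod.intCast_eq_intCast_iff_dvd_sub (((x : ZMod n).val : ℕ) : ℤ) x n).1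
      (by simp)
    exact ⟨i, by omega⟩
  have hc : (x : ℂ) = ((x : ZMod n).val : ℂ) + n * i := by exact_mod_cast hi
  rw [point, hc, Complex.exp_eq_exp_iff_exists_int]
  exact ⟨-i, by push_cast; field_simp; ring⟩

/-- The direction of the vector of an edge. -/
lemma Lift.vec_eq (h : Lift σ a x y) : ∃ c : ℝ, 0 < c ∧
    vec a = c * (Complex.I * Complex.exp (Real.pi * (x + y : ℤ) / n * Complex.I)) := by
  have hn0 : (n : ℂ) ≠ 0 := by exact_mod_cast (NeZero.ne n)
  have hn1 : (0 : ℝ) < n := by exact_mod_cast Nat.pos_of_ne_zero (NeZero.ne n)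
  cases h with
  | spoke h =>
    refine ⟨1, one_pos, ?_⟩
    have : (Real.pi * ((x + (x + n) : ℤ) : ℂ) / n * Complex.I) =
        2 * Real.pi * Complex.I * x / n + Real.pi * Complex.I := by
      push_cast; field_simp; ring
    rw [this, Complex.exp_add, Complex.exp_pi_mul_I, sp, vec, point_cast]
    push_cast
    ring
  | chord h =>
    have h1 : (x : ℝ) < y := by exact_mod_cast h.1
    have h2 : (y : ℝ) < x + n := by exact_mod_cast h.2.1
    refine ⟨2 * Real.sin (Real.pi * (y - x) / n), mul_pos two_pos
      (Real.sin_pos_of_pos_of_lt_pi (div_pos (mul_pos Real.pi_pos (sub_pos.2 h1)) hn1) ?_), ?_⟩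
    · rw [div_lt_iff₀ hn1]
      exact mul_lt_mul_of_pos_left (by linarith) Real.pi_pos
    · have e1 : 2 * Real.pi * Complex.I * (y : ℂ) / n =
          Real.pi * (x + y : ℤ) / n * Complex.I + Real.pi * (y - x) / n * Complex.I := by
        push_cast; field_simp; ring
      have e2 : 2 * Real.pi * Complex.I * (x : ℂ) / n =
          Real.pi * (x + y : ℤ) / n * Complex.I + -(Real.pi * (y - x) / n * Complex.I) := by
        push_cast; field_simp; ring
      rw [ch, vec, point_cast, point_cast, e1, e2, Complex.exp_add, Complex.exp_add]
      push_cast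
      rw [Complex.sin, neg_mul]
      linear_combination (-(Complex.exp (Real.pi * (x + y) / n * Complex.I)) *
        (Complex.exp (-(Real.pi * (y - x) / n * Complex.I)) -
          Complex.exp (Real.pi * (y - x) / n * Complex.I))) * Complex.I_sq

/-- The oriented angle between two edges is computed by lifts: the direction of the edge with lift
`(x, y)` has argument `π (x + y) / n`, up to a constant. -/
lemma Lift.angle_eq {X Y : ℤ} (ha : Lift σ a x y) (hb : Lift σ b X Y) (h1 : x ≤ X) (h2 : X < x +
    n) (h3 : y ≤ Y) (h4 : Y < y + n) : n / Real.pi * angle a b = theta a b := by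
  have hn1 : (0 : ℝ) < n := by exact_mod_cast Nat.pos_of_ne_zero (NeZero.ne n)
  obtain ⟨c, hc, e⟩ := ha.vec_eq
  obtain ⟨c', hc', e'⟩ := hb.vec_eq
  have ht : ((theta a b : ℤ) : ℝ) = (X - x + (Y - y) : ℤ) :=
    congrArg _ (theta_eq ha.facts.2.1 ha.facts.2.2.1 hb.facts.2.1 hb.facts.2.2.1 h1 h2 h3 h4)
  have key : vec b / vec a = ((c' / c : ℝ) : ℂ) *
      Complex.exp ((Real.pi * (theta a b : ℕ) / n : ℝ) * Complex.I) := by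
    have hx : ((Real.pi * (theta a b : ℕ) / n : ℝ) * Complex.I) =
        Real.pi * (X + Y : ℤ) / n * Complex.I - Real.pi * (x + y : ℤ) / n * Complex.I := by
      rw [show ((theta a b : ℕ) : ℝ) = _ from ht]
      push_cast; ring
    rw [hx, Complex.exp_sub, e, e']
    have : (c : ℂ) ≠ 0 := by exact_mod_cast hc.ne'
    have := Complex.exp_ne_zero (Real.pi * (x + y : ℤ) / n * Complex.I)
    have := Complex.I_ne_zero
    push_cast
    field_simp
  have h0 : Real.pi * (theta a b : ℕ) / n ∈ Set.Ico 0 (0 + 2 * Real.pi) := by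
    refine ⟨by positivity, ?_⟩
    have : ((theta a b : ℕ) : ℝ) < 2 * n := by
      rw [show ((theta a b : ℕ) : ℝ) = _ from ht]
      exact_mod_cast (by omega : X - x + (Y - y) < 2 * n)
    rw [div_lt_iff₀ hn1]
    nlinarith [Real.pi_pos]
  rw [angle, key, Complex.arg_real_mul _ (div_pos hc' hc), Complex.arg_exp_mul_I, toIocMod,
    toIcoMod_sub_zsmul, (toIcoMod_eq_self _).2 h0]
  field_simp

lemma LArr.exists_lifts {i : Fin 3} {J₁ J₂ : Option (ZMod n)} {c : Edge n} (h : LArr σ i J J₁ J₂ a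
    b c) : ∃ x y X Y, Lift σ a x y ∧ Lift σ b X Y ∧ x ≤ X ∧ X < x + n ∧ y ≤ Y ∧ Y < y + n := by
  have := two_le_int (n := n)
  cases h with
  | A1 x y z h h' h'' =>
    have := h.1; have := h'.1; have := h''.2.1
    exact ⟨_, _, _, _, .chord h, .chord h'', by omega⟩
  | A2 x y z h h' h'' =>
    have := h.1; have := h'.1; have := h''.2.1
    exact ⟨_, _, _, _, .chord h'', .chord h', by omega⟩
  | A3 x y z h h' h'' =>
    have := h.1; have := h'.1; have := h''.2.1
    exact ⟨_, _, _, _, .chord h', (Lift.chord h).sh 1, by omega⟩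
  | B1 x y t h hx hy =>
    have := h.1; have := h.2.1
    exact ⟨_, _, _, _, .chord h, .spoke hx, by omega⟩
  | B2 x y t h hx hy =>
    have := h.1; have := h.2.1
    exact ⟨_, _, _, _, .spoke hx, .spoke hy, by omega⟩
  | B3 x y t h hx hy =>
    have := h.1; have := h.2.1
    exact ⟨_, _, _, _, .spoke hy, (Lift.chord h).sh 1, by omega⟩
  | D1 k m t h h' hk =>
    have := h.1; have := h.2.1
    refine ⟨m, k + n, k + n * 1, m + n * 1, ?_, (Lift.chord h).sh 1, by omega⟩
    simpa [ch] using Lift.chord h'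
  | D2 k m t h h' hk =>
    have := h.1; have := h.2.1
    exact ⟨_, _, _, _, .chord h, .spoke (by cases t; exacts [hk.1, hk.2]), by omega⟩
  | D3 k m t h h' hk =>
    have := h.1; have := h.2.1
    refine ⟨k, k + n, m, k + n, .spoke (by cases t; exacts [hk.1, hk.2]), ?_, by omega⟩
    simpa [ch] using Lift.chord h'

variable (σ) in
lemma side_lifts (k : ZMod n) :
    ∃ x : ℤ, Lift σ (side (k - 1)) (x - 1) x ∧ Lift σ (side k) x (x + 1) := by
  obtain ⟨x, rfl⟩ := ZMod.intCast_surjective k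
  rw [side_int_pred, side_int]
  have := Lift.chord (isChord_side (σ := σ) (x - 1))
  rw [sub_add_cancel] at this
  exact ⟨x, this, .chord (isChord_side x)⟩

lemma theta_side (σ : TaggedTriangulation n) (k : ZMod n) : theta (side (k - 1)) (side k) = 2 := by
  have := two_le_int (n := n)
  obtain ⟨x, h, h'⟩ := side_lifts σ k
  have := theta_eq h.facts.2.1 h.facts.2.2.1 h'.facts.2.1 h'.facts.2.2.1 (by omega) (by omega)
    (by omega) (by omega)
  omega

lemma thetaLength_eq {a b : QVert σ E} (p : Path a b) : thetaLength p = pathTheta p := by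
  induction p with
  | nil => simp [thetaLength, pathTheta]
  | @cons b c p α ih =>
    rw [thetaLength, ih, pathTheta_cons, Nat.cast_add]
    congr 1
    obtain ⟨J, h, -⟩ | ⟨k, -, hb, hc, -⟩ := arrow_cases α
    · obtain ⟨_, _, _, _, L⟩ := corner_iff.1 h
      obtain ⟨_, _, _, _, h1, h2, h⟩ := L.exists_lifts
      exact h1.angle_eq h2 h.1 h.2.1 h.2.2.1 h.2.2.2
    · have := two_le_int (n := n)
      obtain ⟨x, h, h'⟩ := side_lifts σ k
      rw [hb, hc]
      exact h.angle_eq h' (by omega) (by omega) (by omega) (by omega)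

lemma one_mem_piece : (1 : ScriptR K) ∈ scriptPiece K 0 :=
  mono_zero K .plain ▸ mono_mem K .plain false 0

lemma eps_mem_piece (t : Tag) : eps K t ∈ scriptPiece K 0 := by
  simpa [mono, uPow_zero] using mono_mem K t true 0

lemma unitEps_mem_piece (a : Edge n) : unitEps K a ∈ scriptPiece K 0 := by
  cases a with
  | chord => exact one_mem_piece
  | spoke r t => exact eps_mem_piece t

lemma factor_mem_piece (J : Option (ZMod n)) (a b : Edge n) :
    factor σ K J a b ∈ scriptPiece K 0 := by
  rw [factor]
  split_ifs
  exacts [eps_mem_piece _, one_mem_piece, eps_mem_piece _]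

lemma psi_ar (h : Corner σ J a b) : psi σ K E ((gammaData' K σ).ar J a b) = eUnit σ K E a b (uPow
    K (theta a b) * factor σ K J a b) := by
  obtain ⟨_, _, _, _, L⟩ := corner_iff.1 h
  have e : matRep σ K E ((gammaData' K σ).ar J a b) = _ := matRep_compat.ar h
  rw [psi_apply, e, matData, unitMat_mul_eUnit, mul_left_comm, L.unitEps_mul.1]

lemma psi_ex (k : ZMod n) : psi σ K E ((gammaData' K σ).ex k) =
    eUnit σ K E (side (k - 1)) (side k) (uPow K 2) := by
  have e : matRep σ K E ((gammaData' K σ).ex k) = _ := matRep_compat.ex k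
  rw [psi_apply, e, matData, unitMat_mul_eUnit]
  exact congrArg _ (one_mul _)

lemma iota_internal {a b : Q σ} (h : Corner σ J a.1 b.1) :
    iota K σ (cls K (intArrow J h : a ⟶ b).toPath) = (gammaData' K σ).ar J a.1 b.1 :=
  (iota_arrow _).trans (jacData_ar (a := full a) (b := full b) h).symm

lemma iota_external {k : ZMod n} {a b : Q σ} (hk : k ∈ arcVertices σ) (ha : a.1 = side (k - 1))
    (hb : b.1 = side k) : iota K σ (cls K (Quiver.Hom.toPath (Arrow.external k hk ha hb : a ⟶ b))) =
    (gammaData' K σ).ex k :=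
  (iota_arrow _).trans (pathClass_external (a := full a) (b := full b) _ ha hb)

lemma eUnit_mem_piece {w : ScriptR K} (hw : w ∈ scriptPiece K m)
    (i j : QVert σ E) : eUnit σ K E a b w i j ∈ scriptPiece K m := by
  rw [eUnit_apply]
  split_ifs
  exacts [hw, zero_mem _]

lemma toMat_path_mem {a b : Q σ} (p : Path a b) (i j : Q σ) :
    toMat σ K (cls K p) i j ∈ scriptPiece K (pathTheta p) := by
  induction p generalizing i j with
  | nil => exact toMat_idem (K := K) a ▸ eUnit_mem_piece (unitEps_mem_piece _) i j
  | @cons b c p α ih =>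
    rw [show cls K (p.cons α) = cls K p * cls K α.toPath from pathClass_cons p α, toMat_mul,
      Matrix.mul_apply, pathTheta_cons, Nat.cast_add]
    refine Submodule.sum_mem _ fun d _ => mul_mem_scriptPiece K (ih i d) ?_
    change psi σ K _ (iota K σ _) d j ∈ _
    obtain ⟨J, h, rfl⟩ | ⟨k, hk, hb, hc, rfl⟩ := arrow_cases α
    · rw [iota_internal, psi_ar h]
      refine eUnit_mem_piece ?_ d j
      have := mul_mem_scriptPiece K (mono_mem K .plain false (theta b.1 c.1))
        (factor_mem_piece (K := K) (σ := σ) J b.1 c.1)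
      simpa [mono] using this
    · rw [iota_external, psi_ex, hb, hc, theta_side σ]
      refine eUnit_mem_piece ?_ d j
      simpa [mono] using mono_mem K .plain false 2

/-- A family of subspaces that is mapped injectively into the homogeneous matrices, and that spans
the algebra, is a grading and consists of all the preimages of the homogeneous matrices. -/
lemma graded_of_matrix {B : Type*} [Ring B] [Algebra K B] (T : B →ₗ[K] Matrix (Q σ) (Q σ) (ScriptR
    K)) (hT : Function.Injective T) (hmul : ∀ x y, T (x * y) = T x * T y) (h1 : T 1 = unitMat σ K _)
    (P : ℤ → Submodule K B) (hP : ∀ m, ∀ x ∈ P m, ∀ a b, T x a b ∈ scriptPiece K m) (hsup : iSup P =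
    ⊤) : (∀ m x, x ∈ P m ↔ ∀ a b, T x a b ∈ scriptPiece K m) ∧ Nonempty (GradedAlgebra P) := by
  let L : ℤ → B →ₗ[K] Matrix (Q σ) (Q σ) (ScriptR K) := fun m =>
    (scriptProj K m).mapMatrix ∘ₗ T
  have hL : ∀ m x, (∀ a b, T x a b ∈ scriptPiece K m) → L m x = T x := fun m x h => by
    ext a b
    exact scriptProj_of_mem K (h a b)
  have hL' : ∀ m m' x, m' ≠ m → x ∈ P m → L m' x = 0 := fun m m' x hm h => by
    ext a b
    exact scriptProj_of_ne K hm (hP m x h a b)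
  have hiff : ∀ m x, x ∈ P m ↔ ∀ a b, T x a b ∈ scriptPiece K m := by
    refine fun m x => ⟨hP m x, fun h => ?_⟩
    obtain ⟨f, hf, e⟩ := (Submodule.mem_iSup_iff_exists_finsupp P x).1 (hsup ▸ Submodule.mem_top)
    have : x = f m := by
      apply hT
      rw [← hL m x h, ← hL m (f m) (hP m _ (hf m)), ← e, Finsupp.sum, map_sum,
        Finset.sum_eq_single m (fun i _ hi => hL' i m _ hi.symm (hf i)) fun h => by
          rw [Finsupp.notMem_support_iff.1 h, map_zero]]
    exact this ▸ hf m
  have hind : iSupIndep P := by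
    refine iSupIndep_def.2 fun m => Submodule.disjoint_def.2 fun x hx hx' => hT ?_
    rw [map_zero, ← hL m x (hP m x hx)]
    exact (iSup₂_le fun j hj y hy => hL' j m y (Ne.symm hj) hy :
      ⨆ j, ⨆ (_ : j ≠ m), P j ≤ LinearMap.ker (L m)) hx'
  have : SetLike.GradedMonoid P :=
    { one_mem := by
        rw [hiff, h1]
        intro a b
        rw [unitMat, Matrix.diagonal_apply]
        split_ifs
        exacts [unitEps_mem_piece _, zero_mem _]
      mul_mem := by
        intro i j x y hx hy
        rw [hiff] at hx hy ⊢
        intro a b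
        rw [hmul, Matrix.mul_apply]
        exact Submodule.sum_mem _ fun c _ => mul_mem_scriptPiece K (hx a c) (hy c b) }
  have := ((DirectSum.isInternal_submodule_iff_iSupIndep_and_iSup_eq_top P).2
    ⟨hind, hsup⟩).chooseDecomposition
  exact ⟨hiff, ⟨{}⟩⟩

lemma mem_thetaPiece_aux {x : Gamma K σ} (hx : x ∈ thetaPiece K σ m) (a b : Q σ) :
    toMat σ K x a b ∈ scriptPiece K m := by
  induction hx using Submodule.span_induction generalizing a b with
  | mem x hx =>
    obtain ⟨_, _, p, hp, rfl⟩ := hx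
    rw [thetaLength_eq] at hp
    obtain rfl : (pathTheta p : ℤ) = m := by exact_mod_cast hp
    exact toMat_path_mem p a b
  | zero => simp
  | add _ _ _ _ h1 h2 => rw [map_add]; exact add_mem (h1 a b) (h2 a b)
  | smul c _ _ h => rw [map_smul]; exact Submodule.smul_mem _ c (h a b)

variable (σ K) in
lemma graded_thetaPiece : (∀ m x, x ∈ thetaPiece K σ m ↔ ∀ a b, toMat σ K x a b ∈ scriptPiece K m)
    ∧ Nonempty (GradedAlgebra (thetaPiece K σ)) := by
  refine graded_of_matrix _ toMat_injective toMat_mul toMat_one _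
    (fun m x hx => mem_thetaPiece_aux hx) (eq_top_iff.2 ?_)
  rw [← show _ = (⊤ : Submodule K (Gamma K σ)) from span_pathClass]
  refine Submodule.span_le.2 ?_
  rintro _ ⟨a, b, p, rfl⟩
  exact Submodule.mem_iSup_of_mem (pathTheta p : ℤ) (Submodule.subset_span
    ⟨a, b, p, by rw [thetaLength_eq]; norm_cast, rfl⟩)

lemma phi_mem_iff (m : ℤ) (r : RPrime K n) :
    phi σ K r ∈ centerPiece K σ m ↔ embed K n r ∈ scriptPiece K m := by
  refine ((graded_thetaPiece σ K).1 m (phi σ K r)).trans ?_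
  rw [toMat_phi]
  constructor
  · intro h
    have := h (sideV σ _ 0) (sideV σ _ 0)
    rwa [Matrix.smul_apply, unitMat, Matrix.diagonal_apply_eq, smul_eq_mul,
      show unitEps K (sideV σ (arcVertices σ) 0).1 = 1 from rfl, mul_one] at this
  · intro h a b
    rw [Matrix.smul_apply, unitMat, Matrix.diagonal_apply, smul_eq_mul]
    split_ifs
    · simpa using mul_mem_scriptPiece K h (unitEps_mem_piece a.1)
    · simp

variable (σ K) in
lemma graded_centerPiece : Nonempty (GradedAlgebra (centerPiece K σ)) := by
  refine (graded_of_matrix (toMat σ K ∘ₗ (Subalgebra.center K (Gamma K σ)).val.toLinearMap)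
    (toMat_injective.comp Subtype.val_injective) (fun _ _ => toMat_mul _ _) toMat_one _
    (fun m x hx => mem_thetaPiece_aux hx) (eq_top_iff.2 fun z _ => ?_)).2
  obtain ⟨r, rfl⟩ := (phi σ K).surjective z
  induction RPrime.mem_span n r using Submodule.span_induction with
  | mem r h =>
    obtain ⟨⟨f, i⟩, rfl⟩ := h
    exact Submodule.mem_iSup_of_mem _ ((phi_mem_iff _ _).2
      (embed_basis (K := K) n hn.out f i ▸ mono_mem K _ _ _))
  | zero => simp
  | add _ _ _ _ h1 h2 => rw [map_add]; exact add_mem (h1 trivial) (h2 trivial)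
  | smul c _ _ h => rw [map_smul]; exact Submodule.smul_mem _ c (h trivial)

end

section
variable {n : ℕ} [hn : Fact (2 ≤ n)] {σ : TaggedTriangulation n} {K : Type*} [Field K]
  {E : Set (ZMod n)}

variable {J J₁ J₂ : Option (ZMod n)} {a b : Q' σ}

/-! ### The planar cycles -/

/-- The arrow passes in front of the puncture. -/
def Passing (α : Total (Q' σ)) : Prop :=
  ∃ J, IsInternalAt J α ∧ (J = none ∨ J = some α.left.1.fst ∧ J = some α.right.1.snd)

/-- The value of a path not going through the notched arc of a once-punctured digon. -/
lemma psi_avoiding (p : Path a b) (ha : AvoidsNotched p) : ∃ f, (f = true ↔ ∃ α ∈ arrowList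
    p, Passing α) ∧ psi σ K E (cls' K p) = eUnit σ K E a.1 b.1 (unitEps K a.1 * mono K (mainTag σ) f
    (pathTheta p)) := by
  induction p with
  | nil =>
    refine ⟨false, by simp [arrowList], ?_⟩
    rw [← gammaIde, psi_idem a.2, pathTheta, Nat.cast_zero, mono_zero, mul_one]
  | @cons b c p α ih =>
    simp only [AvoidsNotched, arrowList_cons, List.mem_append, List.mem_singleton, or_imp,
      forall_and, forall_eq] at ha
    obtain ⟨f, hf, e⟩ := ih fun α h => ⟨ha.1.1 α h, ha.2.1 α h⟩
    obtain ⟨s, hs, e'⟩ : ∃ s, (s = true ↔ Passing ⟨b, c, α⟩) ∧ psi σ K E (cls' K α.toPath) =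
        eUnit σ K E b.1 c.1 (mono K (mainTag σ) s (theta b.1 c.1)) := by
      obtain ⟨J, h, rfl⟩ | ⟨k, hk, hb, hc, rfl⟩ := arrow_cases α
      · classical
        refine ⟨decide (J = none ∨ J = some b.1.fst ∧ J = some c.1.snd), ?_, ?_⟩
        · rw [decide_eq_true_iff]
          constructor
          · exact fun H => ⟨J, ⟨h, rfl⟩, H⟩
          · rintro ⟨J', ⟨_, h'⟩, H⟩
            injection h' with h'
            exact h' ▸ H
        · rw [show cls' K (intArrow J h : b ⟶ c).toPath = _ from (jacData_ar h).symm]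
          refine (psi_ar h).trans ?_
          rw [factor, if_pos ⟨ha.1.2, ha.2.2⟩]
          simp only [mono, decide_eq_true_iff]
      · refine ⟨false, ?_, ?_⟩
        · constructor
          · exact fun h => by cases h
          · rintro ⟨_, ⟨_, h⟩, -⟩
            cases h
        · rw [cls', pathClass_external]
          refine (psi_ex k).trans ?_
          rw [hb, hc, theta_side σ]
          simp [mono]
    refine ⟨f || s, ?_, ?_⟩
    · rw [Bool.or_eq_true, hf, hs]
      simp [arrowList_cons, or_and_right, exists_or]
    · rw [show cls' K (p.cons α) = cls' K p * cls' K α.toPath from pathClass_cons p α, psi_mul, e,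
        e', eUnit_mul b.2, mul_assoc, mono_mul, pathTheta_cons, Nat.cast_add]

lemma Lift.theta {a b : Edge n} {x y X Y : ℤ} (ha : Lift σ a x y) (hb : Lift σ b X Y) (h1 : x ≤ X := by omega)
    (h2 : X < x + n := by omega) (h3 : y ≤ Y := by omega) (h4 : Y < y + n := by omega) :
    (theta a b : ℤ) = X - x + (Y - y) :=
  theta_eq ha.facts.2.1 ha.facts.2.2.1 hb.facts.2.1 hb.facts.2.2.1 h1 h2 h3 h4

lemma LArr.cycle {i : Fin 3} {a b c : Edge n} (h : LArr σ i J J₁ J₂ a b c) (hi : i = 0) : theta a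
    b + theta b c + theta c a = 2 * n ∧ (J = some a.fst ∧ J = some b.snd ∨ J₁ = none ∨ J₂ = some
    c.fst ∧ J₂ = some a.snd) := by
  have hnn := two_le_int (n := n)
  cases h with
  | A1 x y z h h' h'' =>
    have := h.1; have := h'.1; have := h''.2.1
    have := (Lift.chord h).theta (.chord h'')
    have := (Lift.chord h'').theta (.chord h')
    have := (Lift.chord h').theta ((Lift.chord h).sh 1)
    exact ⟨by omega, by simp [ch, sp, fst, snd]⟩
  | B1 x y t h hx hy =>
    have := h.1; have := h.2.1
    have := (Lift.chord h).theta (.spoke hx)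
    have := (Lift.spoke hx).theta (.spoke hy)
    have := (Lift.spoke hy).theta ((Lift.chord h).sh 1)
    exact ⟨by omega, by simp [ch, sp, fst, snd]⟩
  | D1 k m t h h' hk =>
    have := h.1; have := h.2.1
    have hs : Lift σ (sp k t) k (k + n) := .spoke (by cases t; exacts [hk.1, hk.2])
    have hm : Lift σ (ch m k) m (k + n) := by simpa [ch] using Lift.chord h'
    have := hm.theta ((Lift.chord h).sh 1)
    have := (Lift.chord h).theta hs
    have := hs.theta hm
    exact ⟨by omega, by simp [ch, sp, fst, snd]⟩
  | _ => cases hi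

lemma clockwise_facts {c : Q' σ} (h : LArr σ 0 J J₁ J₂ a.1 b.1 c.1) : pathTheta (triCycle₀ h).2 =
    2 * n ∧ ∃ α ∈ arrowList (triCycle₀ h).2, Passing α := by
  refine ⟨by simp [triCycle₀, pathTheta, ← (h.cycle rfl).1], ?_⟩
  have hm : ∀ α, α ∈ arrowList (triCycle₀ h).2 ↔ α = ⟨_, _, intArrow J h.corner⟩ ∨
      α = ⟨_, _, intArrow J₁ h.rotate.corner⟩ ∨ α = ⟨_, _, intArrow J₂ h.rotate.rotate.corner⟩ := by
    simp [triCycle₀, arrowList]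
  rcases (h.cycle rfl).2 with e | e | e
  · exact ⟨_, (hm _).2 (.inl rfl), J, ⟨h.corner, rfl⟩, .inr e⟩
  · exact ⟨_, (hm _).2 (.inr (.inl rfl)), J₁, ⟨h.rotate.corner, rfl⟩, .inl e⟩
  · exact ⟨_, (hm _).2 (.inr (.inr rfl)), J₂, ⟨h.rotate.rotate.corner, rfl⟩, .inr e⟩

lemma fan_value (k : ZMod n) : psi σ K E (cls' K (fan σ Set.univ k)) =
    eUnit σ K E (side k) (side (k - 1)) (mono K (mainTag σ) true (2 * n - 2)) := by
  have hnn := two_le_int (n := n)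
  obtain ⟨x, rfl⟩ := ZMod.intCast_surjective k
  have h1 := (isChord_side (σ := σ) x).V
  have h2 := (isChord_side (σ := σ) (x - 1)).V.add
  have e1 : ed σ x (x + 1) = side x := by rw [side_int, (isChord_side x).ed]
  have e2 : ed σ (x - 1 + n) (x - 1 + 1 + n) = side ((x : ZMod n) - 1) := by
    rw [ed_add, (isChord_side _).ed, side_int_pred, sub_add_cancel]
  have hF : Fan σ (gammaData' K σ) (x : ZMod n) (side x) (side ((x : ZMod n) - 1))
      (cls' K (fan σ Set.univ (x : ZMod n))) := ((fanPart_fan (x : ZMod n)).fan).map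
  rw [← e1, ← e2] at hF
  obtain ⟨f, hr, hf⟩ := hF.run h1 h2 (.inl rfl) (.inr (by omega))
  obtain rfl : f = true := hf.2 (by omega)
  have := (hr.map (matRep_compat (E := E))).value
  rw [e1, e2] at this
  have hv : matRep σ K E (cls' K (fan σ Set.univ (x : ZMod n))) = _ := this
  rw [psi_apply, hv, unitMat_mul_eUnit, show unitEps K (side (x : ZMod n)) = 1 from rfl, one_mul]
  congr 2
  ring

lemma mono_injective {t : Tag} {f f' : Bool} {m m' : ℤ} (h : mono K t f m = mono K t f' m') :
    f = f' ∧ m = m' :=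
  Prod.ext_iff.1 ((linearIndependent_mono (K := K) t).injective (a₁ := (f, m)) (a₂ := (f', m')) h)

lemma external_facts (σ : TaggedTriangulation n) (k : ZMod n) : pathTheta (extCycle σ
    (Set.mem_univ k)).2 = 2 * n ∧ ∃ α ∈ arrowList (extCycle σ (Set.mem_univ k)).2, Passing α := by
  obtain ⟨f, hf, e⟩ := psi_avoiding (K := ℚ) (E := Set.univ) (fan σ Set.univ k)
    (fanPart_fan k).2
  rw [fan_value] at e
  have := congrFun₂ e (sideV σ _ k) (sideV σ _ (k - 1))
  rw [eUnit_apply, if_pos ⟨rfl, rfl⟩, eUnit_apply, if_pos ⟨rfl, rfl⟩,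
    show unitEps ℚ (sideV σ Set.univ k).1 = 1 from rfl, one_mul] at this
  obtain ⟨rfl, h⟩ := mono_injective this
  obtain ⟨α, hα, h'⟩ := hf.1 rfl
  constructor
  · rw [extCycle, pathTheta_comp, pathTheta_toPath]
    have := theta_side σ k
    change theta (side (k - 1)) (side k) + _ = _
    omega
  · exact ⟨α, by rw [extCycle, arrowList_comp]; exact List.mem_append_right _ hα, h'⟩

lemma punctured_facts (c : BasedCycle (Q' σ)) (hc : c ∈ puncturedCycles σ Set.univ) :
    pathTheta c.2 = 2 * n ∧ ∃ α ∈ arrowList c.2, Passing α := by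
  obtain ⟨_, _, _, _, _, _, h⟩ := puncturedCycles_facts c hc
  obtain ⟨α, hα⟩ := List.exists_mem_of_ne_nil _ hc.1
  exact ⟨h, α, hα, none, hc.2.2.1 α hα, .inl rfl⟩

/-- All the planar cycles at a vertex have the same value. -/
lemma central_value {c : Path a a} (h : ⟨a, c⟩ ∈ centralCycles σ Set.univ) : psi σ K E
    (cls' K c) = eUnit σ K E a.1 a.1 (unitEps K a.1 * mono K (mainTag σ) true (2 * n)) := by
  obtain ⟨ha, c₀, hc₀, p, q, e₀, e⟩ := h
  have h₀ : pathTheta c₀.2 = 2 * n ∧ ∃ α ∈ arrowList c₀.2, Passing α := by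
    rcases hc₀ with (h | h) | h
    · obtain ⟨_, _, _, _, _, _, h', rfl⟩ := mem_clockwiseTriangles.1 h
      exact clockwise_facts h'
    · obtain ⟨k, _, rfl⟩ := mem_externalCycles.1 h
      exact external_facts σ k
    · exact punctured_facts c₀ h
  obtain ⟨f, hf, hv⟩ := psi_avoiding (K := K) (E := E) c ha
  simp only at e
  obtain rfl : f = true := hf.2 (by
    obtain ⟨α, hα, h⟩ := h₀.2
    rw [e₀, arrowList_comp, List.mem_append] at hα
    exact ⟨α, by rw [e, arrowList_comp, List.mem_append]; exact hα.symm, h⟩)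
  have ht : pathTheta c = 2 * n := by rw [e, pathTheta_comp, add_comm, ← pathTheta_comp, ← e₀, h₀.1]
  rw [hv, ht]
  norm_cast

/-- The external cycle at the first end of an edge goes through this edge. -/
lemma exists_central (a : Q' σ) (h : ¬ IsDigonNotched a) :
    ∃ c : Path a a, ⟨a, c⟩ ∈ centralCycles σ Set.univ := by
  obtain ⟨p, hp⟩ := exists_fanPart_from_side a.1.fst a h (.inl rfl)
  obtain ⟨q, hq⟩ := exists_fanPart_to_side a.1.fst a h (.inl rfl)
  have e : fan σ Set.univ a.1.fst = p.comp q := (fanPart_fan _).unique (fanPart_comp.2 ⟨hp, hq⟩)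
  refine ⟨q.comp ((extArrow (Set.mem_univ a.1.fst)).toPath.comp p), ?_, _,
    .inl (.inr (mem_externalCycles.2 ⟨a.1.fst, Set.mem_univ _, rfl⟩)),
    (extArrow (Set.mem_univ a.1.fst)).toPath.comp p, q, ?_, rfl⟩
  · intro α hα
    simp only [arrowList_comp, List.mem_append, arrowList_toPath, List.mem_singleton] at hα
    rcases hα with h | rfl | h
    · exact hq.2 α h
    · exact ⟨visible_sideV (E := Set.univ) _, visible_sideV (E := Set.univ) _⟩
    · exact hp.2 α h
  · change (extArrow (Set.mem_univ a.1.fst)).toPath.comp (fan σ Set.univ _) = _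
    rw [e]
    exact (Path.comp_assoc _ _ _).symm

end

section
variable {n : ℕ} [hn : Fact (2 ≤ n)] {σ : TaggedTriangulation n} {K : Type*} [Field K]
  {E : Set (ZMod n)}

variable {k : ZMod n} {a b : Q' σ}

/-! ### The external paths -/

lemma allExternal_cons {c : Q' σ} {p : Path a b} {α : b ⟶ c} :
    AllExternal (p.cons α) ↔ AllExternal p ∧ ∃ k, IsExternalAt k ⟨b, c, α⟩ := by
  simp [AllExternal, arrowList_cons, or_imp, forall_and]

/-- The path consisting of `m` external arrows. -/
lemma exists_external (K : Type*) [Field K] (E : Set (ZMod n)) (ha : a.1 = side k) (m : ℕ) (b : Q'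
    σ) (hb : b.1 = side (k + (m : ZMod n))) : ∃ p : Path a b, AllExternal p ∧ p.length = m ∧
    psi σ K E (cls' K p) = eUnit σ K E a.1 b.1 (uPow K (2 * m)) ∧ (∀ j : ℕ, j < m → ∃ α ∈ arrowList
    p, IsExternalAt (k + (j : ZMod n) + 1) α) ∧ (∀ α ∈ arrowList p, ∃ j : ℕ, j < m ∧ IsExternalAt (k
    + (j : ZMod n) + 1) α) ∧ (m ≤ n → (arrowList p).Nodup) := by
  induction m generalizing b with
  | zero =>
    obtain rfl : a = b := Subtype.ext (by rw [ha, hb, Nat.cast_zero, add_zero])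
    refine ⟨.nil, by simp [AllExternal, arrowList], rfl, ?_, by simp, by simp [arrowList],
      by simp [arrowList]⟩
    rw [← gammaIde, psi_idem a.2, ha, Nat.cast_zero, mul_zero, uPow_zero]
    rfl
  | succ m ih =>
    obtain ⟨p, h1, h2, h3, h4, h5, h6⟩ := ih (sideV σ _ (k + (m : ZMod n))) rfl
    have hs : (sideV σ Set.univ (k + (m : ZMod n))).1 = side (k + (m : ZMod n) + 1 - 1) := by
      rw [add_sub_cancel_right]; rfl
    have hb' : b.1 = side (k + (m : ZMod n) + 1) := by rw [hb, Nat.cast_succ, add_assoc]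
    have hx : IsExternalAt (k + (m : ZMod n) + 1) (⟨_, b, Arrow.external (k + (m : ZMod n) + 1) (Set.mem_univ _) hs hb'⟩ :
      Total (Q' σ)) := ⟨_, _, _, rfl⟩
    refine ⟨p.cons (Arrow.external (k + (m : ZMod n) + 1) (Set.mem_univ _) hs hb'),
      allExternal_cons.2 ⟨h1, _, hx⟩, ?_, ?_, ?_, ?_, ?_⟩
    · rw [Path.length_cons, h2]
    · rw [show cls' K (p.cons _) = cls' K p * cls' K _ from pathClass_cons _ _, psi_mul, h3]
      have : cls' K (Quiver.Hom.toPath (Arrow.external (k + (m : ZMod n) + 1) (Set.mem_univ _) hs hb' :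
        sideV σ Set.univ (k + (m : ZMod n)) ⟶ b)) = (gammaData' K σ).ex (k + (m : ZMod n) + 1) :=
          pathClass_external _ hs hb'
      rw [this, psi_ex, ← hs, ← hb', eUnit_mul (sideV σ Set.univ (k + (m : ZMod n))).2, ← uPow_add]
      congr 2
    · intro j hj
      rw [arrowList_cons]
      by_cases e : j = m
      · subst e
        exact ⟨_, by simp, hx⟩
      · obtain ⟨α, hα, h⟩ := h4 j (by omega)
        exact ⟨α, by simp [hα], h⟩
    · intro α hα
      rw [arrowList_cons, List.mem_append, List.mem_singleton] at hα
      grind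
    · intro hm
      rw [arrowList_cons, List.nodup_append]
      refine ⟨h6 (by omega), by simp, ?_⟩
      rintro α hα β hβ rfl
      rw [List.mem_singleton] at hβ
      subst hβ
      obtain ⟨j, hj, _, _, _, h⟩ := h5 _ hα
      injection h with h
      rw [add_left_inj, add_right_inj] at h
      have := (ZMod.natCast_eq_natCast_iff' _ _ _).1 h
      rw [Nat.mod_eq_of_lt (by omega), Nat.mod_eq_of_lt (by omega)] at this
      omega

lemma AllExternal.end_eq {p : Path a b} (h : AllExternal p)
    (ha : a.1 = side k) : b.1 = side (k + (p.length : ZMod n)) := by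
  induction p with
  | nil => simp [ha]
  | cons p α ih =>
    obtain ⟨h1, j, _, hj, hj', -⟩ := allExternal_cons.1 h
    have e := (ih h1).symm.trans hj
    rw [hj', Path.length_cons]
    injection e with e
    rw [Nat.cast_succ, ← add_assoc, e, sub_add_cancel]

lemma exists_bigCycle (K : Type*) [Field K] (E : Set (ZMod n)) (ha : a.1 = side k) : ∃ c :
    Path a a, IsBigCycle c ∧ psi σ K E (cls' K c) = eUnit σ K E a.1 a.1 (uPow K (2 * n))
    := by
  obtain ⟨c, h1, -, h3, h4, -, h6⟩ := exists_external K E ha n a (by simp [ha])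
  refine ⟨c, ⟨h1, h6 le_rfl, fun j => ?_⟩, h3⟩
  obtain ⟨α, hα, h⟩ := h4 (j - 1 - k).val (ZMod.val_lt _)
  rw [ZMod.natCast_zmod_val] at h
  exact ⟨α, hα, by simpa using h⟩

lemma ell_side (σ : TaggedTriangulation n) (k l : ZMod n) :
    ell (side k) (side l) = 2 * ccwDist k l := by
  have hnn := two_le_int (n := n)
  obtain ⟨x, rfl⟩ := ZMod.intCast_surjective k
  have hl : l = ((x + ccwDist x l : ℤ) : ZMod n) := by
    simp [ccwDist, ZMod.natCast_zmod_val]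
  have hd : ccwDist x l < n := ZMod.val_lt _
  generalize ccwDist x l = d at hl hd
  rw [hl, side_int, side_int]
  obtain ⟨i, hi, -⟩ := (Lift.chord (isChord_side (σ := σ) x)).reach
    (.chord (isChord_side (x + d))) (by omega) (by omega)
  obtain rfl : i = 0 := by
    by_contra h
    have : (n : ℤ) * 1 ≤ n * i := mul_le_mul_of_nonneg_left (by omega) (by omega)
    rw [mul_assoc] at hi
    omega
  simp only [Nat.cast_zero, mul_zero] at hi
  omega

lemma exists_shortest (K : Type*) [Field K] (E : Set (ZMod n)) {l : ZMod n} (ha : a.1 = side k)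
    (hb : b.1 = side l) : ∃ p : Path a b, IsShortestExternal p ∧ psi σ K E (cls' K p) = eUnit
    σ K E a.1 b.1 (uPow K (ell a.1 b.1)) := by
  obtain ⟨p, h1, h2, h3, -⟩ := exists_external K E ha (ccwDist k l) b (by
    rw [hb, show (ccwDist k l : ZMod n) = l - k from ZMod.natCast_zmod_val _, add_sub_cancel])
  refine ⟨p, ⟨h1, fun q hq => ?_⟩, ?_⟩
  · have e := (hq.end_eq ha).symm.trans hb
    injection e with e
    rw [h2, ccwDist, ← e, add_sub_cancel_left, ZMod.val_natCast]
    exact Nat.mod_le _ _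
  · rw [h3, ha, hb, ell_side σ]
    push_cast
    rfl

/-! ### Translation to the algebra of the ice quiver -/

lemma toMat_idem_mul_phi (a : Q σ) (r : RPrime K n) : toMat σ K (idem K a * phi σ K r) =
    eUnit σ K _ a.1 a.1 (unitEps K a.1 * embed K n r) := by
  rw [toMat_mul, toMat_idem, toMat_phi, Matrix.mul_smul, eUnit_mul_unitMat, unitEps_idem]
  ext i j
  rw [Matrix.smul_apply, eUnit_apply, eUnit_apply, smul_eq_mul]
  split_ifs <;> ring

lemma idem_mul_phi (a : Q σ) (r : RPrime K n) :
    idem K a * (phi σ K r : Gamma K σ) = (phi σ K r : Gamma K σ) * idem K a :=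
  (Subalgebra.mem_center_iff.1 (phi σ K r).2 _)

lemma embed_X' : embed K n (RPrime.X K n) = uPow K (2 * n) := by
  rw [embed_X, mono, if_neg (by simp), mul_one]

/-- The element of `R'` that is mapped to the class of the planar cycles. -/
lemma exists_cycle_elt (σ : TaggedTriangulation n) : ∃ r : RPrime K n, embed K n r = mono K
    (mainTag σ) true (2 * n) ∧ (HasPlain σ → RPrime.Y K n = r) ∧ (¬ HasPlain σ → RPrime.Y K n =
    RPrime.X K n - r) := by
  by_cases h : HasPlain σ
  · exact ⟨_, by rw [embed_Y n hn.out, mainTag, if_pos h], fun _ => rfl, fun h' => (h' h).elim⟩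
  · refine ⟨RPrime.X K n - RPrime.Y K n, ?_, fun h' => (h h').elim, fun _ => by ring⟩
    rw [map_sub, embed_X, embed_Y n hn.out, mainTag, if_neg h, mono_notched, if_pos rfl]

lemma vElt_pow_eq (σ : TaggedTriangulation n) {l : ℕ} (hl : l ≠ 0) : (HasPlain σ → vElt K ^ l =
    mono K (mainTag σ) true l) ∧ (¬ HasPlain σ → vElt K ^ l = uPow K l - mono K (mainTag σ) true l)
    := by
  have hv : vElt K ^ l = mono K .plain true l := by
    rw [vElt_pow K hl]
    rfl
  refine ⟨fun h => by rw [hv, mainTag, if_pos h], fun h => ?_⟩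
  rw [hv, mainTag, if_neg h, mono_notched, if_pos rfl,
    show mono K .plain false l = uPow K l from mul_one _, sub_sub_cancel]

lemma eps_notched_mul : eps K .notched * mono K .plain true (2 * n) = 0 := by
  rw [mono, if_pos rfl, mul_left_comm, mul_comm (eps K .notched), eps_mul, mul_zero]

/-- The value of the path completing an external arrow to an external cycle. -/
lemma fan_path (K : Type*) [Field K] (E : Set (ZMod n)) (σ : TaggedTriangulation n) {a b : Q' σ}
    {k : ZMod n} (ha : a.1 = side k) (hb : b.1 = side (k - 1)) : ell a.1 b.1 ≠ 0 ∧ ∃ (α : b ⟶ a) (s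
    : Path a b), IsExternalAt k ⟨_, _, α⟩ ∧ ⟨b, α.toPath.comp s⟩ ∈ externalCycles σ Set.univ
    ∧ psi σ K E (cls' K s) = eUnit σ K E a.1 b.1 (mono K (mainTag σ) true (ell a.1 b.1)) := by
  obtain rfl : a = sideV σ _ k := Subtype.ext ha
  obtain rfl : b = sideV σ _ (k - 1) := Subtype.ext hb
  have h1 : ccwDist k (k - 1) = n - 1 := by
    rw [ccwDist, sub_sub_cancel_left]
    have := hn.out
    obtain ⟨m, rfl⟩ : ∃ m, n = m + 1 := ⟨n - 1, by omega⟩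
    simp
  have h2 : ((ell (side k) (side (k - 1)) : ℕ) : ℤ) = 2 * n - 2 := by
    rw [ell_side σ, h1]
    have := hn.out
    omega
  refine ⟨fun h => ?_, extArrow (Set.mem_univ k), fan σ _ k, ⟨_, _, _, rfl⟩,
    mem_externalCycles.2 ⟨k, Set.mem_univ k, rfl⟩, ?_⟩
  · have : ell (side k) (side (k - 1)) = 0 := h
    have := hn.out
    omega
  rw [fan_value]
  grind

/-- Multiplication by an external arrow is injective, since its value is the unit `u ^ 2`. -/
lemma external_cancel (α : a ⟶ b) (h : AllExternal α.toPath) (w : Gamma K σ) : ((iota K σ).symm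
    (cls' K α.toPath) * w = 0 → (iota K σ).symm (cls' K (Path.nil : Path b b)) * w =
    0) ∧ (w * (iota K σ).symm (cls' K α.toPath) = 0 → w * (iota K σ).symm (cls' K (Path.nil :
    Path a a)) = 0) := by
  obtain ⟨k, _, ha, hb, e⟩ := h ⟨a, b, α⟩ (by simp [arrowList_toPath])
  simp only at e
  have hα : toMat σ K ((iota K σ).symm (cls' K α.toPath)) = eUnit σ K _ a.1 b.1 (uPow K 2) := by
    rw [toMat_symm, e, cls', pathClass_external, ha, hb]
    exact psi_ex k
  have hnil : ∀ c : Q' σ, (∃ k, c.1 = side k) → toMat σ K ((iota K σ).symm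
      (cls' K (Path.nil : Path c c))) = eUnit σ K _ c.1 c.1 1 := by
    rintro c ⟨k, hk⟩
    rw [toMat_symm, ← gammaIde, psi_idem c.2, hk]
    rfl
  have hu := uPow_mul_neg K 2
  constructor <;> intro h0 <;> apply toMat_injective <;> have := congrArg (toMat σ K) h0 <;>
    rw [toMat_mul, hα, map_zero] at this <;> rw [toMat_mul, map_zero]
  · rw [hnil b ⟨_, hb⟩, ← mul_zero (eUnit σ K _ b.1 a.1 (uPow K (-2))), ← this, ← mul_assoc,
      eUnit_mul a.2, mul_comm (uPow K (-2)), hu]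
  · rw [hnil a ⟨_, ha⟩, ← zero_mul (eUnit σ K _ b.1 a.1 (uPow K (-2))), ← this, mul_assoc,
      eUnit_mul b.2, hu]

end

end PuncturedPolygon
end

theorem mainTheorem6 (K : Type*) [Field K] (n : ℕ) (hn : 2 ≤ n) (σ : TaggedTriangulation n) :
    -- the `θ`-length is a grading of `Γ_σ`, and of its centre
    Nonempty (GradedAlgebra (thetaPiece K σ)) ∧
    Nonempty (GradedAlgebra (centerPiece K σ)) ∧
    ∃ (ι : Gamma K σ ≃ₐ[K] Gamma' K σ)
      (φ : RPrime K n ≃ₐ[K] Subalgebra.center K (Gamma K σ))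
      (A : NonUnitalSubalgebra (RPrime K n) (Matrix (Q σ) (Q σ) (ScriptR K)))
      (ψ : A ≃+* Gamma K σ)
      (ψc : ∀ a b : Q σ, entry K a.1 b.1 ≃+ peirce K a b),
      -- `ι` is the canonical identification of `Γ_σ` with the quotient of `K Q'_σ`
      (∀ a : Q σ, ι (idem K a) = cls' K (Quiver.Path.nil : Quiver.Path (full a) (full a))) ∧
      (∀ (a b : Q σ) (α : a ⟶ b), ι (cls K α.toPath) = cls' K (fullArrow α).toPath) ∧
      -- `φ` is graded
      (∀ (m : ℤ) (r : RPrime K n), r ∈ rPiece K n m ↔ φ r ∈ centerPiece K σ m) ∧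
      -- `A` consists of the matrices with entries in the `A_{a,b}`
      (∀ M : Matrix (Q σ) (Q σ) (ScriptR K), M ∈ A ↔ ∀ a b : Q σ, M a b ∈ entry K a.1 b.1) ∧
      -- `ψ` is a graded isomorphism of `R'`-algebras
      (∀ (r : RPrime K n) (M : A), ψ (r • M) = (φ r : Gamma K σ) * ψ M) ∧
      (∀ (m : ℤ) (M : A),
        (∀ a b : Q σ, (M : Matrix (Q σ) (Q σ) (ScriptR K)) a b ∈ scriptPiece K m) ↔
          ψ M ∈ thetaPiece K σ m) ∧
      -- `ψ` is induced by graded isomorphisms of `R'`-modules from `A_{a,b}` to `e_a Γ_σ e_b`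
      (∀ (a b : Q σ) (r : RPrime K n) (x : entry K a.1 b.1),
        (ψc a b (r • x) : Gamma K σ) = (φ r : Gamma K σ) * (ψc a b x : Gamma K σ)) ∧
      (∀ (a b : Q σ) (m : ℤ) (x : entry K a.1 b.1),
        (x : ScriptR K) ∈ scriptPiece K m ↔ (ψc a b x : Gamma K σ) ∈ thetaPiece K σ m) ∧
      (∀ (M : A) (hM : ∀ a b : Q σ, (M : Matrix (Q σ) (Q σ) (ScriptR K)) a b ∈ entry K a.1 b.1),
        ψ M = ∑ a : Q σ, ∑ b : Q σ, (ψc a b ⟨_, hM a b⟩ : Gamma K σ)) ∧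
      -- (i) the image of `X` and the big external cycles
      (∀ a ∈ frozen σ (arcVertices σ), ∃ c : Quiver.Path (full a) (full a), IsBigCycle c ∧
        idem K a * (φ (RPrime.X K n) : Gamma K σ) = ι.symm (cls' K c) ∧
        (φ (RPrime.X K n) : Gamma K σ) * idem K a = ι.symm (cls' K c)) ∧
      -- (ii) the image of `Y` and the planar cycles
      (∃ C : Q σ → Gamma K σ,
        (∀ a : Q σ, IsDigonNotched a → C a = 0) ∧
        (∀ a : Q σ, ¬ IsDigonNotched a →
          (∃ c : Quiver.Path (full a) (full a), ⟨full a, c⟩ ∈ centralCycles σ Set.univ) ∧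
          ∀ c : Quiver.Path (full a) (full a), ⟨full a, c⟩ ∈ centralCycles σ Set.univ →
            ι.symm (cls' K c) = C a) ∧
        ∀ a : Q σ,
          idem K a * (φ (RPrime.Y K n) : Gamma K σ) =
            (φ (RPrime.Y K n) : Gamma K σ) * idem K a ∧
          (HasPlain σ → idem K a * (φ (RPrime.Y K n) : Gamma K σ) = C a) ∧
          (¬ HasPlain σ → idem K a * (φ (RPrime.Y K n) : Gamma K σ) =
            idem K a * (φ (RPrime.X K n) : Gamma K σ) - C a)) ∧
      -- (iii) powers of `u` and shortest external paths
      (∀ a ∈ frozen σ (arcVertices σ), ∀ b ∈ frozen σ (arcVertices σ),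
        ∃ p : Quiver.Path (full a) (full b), IsShortestExternal p ∧
          ∃ hu : uPow K (Edge.ell a.1 b.1) ∈ entry K a.1 b.1,
            (ψc a b ⟨_, hu⟩ : Gamma K σ) = ι.symm (cls' K p)) ∧
      -- (iv) powers of `v` and the paths completing external arrows to external cycles
      (∀ a ∈ frozen σ (arcVertices σ), ∀ b ∈ frozen σ (arcVertices σ), b.1.snd = a.1.fst →
        ∃ (α : full b ⟶ full a) (s : Quiver.Path (full a) (full b)),
          IsExternalAt a.1.fst ⟨_, _, α⟩ ∧
          ⟨full b, α.toPath.comp s⟩ ∈ externalCycles σ Set.univ ∧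
          ∃ (hu : uPow K (Edge.ell a.1 b.1) ∈ entry K a.1 b.1)
            (hv : vElt K ^ Edge.ell a.1 b.1 ∈ entry K a.1 b.1),
            (HasPlain σ → (ψc a b ⟨_, hv⟩ : Gamma K σ) = ι.symm (cls' K s)) ∧
            (¬ HasPlain σ → (ψc a b ⟨_, hv⟩ : Gamma K σ) =
              (ψc a b ⟨_, hu⟩ : Gamma K σ) - ι.symm (cls' K s))) ∧
      -- (v) external arrows are not zero divisors
      (∀ (a b : Q' σ) (α : a ⟶ b), AllExternal α.toPath → ∀ w : Gamma K σ,
        (ι.symm (cls' K α.toPath) * w = 0 →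
          ι.symm (cls' K (Quiver.Path.nil : Quiver.Path b b)) * w = 0) ∧
        (w * ι.symm (cls' K α.toPath) = 0 →
          w * ι.symm (cls' K (Quiver.Path.nil : Quiver.Path a a)) = 0)) := by
  have := Fact.mk hn
  have inj : ∀ {x y : Gamma K σ}, toMat σ K x = toMat σ K y → x = y := fun h => toMat_injective h
  have hside : ∀ a : Q σ, a ∈ frozen σ (arcVertices σ) → ∃ k, a.1 = .side k := fun _ h => h
  have hu : ∀ a b : Q σ, a ∈ frozen σ (arcVertices σ) → b ∈ frozen σ (arcVertices σ) →
      uPow K (Edge.ell a.1 b.1) ∈ entry K a.1 b.1 := by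
    rintro a b ⟨k, hk⟩ ⟨l, hl⟩
    have := uPow_mul_unitEps_mem (K := K) a.2 b.2 (hk ▸ side_not_hasTag k)
    rwa [unitEps_eq_one (hl ▸ side_not_hasTag l), mul_one] at this
  refine ⟨(graded_thetaPiece σ K).2, graded_centerPiece σ K, iota K σ, phi σ K, matAlg σ K,
    matIso σ K, peirceIso K, iota_idem, fun _ _ => iota_arrow, fun m r => (phi_mem_iff m r).symm,
    fun _ => Iff.rfl, fun r M => inj ?_, fun m M => ?_, fun a b r x => inj ?_, fun a b m x => ?_,
    fun M hM => inj ?_, ?_, ?_, ?_, ?_, fun a b => external_cancel⟩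
  · rw [toMat_phi_mul, toMat_matIso, toMat_matIso]
    rfl
  · rw [(graded_thetaPiece σ K).1, toMat_matIso]
  · rw [toMat_phi_mul, toMat_peirceIso, toMat_peirceIso]
    ext i j
    rw [Matrix.smul_apply, eUnit_apply, eUnit_apply]
    split_ifs
    · rfl
    · exact (mul_zero _).symm
  · rw [(graded_thetaPiece σ K).1, toMat_peirceIso]
    refine ⟨fun h => eUnit_mem_piece h, fun h => ?_⟩
    simpa [eUnit_apply] using h a b
  · rw [toMat_matIso, map_sum]
    simp only [map_sum, toMat_peirceIso]
    exact matrix_eq_sum _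
  · intro a ha
    obtain ⟨k, hk⟩ := hside a ha
    obtain ⟨c, hc, e⟩ := exists_bigCycle K (arcVertices σ) (a := full a) hk
    have h : idem K a * (phi σ K (RPrime.X K n) : Gamma K σ) = (iota K σ).symm (cls' K c) := by
      apply inj
      rw [toMat_idem_mul_phi, toMat_symm, e, embed_X', unitEps_eq_one (hk ▸ side_not_hasTag k),
        one_mul]
      rfl
    exact ⟨c, hc, h, (idem_mul_phi a _).symm.trans h⟩
  · classical
    obtain ⟨r, hr, h1, h2⟩ := exists_cycle_elt (K := K) σ
    refine ⟨fun a => if IsDigonNotched a then 0 else idem K a * (phi σ K r : Gamma K σ),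
      fun a ha => if_pos ha, fun a ha => ⟨exists_central (full a) ha, fun c hc => ?_⟩,
      fun a => ⟨idem_mul_phi a _, fun h => ?_, fun h => ?_⟩⟩ <;> beta_reduce
    · rw [if_neg ha]
      apply inj
      rw [toMat_symm, central_value hc, toMat_idem_mul_phi, hr]
      rfl
    · split_ifs with ha
      · obtain ⟨k, hk, -⟩ := ha
        apply inj
        rw [toMat_idem_mul_phi, embed_Y n hn, hk, map_zero,
          show unitEps K (Edge.spoke k .notched) = eps K .notched from rfl, eps_notched_mul, eUnit_zero]
      · rw [h1 h]
    · rw [if_neg (fun ⟨k, _, hk⟩ => h ⟨k, hk⟩ : ¬ IsDigonNotched a), h2 h, map_sub, Subalgebra.coe_sub, mul_sub]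
  · intro a ha b hb
    obtain ⟨k, hk⟩ := hside a ha
    obtain ⟨l, hl⟩ := hside b hb
    obtain ⟨p, hp, e⟩ := exists_shortest K (arcVertices σ) (a := full a) (b := full b) hk hl
    refine ⟨p, hp, hu a b ha hb, inj ?_⟩
    rw [toMat_peirceIso, toMat_symm, e]
    rfl
  · intro a ha b hb hab
    obtain ⟨k, hk⟩ := hside a ha
    obtain ⟨l, hl⟩ := hside b hb
    obtain rfl : l = k - 1 := by
      rw [hk, hl] at hab
      exact eq_sub_of_add_eq hab
    obtain ⟨hl0, α, s, h1, h2, h3⟩ := fan_path K (arcVertices σ) σ (a := full a)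
      (b := full b) hk hl
    replace h3 : psi σ K (arcVertices σ) (cls' K s) = eUnit σ K _ a.1 b.1
      (mono K (mainTag σ) true (Edge.ell a.1 b.1)) := h3
    have hs : mono K (mainTag σ) true (Edge.ell a.1 b.1) ∈ entry K a.1 b.1 := by
      have := psi_entry_mem (cls' K s) a b
      rwa [h3, eUnit_apply, if_pos ⟨rfl, rfl⟩] at this
    replace hl0 : Edge.ell a.1 b.1 ≠ 0 := hl0
    obtain ⟨hp', hn'⟩ := vElt_pow_eq (K := K) σ hl0
    refine ⟨α, s, hk ▸ h1, h2, hu a b ha hb, ?_, fun h => inj ?_, fun h => inj ?_⟩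
    · by_cases h : HasPlain σ
      · rwa [hp' h]
      · rw [hn' h]
        exact Submodule.sub_mem _ (hu a b ha hb) hs
    · rw [toMat_peirceIso, toMat_symm, h3]
      exact congrArg _ (hp' h)
    · rw [toMat_peirceIso, map_sub, toMat_peirceIso, toMat_symm, h3]
      refine (congrArg _ (hn' h)).trans ?_
      ext i j
      rw [Matrix.sub_apply, eUnit_apply, eUnit_apply, eUnit_apply]
      split_ifs <;> simp
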